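/- Let $n\ge 1$ and let $\lambda=\omega_{\lambda'_1}+\dots+\omega_{\lambda'_{\lambda_1}}$ be a dominant weight of type $B_n$ which is a sum of non-spin fundamental weights; that is, $\lambda$ is a partition whose columns have heights $\lambda'_1\ge\lambda'_2\ge\dots\ge\lambda'_{\lambda_1}\ge 1$ with $\lambda'_1<n$. **Notation.** Let $[\overline n]=\{1<\dots<n<\overline n<\dots<\overline 1\}$, with $\overline{\overline{\imath}}=i$, $|i|=|\overline{\imath}|=i$; barred letters are negative, unbarred ones positive. Write $a\prec b\prec c$ if $a,b,c$ are distinct and occur in this order when going upwards cyclically in $[\overline n]$ from $a$. Let $W$ be the Weyl group of type $B_n$, i.e. the group of bijections $w$ of $[\overline n]$ with $w(\overline{\imath})=\overline{w(i)}$, with length function $\ell$; let $w[1,k]$ be the column with entries $w(1),\dots,w(k)$. Denote by $(i,j)$, $(i,\overline{\jmath})$, $(i,\overline{\imath})$ the roots $\varepsilon_i-\varepsilon_j$, $\varepsilon_i+\varepsilon_j$, $\varepsilon_i$. With $\rho$ half the sum of the positive roots, the quantum Bruhat graph has an edge $w\xrightarrow{\alpha}ws_\alpha$, for $\alpha$ a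 positive root, iff $\ell(ws_\alpha)=\ell(w)+1$ or $\ell(ws_\alpha)=\ell(w)-2\langle\rho,\alpha^\vee\rangle+1$. For $1\le i\le k<n$ put $$\Gamma^{ki}=\big((i,k+1),\dots,(i,n),\,(i,\overline{\imath}),\,(i,\overline n),\dots,(i,\overline{k+1}),\,(i,\overline{i-1}),\dots,(i,\overline 1)\big),\qquad \Gamma^{i}=\big((i,\overline{\imath}),(i,\overline{i-1}),\dots,(i,\overline 1)\big),$$ $\Gamma^l(k)=\Gamma^{kk}\cdots\Gamma^{k1}$, $\Gamma^r(k)=\Gamma^k\cdots\Gamma^1$, and let $\Gamma=(\beta_1,\dots,\beta_m)=\Gamma^l(\lambda'_1)\Gamma^r(\lambda'_1)\cdots\Gamma^l(\lambda'_{\lambda_1})\Gamma^r(\lambda'_{\lambda_1})$, which is a $\lambda$-chain. Let $\mathcal A(\lambda)$ be the set of subsets $J=\{j_1<\dots<j_s\}\subseteq\{1,\dots,m\}$ such that $1\xrightarrow{\beta_{j_1}}s_{\beta_{j_1}}\xrightarrow{\beta_{j_2}}\cdots\xrightarrow{\beta_{j_s}}s_{\beta_{j_1}}\cdots s_{\beta_{j_s}}$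 is a path in the quantum Bruhat graph. For $J\subseteq\{1,\dots,m\}$ let $\pi^l_i$ (resp. $\pi^r_i$) be the product, from left to right, of the reflections $s_{\beta_j}$, $j\in J$, for $j$ up to the end of the factor $\Gamma^l(\lambda'_i)$ (resp. $\Gamma^r(\lambda'_i)$) belonging to the $i$-th column. The filling map sends $J$ to the filling $\mathrm{fill}_B(J)=C^l_1C^r_1\cdots C^l_{\lambda_1}C^r_{\lambda_1}$ of shape $2\lambda$ with $C^l_i=\pi^l_i[1,\lambda'_i]$ and $C^r_i=\pi^r_i[1,\lambda'_i]$. *KN columns.* A KN column $D$ of type $B_n$ is a column with entries in $\{1<\dots<n<0<\overline n<\dots<\overline 1\}$, strictly increasing from top to bottom except that $0$ may be repeated, such that if $j\in\{1,\dots,n\}$ is in the $a$-th box from the top and $\overline{\jmath}$ in the $b$-th box from the bottom, then $a+b\le j$. Let $z_1\ge\dots\ge z_r$ be all occurrences of $0$ in $D$ together with the unbarred $z$ such that $z,\overline z\in D$, and let $t_i$ be the greatest letter in $\{1,\dots,n\}$ with $t_i<z_i$, $t_i<t_{i-1}$ (if $i>1$), and $t_i,\overline{t_i}\notin D$. Then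 $lD$ is obtained from $D$ by replacing every $z_i$ by $t_i$, and $rD$ by replacing every $\overline{z_i}$ by $\overline{t_i}$ (with $\overline 0=0$). If $D$ has height $h\le k$, the extended columns $\widehat{lD},\widehat{rD}$ of height $k$ are obtained by adding $\overline{\imath_1},\dots,\overline{\imath_{k-h}}$ to $lD$ and $i_1,\dots,i_{k-h}$ to $rD$, where $i_1<\dots<i_{k-h}$ are the smallest unbarred letters that occur, barred or unbarred, in neither $lD$ nor $rD$, and then sorting increasingly. *Conditions on columns.* Columns $C,C'$ of height $k$ are *blocked off at $i$ by $b=C'(i)$* if: $|C(i)|\le b<n$, with $|C(i)|=b$ iff $C(i)=\overline b$; $\{1,\dots,b\}$ is contained in both $\{|C(1)|,\dots,|C(i)|\}$ and $\{|C'(1)|,\dots,|C'(i)|\}$; and the number of $j\le i$ with $C(j)<0$, $C'(j)>0$ is odd. Consider, for the pair $CC'$, the conditions: for all $1\le i<l\le k$, 1. $C(i)\ne C'(l)$; 2. $C(i)\prec C'(l)\prec C'(i)$ only if $C$ and the column obtained from $C'$ by exchanging its entries in rows $i$ and $l$ are blocked off at $i$ by $C'(l)$; 3. $C,C'$ are not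 blocked off at $i$ by $C'(i)$ for any $1\le i<k$. **Proposition.** The restriction of $\mathrm{fill}_B$ to $\mathcal A(\lambda)$ is injective. Its image consists of all fillings $C^l_1C^r_1\cdots C^l_{\lambda_1}C^r_{\lambda_1}$ of the shape $2\lambda$ with entries in $[\overline n]$ such that: (i) $C^l_1$ (if $\lambda\neq 0$) is strictly increasing; (ii) for every $j$, with $k=\lambda'_j$, there is a KN column $D$ of one of the heights $k,k-2,k-4,\dots\ge 0$ such that sorting $C^l_j$ and $C^r_j$ increasingly gives $\widehat{lD}$ and $\widehat{rD}$, respectively; (iii) any two adjacent columns satisfy Conditions 1–3, where for a pair $C^r_jC^l_{j+1}$ the column $C^r_j$ is cut off at the height $\lambda'_{j+1}$. -/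

import Mathlib

/-!
Type `B_n`: signed permutations, the quantum Bruhat graph, the quantum alcove model for columns of
height less than `n`, the filling map, Kashiwara-Nakashima columns with their splitting and
extension, and the conditions on adjacent columns.
-/

namespace TypeB

/-! ### The alphabet `[n̄] = {1 < 2 < ⋯ < n < n̄ < ⋯ < 1̄}` -/

/-- The ordered alphabet `[n̄]`, numbered from `0`: the unbarred letter `i` is the element `i - 1` of
`Fin (2 * n)`, and the bar involution is `Fin.rev`, so that `ī` is the element `2 * n - i`. -/
abbrev Letter (n : ℕ) : Type := Fin (2 * n)

/-- The unbarred letter with index `i` (counted from `0`). -/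
def unb {n : ℕ} (i : Fin n) : Letter n := ⟨i, by omega⟩

/-- The barred letter with index `i` (counted from `0`). -/
def barred {n : ℕ} (i : Fin n) : Letter n := (unb i).rev

/-- A letter is positive if it is unbarred, and negative otherwise. -/
def IsPos {n : ℕ} (x : Letter n) : Prop := (x : ℕ) < n

instance {n : ℕ} (x : Letter n) : Decidable (IsPos x) := inferInstanceAs (Decidable ((x : ℕ) < n))

/-- The absolute value of a letter: `|i| = |ī| = i`. -/
def absL {n : ℕ} (x : Letter n) : Letter n := min x x.rev

/-- The number of steps from `a` to `x` when moving upwards around the circle `[n̄]`. -/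
def circRank {n : ℕ} (a x : Letter n) : ℕ :=
  if a ≤ x then (x : ℕ) - (a : ℕ) else (x : ℕ) + 2 * n - (a : ℕ)

/-- `a ≺ b ≺ c` in the circular order starting at `a`. -/
def CircLT {n : ℕ} (a b c : Letter n) : Prop :=
  circRank a a < circRank a b ∧ circRank a b < circRank a c

/-! ### The Weyl group, its reflections, and the quantum Bruhat graph -/

/-- The Weyl group: permutations `w` of `[n̄]` with `w(ī)` equal to the bar of `w(i)`. -/
def weyl (n : ℕ) : Subgroup (Equiv.Perm (Letter n)) where
  carrier := {w | ∀ x, w x.rev = (w x).rev}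
  mul_mem' := by
    intro v w hv hw x
    have h1 : w x.rev = (w x).rev := hw x
    have h2 : v (w x).rev = (v (w x)).rev := hv (w x)
    rw [Equiv.Perm.mul_apply, Equiv.Perm.mul_apply, h1, h2]
  one_mem' := by intro x; simp
  inv_mem' := by
    intro w hw x
    have h : w (w⁻¹ x).rev = (w (w⁻¹ x)).rev := hw (w⁻¹ x)
    rw [Equiv.Perm.inv_eq_iff_eq, h]
    simp

/-- The reflection `(a, b)`, as a permutation: the transposition of `a` and `b` if `b = ā`, and the
product of the transposition of `a`, `b` with that of `ā`, `b̄` otherwise. -/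
def reflPerm {n : ℕ} (a b : Letter n) : Equiv.Perm (Letter n) :=
  if b = a.rev then Equiv.swap a b else Equiv.swap a b * Equiv.swap a.rev b.rev

theorem reflPerm_mem {n : ℕ} (a b : Letter n) : reflPerm a b ∈ weyl n := by
  intro x
  have hrev : ∀ y z : Letter n, y.rev = z ↔ y = z.rev := fun y z => Fin.rev_eq_iff
  have hinj : ∀ y z : Letter n, y.rev = z.rev ↔ y = z := fun y z => Fin.rev_inj
  have hinv : ∀ y : Letter n, y.rev.rev = y := fun y => Fin.rev_rev y
  unfold reflPerm
  split_ifs with h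
  · simp only [Equiv.swap_apply_def]
    grind
  · simp only [Equiv.Perm.mul_apply, Equiv.swap_apply_def]
    grind

/-- The reflection `(a, b)` as an element of the Weyl group. -/
def refl {n : ℕ} (r : Letter n × Letter n) : weyl n := ⟨reflPerm r.1 r.2, reflPerm_mem r.1 r.2⟩

/-- The vector `ε_i` for the letter `i`, and `-ε_i` for the letter `ī`. -/
def unitVec {n : ℕ} (x : Letter n) : Fin n → ℚ :=
  fun p => if x = unb p then 1 else if x = barred p then -1 else 0

/-- The root denoted by a pair of letters: `(i, j)` is `ε_i - ε_j`, `(i, j̄)` is `ε_i + ε_j`, and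
`(i, ī)` is `ε_i`. -/
def rootVec {n : ℕ} (r : Letter n × Letter n) : Fin n → ℚ :=
  if r.2 = r.1.rev then unitVec r.1 else unitVec r.1 - unitVec r.2

/-- One label for each positive root: the pairs `(i, j)` and `(i, j̄)` with `i < j`, and `(i, ī)`.
These are the pairs `(a, b)` of letters with `a < b ≤ ā`. -/
def posRoots (n : ℕ) : Finset (Letter n × Letter n) :=
  Finset.univ.filter fun r => r.1 < r.2 ∧ r.2 ≤ r.1.rev

/-- Half the sum of the positive roots. -/
def rho (n : ℕ) : Fin n → ℚ := (1 / 2 : ℚ) • ∑ r ∈ posRoots n, rootVec r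

/-- The pairing `⟨x, α^∨⟩` with the coroot `α^∨ = 2 α / ⟨α, α⟩`. -/
def corootPairing {n : ℕ} (x α : Fin n → ℚ) : ℚ := 2 * (x ⬝ᵥ α) / (α ⬝ᵥ α)

/-- The simple reflections: `(i, i + 1)` for `i < n`, and `(n, n̄)`. Since `n̄` is the letter after
`n`, these are the `(a, b)` with `a` unbarred and `b` the letter after `a`. -/
def IsSimpleRefl {n : ℕ} (s : weyl n) : Prop :=
  ∃ a b : Letter n, IsPos a ∧ (b : ℕ) = (a : ℕ) + 1 ∧ s = refl (a, b)

/-- The Coxeter length: the least length of a word in the simple reflections. -/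
noncomputable def len {n : ℕ} (w : weyl n) : ℕ :=
  sInf {m | ∃ L : List (weyl n), (∀ s ∈ L, IsSimpleRefl s) ∧ L.length = m ∧ L.prod = w}

/-- The quantum Bruhat graph has an edge from `w` to `w s_α` labelled by the positive root `α`. -/
def QBGEdge {n : ℕ} (w : weyl n) (r : Letter n × Letter n) : Prop :=
  (len (w * refl r) : ℚ) = (len w : ℚ) + 1 ∨
  (len (w * refl r) : ℚ) = (len w : ℚ) - 2 * corootPairing (rho n) (rootVec r) + 1

/-! ### The chain of roots, admissible subsets, and the filling map -/

/-- The roots `(i, (i-1)‾), (i, (i-2)‾), …, (i, 1̄)`. -/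
def stageIV {n : ℕ} (i : Fin n) : List (Letter n × Letter n) :=
  ((List.finRange n).filter fun j : Fin n => j < i).reverse.map fun j => (unb i, barred j)

/-- The roots `(i, k+1), …, (i, n)`, then `(i, ī)`, then `(i, n̄), …, (i, (k+1)‾)`, then
`(i, (i-1)‾), …, (i, 1̄)`. (Indices in `Fin n` are counted from `0`.) -/
def gammaLeftRow {n : ℕ} (k : ℕ) (i : Fin n) : List (Letter n × Letter n) :=
  (((List.finRange n).filter fun j : Fin n => k ≤ (j : ℕ)).map fun j => (unb i, unb j))
  ++ [(unb i, barred i)]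
  ++ (((List.finRange n).filter fun j : Fin n => k ≤ (j : ℕ)).reverse.map fun j => (unb i, barred j))
  ++ stageIV i

/-- The roots `(i, ī)`, then `(i, (i-1)‾), …, (i, 1̄)`. -/
def gammaRightRow {n : ℕ} (i : Fin n) : List (Letter n × Letter n) :=
  (unb i, barred i) :: stageIV i

/-- The left half of the `ω_k`-chain: the rows for `i = k, k - 1, …, 1`. -/
def gammaLeft (n k : ℕ) : List (Letter n × Letter n) :=
  ((List.finRange n).filter fun i : Fin n => (i : ℕ) < k).reverse.flatMap (gammaLeftRow k)

/-- The right half of the `ω_k`-chain: the rows for `i = k, k - 1, …, 1`. -/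
def gammaRight (n k : ℕ) : List (Letter n × Letter n) :=
  ((List.finRange n).filter fun i : Fin n => (i : ℕ) < k).reverse.flatMap gammaRightRow

/-- The concatenation of the chains of the first `m` columns of the Young diagram `μ`. -/
def chainUpTo (n : ℕ) (μ : YoungDiagram) (m : ℕ) : List (Letter n × Letter n) :=
  (List.range m).flatMap fun j => gammaLeft n (μ.colLen j) ++ gammaRight n (μ.colLen j)

/-- The chain `Γ` of `μ`; the number of columns of `μ` is `μ.rowLen 0`. -/
def chain (n : ℕ) (μ : YoungDiagram) : List (Letter n × Letter n) := chainUpTo n μ (μ.rowLen 0)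

/-- Sets of folding positions in the chain. -/
abbrev Folding (n : ℕ) (μ : YoungDiagram) : Type := Finset (Fin (chain n μ).length)

/-- The product, from left to right, of the reflections at those of the first `p` positions of the
chain that belong to `J`. -/
def partialProd {n : ℕ} {μ : YoungDiagram} (J : Folding n μ) (p : ℕ) : weyl n :=
  (((List.finRange (chain n μ).length).filter fun j : Fin (chain n μ).length => j ∈ J ∧ (j : ℕ) < p).map
    fun j => refl ((chain n μ).get j)).prod

/-- The admissible subsets: applying the selected reflections one after the other to the identity
gives a path in the quantum Bruhat graph. -/
def admissible (n : ℕ) (μ : YoungDiagram) : Set (Folding n μ) :=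
  {J | ∀ j ∈ J, QBGEdge (partialProd J (j : ℕ)) ((chain n μ).get j)}

/-- A column of height `k` with entries in `[n̄]`; rows are counted from `0`. -/
abbrev Column (n k : ℕ) : Type := Fin k → Letter n

/-- Fillings, with entries in `[n̄]`, of the shape `2μ`, in which every column of `μ` is replaced by
a left and a right column of the same height. -/
@[ext] structure Filling (n : ℕ) (μ : YoungDiagram) where
  left : (j : Fin (μ.rowLen 0)) → Column n (μ.colLen j)
  right : (j : Fin (μ.rowLen 0)) → Column n (μ.colLen j)

/-- The first `k` entries `w(1), …, w(k)` of the window of `w`. -/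
def window {n k : ℕ} (hk : k ≤ n) (w : weyl n) : Column n k :=
  fun i => w.1 (unb (Fin.castLE hk i))

theorem colLen_le {n : ℕ} {μ : YoungDiagram} (hμ : μ.colLen 0 < n) (j : ℕ) : μ.colLen j ≤ n :=
  (μ.colLen_anti 0 j (Nat.zero_le j)).trans hμ.le

/-- The filling map. The left column `j` is read off after the left half of the chain of column `j`,
the right column `j` after its right half. -/
def fillB {n : ℕ} {μ : YoungDiagram} (hμ : μ.colLen 0 < n) (J : Folding n μ) : Filling n μ where
  left j := window (colLen_le hμ j)
    (partialProd J ((chainUpTo n μ j).length + (gammaLeft n (μ.colLen j)).length))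
  right j := window (colLen_le hμ j) (partialProd J (chainUpTo n μ ((j : ℕ) + 1)).length)

/-! ### Kashiwara-Nakashima columns, splitting and extending -/

/-- The alphabet `{1 < ⋯ < n < 0 < n̄ < ⋯ < 1̄}`, numbered from `0`; the bar is `Fin.rev`, which
fixes the letter `0`. -/
abbrev KNLetter (n : ℕ) : Type := Fin (2 * n + 1)

/-- The letter `0`, which lies between `n` and `n̄`. -/
def zeroL (n : ℕ) : KNLetter n := ⟨n, by omega⟩

/-- The inclusion of `[n̄]` into the alphabet with `0`. -/
def toKN {n : ℕ} (x : Letter n) : KNLetter n := (zeroL n).succAbove x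

/-- Kashiwara-Nakashima columns of type `B_n`, listed from top to bottom: increasing, where only `0`
may be repeated; and if the letter `j` is in the `a`-th box from the top and `j̄` in the `b`-th box
from the bottom, then `a + b ≤ j`. -/
def IsKNColumn {n : ℕ} (D : List (KNLetter n)) : Prop :=
  (D.Pairwise fun x y => x < y ∨ (x = zeroL n ∧ y = zeroL n)) ∧
  ∀ p q : Fin D.length, D.get p < zeroL n → D.get q = (D.get p).rev →
    ((p : ℕ) + 1) + (D.length - (q : ℕ)) ≤ (D.get p : ℕ) + 1

/-- The letters `z₁ ≥ z₂ ≥ ⋯` to be split in an increasing column `D`: every occurrence of `0`, and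
the unbarred letters `z` such that `z` and `z̄` both occur. -/
def splitLetters {n : ℕ} (D : List (KNLetter n)) : List (KNLetter n) :=
  (D.filter fun x => x ≤ zeroL n ∧ x.rev ∈ D).reverse

/-- `t` lists the letters `t₁ > t₂ > ⋯` used for splitting `D`: `tᵢ` is the greatest unbarred letter
smaller than `zᵢ` and `tᵢ₋₁` such that neither it nor its bar occurs in `D`. -/
def IsSplitting {n : ℕ} (D t : List (KNLetter n)) : Prop :=
  ∃ h : t.length = (splitLetters D).length, ∀ (i : ℕ) (hi : i < t.length),
    IsGreatest {x : KNLetter n | x < zeroL n ∧ x < (splitLetters D)[i]'(h ▸ hi) ∧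
      (∀ _ : 0 < i, x < t[i - 1]'(by omega)) ∧ x ∉ D ∧ x.rev ∉ D} (t[i]'hi)

/-- The left split column, not yet sorted: every `zᵢ` is replaced by `tᵢ`. -/
def leftSplit {n : ℕ} (D t : List (KNLetter n)) : List (KNLetter n) :=
  (D.filter fun x => x ∉ splitLetters D) ++ t

/-- The right split column, not yet sorted: the bar of every `zᵢ` is replaced by that of `tᵢ`. -/
def rightSplit {n : ℕ} (D t : List (KNLetter n)) : List (KNLetter n) :=
  (D.filter fun x => x.rev ∉ splitLetters D) ++ t.map Fin.rev

/-- The `m` smallest unbarred letters that occur, barred or unbarred, in neither split column. -/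
def extLetters {n : ℕ} (D t : List (KNLetter n)) (m : ℕ) : List (KNLetter n) :=
  ((List.finRange (2 * n + 1)).filter fun x => x < zeroL n ∧
    x ∉ leftSplit D t ∧ x.rev ∉ leftSplit D t ∧ x ∉ rightSplit D t ∧ x.rev ∉ rightSplit D t).take m

/-- The left split column extended to height `k` by barred letters, sorted increasingly. -/
def leftExt {n : ℕ} (k : ℕ) (D t : List (KNLetter n)) : List (KNLetter n) :=
  (leftSplit D t ++ (extLetters D t (k - D.length)).map Fin.rev).insertionSort (· ≤ ·)

/-- The right split column extended to height `k` by unbarred letters, sorted increasingly. -/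
def rightExt {n : ℕ} (k : ℕ) (D t : List (KNLetter n)) : List (KNLetter n) :=
  (rightSplit D t ++ extLetters D t (k - D.length)).insertionSort (· ≤ ·)

/-- The entries of a column, sorted increasingly. -/
def sortedCol {n k : ℕ} (C : Column n k) : List (KNLetter n) :=
  (List.ofFn fun i => toKN (C i)).insertionSort (· ≤ ·)

/-- After sorting, `(C, C')` is the extended split pair of a Kashiwara-Nakashima column of one of
the heights `k, k - 2, k - 4, …`, where `k` is the height of `C` and `C'`. -/
def IsSplitPair {n k : ℕ} (C C' : Column n k) : Prop :=
  ∃ D t : List (KNLetter n), IsKNColumn D ∧ D.length ≤ k ∧ Even (k - D.length) ∧ IsSplitting D t ∧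
    sortedCol C = leftExt k D t ∧ sortedCol C' = rightExt k D t

/-! ### Conditions on adjacent columns -/

/-- The columns `C`, `C'` are blocked off at `i` by `b = C'(i)`. -/
def BlockedOff {n k : ℕ} (C C' : Column n k) (i : Fin k) : Prop :=
  (absL (C i) ≤ C' i ∧ (C' i : ℕ) + 1 < n ∧ (absL (C i) = C' i ↔ C i = (C' i).rev)) ∧
  (∀ x : Letter n, x ≤ C' i → (∃ j ≤ i, absL (C j) = x) ∧ (∃ j ≤ i, absL (C' j) = x)) ∧
  Odd (Finset.univ.filter fun j : Fin k => j ≤ i ∧ ¬ IsPos (C j) ∧ IsPos (C' j)).card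

/-- The three conditions on a pair of adjacent columns of height `k`. -/
def AdjConditions {n k : ℕ} (C C' : Column n k) : Prop :=
  (∀ i l : Fin k, i < l → C i ≠ C' l) ∧
  (∀ i l : Fin k, i < l → CircLT (C i) (C' l) (C' i) → BlockedOff C (C' ∘ Equiv.swap i l) i) ∧
  (∀ i : Fin k, (i : ℕ) + 1 < k → ¬ BlockedOff C C' i)

/-- Any two adjacent columns of a filling satisfy the conditions; if the second column is shorter,
the first one is cut off at its height. -/
def AdjacentColumnsOK {n : ℕ} {μ : YoungDiagram} (F : Filling n μ) : Prop :=
  (∀ j, AdjConditions (F.left j) (F.right j)) ∧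
  ∀ (j : ℕ) (hj : j + 1 < μ.rowLen 0),
    AdjConditions
      (fun i => F.right ⟨j, by omega⟩ (Fin.castLE (μ.colLen_anti j (j + 1) (Nat.le_succ j)) i))
      (F.left ⟨j + 1, hj⟩)

end TypeB

set_option linter.unusedSimpArgs false
set_option linter.unusedVariables false

open Finset

namespace TypeB

/-! An element of `W` is treated as the signed sequence `w(1), …, w(n)`, with `-i` for `ī`. The
order `1 < ⋯ < n < n̄ < ⋯ < 1̄` is a rotation of the order of the integers, so cyclic statements can
be checked in `ℤ`. The length counts inversions: a negative entry at position `x` (from `0`)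
accounts for `ε_x` and for one of `ε_x ± ε_y` for each later `y`, in all `n - x`, and `lenPair`
accounts for the remaining pairs. Computing how the length changes turns the edges of the quantum
Bruhat graph into local criteria, `Op.ok`. For `ε_i - ε_j`, no entry between the two positions lies
on the cyclic arc. For `ε_i + ε_j`, the arc must not pass from `n` to `n̄` and must avoid the
entries between, and the entries after together with their negatives. For `ε_i`, which is never the
last simple root because the columns are shorter than `n`, only a positive entry greater than all
later absolute values may change sign.

In the left half, row `p` is treated in four phases: `ε_p - ε_j` with the positions from `k` on,
then `ε_p`, then `ε_p + ε_j` with the positions from `k` on, and finally `ε_p + ε_j` with the rows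
above. In each phase the desired value decides greedily whether the next reflection is applied,
which gives both a reachability criterion and uniqueness. The first three phases only involve the
outer positions (`reach_out`, `out_unique`). The fourth raises the value of row `p` from `v` to its
final value `c` and moves a chain of entries in the rows above (`Chn`).

Rows are treated from the bottom to the top, and after its turn row `p` is final. The theorem for
one left half is therefore a transfer statement: `Cond` for `p + 1` rows before row `p` is treated
amounts to `Cond` for `p` rows afterwards (`Cond.of_row`, `Cond.exists_row`). Blocking apart, `Cond`
says that the arc from `C(i)` to `C'(i)` meets no later entry `C'(l)`. The exceptions occur where
the levels `1, …, b` are used up by the top rows. There the only freedom left is a sign, and the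
parity of the number of negative entries decides it (`even_ng`, `Chn.even`). The same parity makes
the walk unique (`row_unique`).

The right half is a subchain of the left half, so the same conditions are necessary and its walks
are unique as well. In addition it leaves the absolute values in the column unchanged and controls
the number of entries below each `-x` (`Bal`). Conversely, counting the arcs over each letter shows
that under `Bal` no arc passes an outer value or its negative (`RightInv.of_bal`), and then the
first three phases reduce to at most one change of sign (`RightInv.value`).

Finally, `Bal` characterizes the pairs of extended split columns, with `r` the number of zeros of
the Kashiwara-Nakashima column (`isSplitPair_iff`). The column is recovered from the excess of
barred letters: the extension letters are the places where the excess reaches a new minimum. Working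
through the columns one by one, starting from the identity, gives injectivity and the image. -/

/-! ### Signed sequences and the length function -/

/-- The statistic of `(g i, g j)` for `i < j` contributing to the length. -/
def lenPair (a b : ℤ) : ℤ := if 0 < a then (if |b| < |a| then 1 else 0) else (if |a| < |b| then 1 else 0)

/-- The length of a signed sequence `g 0, …, g (n - 1)`. -/
def sgnLen (n : ℕ) (g : ℕ → ℤ) : ℤ :=
  (∑ x ∈ range n, if g x < 0 then (n : ℤ) - x else 0) +
    ∑ x ∈ range n, ∑ y ∈ range n, if x < y then lenPair (g x) (g y) else 0

/-- The elementary operations on signed sequences: the reflections in `ε_i - ε_j`, `ε_i + ε_j` and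
`ε_i`. -/
inductive Op
  | dif (i j : ℕ)
  | sum (i j : ℕ)
  | sgn (i : ℕ)

/-- The action of an operation on a signed sequence. -/
def Op.act : Op → (ℕ → ℤ) → (ℕ → ℤ)
  | .dif i j, g => fun x => if x = i then g j else if x = j then g i else g x
  | .sum i j, g => fun x => if x = i then -g j else if x = j then -g i else g x
  | .sgn i, g => fun x => if x = i then -g i else g x

theorem sum_two_erase {n i j : ℕ} (hi : i < n) (hj : j < n) (hij : i ≠ j) (f : ℕ → ℤ) :
    ∑ x ∈ range n, f x = f i + f j + ∑ x ∈ ((range n).erase i).erase j, f x := by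
  rw [← add_sum_erase (range n) f (mem_range.2 hi),
    ← add_sum_erase ((range n).erase i) f (mem_erase.2 ⟨hij.symm, mem_range.2 hj⟩)]
  ring

theorem sum_one_erase {n i : ℕ} (hi : i < n) (f : ℕ → ℤ) :
    ∑ x ∈ range n, f x = f i + ∑ x ∈ (range n).erase i, f x :=
  (add_sum_erase (range n) f (mem_range.2 hi)).symm

theorem sum_between {n i j : ℕ} (hij : i < j) (hj : j < n) :
    ∑ x ∈ ((range n).erase i).erase j, (if i < x ∧ x < j then (1 : ℤ) else 0) = (j : ℤ) - i - 1 := by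
  rw [← sum_filter, sum_const, nsmul_one]
  have : (((range n).erase i).erase j).filter (fun x => i < x ∧ x < j) = Ioo i j := by
    ext x; simp only [mem_filter, mem_erase, mem_range, mem_Ioo]; omega
  rw [this, Nat.card_Ioo]; omega

theorem sum_after {n i j : ℕ} (hij : i < j) (hj : j < n) :
    ∑ x ∈ ((range n).erase i).erase j, (if j < x then (1 : ℤ) else 0) = (n : ℤ) - j - 1 := by
  rw [← sum_filter, sum_const, nsmul_one]
  have : (((range n).erase i).erase j).filter (fun x => j < x) = Ioo j n := by
    ext x; simp only [mem_filter, mem_erase, mem_range, mem_Ioo]; omega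
  rw [this, Nat.card_Ioo]; omega

theorem sum_after_one {n i : ℕ} (hi : i < n) :
    ∑ x ∈ (range n).erase i, (if i < x then (1 : ℤ) else 0) = (n : ℤ) - i - 1 := by
  rw [← sum_filter, sum_const, nsmul_one]
  have : ((range n).erase i).filter (fun x => i < x) = Ioo i n := by
    ext x; simp only [mem_filter, mem_erase, mem_range, mem_Ioo]; omega
  rw [this, Nat.card_Ioo]; omega

/-- The terms involving `i` or `j` are isolated. The rest is untouched by an operation at these
positions and cancels in a difference of lengths. -/
theorem sgnLen_split {n i j : ℕ} (hij : i < j) (hj : j < n) (g : ℕ → ℤ) :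
    sgnLen n g = (if g i < 0 then (n : ℤ) - i else 0) + (if g j < 0 then (n : ℤ) - j else 0) +
      lenPair (g i) (g j) +
      ∑ x ∈ ((range n).erase i).erase j,
        ((if i < x then lenPair (g i) (g x) else 0) + (if j < x then lenPair (g j) (g x) else 0) +
         (if x < i then lenPair (g x) (g i) else 0) + (if x < j then lenPair (g x) (g j) else 0)) +
      ((∑ x ∈ ((range n).erase i).erase j, if g x < 0 then (n : ℤ) - x else 0) +
       ∑ x ∈ ((range n).erase i).erase j, ∑ y ∈ ((range n).erase i).erase j,
        if x < y then lenPair (g x) (g y) else 0) := by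
  have hi : i < n := hij.trans hj
  have hne : i ≠ j := hij.ne
  unfold sgnLen
  rw [sum_two_erase hi hj hne, sum_two_erase hi hj hne,
    sum_two_erase hi hj hne (fun y => if i < y then lenPair (g i) (g y) else 0),
    sum_two_erase hi hj hne (fun y => if j < y then lenPair (g j) (g y) else 0),
    sum_congr rfl (fun x _ => sum_two_erase hi hj hne (fun y => if x < y then lenPair (g x) (g y) else 0))]
  simp only [sum_add_distrib, lt_irrefl, if_false, hij, if_true, not_lt.2 hij.le]
  ring

theorem sgnLen_split_one {n i : ℕ} (hi : i < n) (g : ℕ → ℤ) :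
    sgnLen n g = (if g i < 0 then (n : ℤ) - i else 0) +
      ∑ x ∈ (range n).erase i,
        ((if i < x then lenPair (g i) (g x) else 0) + (if x < i then lenPair (g x) (g i) else 0)) +
      ((∑ x ∈ (range n).erase i, if g x < 0 then (n : ℤ) - x else 0) +
       ∑ x ∈ (range n).erase i, ∑ y ∈ (range n).erase i,
        if x < y then lenPair (g x) (g y) else 0) := by
  unfold sgnLen
  rw [sum_one_erase hi, sum_one_erase hi, sum_one_erase hi (fun y => if i < y then lenPair (g i) (g y) else 0),
    sum_congr rfl (fun x _ => sum_one_erase hi (fun y => if x < y then lenPair (g x) (g y) else 0))]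
  simp only [sum_add_distrib, lt_irrefl, if_false]
  ring

/-- `x` is met when going upwards cyclically from `a` before `b`. -/
def cyc (a x b : ℤ) : Prop := (a < x ∧ x < b) ∨ (x < b ∧ b < a) ∨ (b < a ∧ a < x)

instance (a x b : ℤ) : Decidable (cyc a x b) := by unfold cyc; infer_instance

/-- The order `1 < ⋯ < n < -n < ⋯ < -1`. -/
def ltB (a b : ℤ) : Prop := (0 < a ∧ 0 < b ∧ a < b) ∨ (0 < a ∧ b < 0) ∨ (a < 0 ∧ b < 0 ∧ a < b)

instance (a b : ℤ) : Decidable (ltB a b) := by unfold ltB; infer_instance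

/-- Signed permutations of `1, …, n` as sequences. -/
structure IsSgn (n : ℕ) (g : ℕ → ℤ) : Prop where
  ne_zero : ∀ i < n, g i ≠ 0
  abs_le : ∀ i < n, |g i| ≤ n
  inj : ∀ i < n, ∀ j < n, |g i| = |g j| → i = j

theorem IsSgn.abs_ne {n : ℕ} {g : ℕ → ℤ} (h : IsSgn n g) {i j : ℕ} (hi : i < n) (hj : j < n)
    (hij : i ≠ j) : g i ≠ g j ∧ g i ≠ -g j := by
  constructor <;> intro e <;> exact hij (h.inj i hi j hj (by rw [e]; try rw [abs_neg]))

theorem lenPair_of_pos {a : ℤ} (ha : 0 < a) (b : ℤ) : lenPair a b = if |b| < a then 1 else 0 := by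
  simp [lenPair, ha, abs_of_pos ha]

theorem lenPair_of_neg {a : ℤ} (ha : a < 0) (b : ℤ) : lenPair a b = if -a < |b| then 1 else 0 := by
  simp [lenPair, not_lt.2 ha.le, abs_of_neg ha]

theorem lenPair_neg_right (a b : ℤ) : lenPair a (-b) = lenPair a b := by
  simp [lenPair]

/-- The pairwise non-equality up to sign of three letters. -/
def Indep (a b : ℤ) : Prop := a ≠ b ∧ a ≠ -b

/-- The difference of signs is the share of one position between the two in the change of the
weights `n - x`. Together with this share the position contributes an even number that only tests
the cyclic order: `0` for all positions characterizes a cover, `-2` for all positions the greatest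
drop. -/
theorem lenPair_between_dif {a b c : ℤ} (h1 : a ≠ 0) (h2 : b ≠ 0) (h3 : c ≠ 0) (h4 : Indep a b)
    (h5 : Indep c a) (h6 : Indep c b) :
    lenPair b c + lenPair c a = lenPair a c + lenPair c b +
     ((if ltB a b then (if cyc a c b then 2 else 0) else (if cyc a c b then 0 else -2))
       - ((if b < 0 then 1 else 0) - (if a < 0 then 1 else 0))) := by
  unfold Indep at *
  rcases lt_or_gt_of_ne h1 with ha | ha <;> rcases lt_or_gt_of_ne h2 with hb | hb <;>
  rcases lt_or_gt_of_ne h3 with hc | hc <;>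
  simp only [lenPair_of_pos, lenPair_of_neg, ha, hb, hc, abs_of_pos, abs_of_neg, not_lt.2 ha.le,
    not_lt.2 hb.le, ltB, cyc, if_true, if_false, true_and, false_and, and_true, and_false, or_false,
    false_or] <;>
  split_ifs <;> omega

theorem lenPair_base_dif {a b : ℤ} (h1 : a ≠ 0) (h2 : b ≠ 0) (h4 : Indep a b) (n i j : ℤ) :
    (if b < 0 then n - i else 0) + (if a < 0 then n - j else 0) + lenPair b a
      - ((if b < 0 then 1 else 0) - (if a < 0 then 1 else 0)) * (j - i - 1) =
      (if a < 0 then n - i else 0) + (if b < 0 then n - j else 0) + lenPair a b +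
      (if ltB a b then 1 else -1) := by
  unfold Indep at *
  rcases lt_or_gt_of_ne h1 with ha | ha <;> rcases lt_or_gt_of_ne h2 with hb | hb <;>
  simp only [lenPair_of_pos, lenPair_of_neg, ha, hb, abs_of_pos, abs_of_neg, not_lt.2 ha.le,
    not_lt.2 hb.le, ltB, if_true, if_false, true_and, false_and, and_true, and_false, or_false,
    false_or] <;>
  split_ifs <;> grind

/-- The excess of a position between `i` and `j` for the reflection in `ε_i + ε_j`. -/
def excessBetween (a b c : ℤ) : ℤ :=
  lenPair (-b) c + lenPair c a - lenPair a c - lenPair c b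
    + (1 - (if a < 0 then 1 else 0) - (if b < 0 then 1 else 0))

/-- The excess of a position after `j` for the reflection in `ε_i + ε_j`. -/
def excessAfter (a b c : ℤ) : ℤ :=
  lenPair (-b) c + lenPair (-a) c - lenPair a c - lenPair b c
    + 2 * (1 - (if a < 0 then 1 else 0) - (if b < 0 then 1 else 0))

/-- The change of length in the absence of other positions for the reflection in `ε_i + ε_j`. -/
def excessBase (a b : ℤ) : ℤ :=
  lenPair (-b) a - lenPair a b + 3 * (1 - (if a < 0 then 1 else 0) - (if b < 0 then 1 else 0))

/-- Here `a` and `-b` have the same sign and the arc stays in one half of the alphabet. The base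
change is `1`, so an edge must be a cover, and every other position has to contribute `0`. -/
theorem excess_up {a b : ℤ} (h1 : a ≠ 0) (h2 : b ≠ 0) (h4 : Indep a b) (hs : 0 < a ↔ b < 0)
    (hab : a < -b) : excessBase a b = 1 ∧ ∀ c : ℤ, c ≠ 0 → Indep c a → Indep c b →
      0 ≤ excessBetween a b c ∧ 0 ≤ excessAfter a b c ∧
      (excessBetween a b c = 0 ↔ ¬ (a < c ∧ c < -b)) ∧
      (excessAfter a b c = 0 ↔ ¬ (a < c ∧ c < -b) ∧ ¬ (a < -c ∧ -c < -b)) := by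
  unfold Indep excessBase excessBetween excessAfter at *
  rcases lt_or_gt_of_ne h1 with ha | ha <;> rcases lt_or_gt_of_ne h2 with hb | hb
  · omega
  rotate_left
  rotate_left
  · omega
  all_goals
    constructor
    · simp only [lenPair_of_pos, lenPair_of_neg, ha, hb, abs_of_pos, abs_of_neg,
        not_lt.2 ha.le, not_lt.2 hb.le, if_true, if_false, Left.neg_pos_iff, Left.neg_neg_iff]
      split_ifs <;> omega
    · intro c h3 h5 h6
      rcases lt_or_gt_of_ne h3 with hc | hc <;>
      simp only [lenPair_of_pos, lenPair_of_neg, ha, hb, hc, abs_of_pos, abs_of_neg,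
        not_lt.2 ha.le, not_lt.2 hb.le, if_true, if_false, Left.neg_pos_iff, Left.neg_neg_iff] <;>
      split_ifs <;> omega

/-- Two barred entries become unbarred, so the arc passes the end of the alphabet. The drop demanded
of a quantum edge is attained iff every position contributes its minimum, `-2` between the two
positions and `-4` after them. -/
theorem excess_quantum {a b : ℤ} (h4 : Indep a b) (ha : a < 0) (hb : b < 0) :
    excessBase a b = -3 ∧ ∀ c : ℤ, c ≠ 0 → Indep c a → Indep c b →
      -2 ≤ excessBetween a b c ∧ -4 ≤ excessAfter a b c ∧
      excessBetween a b c ≤ 0 ∧ excessAfter a b c ≤ 0 ∧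
      (excessBetween a b c = -2 ↔ ¬ (a < c ∧ c < -b)) ∧
      (excessAfter a b c = -4 ↔ ¬ (a < c ∧ c < -b) ∧ ¬ (a < -c ∧ -c < -b)) := by
  unfold Indep excessBase excessBetween excessAfter at *
  constructor
  · simp only [lenPair_of_pos, lenPair_of_neg, ha, hb, abs_of_pos, abs_of_neg,
      not_lt.2 ha.le, not_lt.2 hb.le, if_true, if_false, Left.neg_pos_iff, Left.neg_neg_iff]
    split_ifs <;> omega
  · intro c h3 h5 h6
    rcases lt_or_gt_of_ne h3 with hc | hc <;>
    simp only [lenPair_of_pos, lenPair_of_neg, ha, hb, hc, abs_of_pos, abs_of_neg,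
      not_lt.2 ha.le, not_lt.2 hb.le, if_true, if_false, Left.neg_pos_iff, Left.neg_neg_iff] <;>
    split_ifs <;> omega

/-- Either the length grows by at least `3`, or it drops by at least `2` too little for a quantum
edge; so there is no edge. -/
theorem excess_none {a b : ℤ} (h1 : a ≠ 0) (h2 : b ≠ 0) (h4 : Indep a b) (hab : -b < a) :
    (excessBase a b = 3 ∧ ∀ c : ℤ, c ≠ 0 → Indep c a → Indep c b →
      0 ≤ excessBetween a b c ∧ 0 ≤ excessAfter a b c) ∨
    (excessBase a b = -1 ∧ ∀ c : ℤ, c ≠ 0 → Indep c a → Indep c b →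
      excessBetween a b c ≤ 0 ∧ excessAfter a b c ≤ 0 ∧
      -2 ≤ excessBetween a b c ∧ -4 ≤ excessAfter a b c) := by
  unfold Indep excessBase excessBetween excessAfter at *
  rcases lt_or_gt_of_ne h1 with ha | ha <;> rcases lt_or_gt_of_ne h2 with hb | hb
  · omega
  · right
    constructor
    · simp only [lenPair_of_pos, lenPair_of_neg, ha, hb, abs_of_pos, abs_of_neg,
        not_lt.2 ha.le, not_lt.2 hb.le, if_true, if_false, Left.neg_pos_iff, Left.neg_neg_iff]
      split_ifs <;> omega
    · intro c h3 h5 h6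
      rcases lt_or_gt_of_ne h3 with hc | hc <;>
      simp only [lenPair_of_pos, lenPair_of_neg, ha, hb, hc, abs_of_pos, abs_of_neg,
        not_lt.2 ha.le, not_lt.2 hb.le, if_true, if_false, Left.neg_pos_iff, Left.neg_neg_iff] <;>
      split_ifs <;> omega
  · right
    constructor
    · simp only [lenPair_of_pos, lenPair_of_neg, ha, hb, abs_of_pos, abs_of_neg,
        not_lt.2 ha.le, not_lt.2 hb.le, if_true, if_false, Left.neg_pos_iff, Left.neg_neg_iff]
      split_ifs <;> omega
    · intro c h3 h5 h6
      rcases lt_or_gt_of_ne h3 with hc | hc <;>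
      simp only [lenPair_of_pos, lenPair_of_neg, ha, hb, hc, abs_of_pos, abs_of_neg,
        not_lt.2 ha.le, not_lt.2 hb.le, if_true, if_false, Left.neg_pos_iff, Left.neg_neg_iff] <;>
      split_ifs <;> omega
  · left
    constructor
    · simp only [lenPair_of_pos, lenPair_of_neg, ha, hb, abs_of_pos, abs_of_neg,
        not_lt.2 ha.le, not_lt.2 hb.le, if_true, if_false, Left.neg_pos_iff, Left.neg_neg_iff]
      split_ifs <;> omega
    · intro c h3 h5 h6
      rcases lt_or_gt_of_ne h3 with hc | hc <;>
      simp only [lenPair_of_pos, lenPair_of_neg, ha, hb, hc, abs_of_pos, abs_of_neg,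
        not_lt.2 ha.le, not_lt.2 hb.le, if_true, if_false, Left.neg_pos_iff, Left.neg_neg_iff] <;>
      split_ifs <;> omega

theorem IsSgn.indep {n : ℕ} {g : ℕ → ℤ} (h : IsSgn n g) {i j : ℕ} (hi : i < n) (hj : j < n)
    (hij : i ≠ j) : Indep (g i) (g j) := by
  constructor <;> intro e <;> exact hij (h.inj i hi j hj (by rw [e]; try rw [abs_neg]))

theorem sgnLen_dif {n i j : ℕ} (hij : i < j) (hj : j < n) {g : ℕ → ℤ} (hg : IsSgn n g) :
    sgnLen n ((Op.dif i j).act g) = sgnLen n g +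
      (if ltB (g i) (g j) then 1 else -1) +
      ∑ x ∈ ((range n).erase i).erase j, (if i < x ∧ x < j then
        (if ltB (g i) (g j) then (if cyc (g i) (g x) (g j) then 2 else 0)
          else (if cyc (g i) (g x) (g j) then 0 else -2)) else 0 : ℤ) := by
  have hi : i < n := hij.trans hj
  rw [sgnLen_split hij hj, sgnLen_split hij hj g]
  have hSg : ∀ x ∈ ((range n).erase i).erase j, (Op.dif i j).act g x = g x := by
    intro x hx; simp only [mem_erase] at hx; simp [Op.act, hx.1, hx.2.1]
  have e1 : (Op.dif i j).act g i = g j := by simp [Op.act]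
  have e2 : (Op.dif i j).act g j = g i := by simp [Op.act, hij.ne']
  rw [e1, e2]
  rw [sum_congr rfl (fun x hx => by rw [hSg x hx]),
    sum_congr (s₁ := ((range n).erase i).erase j)
      (f := fun x => if (Op.dif i j).act g x < 0 then (n:ℤ) - x else 0) rfl
      (fun x hx => by rw [hSg x hx]),
    sum_congr (s₁ := ((range n).erase i).erase j)
      (f := fun x => ∑ y ∈ ((range n).erase i).erase j,
        if x < y then lenPair ((Op.dif i j).act g x) ((Op.dif i j).act g y) else 0)
     rfl (fun x hx => sum_congr rfl (fun y hy => by rw [hSg x hx, hSg y hy]))]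
  have key : ∑ x ∈ ((range n).erase i).erase j,
        ((if i < x then lenPair (g j) (g x) else 0) + (if j < x then lenPair (g i) (g x) else 0) +
         (if x < i then lenPair (g x) (g j) else 0) + (if x < j then lenPair (g x) (g i) else 0)) =
      ∑ x ∈ ((range n).erase i).erase j,
        ((if i < x then lenPair (g i) (g x) else 0) + (if j < x then lenPair (g j) (g x) else 0) +
         (if x < i then lenPair (g x) (g i) else 0) + (if x < j then lenPair (g x) (g j) else 0))
      + ∑ x ∈ ((range n).erase i).erase j, ((if i < x ∧ x < j then
        (if ltB (g i) (g j) then (if cyc (g i) (g x) (g j) then 2 else 0)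
          else (if cyc (g i) (g x) (g j) then 0 else -2)) else 0 : ℤ)
          - ((if g j < 0 then 1 else 0) - (if g i < 0 then 1 else 0)) *
            (if i < x ∧ x < j then 1 else 0)) := by
    rw [← sum_add_distrib]
    refine sum_congr rfl fun x hx => ?_
    simp only [mem_erase, mem_range] at hx
    obtain ⟨hxj, hxi, hxn⟩ := hx
    have hb := lenPair_between_dif (hg.ne_zero i hi) (hg.ne_zero j hj) (hg.ne_zero x hxn)
      (hg.indep hi hj hij.ne) (hg.indep hxn hi hxi) (hg.indep hxn hj hxj)
    rcases lt_or_gt_of_ne hxi with h | h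
    · have h' : x < j := by omega
      simp only [h, h', not_lt.2 h.le, not_lt.2 h'.le, if_true, if_false, false_and]; ring
    · rcases lt_or_gt_of_ne hxj with h' | h'
      · simp only [h, h', not_lt.2 h.le, not_lt.2 h'.le, if_true, if_false, and_self]
        linarith
      · simp only [h, h', not_lt.2 h.le, not_lt.2 h'.le, if_true, if_false, and_false]; ring
  rw [key, sum_sub_distrib, ← mul_sum, sum_between hij hj]
  have base := lenPair_base_dif (hg.ne_zero i hi) (hg.ne_zero j hj) (hg.indep hi hj hij.ne) n i j
  linarith

theorem sgnLen_sum {n i j : ℕ} (hij : i < j) (hj : j < n) {g : ℕ → ℤ} (hg : IsSgn n g) :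
    sgnLen n ((Op.sum i j).act g) = sgnLen n g + excessBase (g i) (g j) +
      ∑ x ∈ ((range n).erase i).erase j,
        ((if i < x ∧ x < j then excessBetween (g i) (g j) (g x) else 0) +
         (if j < x then excessAfter (g i) (g j) (g x) else 0)) := by
  have hi : i < n := hij.trans hj
  rw [sgnLen_split hij hj, sgnLen_split hij hj g]
  have hSg : ∀ x ∈ ((range n).erase i).erase j, (Op.sum i j).act g x = g x := by
    intro x hx; simp only [mem_erase] at hx; simp [Op.act, hx.1, hx.2.1]
  have e1 : (Op.sum i j).act g i = -g j := by simp [Op.act]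
  have e2 : (Op.sum i j).act g j = -g i := by simp [Op.act, hij.ne']
  rw [e1, e2]
  simp only [lenPair_neg_right]
  rw [sum_congr rfl (fun x hx => by rw [hSg x hx]),
    sum_congr (s₁ := ((range n).erase i).erase j)
      (f := fun x => if (Op.sum i j).act g x < 0 then (n:ℤ) - x else 0) rfl
      (fun x hx => by rw [hSg x hx]),
    sum_congr (s₁ := ((range n).erase i).erase j)
      (f := fun x => ∑ y ∈ ((range n).erase i).erase j,
        if x < y then lenPair ((Op.sum i j).act g x) ((Op.sum i j).act g y) else 0)
     rfl (fun x hx => sum_congr rfl (fun y hy => by rw [hSg x hx, hSg y hy]))]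
  have key : ∑ x ∈ ((range n).erase i).erase j,
        ((if i < x then lenPair (-g j) (g x) else 0) + (if j < x then lenPair (-g i) (g x) else 0) +
         (if x < i then lenPair (g x) (g j) else 0) + (if x < j then lenPair (g x) (g i) else 0)) =
      ∑ x ∈ ((range n).erase i).erase j,
        ((if i < x then lenPair (g i) (g x) else 0) + (if j < x then lenPair (g j) (g x) else 0) +
         (if x < i then lenPair (g x) (g i) else 0) + (if x < j then lenPair (g x) (g j) else 0))
      + ∑ x ∈ ((range n).erase i).erase j,
        (((if i < x ∧ x < j then excessBetween (g i) (g j) (g x) else 0) +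
         (if j < x then excessAfter (g i) (g j) (g x) else 0))
          - (1 - (if g i < 0 then 1 else 0) - (if g j < 0 then 1 else 0)) *
            ((if i < x ∧ x < j then 1 else 0) + 2 * (if j < x then 1 else 0))) := by
    rw [← sum_add_distrib]
    refine sum_congr rfl fun x hx => ?_
    simp only [mem_erase, mem_range] at hx
    obtain ⟨hxj, hxi, hxn⟩ := hx
    unfold excessBetween excessAfter
    rcases lt_or_gt_of_ne hxi with h | h
    · have h' : x < j := by omega
      simp only [h, h', not_lt.2 h.le, not_lt.2 h'.le, if_true, if_false, false_and]; ring
    · rcases lt_or_gt_of_ne hxj with h' | h'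
      · simp only [h, h', not_lt.2 h.le, not_lt.2 h'.le, if_true, if_false, and_self]
        ring
      · simp only [h, h', not_lt.2 h.le, not_lt.2 h'.le, if_true, if_false, and_false]; ring
  rw [key, sum_sub_distrib, ← mul_sum, sum_add_distrib (g := fun x => 2 * if j < x then (1:ℤ) else 0),
    ← mul_sum, sum_between hij hj, sum_after hij hj]
  have h1 := hg.ne_zero i hi
  have h2 := hg.ne_zero j hj
  unfold excessBase
  generalize g i = a at *
  generalize g j = b at *
  rcases lt_or_gt_of_ne h1 with ha | ha <;> rcases lt_or_gt_of_ne h2 with hb | hb <;>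
    simp only [ha, hb, not_lt.2 ha.le, not_lt.2 hb.le, if_true, if_false, Left.neg_neg_iff] <;> ring

theorem sgnLen_sgn {n i : ℕ} (hi : i < n) {g : ℕ → ℤ} (hg : IsSgn n g) :
    sgnLen n ((Op.sgn i).act g) = sgnLen n g + (if 0 < g i then 1 else -1) +
      ∑ x ∈ (range n).erase i, (if i < x ∧ |g i| < |g x| then (if 0 < g i then 2 else -2) else 0) := by
  rw [sgnLen_split_one hi, sgnLen_split_one hi g]
  have hSg : ∀ x ∈ (range n).erase i, (Op.sgn i).act g x = g x := by
    intro x hx; simp only [mem_erase] at hx; simp [Op.act, hx.1]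
  have e1 : (Op.sgn i).act g i = -g i := by simp [Op.act]
  rw [e1]
  simp only [lenPair_neg_right]
  rw [sum_congr rfl (fun x hx => by rw [hSg x hx]),
    sum_congr (s₁ := (range n).erase i)
      (f := fun x => if (Op.sgn i).act g x < 0 then (n:ℤ) - x else 0) rfl
      (fun x hx => by rw [hSg x hx]),
    sum_congr (s₁ := (range n).erase i)
      (f := fun x => ∑ y ∈ (range n).erase i,
        if x < y then lenPair ((Op.sgn i).act g x) ((Op.sgn i).act g y) else 0)
     rfl (fun x hx => sum_congr rfl (fun y hy => by rw [hSg x hx, hSg y hy]))]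
  have key : ∑ x ∈ (range n).erase i,
        ((if i < x then lenPair (-g i) (g x) else 0) + (if x < i then lenPair (g x) (g i) else 0)) =
      ∑ x ∈ (range n).erase i,
        ((if i < x then lenPair (g i) (g x) else 0) + (if x < i then lenPair (g x) (g i) else 0))
      + ∑ x ∈ (range n).erase i,
        ((if i < x ∧ |g i| < |g x| then (if 0 < g i then 2 else -2) else 0 : ℤ)
          - (if 0 < g i then 1 else -1) * (if i < x then 1 else 0)) := by
    rw [← sum_add_distrib]
    refine sum_congr rfl fun x hx => ?_
    simp only [mem_erase, mem_range] at hx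
    obtain ⟨hxi, hxn⟩ := hx
    have h1 := hg.ne_zero i hi
    have h2 : |g x| ≠ |g i| := fun e => hxi (hg.inj x hxn i hi e)
    unfold lenPair
    rw [abs_neg]
    rcases lt_or_gt_of_ne hxi with h | h
    · simp [h, not_lt.2 h.le]
    · simp only [h, not_lt.2 h.le, if_true, if_false, true_and]
      rcases lt_or_gt_of_ne h1 with ha | ha <;>
        simp only [ha, not_lt.2 ha.le, if_true, if_false, Left.neg_pos_iff] <;> split_ifs <;> omega
  rw [key, sum_sub_distrib, ← mul_sum, sum_after_one hi]
  rcases lt_or_gt_of_ne (hg.ne_zero i hi) with ha | ha <;>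
    simp only [ha, not_lt.2 ha.le, if_true, if_false, Left.neg_neg_iff] <;> ring

/-! ### Which changes of length are edges -/

/-- The condition for an operation to be an edge of the quantum Bruhat graph. -/
def Op.ok (n : ℕ) : Op → (ℕ → ℤ) → Prop
  | .dif i j, g => ∀ x, i < x → x < j → ¬ cyc (g i) (g x) (g j)
  | .sum i j, g => g (min i j) < -g (max i j) ∧
      (∀ x, min i j < x → x < max i j → ¬ (g (min i j) < g x ∧ g x < -g (max i j))) ∧
      (∀ x, max i j < x → x < n → ¬ (g (min i j) < g x ∧ g x < -g (max i j)) ∧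
        ¬ (g (min i j) < -g x ∧ -g x < -g (max i j)))
  | .sgn i, g => 0 < g i ∧ ∀ x, i < x → x < n → |g x| < g i

theorem edge_dif {n i j : ℕ} (hij : i < j) (hj : j < n) {g : ℕ → ℤ} (hg : IsSgn n g) :
    (sgnLen n ((Op.dif i j).act g) = sgnLen n g + 1 ∨
      sgnLen n ((Op.dif i j).act g) = sgnLen n g - 2 * ((j : ℤ) - i) + 1) ↔ (Op.dif i j).ok n g := by
  rw [sgnLen_dif hij hj hg]
  have hmem : ∀ x, i < x → x < j → x ∈ ((range n).erase i).erase j := by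
    intro x h1 h2; simp only [mem_erase, mem_range]; omega
  by_cases h : ltB (g i) (g j)
  · simp only [h, if_true]
    have hnn : ∀ x ∈ ((range n).erase i).erase j, (0 : ℤ) ≤
        (if i < x ∧ x < j then (if cyc (g i) (g x) (g j) then 2 else 0) else 0) := by
      intro x _; split_ifs <;> omega
    have hz := sum_eq_zero_iff_of_nonneg hnn
    have hs := sum_nonneg hnn
    set S := ∑ x ∈ ((range n).erase i).erase j,
      (if i < x ∧ x < j then (if cyc (g i) (g x) (g j) then 2 else 0) else 0 : ℤ)
    have : (sgnLen n g + 1 + S = sgnLen n g + 1 ∨ sgnLen n g + 1 + S = sgnLen n g - 2 * ((j : ℤ) - i) + 1)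
        ↔ S = 0 := by omega
    rw [this, hz]
    constructor
    · intro H x h1 h2 h3
      have := H x (hmem x h1 h2)
      simp [h1, h2, h3] at this
    · intro H x _
      split_ifs with h1 h2
      · exact absurd h2 (H x h1.1 h1.2)
      · rfl
      · rfl
  · simp only [h, if_false]
    have hb := sum_between hij hj
    -- Adding `2` for each of the `j - i - 1` positions between turns the greatest possible drop
    -- into the vanishing of a sum of nonnegative terms.
    have hnn : ∀ x ∈ ((range n).erase i).erase j, (0 : ℤ) ≤
        ((if i < x ∧ x < j then (if cyc (g i) (g x) (g j) then 0 else -2) else 0) +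
          2 * (if i < x ∧ x < j then 1 else 0)) := by
      intro x _; split_ifs <;> omega
    have hz := sum_eq_zero_iff_of_nonneg hnn
    have hs := sum_nonneg hnn
    rw [sum_add_distrib, ← mul_sum, hb] at hz hs
    have hle : ∑ x ∈ ((range n).erase i).erase j,
      (if i < x ∧ x < j then (if cyc (g i) (g x) (g j) then 0 else -2) else 0 : ℤ) ≤ 0 :=
      sum_nonpos (by intro x _; split_ifs <;> omega)
    set S := ∑ x ∈ ((range n).erase i).erase j,
      (if i < x ∧ x < j then (if cyc (g i) (g x) (g j) then 0 else -2) else 0 : ℤ)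
    have : (sgnLen n g + -1 + S = sgnLen n g + 1 ∨
        sgnLen n g + -1 + S = sgnLen n g - 2 * ((j : ℤ) - i) + 1) ↔
        S + 2 * ((j : ℤ) - i - 1) = 0 := by omega
    rw [this, hz]
    constructor
    · intro H x h1 h2 h3
      have := H x (hmem x h1 h2)
      simp [h1, h2, h3] at this
    · intro H x _
      split_ifs with h1 h2
      · exact absurd h2 (H x h1.1 h1.2)
      · rfl
      · rfl

theorem ok_sum_of_lt {n i j : ℕ} (hij : i < j) (g : ℕ → ℤ) : (Op.sum i j).ok n g ↔ g i < -g j ∧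
    (∀ x, i < x → x < j → ¬ (g i < g x ∧ g x < -g j)) ∧
    (∀ x, j < x → x < n → ¬ (g i < g x ∧ g x < -g j) ∧ ¬ (g i < -g x ∧ -g x < -g j)) := by
  simp only [Op.ok, min_eq_left hij.le, max_eq_right hij.le]

theorem edge_sum {n i j : ℕ} (hij : i < j) (hj : j < n) {g : ℕ → ℤ} (hg : IsSgn n g) :
    (sgnLen n ((Op.sum i j).act g) = sgnLen n g + 1 ∨
      sgnLen n ((Op.sum i j).act g) = sgnLen n g - 2 * (2 * (n : ℤ) - i - j - 1) + 1) ↔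
    (Op.sum i j).ok n g := by
  have hi : i < n := hij.trans hj
  rw [sgnLen_sum hij hj hg, ok_sum_of_lt hij]
  have h1 := hg.ne_zero i hi
  have h2 := hg.ne_zero j hj
  have h4 := hg.indep hi hj hij.ne
  have hS : ∀ x ∈ ((range n).erase i).erase j,
      g x ≠ 0 ∧ Indep (g x) (g i) ∧ Indep (g x) (g j) := by
    intro x hx
    simp only [mem_erase, mem_range] at hx
    exact ⟨hg.ne_zero x hx.2.2, hg.indep hx.2.2 hi hx.2.1, hg.indep hx.2.2 hj hx.1⟩
  have hmem : ∀ x, i < x → x < n → x ≠ j → x ∈ ((range n).erase i).erase j := by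
    intro x h1 h2 h3; simp only [mem_erase, mem_range]; omega
  have hb := sum_between hij hj
  have ha := sum_after hij hj
  set S := ∑ x ∈ ((range n).erase i).erase j,
        ((if i < x ∧ x < j then excessBetween (g i) (g j) (g x) else 0) +
         (if j < x then excessAfter (g i) (g j) (g x) else 0)) with hSdef
  have hlow : ∀ f : ℕ → ℤ, (∀ x ∈ ((range n).erase i).erase j, 0 ≤ f x) →
      0 ≤ ∑ x ∈ ((range n).erase i).erase j, f x := fun f hf => sum_nonneg hf
  have hlower : (∀ c : ℤ, c ≠ 0 → Indep c (g i) → Indep c (g j) →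
      -2 ≤ excessBetween (g i) (g j) c ∧ -4 ≤ excessAfter (g i) (g j) c) →
      0 ≤ S + 2 * ((j : ℤ) - i - 1) + 4 * ((n : ℤ) - j - 1) := by
    intro H
    rw [← hb, ← ha, mul_sum, mul_sum, hSdef, ← sum_add_distrib, ← sum_add_distrib]
    refine sum_nonneg fun x hx => ?_
    obtain ⟨q1, q2, q3⟩ := hS x hx
    have := H _ q1 q2 q3
    split_ifs <;> omega
  have hupper : (∀ c : ℤ, c ≠ 0 → Indep c (g i) → Indep c (g j) →
      excessBetween (g i) (g j) c ≤ 0 ∧ excessAfter (g i) (g j) c ≤ 0) → S ≤ 0 := by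
    intro H
    refine sum_nonpos fun x hx => ?_
    obtain ⟨q1, q2, q3⟩ := hS x hx
    have := H _ q1 q2 q3
    split_ifs <;> omega
  have hnonneg : (∀ c : ℤ, c ≠ 0 → Indep c (g i) → Indep c (g j) →
      0 ≤ excessBetween (g i) (g j) c ∧ 0 ≤ excessAfter (g i) (g j) c) → 0 ≤ S := by
    intro H
    refine sum_nonneg fun x hx => ?_
    obtain ⟨q1, q2, q3⟩ := hS x hx
    have := H _ q1 q2 q3
    split_ifs <;> omega
  by_cases hab : g i < -g j
  · by_cases hs : (0 < g i ↔ g j < 0)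
    · obtain ⟨hbase, hex⟩ := excess_up h1 h2 h4 hs hab
      have hn := hnonneg fun c q1 q2 q3 => ⟨(hex c q1 q2 q3).1, (hex c q1 q2 q3).2.1⟩
      have hz : S = 0 ↔ _ := sum_eq_zero_iff_of_nonneg (s := ((range n).erase i).erase j)
        (f := fun x => (if i < x ∧ x < j then excessBetween (g i) (g j) (g x) else 0) +
         (if j < x then excessAfter (g i) (g j) (g x) else 0)) (by
          intro x hx
          obtain ⟨q1, q2, q3⟩ := hS x hx
          have := hex _ q1 q2 q3
          try dsimp only
          split_ifs <;> omega)
      rw [hbase]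
      have : (sgnLen n g + 1 + S = sgnLen n g + 1 ∨
          sgnLen n g + 1 + S = sgnLen n g - 2 * (2 * (n : ℤ) - i - j - 1) + 1) ↔ S = 0 := by omega
      rw [this, hz]
      constructor
      · intro H
        refine ⟨hab, fun x k1 k2 => ?_, fun x k1 k2 => ?_⟩
        · have hx := hmem x k1 (by omega) (by omega)
          obtain ⟨q1, q2, q3⟩ := hS x hx
          have := H x hx
          simp only [k1, k2, not_lt.2 k2.le, and_self, if_true, if_false, add_zero] at this
          exact (hex _ q1 q2 q3).2.2.1.1 this
        · have hx := hmem x (by omega) (by omega) (by omega)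
          obtain ⟨q1, q2, q3⟩ := hS x hx
          have := H x hx
          simp only [k1, not_lt.2 k1.le, and_false, if_true, if_false, zero_add] at this
          exact (hex _ q1 q2 q3).2.2.2.1 this
      · rintro ⟨-, H1, H2⟩ x hx
        obtain ⟨q1, q2, q3⟩ := hS x hx
        have := hex _ q1 q2 q3
        simp only [mem_erase, mem_range] at hx
        split_ifs with k1 k2 k2
        · omega
        · rw [this.2.2.1.2 (H1 x k1.1 k1.2)]; rfl
        · rw [this.2.2.2.2 (H2 x k2 hx.2.2)]; rfl
        · rfl
    · have hai : g i < 0 := by omega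
      have hbj : g j < 0 := by omega
      obtain ⟨hbase, hex⟩ := excess_quantum h4 hai hbj
      have hu := hupper fun c q1 q2 q3 => ⟨(hex c q1 q2 q3).2.2.1, (hex c q1 q2 q3).2.2.2.1⟩
      have hz := sum_eq_zero_iff_of_nonneg (s := ((range n).erase i).erase j)
        (f := fun x => ((if i < x ∧ x < j then excessBetween (g i) (g j) (g x) else 0) +
         (if j < x then excessAfter (g i) (g j) (g x) else 0)) +
          2 * (if i < x ∧ x < j then 1 else 0) + 4 * (if j < x then 1 else 0)) (by
          intro x hx
          obtain ⟨q1, q2, q3⟩ := hS x hx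
          have := hex _ q1 q2 q3
          try dsimp only
          split_ifs <;> omega)
      rw [sum_add_distrib, sum_add_distrib, ← mul_sum, ← mul_sum, hb, ha, ← hSdef] at hz
      rw [hbase]
      have : (sgnLen n g + -3 + S = sgnLen n g + 1 ∨
          sgnLen n g + -3 + S = sgnLen n g - 2 * (2 * (n : ℤ) - i - j - 1) + 1) ↔
          S + 2 * ((j : ℤ) - i - 1) + 4 * ((n : ℤ) - j - 1) = 0 := by omega
      rw [this, hz]
      constructor
      · intro H
        refine ⟨hab, fun x k1 k2 => ?_, fun x k1 k2 => ?_⟩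
        · have hx := hmem x k1 (by omega) (by omega)
          obtain ⟨q1, q2, q3⟩ := hS x hx
          have := H x hx
          simp only [k1, k2, not_lt.2 k2.le, and_self, if_true, if_false] at this
          exact (hex _ q1 q2 q3).2.2.2.2.1.1 (by omega)
        · have hx := hmem x (by omega) (by omega) (by omega)
          obtain ⟨q1, q2, q3⟩ := hS x hx
          have := H x hx
          simp only [k1, not_lt.2 k1.le, and_false, if_true, if_false, zero_add] at this
          exact (hex _ q1 q2 q3).2.2.2.2.2.1 (by omega)
      · rintro ⟨-, H1, H2⟩ x hx
        obtain ⟨q1, q2, q3⟩ := hS x hx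
        have := hex _ q1 q2 q3
        simp only [mem_erase, mem_range] at hx
        split_ifs with k1 k2 k2
        · omega
        · rw [this.2.2.2.2.1.2 (H1 x k1.1 k1.2)]; rfl
        · rw [this.2.2.2.2.2.2 (H2 x k2 hx.2.2)]; rfl
        · rfl
  · have hab' : -g j < g i := by have := h4.2; omega
    refine iff_of_false ?_ (fun h => hab h.1)
    rcases excess_none h1 h2 h4 hab' with ⟨hbase, hex⟩ | ⟨hbase, hex⟩
    · have := hnonneg hex
      omega
    · have := hupper fun c q1 q2 q3 => ⟨(hex c q1 q2 q3).1, (hex c q1 q2 q3).2.1⟩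
      have := hlower fun c q1 q2 q3 => (hex c q1 q2 q3).2.2
      omega

/-- A quantum edge would need a drop by `4(n - i) - 3`, while a change of sign lowers the length by
at most `2(n - i) - 1`. For `i + 1 < n` the former is greater, so only covers remain. This is where
columns of height less than `n` matter. -/
theorem edge_sgn {n i : ℕ} (hi : i + 1 < n) {g : ℕ → ℤ} (hg : IsSgn n g) :
    (sgnLen n ((Op.sgn i).act g) = sgnLen n g + 1 ∨
      sgnLen n ((Op.sgn i).act g) = sgnLen n g - 2 * (2 * ((n : ℤ) - i) - 1) + 1) ↔
    (Op.sgn i).ok n g := by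
  have hi' : i < n := by omega
  rw [sgnLen_sgn hi' hg]
  have hc := sum_after_one hi'
  rcases lt_or_gt_of_ne (hg.ne_zero i hi') with ha | ha
  · refine iff_of_false ?_ (fun h => absurd h.1 (by omega))
    simp only [not_lt.2 ha.le, if_false]
    have hu : ∑ x ∈ (range n).erase i, (if i < x ∧ |g i| < |g x| then -2 else 0 : ℤ) ≤ 0 :=
      sum_nonpos (by intro x _; split_ifs <;> omega)
    have hl : 0 ≤ (∑ x ∈ (range n).erase i, (if i < x ∧ |g i| < |g x| then -2 else 0 : ℤ)) +
        2 * ((n : ℤ) - i - 1) := by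
      rw [← hc, mul_sum, ← sum_add_distrib]
      exact sum_nonneg (by intro x _; split_ifs <;> omega)
    omega
  · simp only [ha, if_true, Op.ok, true_and]
    have hnn : ∀ x ∈ (range n).erase i, (0 : ℤ) ≤ if i < x ∧ |g i| < |g x| then 2 else 0 := by
      intro x _; split_ifs <;> omega
    have hz := sum_eq_zero_iff_of_nonneg hnn
    have hs := sum_nonneg hnn
    set S := ∑ x ∈ (range n).erase i, (if i < x ∧ |g i| < |g x| then 2 else 0 : ℤ)
    have : (sgnLen n g + 1 + S = sgnLen n g + 1 ∨
        sgnLen n g + 1 + S = sgnLen n g - 2 * (2 * ((n : ℤ) - i) - 1) + 1) ↔ S = 0 := by omega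
    rw [this, hz]
    constructor
    · intro H x h1 h2
      have := H x (by simp only [mem_erase, mem_range]; omega)
      rw [abs_of_pos ha] at this
      have h3 : |g x| ≠ g i := fun e => by
        have := hg.inj x h2 i hi' (by rw [e, abs_of_pos ha]); omega
      simp only [h1, true_and, ite_eq_right_iff] at this
      by_contra h4
      exact absurd (this (by omega)) (by norm_num)
    · intro H x hx
      simp only [mem_erase, mem_range] at hx
      rw [abs_of_pos ha]
      split_ifs with h1
      · have := H x h1.1 hx.2; omega
      · rfl

theorem IsSgn.act_dif {n i j : ℕ} {g : ℕ → ℤ} (hg : IsSgn n g) (hi : i < n) (hj : j < n) :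
    IsSgn n ((Op.dif i j).act g) := by
  refine ⟨fun x hx => ?_, fun x hx => ?_, fun x hx y hy h => ?_⟩
  · simp only [Op.act]; split_ifs <;> exact hg.ne_zero _ (by assumption)
  · simp only [Op.act]; split_ifs <;> exact hg.abs_le _ (by assumption)
  · simp only [Op.act] at h
    split_ifs at h <;> have := hg.inj _ (by assumption) _ (by assumption) h <;> omega

theorem IsSgn.act_sum {n i j : ℕ} {g : ℕ → ℤ} (hg : IsSgn n g) (hi : i < n) (hj : j < n) :
    IsSgn n ((Op.sum i j).act g) := by
  refine ⟨fun x hx => ?_, fun x hx => ?_, fun x hx y hy h => ?_⟩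
  · simp only [Op.act]; split_ifs <;> simp only [ne_eq, neg_eq_zero] <;>
      exact hg.ne_zero _ (by assumption)
  · simp only [Op.act]; split_ifs <;> try rw [abs_neg]
    all_goals exact hg.abs_le _ (by assumption)
  · simp only [Op.act] at h
    split_ifs at h <;> first
      | omega
      | (rw [abs_neg, abs_neg] at h; have := hg.inj _ (by assumption) _ (by assumption) h; omega)
      | (rw [abs_neg] at h; have := hg.inj _ (by assumption) _ (by assumption) h; omega)
      | (have := hg.inj _ (by assumption) _ (by assumption) h; omega)

theorem IsSgn.act_sgn {n i : ℕ} {g : ℕ → ℤ} (hg : IsSgn n g) (hi : i < n) :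
    IsSgn n ((Op.sgn i).act g) := by
  refine ⟨fun x hx => ?_, fun x hx => ?_, fun x hx y hy h => ?_⟩
  · simp only [Op.act]; split_ifs <;> simp only [ne_eq, neg_eq_zero] <;>
      exact hg.ne_zero _ (by assumption)
  · simp only [Op.act]; split_ifs <;> try rw [abs_neg]
    all_goals exact hg.abs_le _ (by assumption)
  · simp only [Op.act] at h
    split_ifs at h <;> first
      | omega
      | (rw [abs_neg, abs_neg] at h; have := hg.inj _ (by assumption) _ (by assumption) h; omega)
      | (rw [abs_neg] at h; have := hg.inj _ (by assumption) _ (by assumption) h; omega)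
      | (have := hg.inj _ (by assumption) _ (by assumption) h; omega)

/-! ### From the Weyl group to signed sequences -/

/-- The letters as nonzero integers: `i` is `i`, and `ī` is `-i`. -/
def sg {n : ℕ} (x : Letter n) : ℤ := if (x : ℕ) < n then (x : ℤ) + 1 else (x : ℤ) - 2 * n

theorem sg_rev {n : ℕ} (x : Letter n) : sg x.rev = -sg x := by
  have := x.isLt
  simp only [sg, Fin.val_rev]
  split_ifs <;> omega

theorem sg_inj {n : ℕ} {x y : Letter n} (h : sg x = sg y) : x = y := by
  have := x.isLt; have := y.isLt
  simp only [sg] at h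
  apply Fin.ext
  split_ifs at h <;> omega

theorem sg_ne_zero {n : ℕ} (x : Letter n) : sg x ≠ 0 := by
  have := x.isLt
  simp only [sg]
  split_ifs <;> omega

theorem abs_sg_le {n : ℕ} (x : Letter n) : |sg x| ≤ n := by
  have := x.isLt
  simp only [sg, abs_le]
  split_ifs <;> constructor <;> omega

theorem sg_unb {n : ℕ} (i : Fin n) : sg (unb i) = (i : ℤ) + 1 := by simp [sg, unb]

theorem sg_barred {n : ℕ} (i : Fin n) : sg (barred i) = -((i : ℤ) + 1) := by
  rw [barred, sg_rev, sg_unb]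

theorem unb_inj {n : ℕ} {i j : Fin n} : unb i = unb j ↔ i = j := by
  simp [unb, Fin.ext_iff]

theorem unb_ne_barred {n : ℕ} (i j : Fin n) : unb i ≠ barred j := by
  intro h
  have := congrArg sg h
  rw [sg_unb, sg_barred] at this
  omega

theorem rev_unb {n : ℕ} (i : Fin n) : (unb i).rev = barred i := rfl

theorem rev_barred {n : ℕ} (i : Fin n) : (barred i).rev = unb i := Fin.rev_rev _

theorem barred_inj {n : ℕ} {i j : Fin n} : barred i = barred j ↔ i = j := by
  rw [barred, barred, Fin.rev_inj, unb_inj]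

theorem letter_cases {n : ℕ} (x : Letter n) : ∃ i : Fin n, x = unb i ∨ x = barred i := by
  have := x.isLt
  by_cases h : (x : ℕ) < n
  · exact ⟨⟨x, h⟩, Or.inl rfl⟩
  · refine ⟨⟨2 * n - 1 - x, by omega⟩, Or.inr ?_⟩
    apply Fin.ext
    simp only [barred, unb, Fin.val_rev]
    omega

/-- The signed sequence `w(1), …, w(n)` of a Weyl group element. -/
def st {n : ℕ} (w : weyl n) : ℕ → ℤ := fun i => if h : i < n then sg (w.1 (unb ⟨i, h⟩)) else 0

theorem st_fin {n : ℕ} (w : weyl n) (i : Fin n) : st w i = sg (w.1 (unb i)) := by simp [st]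

theorem weyl_barred {n : ℕ} (w : weyl n) (i : Fin n) : sg (w.1 (barred i)) = -st w i := by
  rw [barred, w.2 (unb i), sg_rev, st_fin]

theorem st_inj {n : ℕ} {v w : weyl n} (h : ∀ i < n, st v i = st w i) : v = w := by
  apply Subtype.ext
  ext x
  obtain ⟨i, rfl | rfl⟩ := letter_cases x
  · have := h i i.2
    rw [st_fin, st_fin] at this
    rw [sg_inj this]
  · have := h i i.2
    rw [← neg_inj, ← weyl_barred, ← weyl_barred] at this
    rw [sg_inj this]

theorem isSgn_st {n : ℕ} (w : weyl n) : IsSgn n (st w) := by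
  refine ⟨fun i hi => ?_, fun i hi => ?_, fun i hi j hj h => ?_⟩
  · simp only [st, hi, dif_pos]; exact sg_ne_zero _
  · simp only [st, hi, dif_pos]; exact abs_sg_le _
  · simp only [st, hi, hj, dif_pos] at h
    rcases abs_eq_abs.1 h with h | h
    · have := w.1.injective (sg_inj h)
      simpa [unb] using this
    · rw [← sg_rev, ← w.2] at h
      exact absurd (w.1.injective (sg_inj h)) (unb_ne_barred _ _)

theorem st_zero {n : ℕ} (w : weyl n) {x : ℕ} (hx : ¬ x < n) : st w x = 0 := by simp [st, hx]

theorem st_mul_dif {n : ℕ} (w : weyl n) {i j : Fin n} (hij : i ≠ j) :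
    st (w * refl (unb i, unb j)) = (Op.dif i j).act (st w) := by
  funext x
  by_cases hx : x < n
  · obtain ⟨x, rfl⟩ : ∃ y : Fin n, (y : ℕ) = x := ⟨⟨x, hx⟩, rfl⟩
    have e : (refl (unb i, unb j)).1 =
        Equiv.swap (unb i) (unb j) * Equiv.swap (barred i) (barred j) := if_neg (unb_ne_barred j i)
    simp only [st_fin, Op.act, Subgroup.coe_mul, Equiv.Perm.mul_apply, e, Fin.val_inj]
    simp only [Equiv.swap_apply_of_ne_of_ne (unb_ne_barred x i) (unb_ne_barred x j)]
    split_ifs with h1 h2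
    · rw [h1, Equiv.swap_apply_left]
    · rw [h2, Equiv.swap_apply_right]
    · rw [Equiv.swap_apply_of_ne_of_ne (fun h => h1 (unb_inj.1 h)) (fun h => h2 (unb_inj.1 h))]
  · have h1 : x ≠ i := by omega
    have h2 : x ≠ j := by omega
    simp [Op.act, st_zero _ hx, h1, h2]

theorem st_mul_sum {n : ℕ} (w : weyl n) {i j : Fin n} (hij : i ≠ j) :
    st (w * refl (unb i, barred j)) = (Op.sum i j).act (st w) := by
  funext x
  by_cases hx : x < n
  · obtain ⟨x, rfl⟩ : ∃ y : Fin n, (y : ℕ) = x := ⟨⟨x, hx⟩, rfl⟩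
    simp only [Op.act, Fin.val_inj]
    rw [st_fin]
    simp only [Subgroup.coe_mul, Equiv.Perm.mul_apply, refl, reflPerm, rev_unb, rev_barred]
    rw [if_neg (fun h => hij (barred_inj.1 h).symm)]
    simp only [Equiv.Perm.mul_apply]
    split_ifs with h1 h2
    · rw [h1, Equiv.swap_apply_of_ne_of_ne (unb_ne_barred i i) (fun h => hij (unb_inj.1 h)),
        Equiv.swap_apply_left, weyl_barred]
    · rw [h2, Equiv.swap_apply_right,
        Equiv.swap_apply_of_ne_of_ne (unb_ne_barred i i).symm (fun h => hij (barred_inj.1 h)),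
        weyl_barred]
    · rw [Equiv.swap_apply_of_ne_of_ne (unb_ne_barred x i) (fun h => h2 (unb_inj.1 h)),
        Equiv.swap_apply_of_ne_of_ne (fun h => h1 (unb_inj.1 h)) (unb_ne_barred x j), st_fin]
  · have h1 : x ≠ i := by omega
    have h2 : x ≠ j := by omega
    simp [Op.act, st_zero _ hx, h1, h2]

theorem st_mul_sgn {n : ℕ} (w : weyl n) (i : Fin n) :
    st (w * refl (unb i, barred i)) = (Op.sgn i).act (st w) := by
  funext x
  by_cases hx : x < n
  · obtain ⟨x, rfl⟩ : ∃ y : Fin n, (y : ℕ) = x := ⟨⟨x, hx⟩, rfl⟩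
    simp only [Op.act, Fin.val_inj]
    rw [st_fin]
    have e : (refl (unb i, barred i)).1 = Equiv.swap (unb i) (barred i) := if_pos rfl
    simp only [Subgroup.coe_mul, Equiv.Perm.mul_apply, e]
    split_ifs with h1
    · rw [h1, Equiv.swap_apply_left, weyl_barred]
    · rw [Equiv.swap_apply_of_ne_of_ne (fun h => h1 (unb_inj.1 h)) (unb_ne_barred x i), st_fin]
  · have h1 : x ≠ i := by omega
    simp [Op.act, st_zero _ hx, h1]

/-! ### The Coxeter length -/

theorem sgnLen_dif_succ {n i : ℕ} (hi : i + 1 < n) {g : ℕ → ℤ} (hg : IsSgn n g) :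
    sgnLen n ((Op.dif i (i + 1)).act g) = sgnLen n g + (if ltB (g i) (g (i + 1)) then 1 else -1) := by
  rw [sgnLen_dif (Nat.lt_succ_self i) hi hg, sum_eq_zero, add_zero]
  intro x hx
  rw [if_neg (by omega)]

theorem sgnLen_sgn_last {n : ℕ} {g : ℕ → ℤ} (hg : IsSgn (n + 1) g) :
    sgnLen (n + 1) ((Op.sgn n).act g) = sgnLen (n + 1) g + (if 0 < g n then 1 else -1) := by
  rw [sgnLen_sgn (Nat.lt_succ_self n) hg, sum_eq_zero, add_zero]
  intro x hx
  simp only [mem_erase, mem_range] at hx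
  rw [if_neg (by omega)]

theorem simpleRefl_cases {n : ℕ} {s : weyl n} (hs : IsSimpleRefl s) :
    (∃ (i : ℕ) (hi : i + 1 < n), s = refl (unb ⟨i, by omega⟩, unb ⟨i + 1, hi⟩)) ∨
    (∃ (i : ℕ) (hi : i + 1 = n), s = refl (unb ⟨i, by omega⟩, barred ⟨i, by omega⟩)) := by
  obtain ⟨a, b, ha, hb, rfl⟩ := hs
  have ha' : (a : ℕ) < n := ha
  rcases Nat.lt_or_ge (a + 1) n with h | h
  · left
    refine ⟨a, h, ?_⟩
    congr 2
    exact Fin.ext hb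
  · right
    refine ⟨a, by omega, ?_⟩
    congr 2
    apply Fin.ext
    simp only [barred, unb, Fin.val_rev]
    omega

theorem simpleRefl_dif {n i : ℕ} (hi : i + 1 < n) :
    IsSimpleRefl (refl (unb (⟨i, by omega⟩ : Fin n), unb ⟨i + 1, hi⟩)) :=
  ⟨_, _, by simp only [IsPos, unb]; omega, rfl, rfl⟩

theorem simpleRefl_sgn {n i : ℕ} (hi : i + 1 = n) :
    IsSimpleRefl (refl (unb (⟨i, by omega⟩ : Fin n), barred ⟨i, by omega⟩)) :=
  ⟨_, _, by simp only [IsPos, unb]; omega, by simp only [barred, unb, Fin.val_rev]; omega, rfl⟩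

theorem sgnLen_mul_simple_le {n : ℕ} (w : weyl n) {s : weyl n} (hs : IsSimpleRefl s) :
    sgnLen n (st (w * s)) ≤ sgnLen n (st w) + 1 := by
  rcases simpleRefl_cases hs with ⟨i, hi, rfl⟩ | ⟨i, hi, rfl⟩
  · rw [st_mul_dif w (by simp), sgnLen_dif_succ hi (isSgn_st w)]
    split_ifs <;> omega
  · rw [st_mul_sgn w]
    subst hi
    rw [sgnLen_sgn_last (isSgn_st w)]
    split_ifs <;> omega

theorem lenPair_nonneg (a b : ℤ) : 0 ≤ lenPair a b := by
  unfold lenPair; split_ifs <;> omega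

theorem sgnLen_nonneg (n : ℕ) (g : ℕ → ℤ) : 0 ≤ sgnLen n g := by
  unfold sgnLen
  refine add_nonneg (sum_nonneg fun x hx => ?_) (sum_nonneg fun x hx => sum_nonneg fun y hy => ?_)
  · have := mem_range.1 hx
    split_ifs <;> omega
  · split_ifs
    · exact lenPair_nonneg _ _
    · rfl

theorem st_one {n : ℕ} {i : ℕ} (hi : i < n) : st (1 : weyl n) i = (i : ℤ) + 1 := by
  simp only [st, hi, dif_pos, Subgroup.coe_one, Equiv.Perm.one_apply, sg_unb]

theorem sgnLen_one (n : ℕ) : sgnLen n (st (1 : weyl n)) = 0 := by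
  unfold sgnLen
  rw [sum_eq_zero, sum_eq_zero, add_zero]
  · intro x hx
    refine sum_eq_zero fun y hy => ?_
    rw [mem_range] at hx hy
    rw [st_one hx, st_one hy]
    unfold lenPair
    split_ifs with h1 h2 h3 <;> first | rfl | skip
    · rw [abs_of_pos (by omega), abs_of_pos (by omega)] at h3; omega
    · omega
  · intro x hx
    rw [mem_range] at hx
    rw [st_one hx, if_neg (by omega)]

/-- If no simple reflection lowers the length, the last entry is positive and the sequence increases
in the order with the negative letters at the end. So all entries are positive, and increasing from
at least `1` to at most `n` they are those of the identity. -/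
theorem exists_descent {n : ℕ} (w : weyl n) (hw : w ≠ 1) :
    ∃ s, IsSimpleRefl s ∧ sgnLen n (st (w * s)) = sgnLen n (st w) - 1 := by
  by_contra! H
  have hg := isSgn_st w
  apply hw
  rcases n with _ | n
  · exact st_inj (fun i hi => by omega)
  have hpos : 0 < st w n := by
    by_contra h
    refine H _ (simpleRefl_sgn (n := n + 1) rfl) ?_
    rw [st_mul_sgn w]
    have := sgnLen_sgn_last hg
    rw [if_neg h] at this
    exact this
  have hup : ∀ i < n, ltB (st w i) (st w (i + 1)) := by
    intro i hi
    by_contra h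
    refine H _ (simpleRefl_dif (n := n + 1) (i := i) (by omega)) ?_
    rw [st_mul_dif w (by simp)]
    have := sgnLen_dif_succ (i := i) (by omega) hg
    rw [if_neg h] at this
    exact this
  have h1 : ∀ d ≤ n, 0 < st w (n - d) ∧ st w (n - d) ≤ (n - d : ℕ) + 1 := by
    intro d hd
    induction d with
    | zero =>
      refine ⟨hpos, ?_⟩
      have := hg.abs_le n (by omega)
      rw [Nat.sub_zero, ← abs_of_pos hpos]; exact_mod_cast this
    | succ d ih =>
      obtain ⟨ih1, ih2⟩ := ih (by omega)
      have := hup (n - (d + 1)) (by omega)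
      rw [show n - (d + 1) + 1 = n - d by omega] at this
      unfold ltB at this
      omega
  have h2 : ∀ i ≤ n, (i : ℤ) + 1 ≤ st w i := by
    intro i hi
    induction i with
    | zero =>
      have := (h1 n le_rfl).1
      rw [Nat.sub_self] at this
      push_cast; omega
    | succ i ih =>
      have h := ih (by omega)
      have := hup i (by omega)
      unfold ltB at this
      have h3 := (h1 (n - (i + 1)) (by omega)).1
      rw [show n - (n - (i + 1)) = i + 1 by omega] at h3
      push_cast; omega
  refine st_inj fun i hi => ?_
  rw [st_one hi]
  have h3 := h1 (n - i) (by omega)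
  rw [show n - (n - i) = i by omega] at h3
  have := h2 i (by omega)
  omega

theorem sgnLen_prod_le {n : ℕ} (L : List (weyl n)) (hL : ∀ s ∈ L, IsSimpleRefl s) (w : weyl n) :
    sgnLen n (st (w * L.prod)) ≤ sgnLen n (st w) + L.length := by
  induction L generalizing w with
  | nil => simp
  | cons s L ih =>
    rw [List.prod_cons, ← mul_assoc, List.length_cons]
    have h1 := ih (fun t ht => hL t (List.mem_cons_of_mem _ ht)) (w * s)
    have h2 := sgnLen_mul_simple_le w (hL s List.mem_cons_self)
    push_cast
    omega

theorem simpleRefl_sq {n : ℕ} {s : weyl n} (hs : IsSimpleRefl s) : s * s = 1 := by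
  obtain ⟨a, b, ha, hb, rfl⟩ := hs
  apply Subtype.ext
  simp only [refl, Subgroup.coe_mul, Subgroup.coe_one, reflPerm]
  split_ifs with h
  · exact Equiv.swap_mul_self _ _
  · ext x
    have hab : a ≠ b := by intro h; rw [h] at hb; omega
    have ha0 := Fin.rev_inj (i := a) (j := b)
    simp only [Equiv.Perm.mul_apply, Equiv.swap_apply_def, Equiv.Perm.one_apply]
    have hrev : ∀ y z : Letter n, y.rev = z ↔ y = z.rev := fun y z => Fin.rev_eq_iff
    have hself : ∀ y : Letter n, y ≠ y.rev := by
      intro y hy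
      have := congrArg sg hy
      rw [sg_rev] at this
      have := sg_ne_zero y
      omega
    grind

theorem exists_word {n : ℕ} (m : ℕ) (w : weyl n) (h : sgnLen n (st w) = m) :
    ∃ L : List (weyl n), (∀ s ∈ L, IsSimpleRefl s) ∧ L.length = m ∧ L.prod = w := by
  induction m generalizing w with
  | zero =>
    by_cases hw : w = 1
    · exact ⟨[], by simp, rfl, by simp [hw]⟩
    · obtain ⟨s, hs, h1⟩ := exists_descent w hw
      have := sgnLen_nonneg n (st (w * s))
      push_cast at h; omega
  | succ m ih =>
    have hw : w ≠ 1 := by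
      rintro rfl
      rw [sgnLen_one] at h; push_cast at h; omega
    obtain ⟨s, hs, h1⟩ := exists_descent w hw
    obtain ⟨L, hL, hl, hp⟩ := ih (w * s) (by push_cast at h; omega)
    refine ⟨L ++ [s], ?_, by simp [hl], ?_⟩
    · intro t ht
      rcases List.mem_append.1 ht with ht | ht
      · exact hL t ht
      · rw [List.mem_singleton.1 ht]; exact hs
    · rw [List.prod_append, hp, List.prod_singleton, mul_assoc, simpleRefl_sq hs, mul_one]

/-- A simple reflection raises `sgnLen` by at most one, so a word cannot be shorter than `sgnLen`;
descents produce a word of exactly this length. -/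
theorem len_eq_sgnLen {n : ℕ} (w : weyl n) : (len w : ℤ) = sgnLen n (st w) := by
  obtain ⟨m, hm⟩ := Int.eq_ofNat_of_zero_le (sgnLen_nonneg n (st w))
  rw [hm]
  have hmem : m ∈ {m | ∃ L : List (weyl n), (∀ s ∈ L, IsSimpleRefl s) ∧ L.length = m ∧ L.prod = w} :=
    exists_word m w hm
  congr 1
  refine le_antisymm (Nat.sInf_le hmem) (le_csInf ⟨m, hmem⟩ ?_)
  rintro b ⟨L, hL, rfl, rfl⟩
  have := sgnLen_prod_le L hL 1
  rw [one_mul, sgnLen_one] at this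
  omega

/-! ### The half sum of the positive roots -/

theorem unitVec_unb {n : ℕ} (i : Fin n) : unitVec (unb i) = Pi.single i (1 : ℚ) := by
  funext p
  simp only [unitVec, unb_inj, unb_ne_barred, if_false, Pi.single_apply]
  simp only [eq_comm]

theorem unitVec_rev {n : ℕ} (x : Letter n) : unitVec x.rev = -unitVec x := by
  funext p
  have h1 : x.rev = unb p ↔ x = barred p := by rw [Fin.rev_eq_iff]; rfl
  have h2 : x.rev = barred p ↔ x = unb p := by rw [Fin.rev_eq_iff, rev_barred]
  have h3 := unb_ne_barred p p
  simp only [unitVec, h1, h2, Pi.neg_apply]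
  split_ifs with h4 h5 h5
  · exact absurd (h5.symm.trans h4) h3
  · rfl
  · rfl
  · simp

/-- Among the roots labelled `(a, b)`, the summands `±ε_b` for `b` and its bar cancel, so only a
multiple of `ε_a` is left. There are `2n - 1 - 2a` letters after `a` up to its bar. -/
theorem sum_rootVec_row {n : ℕ} (a : Letter n) (ha : IsPos a) (p : Fin n) :
    ∑ b : Letter n, (if a < b ∧ b ≤ a.rev then rootVec (a, b) p else 0) =
      (2 * n - 1 - 2 * (a : ℕ) : ℚ) * unitVec a p := by
  have ha' : (a : ℕ) < n := ha
  have h1 : ∀ b : Letter n, (if a < b ∧ b ≤ a.rev then rootVec (a, b) p else 0) =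
      (if a < b ∧ b ≤ a.rev then unitVec a p else 0) - (if a < b ∧ b < a.rev then unitVec b p else 0) := by
    intro b
    simp only [rootVec]
    by_cases hb : b = a.rev
    · have : ¬ (a < b ∧ b < a.rev) := by rw [hb]; simp
      simp [hb]
    · have : (a < b ∧ b < a.rev) ↔ (a < b ∧ b ≤ a.rev) := by
        simp only [Fin.lt_def, Fin.le_def, Fin.ext_iff] at *; omega
      simp only [this, hb, if_false, Pi.sub_apply]
      split_ifs <;> simp
  rw [sum_congr rfl (fun b _ => h1 b), sum_sub_distrib]
  have h2 : ∑ b : Letter n, (if a < b ∧ b < a.rev then unitVec b p else 0) = 0 := by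
    have h3 := Equiv.sum_comp Fin.revPerm (fun b : Letter n => if a < b ∧ b < a.rev then unitVec b p else 0)
    have h4 : ∀ b : Letter n, (if a < Fin.revPerm b ∧ Fin.revPerm b < a.rev then unitVec (Fin.revPerm b) p else 0)
        = - (if a < b ∧ b < a.rev then unitVec b p else 0) := by
      intro b
      have : (a < Fin.revPerm b ∧ Fin.revPerm b < a.rev) ↔ (a < b ∧ b < a.rev) := by
        simp only [Fin.revPerm_apply, Fin.lt_def, Fin.val_rev]; omega
      rw [if_congr this rfl rfl]
      simp only [Fin.revPerm_apply, unitVec_rev, Pi.neg_apply]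
      split_ifs <;> simp
    rw [sum_congr rfl (fun b _ => h4 b), sum_neg_distrib] at h3
    linarith
  rw [h2, sub_zero, ← sum_filter, sum_const, nsmul_eq_mul]
  congr 1
  have : (univ.filter fun b : Letter n => a < b ∧ b ≤ a.rev) = Ioc a a.rev := by
    ext b; simp
  rw [this, Fin.card_Ioc, Fin.val_rev]
  rw [Nat.cast_sub (by omega), Nat.cast_sub (by omega)]
  push_cast; ring

theorem rho_apply {n : ℕ} (p : Fin n) : rho n p = (2 * n - 1 - 2 * (p : ℕ) : ℚ) / 2 := by
  unfold rho posRoots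
  rw [Pi.smul_apply, Finset.sum_apply, sum_filter, ← univ_product_univ, sum_product,
    sum_eq_single (unb p)]
  · dsimp only
    rw [sum_rootVec_row (unb p) (by simp [IsPos, unb]), unitVec_unb]
    simp only [Pi.single_eq_same, unb, smul_eq_mul]
    ring
  · intro a _ ha
    dsimp only
    by_cases h : IsPos a
    · rw [sum_rootVec_row a h]
      have : a ≠ barred p := by
        rintro rfl
        simp only [IsPos, barred, unb, Fin.val_rev] at h
        omega
      simp [unitVec, ha, this]
    · refine sum_eq_zero fun b _ => if_neg ?_
      simp only [IsPos] at h
      simp only [Fin.lt_def, Fin.le_def, Fin.val_rev]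
      omega
  · simp

theorem coroot_dif {n : ℕ} {i j : Fin n} (hij : i ≠ j) :
    corootPairing (rho n) (rootVec (unb i, unb j)) = (j : ℚ) - i := by
  have : rootVec (unb i, unb j) = Pi.single i 1 - Pi.single j (1 : ℚ) := by
    simp only [rootVec, rev_unb, unb_ne_barred, if_false, unitVec_unb]
  rw [this, corootPairing]
  simp only [dotProduct_sub, sub_dotProduct, dotProduct_single, single_dotProduct, rho_apply,
    Pi.single_eq_same, Pi.single_eq_of_ne hij, Pi.single_eq_of_ne hij.symm, Pi.sub_apply, Pi.add_apply]
  ring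

theorem coroot_sum {n : ℕ} {i j : Fin n} (hij : i ≠ j) :
    corootPairing (rho n) (rootVec (unb i, barred j)) = 2 * n - i - j - 1 := by
  have : rootVec (unb i, barred j) = Pi.single i 1 + Pi.single j (1 : ℚ) := by
    simp only [rootVec, rev_unb, barred_inj, hij.symm, if_false, unitVec_unb]
    rw [barred, unitVec_rev, unitVec_unb, sub_neg_eq_add]
  rw [this, corootPairing]
  simp only [dotProduct_add, add_dotProduct, dotProduct_single, single_dotProduct, rho_apply,
    Pi.single_eq_same, Pi.single_eq_of_ne hij, Pi.single_eq_of_ne hij.symm, Pi.sub_apply, Pi.add_apply]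
  ring

theorem coroot_sgn {n : ℕ} (i : Fin n) :
    corootPairing (rho n) (rootVec (unb i, barred i)) = 2 * (n - i) - 1 := by
  have : rootVec (unb i, barred i) = Pi.single i (1 : ℚ) := by
    simp only [rootVec, rev_unb, if_true, unitVec_unb]
  rw [this, corootPairing]
  simp only [dotProduct_single, single_dotProduct, rho_apply, Pi.single_eq_same]
  ring

/-! ### The edges of the quantum Bruhat graph -/

theorem qbgEdge_iff {n : ℕ} (w : weyl n) (r : Letter n × Letter n) (h : ℤ)
    (hh : corootPairing (rho n) (rootVec r) = h) :
    QBGEdge w r ↔ (sgnLen n (st (w * refl r)) = sgnLen n (st w) + 1 ∨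
      sgnLen n (st (w * refl r)) = sgnLen n (st w) - 2 * h + 1) := by
  unfold QBGEdge
  rw [hh, ← len_eq_sgnLen, ← len_eq_sgnLen]
  constructor <;> rintro (h | h) <;> [left; right; left; right] <;> exact_mod_cast h

theorem qbgEdge_dif {n : ℕ} (w : weyl n) {i j : Fin n} (hij : i < j) :
    QBGEdge w (unb i, unb j) ↔ (Op.dif i j).ok n (st w) := by
  rw [qbgEdge_iff w _ ((j : ℤ) - i) (by rw [coroot_dif hij.ne]; push_cast; ring), st_mul_dif w hij.ne,
    edge_dif hij j.2 (isSgn_st w)]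

theorem Op.act_sum_comm (i j : ℕ) (g : ℕ → ℤ) : (Op.sum i j).act g = (Op.sum j i).act g := by
  funext x; simp only [Op.act]; split_ifs <;> simp_all

theorem Op.ok_sum_comm (n i j : ℕ) (g : ℕ → ℤ) : (Op.sum i j).ok n g ↔ (Op.sum j i).ok n g := by
  simp only [Op.ok, min_comm i j, max_comm i j]

theorem qbgEdge_sum {n : ℕ} (w : weyl n) {i j : Fin n} (hij : i ≠ j) :
    QBGEdge w (unb i, barred j) ↔ (Op.sum i j).ok n (st w) := by
  rw [qbgEdge_iff w _ (2 * n - i - j - 1) (by rw [coroot_sum hij]; push_cast; ring),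
    st_mul_sum w hij]
  rcases lt_or_gt_of_ne hij with h | h
  · rw [edge_sum h j.2 (isSgn_st w)]
  · rw [Op.act_sum_comm, Op.ok_sum_comm, ← edge_sum h i.2 (isSgn_st w)]
    rw [show (2 * n - i - j - 1 : ℤ) = 2 * n - j - i - 1 by ring]

theorem qbgEdge_sgn {n : ℕ} (w : weyl n) {i : Fin n} (hi : (i : ℕ) + 1 < n) :
    QBGEdge w (unb i, barred i) ↔ (Op.sgn i).ok n (st w) := by
  rw [qbgEdge_iff w _ (2 * (n - i) - 1) (by rw [coroot_sgn]; push_cast; ring),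
    st_mul_sgn w, edge_sgn hi (isSgn_st w)]

/-! ### Pairs of columns as signed sequences -/

/-- `x` lies on the arc going upwards cyclically from `a` (included) to `d` (excluded). -/
def pass (a x d : ℤ) : Prop := (a ≤ x ∧ x < d) ∨ (x < d ∧ d < a) ∨ (d < a ∧ a ≤ x)

/-- The number of entries of `f 0, …, f (m - 1)` in the interval `[s, t)`. -/
def cnt (f : ℕ → ℤ) (m : ℕ) (s t : ℤ) : ℕ := #{j ∈ range m | s ≤ f j ∧ f j < t}

/-- The number of negative entries of `f 0, …, f (m - 1)` of absolute value at most `b`. -/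
def ng (f : ℕ → ℤ) (m : ℕ) (b : ℤ) : ℕ := cnt f m (-b) 0

theorem ng_split (f : ℕ → ℤ) (m : ℕ) {y N : ℤ} (hy : 0 ≤ y) (hN : y ≤ N) :
    ng f m N = cnt f m (-N) (-y) + ng f m y := by
  unfold ng cnt
  rw [← card_union_of_disjoint]
  · congr 1; ext j; simp only [mem_filter, mem_union]
    constructor
    · rintro ⟨h1, h2, h3⟩
      rcases lt_or_ge (f j) (-y) with h | h
      · exact Or.inl ⟨h1, h2, h⟩
      · exact Or.inr ⟨h1, h, h3⟩
    · rintro (⟨h1, h2, h3⟩ | ⟨h1, h2, h3⟩) <;> exact ⟨h1, by omega, by omega⟩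
  · rw [disjoint_left]; intro j h1 h2
    simp only [mem_filter] at h1 h2; omega

theorem cnt_congr {f h : ℕ → ℤ} {m m' : ℕ} {s t s' t' : ℤ}
    (H : ∀ j, (j < m ∧ s ≤ f j ∧ f j < t) ↔ (j < m' ∧ s' ≤ h j ∧ h j < t')) :
    cnt f m s t = cnt h m' s' t' := by
  unfold cnt; congr 1; ext j; simpa only [mem_filter, mem_range] using H j

theorem cnt_insert {f h : ℕ → ℤ} {m m' : ℕ} {s t s' t' : ℤ} (i : ℕ)
    (hi : ¬ (i < m' ∧ s' ≤ h i ∧ h i < t'))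
    (H : ∀ j, (j < m ∧ s ≤ f j ∧ f j < t) ↔ (j = i ∨ (j < m' ∧ s' ≤ h j ∧ h j < t'))) :
    cnt f m s t = cnt h m' s' t' + 1 := by
  unfold cnt
  rw [← card_insert_of_notMem (a := i) (by simpa only [mem_filter, mem_range] using hi)]
  congr 1; ext j; simpa only [mem_filter, mem_range, mem_insert] using H j

theorem ng_zero (f : ℕ → ℤ) (m : ℕ) : ng f m 0 = 0 := by
  unfold ng cnt; rw [card_eq_zero, filter_eq_empty_iff]; intro j _; omega

/-- Nonzero entries of distinct absolute values. -/
structure AbsInj (f : ℕ → ℤ) (m : ℕ) : Prop where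
  ne_zero : ∀ i < m, f i ≠ 0
  inj : ∀ i < m, ∀ j < m, |f i| = |f j| → i = j

theorem AbsInj.mono {f : ℕ → ℤ} {m m' : ℕ} (h : AbsInj f m) (hm : m' ≤ m) : AbsInj f m' :=
  ⟨fun i hi => h.ne_zero i (by omega), fun i hi j hj => h.inj i (by omega) j (by omega)⟩

/-- The abstract blocking condition at row `i` and level `b`, without the parity condition. -/
structure Blk (g h : ℕ → ℤ) (i : ℕ) (b : ℤ) : Prop where
  pos : 0 < b
  le : |g i| ≤ b
  ne : g i ≠ b
  full : ∀ x, 0 < x → x ≤ b → ∃ j ≤ i, |g j| = x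
  full' : ∀ x, 0 < x → x < b → ∃ j < i, |h j| = x

theorem Blk.le_of {g h : ℕ → ℤ} {i m : ℕ} {b : ℤ} (B : Blk g h i b) (hg : AbsInj g m) (hi : i < m)
    {x : ℕ} (hx : x < m) (hb : |g x| ≤ b) : x ≤ i := by
  obtain ⟨j, hj, e⟩ := B.full _ (abs_pos.2 (hg.ne_zero x hx)) hb
  rw [← hg.inj j (by omega) x hx e]; exact hj

theorem Blk.lt_of {g h : ℕ → ℤ} {i m : ℕ} {b : ℤ} (B : Blk g h i b) (hh : AbsInj h m) (hi : i < m)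
    {x : ℕ} (hx : x < m) (hb : |h x| < b) : x < i := by
  obtain ⟨j, hj, e⟩ := B.full' _ (abs_pos.2 (hh.ne_zero x hx)) hb
  rw [← hh.inj j (by omega) x hx e]; exact hj

/-- The conditions on the first `p` rows. -/
structure CondIn (p : ℕ) (g h : ℕ → ℤ) : Prop where
  adj : ∀ i l, i < l → l < p → pass (g i) (h l) (h i) →
    Blk g h i (h l) ∧ Odd (ng g (i + 1) (h l) + ng h i (h l))
  blk : ∀ i < p, Blk g h i (h i) → Even (ng g (i + 1) (h i) + ng h i (h i))

/-- The conditions on the first `p` of `k` rows, when the remaining rows of the two columns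
agree. -/
structure Cond (p k : ℕ) (g h : ℕ → ℤ) : Prop where
  adj : ∀ i l, i < l → l < p → pass (g i) (h l) (h i) →
    Blk g h i (h l) ∧ Odd (ng g (i + 1) (h l) + ng h i (h l))
  out : ∀ i l, i < p → p ≤ l → l < k → ¬ pass (g i) (h l) (h i)
  blk : ∀ i < p, i + 1 < k → Blk g h i (h i) → Even (ng g (i + 1) (h i) + ng h i (h i))

theorem Cond.condIn {p q k : ℕ} {g h : ℕ → ℤ} (H : Cond p k g h) (hq : q ≤ p) (hk : q < k) :
    CondIn q g h :=
  ⟨fun i l h1 h2 => H.adj i l h1 (by omega), fun i h1 => H.blk i (by omega) (by omega)⟩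

/-- At least `#A` rows start in `A`; their ends are distinct elements of `A'`, which is not larger.
So all inequalities are equalities: no further row ends in `A'`, and `A'` is exhausted. Most
closedness arguments below are instances of this. -/
theorem pigeonhole {Q : Finset ℕ} {f h : ℕ → ℤ} {A A' : Finset ℤ} (hA : ∀ y ∈ A, ∃ r ∈ Q, |f r| = y)
    (hinj : ∀ r ∈ Q, ∀ s ∈ Q, |h r| = |h s| → r = s) (hcard : #A' ≤ #A)
    (stay : ∀ r ∈ Q, |f r| ∈ A → |h r| ∈ A') :
    (∀ r ∈ Q, |h r| ∈ A' → |f r| ∈ A) ∧ ∀ y ∈ A', ∃ r ∈ Q, |h r| = y := by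
  set S := Q.filter fun r => |f r| ∈ A
  set S' := Q.filter fun r => |h r| ∈ A'
  have hS : S ⊆ S' := fun r hr => by
    simp only [S, S', mem_filter] at hr ⊢; exact ⟨hr.1, stay r hr.1 hr.2⟩
  have h1 : #A ≤ #S := by
    refine le_trans (card_le_card fun y hy => ?_) (card_image_le (s := S) (f := fun r => |f r|))
    obtain ⟨r, hr, e⟩ := hA y hy
    exact mem_image.2 ⟨r, mem_filter.2 ⟨hr, e ▸ hy⟩, e⟩
  have h2 : #(S'.image fun r => |h r|) = #S' := card_image_of_injOn fun r hr s hs e =>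
    hinj r (mem_filter.1 hr).1 s (mem_filter.1 hs).1 e
  have h3 : S'.image (fun r => |h r|) ⊆ A' := by
    intro y hy; obtain ⟨r, hr, rfl⟩ := mem_image.1 hy; exact (mem_filter.1 hr).2
  have h4 := card_le_card h3
  have h5 := card_le_card hS
  have h6 : S = S' := eq_of_subset_of_card_le hS (by omega)
  have h7 : S'.image (fun r => |h r|) = A' := eq_of_subset_of_card_le h3 (by omega)
  refine ⟨fun r hr hh => ?_, fun y hy => ?_⟩
  · have : r ∈ S' := mem_filter.2 ⟨hr, hh⟩
    rw [← h6] at this; exact (mem_filter.1 this).2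
  · rw [← h7] at hy
    obtain ⟨r, hr, e⟩ := mem_image.1 hy
    exact ⟨r, (mem_filter.1 hr).1, e⟩

/-- A row other than `j` that starts within the level can neither pass `y` nor end in `±y`, so it
rises as an integer and ends strictly inside. This matches the levels `1, …, y` without `|C j|` to
the levels `1, …, y - 1`, and `pigeonhole` shows that no row enters from outside. -/
theorem Blk.closed {C D : ℕ → ℤ} {m j l : ℕ} {y : ℤ} (B : Blk C D j y) (hC : AbsInj C m)
    (hD : AbsInj D m) (hj : j < m) (hl : l < m) (hjl : j ≤ l) (hy : D l = y)
    (hn : ∀ r < j, |C r| ≤ y → ¬ pass (C r) y (D r)) :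
    ∀ r < m, r ≠ j → (|C r| ≤ y ↔ |D r| < y) ∧ (|C r| ≤ y → C r ≤ D r) := by
  have h0 := B.pos
  have key : ∀ r < m, r ≠ j → |C r| ≤ y → |D r| < y ∧ C r ≤ D r := by
    intro r hr hrj hry
    have h1 : r < j := lt_of_le_of_ne (B.le_of hC hj hr hry) hrj
    have h2 := hn r h1 hry
    have h3 : |D r| ≠ y := fun e => by
      have := hD.inj r hr l hl (by rw [e, hy, abs_of_pos h0]); omega
    unfold pass at h2
    rw [abs_le] at hry
    rw [abs_lt]
    rcases abs_cases (D r) with h4 | h4 <;> omega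
  have h2 := (pigeonhole (Q := (range m).erase j) (f := C) (h := D) (A := (Icc 1 y).erase |C j|)
    (A' := Icc 1 (y - 1)) (fun x hx => by
      simp only [mem_erase, mem_Icc] at hx
      obtain ⟨s, hs, e⟩ := B.full x (by omega) hx.2.2
      refine ⟨s, ?_, e⟩
      simp only [mem_erase, mem_range]
      exact ⟨fun h => hx.1 (by rw [← e, h]), by omega⟩)
    (fun r hr s hs => by
      simp only [mem_erase, mem_range] at hr hs
      exact hD.inj r hr.2 s hs.2)
    (by
      have : |C j| ∈ Icc 1 y := by
        rw [mem_Icc]; exact ⟨abs_pos.2 (hC.ne_zero j hj), B.le⟩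
      rw [card_erase_of_mem this, Int.card_Icc, Int.card_Icc]; omega)
    (fun r hr h => by
      simp only [mem_erase, mem_range, mem_Icc] at hr h ⊢
      have := (key r hr.2 hr.1 h.2.2).1
      exact ⟨abs_pos.2 (hD.ne_zero r hr.2), by omega⟩)).1
  refine fun r hr hrj => ⟨⟨fun h => (key r hr hrj h).1, fun h => ?_⟩, fun h => (key r hr hrj h).2⟩
  have := h2 r (by simp only [mem_erase, mem_range]; exact ⟨hrj, hr⟩) (by
    rw [mem_Icc]; exact ⟨abs_pos.2 (hD.ne_zero r hr), by omega⟩)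
  simp only [mem_erase, mem_Icc] at this
  exact this.2.2

/-- Closedness of a full level that no row passes. -/
theorem closed_of_not_pass {C D : ℕ → ℤ} {p : ℕ} {N : ℤ} (hC : AbsInj C p) (hD : AbsInj D p)
    (full : ∀ x, 0 < x → x ≤ N → ∃ j < p, |C j| = x)
    (hn : ∀ j < p, |C j| ≤ N → ¬ pass (C j) N (D j)) :
    (∀ j < p, |C j| ≤ N ↔ |D j| ≤ N) ∧ (∀ j < p, |C j| ≤ N → C j ≤ D j) ∧
      ∀ x, 0 < x → x ≤ N → ∃ j < p, |D j| = x := by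
  have key : ∀ j < p, |C j| ≤ N → |D j| ≤ N ∧ C j ≤ D j := by
    intro j hj h
    have h2 := hn j hj h
    unfold pass at h2
    rw [abs_le] at *
    omega
  have ph := pigeonhole (Q := range p) (f := C) (h := D) (A := Icc 1 N) (A' := Icc 1 N)
    (fun x hx => by
      rw [mem_Icc] at hx
      obtain ⟨s, hs, e⟩ := full x (by omega) hx.2
      exact ⟨s, mem_range.2 hs, e⟩)
    (fun r hr s hs => hD.inj r (mem_range.1 hr) s (mem_range.1 hs)) le_rfl
    (fun r hr h => by
      rw [mem_range] at hr
      rw [mem_Icc] at h ⊢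
      exact ⟨abs_pos.2 (hD.ne_zero r hr), (key r hr h.2).1⟩)
  refine ⟨fun j hj => ⟨fun h => (key j hj h).1, fun h => ?_⟩, fun j hj h => (key j hj h).2, ?_⟩
  · exact (mem_Icc.1 (ph.1 j (mem_range.2 hj) (mem_Icc.2 ⟨abs_pos.2 (hD.ne_zero j hj), h⟩))).2
  · intro x h1 h2
    obtain ⟨r, hr, e⟩ := ph.2 x (mem_Icc.2 ⟨h1, h2⟩)
    exact ⟨r, mem_range.1 hr, e⟩

/-- The contribution of the levels above a blocked level. -/
theorem cnt_above_blk {C D : ℕ → ℤ} {p j i : ℕ} {y N : ℤ} (B : Blk C D j y) (hC : AbsInj C p)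
    (hD : AbsInj D p) (hj : j < i) (hi : i < p) (hy : D i = y)
    (hn : ∀ r < i, pass (C r) y (D r) → r = j)
    (hCN : -N ≤ C i) (hCi : C i < -y)
    (hup : ∀ r < p, r ≠ i → -N ≤ C r → C r < -y → C r ≤ D r ∧ D r ≤ y)
    (hdn : ∀ r < p, -N ≤ D r → D r < -y → -N ≤ C r ∧ C r ≤ D r) :
    cnt C p (-N) (-y) = cnt D p (-N) (-y) + 1 := by
  have h0 := B.pos
  have hcl := B.closed hC hD (by omega) hi hj.le hy
    (fun r hr h1 h2 => absurd (hn r (by omega) h2) (by omega))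
  refine cnt_insert i (by omega) fun r => ?_
  constructor
  · rintro ⟨hr, h1, h2⟩
    by_cases hri : r = i
    · exact Or.inl hri
    right
    have hrj : r ≠ j := by
      rintro rfl; have := B.le; rw [abs_le] at this; omega
    have h3 := hup r hr hri h1 h2
    have h5 : ¬ |D r| < y := fun h => by
      have := (hcl r hr hrj).1.2 h; rw [abs_le] at this; omega
    have h6 : |D r| ≠ y := fun e => hri (hD.inj r hr i hi (by rw [e, hy, abs_of_pos h0]))
    rcases abs_cases (D r) with h7 | h7 <;> exact ⟨hr, by omega, by omega⟩
  · rintro (rfl | ⟨hr, h1, h2⟩)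
    · exact ⟨hi, hCN, hCi⟩
    · have := hdn r hr h1 h2; exact ⟨hr, this.1, by omega⟩

/-- Below a blocked level all relevant entries lie in the rows up to `j`, so cutting off the count
there loses nothing. -/
theorem Blk.ng_eq {C D : ℕ → ℤ} {m j l : ℕ} {y : ℤ} (B : Blk C D j y) (hC : AbsInj C m)
    (hD : AbsInj D m) (hj : j < m) (hl : l < m) (hjl : j ≤ l) (hy : D l = y) :
    ng C (j + 1) y = ng C m y ∧ ng D j y = ng D m y := by
  have h0 := B.pos
  constructor
  · refine cnt_congr fun r => ⟨fun h => ⟨by omega, h.2⟩, fun h => ⟨?_, h.2⟩⟩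
    have := B.le_of hC hj h.1 (by rw [abs_le]; omega)
    omega
  · refine cnt_congr fun r => ⟨fun h => ⟨by omega, h.2⟩, fun h => ⟨?_, h.2⟩⟩
    refine B.lt_of hD hj h.1 (lt_of_le_of_ne (by rw [abs_le]; omega) fun e => ?_)
    have := hD.inj r h.1 l hl (by rw [e, hy, abs_of_pos h0])
    subst this; omega

/-- In a closed block the numbers of negative entries of the two columns have the same parity. -/
theorem even_ng {C D : ℕ → ℤ} {p : ℕ} (hC : AbsInj C p) (hD : AbsInj D p) (H : CondIn p C D) (N : ℕ)
    (full : ∀ x, 0 < x → x ≤ (N : ℤ) → ∃ j < p, |C j| = x)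
    (hn : ∀ j < p, |C j| ≤ (N : ℤ) → ¬ pass (C j) N (D j)) :
    Even (ng C p N + ng D p N) := by
  induction N using Nat.strong_induction_on with
  | _ N ih =>
  rcases Nat.eq_zero_or_pos N with rfl | hN
  · simp [ng_zero]
  obtain ⟨hcl, hmono, fullD⟩ := closed_of_not_pass hC hD full hn
  -- If no row of the block passes a smaller level `y` either, the same rows of both columns have
  -- their entries in `[-N, -y)`, and the parity is inherited from level `y`.
  have red : ∀ y : ℕ, y < N → (∀ j < p, |C j| ≤ N → ¬ pass (C j) y (D j)) →
      Even (ng C p N + ng D p N) := by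
    intro y hy hyn
    have hfy : ∀ x, 0 < x → x ≤ (y : ℤ) → ∃ j < p, |C j| = x := fun x h1 h2 => full x h1 (by omega)
    have hny : ∀ j < p, |C j| ≤ (y : ℤ) → ¬ pass (C j) y (D j) := fun j hj h => hyn j hj (by omega)
    have he := ih y hy hfy hny
    obtain ⟨hcl', -, -⟩ := closed_of_not_pass hC hD hfy hny
    have : cnt C p (-N) (-y) = cnt D p (-N) (-y) := by
      refine cnt_congr fun j => ⟨fun ⟨h1, h2, h3⟩ => ?_, fun ⟨h1, h2, h3⟩ => ?_⟩
      · have h4 : |C j| ≤ N := by rw [abs_le]; omega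
        have h5 := hmono j h1 h4
        have h6 := hyn j h1 h4
        have h7 : ¬ |D j| ≤ (y : ℤ) := fun h => by
          have := (hcl' j h1).2 h; rw [abs_le] at this; omega
        unfold pass at h6
        rw [abs_le] at h7
        exact ⟨h1, by omega, by omega⟩
      · have h4 := (hcl j h1).2 (by rw [abs_le]; omega)
        have h5 := hmono j h1 h4
        rw [abs_le] at h4
        exact ⟨h1, by omega, by omega⟩
    rw [ng_split C p (y := y) (N := N) (by omega) (by omega),
      ng_split D p (y := y) (N := N) (by omega) (by omega), this]
    have e : cnt D p (-N) (-y) + ng C p y + (cnt D p (-N) (-y) + ng D p y) =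
      2 * cnt D p (-N) (-y) + (ng C p y + ng D p y) := by ring
    rw [e]
    exact (even_two_mul _).add he
  -- the last row of the block
  have hne : ((range p).filter fun j => |C j| ≤ N).Nonempty := by
    obtain ⟨j, hj, e⟩ := full N (by omega) le_rfl
    exact ⟨j, mem_filter.2 ⟨mem_range.2 hj, e.le⟩⟩
  obtain ⟨i, hi, hmax⟩ := exists_max_image _ (fun j => j) hne
  simp only [mem_filter, mem_range] at hi hmax
  obtain ⟨hip, hiN⟩ := hi
  have hDi := (hcl i hip).1 hiN
  have hD0 := hD.ne_zero i hip
  have hself : ¬ pass (C i) (D i) (D i) := by unfold pass; omega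
  have hpass : ∀ j < p, |C j| ≤ N → pass (C j) (D i) (D j) →
      j < i ∧ Blk C D j (D i) ∧ Odd (ng C (j + 1) (D i) + ng D j (D i)) := by
    intro j hj h1 h2
    have h3 : j < i := lt_of_le_of_ne (hmax j ⟨hj, h1⟩) (by rintro rfl; exact hself h2)
    exact ⟨h3, H.adj j i h3 hip h2⟩
  rcases lt_or_gt_of_ne hD0 with hneg | hpos
  -- A negative entry never blocks, so no row of the block passes `D i`. Then the level `z = |D i| -
  -- 1` is not passed either, and the claim reduces to it.
  · obtain ⟨z, hz⟩ : ∃ z : ℕ, -D i = z + 1 := ⟨(-D i - 1).toNat, by omega⟩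
    rw [abs_of_neg hneg] at hDi
    have hnp : ∀ j < p, |C j| ≤ N → ¬ pass (C j) (D i) (D j) := fun j hj h1 h2 => by
      have := (hpass j hj h1 h2).2.1.pos; omega
    have hst : ∀ j < p, (z : ℤ) + 1 ≤ |C j| → |C j| ≤ N → (z : ℤ) + 1 ≤ |D j| ∧ (C j < 0 → D j < 0) := by
      intro j hj h1 h2
      have h3 := hnp j hj h2
      have h4 := hmono j hj h2
      unfold pass at h3
      rcases abs_cases (C j) with h5 | h5 <;> rcases abs_cases (D j) with h6 | h6 <;> omega
    have ph := pigeonhole (Q := range p) (f := C) (h := D) (A := Icc ((z : ℤ) + 1) N)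
      (A' := Icc ((z : ℤ) + 1) N)
      (fun x hx => by
        rw [mem_Icc] at hx
        obtain ⟨s, hs, e⟩ := full x (by omega) hx.2
        exact ⟨s, mem_range.2 hs, e⟩)
      (fun r hr s hs => hD.inj r (mem_range.1 hr) s (mem_range.1 hs)) le_rfl
      (fun r hr h => by
        rw [mem_range] at hr
        rw [mem_Icc] at h ⊢
        exact ⟨(hst r hr h.1 h.2).1, (hcl r hr).1 h.2⟩)
    refine red z (by omega) fun j hj h1 h2 => ?_
    have h3 := hmono j hj h1
    have h4 := (hcl j hj).1 h1
    have h5 : (z : ℤ) + 1 ≤ |D j| := by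
      unfold pass at h2
      have := le_abs_self (D j); omega
    have h6 := (mem_Icc.1 (ph.1 j (mem_range.2 hj) (mem_Icc.2 ⟨h5, h4⟩))).1
    have h7 := hst j hj h6 h1
    unfold pass at h2
    rcases abs_cases (C j) with h5 | h5 <;> rcases abs_cases (D j) with h6 | h6 <;> omega
  · rw [abs_of_pos hpos] at hDi
    obtain ⟨y, hy⟩ : ∃ y : ℕ, D i = y := ⟨(D i).toNat, by omega⟩
    by_cases hex : ∃ j < p, |C j| ≤ N ∧ pass (C j) (D i) (D j)
    -- The passing row makes the count within level `D i` odd. Beyond that level, `C` has exactly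
    -- one negative entry more than `D`, that of row `i`; together this is even.
    · obtain ⟨j, hj, h1, h2⟩ := hex
      obtain ⟨hji, B, hodd⟩ := hpass j hj h1 h2
      obtain ⟨e1, e2⟩ := B.ng_eq hC hD hj hip hji.le rfl
      have hB : ∀ r < i, pass (C r) (D i) (D r) → r = j := by
        intro r hr h3
        have B' := (H.adj r i hr hip h3).1
        exact le_antisymm (B.le_of hC hj (by omega) B'.le) (B'.le_of hC (by omega) hj B.le)
      have := cnt_above_blk (N := N) B hC hD hji hip rfl hB
        (abs_le.1 hiN).1
        (by
          have h3 := hmono i hip hiN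
          have h4 : ¬ |C i| ≤ D i := fun h => by have := B.le_of hC hj hip h; omega
          rw [abs_le] at h4; omega)
        (fun r hr h5 h3 h4 => by
          have h8 : |C r| ≤ N := by rw [abs_le]; omega
          have h6 : r < i := lt_of_le_of_ne (hmax r ⟨hr, h8⟩) h5
          have h9 := hmono r hr h8
          refine ⟨h9, ?_⟩
          by_contra h10
          have h11 := hB r h6 (by unfold pass; omega)
          subst h11
          have := B.le; rw [abs_le] at this; omega)
        (fun r hr h3 h4 => by
          have h5 := (hcl r hr).2 (by rw [abs_le]; omega)
          have h6 := hmono r hr h5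
          rw [abs_le] at h5; omega)
      rw [ng_split C p (y := D i) (N := N) (by omega) (by omega),
        ng_split D p (y := D i) (N := N) (by omega) (by omega), this]
      rw [e1, e2] at hodd
      have e : cnt D p (-N) (-D i) + 1 + ng C p (D i) + (cnt D p (-N) (-D i) + ng D p (D i)) =
        2 * cnt D p (-N) (-D i) + ((ng C p (D i) + ng D p (D i)) + 1) := by ring
      rw [e]
      exact (even_two_mul _).add (hodd.add_odd odd_one)
    · push Not at hex
      rcases lt_or_eq_of_le hDi with hlt | heq
      · exact red y (by omega) (fun j hj h1 => by rw [← hy]; exact hex j hj h1)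
      · by_cases hCN : C i = N
        -- Row `i` keeps its entry `N`, so level `N - 1` is not passed by any row of the block.
        · obtain ⟨M, rfl⟩ : ∃ M, N = M + 1 := ⟨N - 1, by omega⟩
          refine red M (by omega) fun j hj h1 h2 => ?_
          have h3 := hmono j hj h1
          have h4 := (hcl j hj).1 h1
          have h5 : D j = D i := by
            unfold pass at h2; rw [abs_le] at h4; push_cast at *; omega
          have h6 := hD.inj j hj i hip (by rw [h5])
          subst h6
          unfold pass at h2; push_cast at *; omega
        -- The columns are blocked at the last row of the block by `N` itself, and the third
        -- condition is the claim.
        · have B : Blk C D i (D i) := by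
            refine ⟨hpos, by rw [heq]; exact hiN, by rw [heq]; exact hCN, fun x h1 h2 => ?_,
              fun x h1 h2 => ?_⟩
            · obtain ⟨j, hj, e⟩ := full x h1 (by omega)
              exact ⟨j, hmax j ⟨hj, by omega⟩, e⟩
            · obtain ⟨j, hj, e⟩ := fullD x h1 (by omega)
              refine ⟨j, lt_of_le_of_ne (hmax j ⟨hj, (hcl j hj).2 (by omega)⟩) ?_, e⟩
              rintro rfl
              rw [abs_of_pos hpos] at e; omega
          obtain ⟨e1, e2⟩ := B.ng_eq hC hD hip hip le_rfl rfl
          have := H.blk i hip B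
          rw [e1, e2, heq] at this
          exact this

theorem ng_pred {f : ℕ → ℤ} {p : ℕ} {c : ℤ} (h : ∀ r < p, f r ≠ -c) : ng f p (c - 1) = ng f p c := by
  refine cnt_congr fun r => ⟨fun ⟨h1, h2, h3⟩ => ⟨h1, by omega, h3⟩, fun ⟨h1, h2, h3⟩ => ?_⟩
  have := h r h1
  exact ⟨h1, by omega, h3⟩

theorem pass_of_between {a b x d : ℤ} (h : pass a x d) (hab : a ≤ b) (hx : ¬ (a ≤ x ∧ x < b)) :
    pass b x d := by
  unfold pass at *; omega

theorem pass_of_pass {a b x d : ℤ} (h : pass b x d) (hab : a ≤ b) (hx : ¬ (a ≤ d ∧ d < b)) :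
    pass a x d := by
  unfold pass at *; omega

/-- Blocking only depends on the entries of absolute value at most `b`. -/
theorem Blk.transfer {f g h : ℕ → ℤ} {i : ℕ} {b : ℤ} (B : Blk f h i b)
    (H : ∀ j ≤ i, g j ≠ f j → b < |f j| ∧ b < |g j|) :
    Blk g h i b ∧ ng g (i + 1) b = ng f (i + 1) b := by
  have h0 := B.pos
  have key : ∀ j ≤ i, (|f j| ≤ b ∨ |g j| ≤ b) → g j = f j := fun j hj h => by
    by_contra hne; have := H j hj hne; omega
  have hi := key i le_rfl (Or.inl B.le)
  refine ⟨⟨h0, hi ▸ B.le, hi ▸ B.ne, fun x h1 h2 => ?_, B.full'⟩, cnt_congr fun j => ?_⟩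
  · obtain ⟨j, hj, e⟩ := B.full x h1 h2
    exact ⟨j, hj, by rw [key j hj (Or.inl (by omega)), e]⟩
  · constructor <;> rintro ⟨h1, h2, h3⟩
    · have := key j (by omega) (Or.inr (by rw [abs_le]; omega))
      rw [this] at h2 h3; exact ⟨h1, h2, h3⟩
    · have := key j (by omega) (Or.inl (by rw [abs_le]; omega))
      rw [← this] at h2 h3; exact ⟨h1, h2, h3⟩

/-! ### The fourth phase as a chain of moved entries -/

/-- The relation between two columns established by the successive reflections of row `p` with the
rows above, moving the value of row `p` from `v` up to `c`. -/
structure Chn (p : ℕ) (C C' : ℕ → ℤ) (v c : ℤ) : Prop where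
  lt : v < c
  step : ∀ j < p, C' j ≠ C j → -c ≤ C j ∧ C j < C' j ∧ C' j ≤ -v
  gap : ∀ j j', j < j' → j' < p → C' j ≠ C j → ¬ (-c ≤ C j' ∧ C j' < C' j)
  up : ∀ j < p, C' j ≠ C j → C' j = -v ∨ ∃ j', j < j' ∧ j' < p ∧ C' j' ≠ C j' ∧ C j' = C' j
  down : ∀ j < p, C' j ≠ C j → C j = -c ∨ ∃ j' < j, C' j' ≠ C j' ∧ C' j' = C j
  top : ∃ j < p, C' j ≠ C j ∧ C' j = -v
  bot : ∃ j < p, C j = -c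
  full : ∀ y, v < y → y < c → y ≠ 0 → |y| = |v| ∨ ∃ x < p, |C x| = |y|
  inj : AbsInj C p
  inj' : AbsInj C' p
  v0 : v ≠ 0
  c0 : c ≠ 0
  vC : ∀ x < p, |C x| ≠ |v|
  cC : ∀ x < p, |C' x| ≠ |c|

/-- The conditions on the first `p` rows of columns whose rows after `p` agree. -/
structure CondLt (p k : ℕ) (g h : ℕ → ℤ) : Prop where
  adj : ∀ i l, i < l → i < p → l ≤ p → pass (g i) (h l) (h i) →
    Blk g h i (h l) ∧ Odd (ng g (i + 1) (h l) + ng h i (h l))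
  out : ∀ i l, i < p → p < l → l < k → ¬ pass (g i) (h l) (h i)
  blk : ∀ i < p, Blk g h i (h i) → Even (ng g (i + 1) (h i) + ng h i (h i))

theorem CondLt.condIn {p k : ℕ} {g h : ℕ → ℤ} (H : CondLt p k g h) : CondIn p g h :=
  ⟨fun i l h1 h2 => H.adj i l h1 (by omega) h2.le, H.blk⟩

namespace Chn
variable {p k : ℕ} {C C' D : ℕ → ℤ} {v c : ℤ}

theorem mem (h : Chn p C C' v c) {y : ℤ} (hy : y ≠ |c|) (hx : ∃ x < p, |C x| = y) :
    ∃ x < p, |C' x| = y := by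
  obtain ⟨x, hx, e⟩ := hx
  by_cases hc : C' x = C x
  · exact ⟨x, hx, by rw [hc, e]⟩
  · rcases h.down x hx hc with h1 | ⟨j, hj, h1, h2⟩
    · rw [h1, abs_neg] at e; exact absurd e.symm hy
    · exact ⟨j, by omega, by rw [h2, e]⟩

theorem full_mid (h : Chn p C C' v c) {y : ℤ} (h1 : v < y) (h2 : y < c) (h3 : y ≠ 0)
    (h4 : |y| ≠ |c|) : ∃ x < p, |C' x| = |y| := by
  rcases h.full y h1 h2 h3 with h5 | h5
  · obtain ⟨j, hj, -, e⟩ := h.top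
    exact ⟨j, hj, by rw [e, abs_neg, h5]⟩
  · exact h.mem h4 h5

theorem val_mem (h : Chn p C C' v c) {x : ℤ} (hx : x ≠ -c) (hr : ∃ r < p, C r = x) :
    ∃ r < p, C' r = x := by
  obtain ⟨r, hr, rfl⟩ := hr
  by_cases hc : C' r = C r
  · exact ⟨r, hr, hc⟩
  · rcases h.down r hr hc with h1 | ⟨j, hj, h1, h2⟩
    · exact absurd h1 hx
    · exact ⟨j, by omega, h2⟩

theorem val_mem' (h : Chn p C C' v c) {x : ℤ} (hx : x ≠ -v) (hr : ∃ r < p, C' r = x) :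
    ∃ r < p, C r = x := by
  obtain ⟨r, hr, rfl⟩ := hr
  by_cases hc : C' r = C r
  · exact ⟨r, hr, hc.symm⟩
  · rcases h.up r hr hc with h1 | ⟨j, hj, h1, h2, h3⟩
    · exact absurd h1 hx
    · exact ⟨j, h1, h3⟩

theorem abs_vc (h : Chn p C C' v c) : |v| ≠ |c| := by
  obtain ⟨j, hj, -, e⟩ := h.top
  have := h.cC j hj
  rwa [e, abs_neg] at this

end Chn

theorem ng_eq_card {f : ℕ → ℤ} {p : ℕ} (hf : AbsInj f p) (b : ℤ) [DecidablePred fun x => ∃ r < p, f r = x] :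
    ng f p b = #{x ∈ Ico (-b) 0 | ∃ r < p, f r = x} := by
  unfold ng cnt
  refine card_bij (fun r _ => f r) (fun r hr => ?_) (fun r hr s hs e => ?_) (fun x hx => ?_)
  · simp only [mem_filter, mem_range, mem_Ico] at hr ⊢
    exact ⟨hr.2, r, hr.1, rfl⟩
  · simp only [mem_filter, mem_range] at hr hs
    exact hf.inj r hr.1 s hs.1 (by rw [e])
  · simp only [mem_filter, mem_Ico] at hx
    obtain ⟨h1, r, hr, rfl⟩ := hx
    exact ⟨r, by simp only [mem_filter, mem_range]; exact ⟨hr, h1⟩, rfl⟩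

namespace Chn
variable {p k : ℕ} {C C' D : ℕ → ℤ} {v c : ℤ}

-- The entries of `C'` are those of `C` with `-c` replaced by `-v`. The entry `-c` is counted, and
-- `-v` is counted iff `v` is positive, as `v < c`.
open Classical in
theorem ng_eq (h : Chn p C C' v c) (hc : 0 < c) :
    ng C p c + (if 0 < v then 1 else 0) = ng C' p c + 1 := by
  rw [ng_eq_card h.inj, ng_eq_card h.inj']
  have hlt := h.lt
  obtain ⟨jt, hjt, -, et⟩ := h.top
  obtain ⟨jb, hjb, eb⟩ := h.bot
  have h1 : ¬ ∃ r < p, C' r = -c := fun ⟨r, hr, e⟩ => h.cC r hr (by rw [e, abs_neg])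
  have h2 : ¬ ∃ r < p, C r = -v := fun ⟨r, hr, e⟩ => h.vC r hr (by rw [e, abs_neg])
  have e2 : #{x ∈ Ico (-c) 0 | ∃ r < p, C' r = x} + 1 =
      #(insert (-c) {x ∈ Ico (-c) 0 | ∃ r < p, C' r = x}) := by
    rw [card_insert_of_notMem]; intro hh; exact h1 (mem_filter.1 hh).2
  rw [e2]
  split_ifs with hv
  · rw [← card_insert_of_notMem (a := -v) (fun hh => h2 (mem_filter.1 hh).2)]
    congr 1; ext x
    simp only [mem_insert, mem_filter, mem_Ico]
    constructor
    · rintro (rfl | ⟨h3, h4⟩)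
      · exact Or.inr ⟨by omega, jt, hjt, et⟩
      · by_cases hx : x = -c
        · exact Or.inl hx
        · exact Or.inr ⟨h3, h.val_mem hx h4⟩
    · rintro (rfl | ⟨h3, h4⟩)
      · exact Or.inr ⟨by omega, jb, hjb, eb⟩
      · by_cases hx : x = -v
        · exact Or.inl hx
        · exact Or.inr ⟨h3, h.val_mem' hx h4⟩
  · rw [add_zero]; congr 1; ext x
    simp only [mem_insert, mem_filter, mem_Ico]
    constructor
    · rintro ⟨h3, h4⟩
      by_cases hx : x = -c
      · exact Or.inl hx
      · exact Or.inr ⟨h3, h.val_mem hx h4⟩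
    · rintro (rfl | ⟨h3, h4⟩)
      · exact ⟨by omega, jb, hjb, eb⟩
      · exact ⟨h3, h.val_mem' (by omega) h4⟩

/-- In the situation of a blocked level all moved entries are beyond that level. -/
theorem outside (h : Chn p C C' v c) {i : ℕ} {b : ℤ} (hi : i < p) (hCi : C' i = C i)
    (full : ∀ x, 0 < x → x ≤ b → ∃ j ≤ i, |C j| = x) (hib : |C i| ≤ b) (hbc : b < |c|) :
    ∀ j ≤ i, C' j ≠ C j → b < |C j| ∧ b < |C' j| := by
  have hb0 : 0 ≤ b := (abs_nonneg _).trans hib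
  have hcb : ∀ x : ℤ, -c ≤ x → x ≤ b → b < c := fun x h1 h2 => by
    rcases abs_cases c with h3 | h3 <;> omega
  have hib' := abs_le.1 hib
  have key : ∀ d j, p - j = d → j ≤ i → C' j ≠ C j → b < |C' j| := by
    intro d
    induction d using Nat.strong_induction_on with
    | _ d ih =>
    intro j hd hj hc
    by_contra hle
    have hle' := abs_le.1 (not_lt.1 hle)
    have hs := h.step j (by omega) hc
    have hcb' := hcb (C j) hs.1 (by omega)
    rcases h.up j (by omega) hc with h1 | ⟨j', h1, h2, h3, h4⟩
    · obtain ⟨s, hs, e⟩ := full |v| (abs_pos.2 h.v0) (by rw [← abs_neg, ← h1]; omega)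
      exact h.vC s (by omega) e
    · have h5 : j' ≤ i := by
        obtain ⟨s, hs, e⟩ := full |C j'| (abs_pos.2 (h.inj.ne_zero j' h2)) (by rw [h4]; omega)
        rw [← h.inj.inj s (by omega) j' h2 e]; exact hs
      have h6 : j' ≠ i := by rintro rfl; exact h3 hCi
      have h7 := ih (p - j') (by omega) j' rfl h5 h3
      have h8 := h.step j' h2 h3
      have h9 := h.gap j' i (by omega) hi h3
      rcases abs_cases (C' j') with h10 | h10 <;> omega
  intro j hj hc
  have h7 := key _ j rfl hj hc
  refine ⟨?_, h7⟩
  by_contra hle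
  have hle' := abs_le.1 (not_lt.1 hle)
  have h8 := h.step j (by omega) hc
  have h6 : j ≠ i := by rintro rfl; exact hc hCi
  have h9 := h.gap j i (by omega) hi hc
  have := hcb (C j) h8.1 (by omega)
  rcases abs_cases (C' j) with h10 | h10 <;> omega

/-- If the new entry is on the way of no entry below, nothing is skipped. -/
theorem no_skip (h : Chn p C C' v c) (hD : AbsInj D (p + 1)) (hDp : D p = c)
    (hc : ∀ r < p, ¬ pass (C' r) c (D r))
    (adj : ∀ i l, i < l → l < p → pass (C' i) (D l) (D i) → Blk C' D i (D l)) {j l : ℕ} (hjl : j ≤ l)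
    (hl : l < p) (hch : C' j ≠ C j) : ¬ (C j ≤ D l ∧ D l < C' j) := by
  rintro ⟨hx1, hx2⟩
  have hs := h.step j (by omega) hch
  have hDc : ∀ r < p, |D r| ≠ |c| := fun r hr e => by
    have := hD.inj r (by omega) p (by omega) (by rw [e, hDp]); omega
  have hxc := hDc l hl
  have hx0 := hD.ne_zero l (by omega)
  have hc0 := h.c0
  set x := D l with hx
  have hne1 : x ≠ c := fun e => hxc (by rw [e])
  have hne2 : x ≠ -c := fun e => hxc (by rw [e, abs_neg])
  -- These are the absolute values of the letters in `[-c, x]` and `[-x, c]` other than `|c|`. All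
  -- of them occur in `C'`, and rows starting in the set end in it. So row `l`, which ends in `x`,
  -- starts in it as well; but `gap` and the absence of arcs over `c` leave no place for its start.
  set A := (Icc 1 (max |x| |c|)).filter fun y => ((-x ≤ y ∧ y ≤ c) ∨ (-c ≤ y ∧ y ≤ x)) ∧ y ≠ |c|
    with hA
  have hmemA : ∀ y : ℤ, y ≠ 0 → |y| ≠ |c| → ((-x ≤ y ∧ y ≤ c) ∨ (-c ≤ y ∧ y ≤ x)) → |y| ∈ A := by
    intro y h1 h2 h3
    simp only [hA, mem_filter, mem_Icc]
    refine ⟨⟨abs_pos.2 h1, ?_⟩, ?_, h2⟩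
    · rw [le_max_iff]
      rcases abs_cases y with h4 | h4 <;> rcases abs_cases x with h5 | h5 <;>
        rcases abs_cases c with h6 | h6 <;> omega
    · rcases abs_cases y with h4 | h4 <;> omega
  have hAmem : ∀ y : ℤ, |y| ∈ A → ((-x ≤ y ∧ y ≤ c) ∨ (-c ≤ y ∧ y ≤ x)) := by
    intro y h1
    simp only [hA, mem_filter, mem_Icc] at h1
    rcases abs_cases y with h4 | h4 <;> omega
  have hlow : ∀ r < p, -c ≤ C' r → C' r ≤ x → r < j := by
    intro r hr h1 h2
    by_contra hrj
    rcases Nat.eq_or_lt_of_le (not_lt.1 hrj) with rfl | hlt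
    · omega
    · have h3 := h.gap j r hlt hr hch
      by_cases h4 : C' r = C r
      · omega
      · have := h.step r hr h4; omega
  have ph := (pigeonhole (Q := range p) (f := C') (h := D) (A := A) (A' := A)
    (fun y hy => by
      have hy' := hy
      simp only [hA, mem_filter, mem_Icc] at hy
      obtain ⟨⟨h1, -⟩, h2, h3⟩ := hy
      have hy1 : |y| = y := abs_of_pos (by omega)
      have hyc : y ≠ c := fun e => h3 (by rw [← hy1, e])
      have hyc' : y ≠ -c := fun e => h3 (by rw [← hy1, e, abs_neg])
      rcases h2 with h2 | h2
      · obtain ⟨s, hs, e⟩ := h.full_mid (y := y) (by omega) (by omega) (by omega) (by rw [hy1]; exact h3)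
        exact ⟨s, mem_range.2 hs, by rw [e, hy1]⟩
      · obtain ⟨s, hs, e⟩ := h.full_mid (y := -y) (by omega) (by omega) (by omega)
          (by rw [abs_neg, hy1]; exact h3)
        exact ⟨s, mem_range.2 hs, by rw [e, abs_neg, hy1]⟩)
    (fun r hr s hs => by
      rw [mem_range] at hr hs
      exact hD.inj r (by omega) s (by omega)) le_rfl
    (fun r hr hrA => by
      rw [mem_range] at hr
      have h1 := hAmem _ hrA
      have h2 := hc r hr
      have h3 := hDc r hr
      have h0 := hD.ne_zero r (by omega)
      refine hmemA _ h0 h3 ?_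
      have h4 : -c ≤ C' r → C' r ≤ x → pass (C' r) x (D r) → 0 < x ∧ x < c := by
        intro h5 h6 h7
        have h8 := hlow r hr h5 h6
        have B := adj r l (by omega) hl h7
        have h9 : x < |c| := by
          by_contra h9
          obtain ⟨s, hs, e⟩ := B.full |c| (abs_pos.2 hc0) (by omega)
          exact h.cC s (by omega) e
        have := B.pos
        refine ⟨this, ?_⟩
        rcases abs_cases c with h10 | h10 <;> omega
      unfold pass at h2 h4
      by_cases h5 : -c ≤ C' r ∧ C' r ≤ x
      · have h6 := h4 h5.1 h5.2
        omega
      · omega)).1 l (mem_range.2 hl) (hmemA x hx0 hxc (by omega))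
  have h1 := hAmem _ ph
  have h2 := hc l hl
  have h3 := hlow l hl
  rw [← hx] at h2
  unfold pass at h2
  omega

end Chn

namespace Chn
variable {p k : ℕ} {C C' D : ℕ → ℤ} {v c : ℤ}

/-- No row of the first `p` has the entry `±c` in the second column. -/
theorem abs_ne_of {D : ℕ → ℤ} {k p : ℕ} (hD : AbsInj D k) (hpk : p < k) {r : ℕ} (hr : r < k)
    (hrp : r ≠ p) : D r ≠ D p ∧ D r ≠ -D p :=
  ⟨fun e => hrp (hD.inj r hr p hpk (by rw [e])), fun e => hrp (hD.inj r hr p hpk (by rw [e, abs_neg]))⟩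

/-- Necessity across the fourth phase. Before the phase the arcs of the moved rows are longer by an
initial piece. By `no_skip` this piece contains no target of the relevant rows above `p`; by `full`
it contains no entry of the rows below `p`; and a row whose piece contains `c` turns out to be
blocked by `c`, with the right parity. -/
theorem condLt (h : Chn p C C' v c) (hD : AbsInj D k) (hpk : p < k) (hDp : D p = c)
    (H : Cond p k C' D) (hF : ∀ l, p < l → l < k → |D l| ≠ |v| ∧ ∀ x < p, |C x| ≠ |D l|) :
    CondLt p k C D := by
  have hc : ∀ r < p, ¬ pass (C' r) c (D r) := fun r hr => hDp ▸ H.out r p hr le_rfl hpk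
  have hD' : AbsInj D (p + 1) := hD.mono hpk
  have hDc : ∀ r < p, D r ≠ c ∧ D r ≠ -c := fun r hr => hDp ▸ abs_ne_of hD hpk (by omega) hr.ne
  have skip : ∀ j l, j ≤ l → l < p → C' j ≠ C j → ¬ (C j ≤ D l ∧ D l < C' j) := fun j l h1 h2 h3 =>
    h.no_skip hD' hDp hc (fun i l h4 h5 h6 => (H.adj i l h4 h5 h6).1) h1 h2 h3
  -- the levels below `c`
  have hcl : ∀ b : ℤ, b < c → -b ≤ -v → 0 < c → (∀ x, 0 < x → x ≤ b → ∃ j < p, |C' j| = x) →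
      (∀ x, 0 < x → x ≤ c - 1 → ∃ j < p, |C' j| = x) := by
    intro b h1 h2 h3 h4 x h5 h6
    rcases le_or_gt x b with h7 | h7
    · exact h4 x h5 h7
    · have := h.full_mid (y := x) (by omega) (by omega) (by omega)
        (by rw [abs_of_pos h5, abs_of_pos h3]; omega)
      rwa [abs_of_pos h5] at this
  have hnp : 0 < c → ∀ j < p, |C' j| ≤ c - 1 → ¬ pass (C' j) (c - 1) (D j) := by
    intro h0 j hj h1 h2
    have h3 := hc j hj
    have h4 := hDc j hj
    rw [abs_le] at h1
    unfold pass at h2 h3; omega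
  refine ⟨fun i l hil hip hlp hp => ?_, fun i l hip hl hlk hp => ?_, fun i hip B => ?_⟩
  · rcases lt_or_eq_of_le hlp with hlp | rfl
    · -- two rows above row `p`
      have hp' : pass (C' i) (D l) (D i) := by
        by_cases hch : C' i = C i
        · rwa [hch]
        · exact pass_of_between hp (h.step i hip hch).2.1.le (skip i l hil.le hlp hch)
      obtain ⟨B, hodd⟩ := H.adj i l hil hlp hp'
      have hb0 := B.pos
      set b := D l with hb
      have hbc : b < |c| := by
        by_contra hbc
        obtain ⟨s, hs, e⟩ := B.full |c| (abs_pos.2 h.c0) (by omega)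
        exact h.cC s (by omega) e
      -- A moved row within level `b` would make all levels below `c` full, hence closed. Then row
      -- `l`, which ends in `b`, starts below `c` in absolute value but beyond level `b`, which
      -- contradicts `gap`.
      have h1 : ∀ j ≤ i, C' j ≠ C j → b < |C' j| := by
        intro j hj hch
        by_contra hle
        have hle' := abs_le.1 (not_lt.1 hle)
        have hs := h.step j (by omega) hch
        have hbc' : b < c := by rcases abs_cases c with h3 | h3 <;> omega
        have hfull := hcl b hbc' (by omega) (by omega) (fun x h2 h3 => by
          obtain ⟨s, hs, e⟩ := B.full x h2 h3; exact ⟨s, by omega, e⟩)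
        have h2 := ((closed_of_not_pass h.inj' (hD.mono hpk.le) hfull (hnp (by omega))).1 l hlp).2
          (by rw [← hb, abs_of_pos hb0]; omega)
        have h3 : ¬ |C' l| ≤ b := fun h3 => by
          have := B.le_of h.inj' hip hlp h3; omega
        have h4 := hc l hlp
        rw [← hb] at h4
        have h5 := h.gap j l (by omega) hlp hch
        rw [abs_le] at h2 h3
        unfold pass at h4
        by_cases h6 : C' l = C l
        · omega
        · have := h.step l hlp h6; omega
      have h2 : ∀ j ≤ i, C j ≠ C' j → b < |C' j| ∧ b < |C j| := by
        intro j hj hch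
        refine ⟨h1 j hj hch.symm, ?_⟩
        rcases h.down j (by omega) hch.symm with h3 | ⟨j', h3, h4, h5⟩
        · rw [h3, abs_neg]; exact hbc
        · rw [← h5]; exact h1 j' (by omega) h4
      obtain ⟨B', e⟩ := B.transfer h2
      exact ⟨B', e ▸ hodd⟩
    · -- row `p` itself
      rw [hDp] at hp ⊢
      have h1 := hc i hip
      have hch : C' i ≠ C i := fun e => h1 (e ▸ hp)
      have hs := h.step i hip hch
      have h2 : C i ≤ c ∧ c < C' i := by
        by_contra h2; exact h1 (pass_of_between hp hs.2.1.le h2)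
      have h3 : C i ≠ c := fun e => by
        rcases h.down i hip hch with h3 | ⟨j', h3, h4, h5⟩
        · have := h.c0; omega
        · exact h.cC j' (by omega) (by rw [h5, e])
      have h0 : 0 < c := by have := h.c0; omega
      have h4 : ∀ r < l, -c ≤ C r → C r ≤ c → r ≤ i := by
        intro r hr h5 h6
        by_contra h7
        exact h.gap i r (by omega) hr hch ⟨h5, by omega⟩
      have hfull := hcl 0 h0 (by omega) h0 (fun x h5 h6 => by omega)
      obtain ⟨hclo, hmono, hfullD⟩ := closed_of_not_pass h.inj' (hD.mono hpk.le) hfull (hnp h0)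
      obtain ⟨j0, hj0, e0⟩ := h.bot
      have hvc : |c| < |v| := by rw [abs_of_pos h0, abs_of_neg (by omega)]; omega
      have B : Blk C D i c := by
        refine ⟨h0, by rw [abs_le]; omega, h3, fun x h5 h6 => ?_, fun x h5 h6 => ?_⟩
        · rcases lt_or_eq_of_le h6 with h6 | rfl
          · rcases h.full x (by omega) h6 (by omega) with h7 | ⟨s, hs, e⟩
            · rw [abs_of_pos h5, abs_of_neg (show v < 0 by omega)] at h7; omega
            · rw [abs_of_pos h5] at e
              exact ⟨s, h4 s hs (by have := abs_le.1 (e.le.trans h6.le); omega)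
                (by have := abs_le.1 (e.le.trans h6.le); omega), e⟩
          · exact ⟨j0, h4 j0 hj0 e0.ge (by omega), by rw [e0, abs_neg, abs_of_pos h0]⟩
        · obtain ⟨s, hs, e⟩ := hfullD x h5 (by omega)
          refine ⟨s, ?_, e⟩
          have h7 := abs_le.1 ((hclo s hs).2 (by omega))
          have hsi : s ≠ i := by rintro rfl; omega
          have : s ≤ i := by
            by_contra h8
            have h9 := h.gap i s (by omega) hs hch
            by_cases h10 : C' s = C s
            · omega
            · have := h.step s hs h10; omega
          omega
      refine ⟨B, ?_⟩
      -- Level `c - 1` is full in `C'` and not passed, so `C'` and `D` agree in parity there. Going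
      -- back to `C` adds the entry `-c`, while `-v` is positive and was not counted; hence the sum
      -- becomes odd.
      obtain ⟨N, hN⟩ : ∃ N : ℕ, (N : ℤ) = c - 1 := ⟨(c - 1).toNat, by omega⟩
      have he := even_ng h.inj' (hD.mono hpk.le) (H.condIn le_rfl hpk) N
        (fun x h5 h6 => hfull x h5 (by omega)) (fun j hj h5 => hN ▸ hnp h0 j hj (by omega))
      rw [hN, ng_pred (fun r hr e => h.cC r hr (by rw [e, abs_neg])),
        ng_pred (fun r hr => (hDc r hr).2)] at he
      have h5 : ng C (i + 1) c = ng C l c := cnt_congr fun r =>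
        ⟨fun h => ⟨by omega, h.2⟩, fun h => ⟨by have := h4 r h.1 h.2.1 (by omega); omega, h.2⟩⟩
      have h6 : ng D i c = ng D l c := cnt_congr fun r =>
        ⟨fun h => ⟨by omega, h.2⟩, fun h => ⟨B.lt_of (hD.mono hpk.le) hip h.1 (by
          have := (hDc r h.1).2; rw [abs_lt]; omega), h.2⟩⟩
      have h7 := h.ng_eq h0
      rw [if_neg (by omega)] at h7
      rw [h5, h6, show ng C l c = ng C' l c + 1 by omega, Nat.odd_iff]
      rw [Nat.even_iff] at he; omega
  · -- rows after row `p`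
    refine H.out i l hip hl.le hlk ?_
    by_cases hch : C' i = C i
    · rwa [hch]
    · have hs := h.step i hip hch
      refine pass_of_between hp hs.2.1.le fun h1 => ?_
      have h2 := abs_ne_of hD hpk hlk hl.ne'
      rw [hDp] at h2
      have h3 := hF l hl hlk
      rcases h.full (-D l) (by omega) (by omega) (by have := hD.ne_zero l hlk; omega) with h4 | ⟨x, hx, e⟩
      · rw [abs_neg] at h4; exact h3.1 h4
      · rw [abs_neg] at e; exact h3.2 x hx e
  · -- blocked rows
    have hb0 := B.pos
    set b := D i with hb
    have hbc : b < |c| := by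
      by_contra hbc
      have h1 := hDc i hip
      rcases lt_or_eq_of_le (not_lt.1 hbc) with h2 | h2
      · obtain ⟨s, hs, e⟩ := B.full' |c| (abs_pos.2 h.c0) h2
        have := hDc s (by omega)
        rcases abs_eq_abs.1 e with h3 | h3 <;> omega
      · rcases abs_cases c with h3 | h3 <;> omega
    have hch : C' i = C i := by
      by_contra hch
      have h1 := skip i i le_rfl hip hch
      have h2 := abs_le.1 B.le
      have h3 := B.ne
      have hs := h.step i hip hch
      have h4 : |C' i| ≤ b := by rw [abs_le]; omega
      rcases h.up i hip hch with h5 | ⟨j', h5, h6, h7, h8⟩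
      · obtain ⟨s, hs, e⟩ := B.full |v| (abs_pos.2 h.v0) (by rw [← abs_neg, ← h5]; exact h4)
        exact h.vC s (by omega) e
      · have := B.le_of h.inj hip h6 (by rw [h8]; exact h4)
        omega
    have h1 := h.outside hip hch B.full B.le hbc
    obtain ⟨B', e⟩ := B.transfer h1
    rw [← e]
    exact H.blk i hip (by omega) B'

end Chn

namespace Chn
variable {p k : ℕ} {C C' D : ℕ → ℤ} {v c : ℤ}

/-- No moved entry overshoots its target. -/
theorem no_overshoot (h : Chn p C C' v c) (hD : AbsInj D (p + 1)) (hDp : D p = c)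
    (H : CondLt p k C D)
    (hpar : 0 < c → |v| < c → (∀ x, 0 < x → x ≤ c → x = |v| ∨ ∃ r < p, |C r| = x) →
      Odd (ng C p c + ng D p c + if 0 < v then 1 else 0))
    {j : ℕ} (hj : j < p) (hch : C' j ≠ C j) : ¬ (C j ≤ D j ∧ D j < C' j) := by
  rintro ⟨hx1, hx2⟩
  have hDp' : AbsInj D p := hD.mono (Nat.le_succ p)
  have hDc : ∀ r < p, D r ≠ c ∧ D r ≠ -c := fun r hr =>
    hDp ▸ abs_ne_of hD (Nat.lt_succ_self p) (by omega) hr.ne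
  have hlt := h.lt
  have hc0 := h.c0
  have hvc := h.abs_vc
  have hs := h.step j hj hch
  have hxc := hDc j hj
  have hx0 := hDp'.ne_zero j hj
  obtain ⟨j0, hj0, e0⟩ := h.bot
  set x := D j with hx
  have hlow : ∀ r < p, -c ≤ C r → C r ≤ x → r ≤ j := by
    intro r hr h1 h2
    by_contra h3
    exact h.gap j r (by omega) hr hch ⟨h1, by omega⟩
  have adjx : ∀ r < j, pass (C r) x (D r) → Blk C D r x ∧ Odd (ng C (r + 1) x + ng D r x) :=
    fun r hr => H.adj r j hr (by omega) hj.le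
  have adjc : ∀ r < p, pass (C r) c (D r) → Blk C D r c ∧ Odd (ng C (r + 1) c + ng D r c) :=
    fun r hr hp => by
      have := H.adj r p hr hr le_rfl (by rwa [hDp])
      rwa [hDp] at this
  -- the symmetric set of letters on the way
  set Y : ℤ → Prop := fun y => (-x ≤ y ∧ y ≤ c) ∨ (-c ≤ y ∧ y ≤ x) with hY
  set A := (Icc 1 (max |x| |c|)).filter Y with hA
  have hYneg : ∀ y, Y (-y) ↔ Y y := fun y => by simp only [hY]; omega
  have hmemA : ∀ y : ℤ, |y| ∈ A ↔ y ≠ 0 ∧ Y y := by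
    intro y
    have h1 : Y |y| ↔ Y y := by rcases abs_cases y with h4 | h4 <;> rw [h4.1]; exact hYneg y
    simp only [hA, mem_filter, mem_Icc, h1]
    constructor
    · rintro ⟨⟨h2, -⟩, h3⟩
      exact ⟨abs_pos.1 (by omega), h3⟩
    · rintro ⟨h2, h3⟩
      refine ⟨⟨abs_pos.2 h2, ?_⟩, h3⟩
      simp only [hY] at h3
      rw [le_max_iff]
      rcases abs_cases y with h4 | h4 <;> rcases abs_cases x with h5 | h5 <;>
        rcases abs_cases c with h6 | h6 <;> omega
  have hApos : ∀ y ∈ A, 0 < y ∧ Y y := fun y hy => by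
    have := (mem_Icc.1 (mem_filter.1 hy).1).1
    exact ⟨by omega, (mem_filter.1 hy).2⟩
  have hcY : Y c := by simp only [hY]; omega
  -- If the rows of `Q` supply all letters on the way and remain among them, some row above `p` ends
  -- in `±c`, although `D p = c`.
  have count : ∀ Q : Finset ℕ, (∀ r ∈ Q, r < p) → (∀ y, 0 < y → Y y → ∃ r ∈ Q, |C r| = y) →
      (∀ r ∈ Q, Y (C r) → Y (D r)) → False := by
    intro Q hQ hfull hstay
    have ph := (pigeonhole (Q := Q) (f := C) (h := D) (A := A) (A' := A)
      (fun y hy => hfull y (hApos y hy).1 (hApos y hy).2)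
      (fun r hr s hs => hDp'.inj r (hQ r hr) s (hQ s hs)) le_rfl
      (fun r hr h1 => (hmemA _).2 ⟨hDp'.ne_zero r (hQ r hr), hstay r hr ((hmemA _).1 h1).2⟩)).2
      |c| ((hmemA c).2 ⟨hc0, hcY⟩)
    obtain ⟨r, hr, e⟩ := ph
    have := hDc r (hQ r hr)
    rcases abs_eq_abs.1 e with h3 | h3 <;> omega
  by_cases hbig : |c| < x
  · have hbig' := abs_lt.1 hbig
    refine count (range p) (fun r hr => mem_range.1 hr) (fun y hy hYy => ?_) (fun r hr hYr => ?_)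
    · by_cases hyc : y = |c|
      · exact ⟨j0, mem_range.2 hj0, by rw [e0, abs_neg, hyc]⟩
      · have key : ∀ z, v < z → z < c → z ≠ 0 → |z| = y → ∃ r ∈ range p, |C r| = y := by
          intro z h1 h2 h3 h4
          rcases h.full z h1 h2 h3 with h5 | ⟨s, hs, e⟩
          · rw [abs_of_neg (show v < 0 by omega)] at h5
            simp only [hY] at hYy
            omega
          · exact ⟨s, mem_range.2 hs, by rw [e, h4]⟩
        have hyc' : y ≠ c ∧ y ≠ -c := by rcases abs_cases c with h4 | h4 <;> omega
        simp only [hY] at hYy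
        rcases hYy with h1 | h1
        · exact key y (by omega) (by omega) (by omega) (abs_of_pos hy)
        · exact key (-y) (by omega) (by omega) (by omega) (by rw [abs_neg, abs_of_pos hy])
    · rw [mem_range] at hr
      have h2 : r < j → ¬ pass (C r) x (D r) := fun h3 h4 => by
        have := (adjx r h3 h4).1.le_of h.inj hr hj (by rw [abs_le]; omega)
        omega
      have h3 := hlow r hr
      have h5 : pass (C r) c (D r) → -c ≤ C r ∧ C r ≤ c ∧ 0 < c ∧ ∀ s < p, |C s| ≤ c → s ≤ r :=
        fun h4 => by
          have B := (adjc r hr h4).1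
          have := abs_le.1 B.le
          exact ⟨by omega, by omega, B.pos, fun s hs h6 => B.le_of h.inj hr hs h6⟩
      simp only [hY] at hYr ⊢
      by_cases hrj : r = j
      · subst hrj; rw [← hx]; omega
      unfold pass at h2 h5
      by_cases h6 : r < j
      · have := h2 h6; omega
      · have h7 : C r < -c ∨ x < C r := by
          by_contra h8; have := h3 (by omega) (by omega); omega
        omega
  · have hbig' : -c < x ∧ x < c := by rcases abs_cases c with h4 | h4 <;> omega
    -- The rows `Q` omit at most the one that passes `c`, and `|w|` is the absolute value they may
    -- fail to supply: `w = v` if no row passes `c`, and `w = -C e` if row `e` does and is left out.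
    have main : ∀ (w : ℤ) (Q : Finset ℕ), (∀ r ∈ Q, r < p ∧ ¬ pass (C r) c (D r)) →
        (∀ y, 0 < y → y ≤ c → y ≠ |w| → (w < y ∧ y < c ∨ w < -y ∨ y = c) → ∃ r ∈ Q, |C r| = y) →
        x < -w → w ≠ -c → w ≠ 0 → (w < 0 → -w < c → Odd (ng C p c + ng D p c)) →
        (∀ r < p, r ∉ Q → C r = -w ∧ ¬ |D r| ≤ c) → False := by
      intro w Q hQ hfull hxw hwc hw0 hodd hnQ
      have hstay : ∀ r ∈ Q, Y (C r) → Y (D r) := by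
        intro r hr hYr
        obtain ⟨hrp, h1⟩ := hQ r hr
        have h3 := hlow r hrp
        by_cases hrj : r = j
        · subst hrj; simp only [hY]; rw [← hx]; omega
        have h2 : r < j → pass (C r) x (D r) → 0 < x := fun h3 h4 => (adjx r h3 h4).1.pos
        simp only [hY] at hYr ⊢
        unfold pass at h1 h2
        by_cases h4 : -c ≤ C r ∧ C r ≤ x
        · have := h3 h4.1 h4.2
          have := h2 (by omega)
          omega
        · omega
      -- If `-w` is on the way, one letter is missing on either side, `-w` for `C` and `c` for `D`,
      -- and counting alone gives no contradiction. It does match the rows exactly, and then the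
      -- negative entries within level `|x|` and between this level and `c` contradict the parity.
      by_cases hwY : w < 0 ∧ -w < c ∧ -x ≤ -w
      · obtain ⟨hw, hwc', hxw'⟩ := hwY
        have hodd := hodd hw hwc'
        have habsw : |w| = -w := abs_of_neg hw
        have hwA : -w ∈ A := by
          rw [← habsw, hmemA]; simp only [hY]; omega
        have hcA : c ∈ A := by
          have := (hmemA c).2 ⟨hc0, hcY⟩
          rwa [abs_of_pos (by omega)] at this
        have ph := (pigeonhole (Q := Q) (f := C) (h := D) (A := A.erase (-w)) (A' := A.erase c)
          (fun y hy => by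
            rw [mem_erase] at hy
            obtain ⟨h1, h2⟩ := hApos y hy.2
            simp only [hY] at h2
            exact hfull y h1 (by omega) (by omega) (by omega))
          (fun r hr s hs => hDp'.inj r (hQ r hr).1 s (hQ s hs).1)
          (by rw [card_erase_of_mem hwA, card_erase_of_mem hcA])
          (fun r hr h1 => by
            rw [mem_erase] at h1 ⊢
            have h2 := hDc r (hQ r hr).1
            refine ⟨fun e => ?_, (hmemA _).2 ⟨hDp'.ne_zero r (hQ r hr).1, hstay r hr ((hmemA _).1 h1.2).2⟩⟩
            rcases abs_cases (D r) with h4 | h4 <;> omega)).1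
        have hinv : ∀ r < p, Y (D r) → r ∈ Q ∧ Y (C r) ∧ C r ≤ D r ∧ ¬ pass (C r) c (D r) := by
          intro r hr h1
          have h2 := hDc r hr
          have hrQ : r ∈ Q := by
            by_contra h3
            have := (hnQ r hr h3).2
            simp only [hY] at h1
            rw [abs_le] at this; omega
          have h3 := ph r hrQ (by
            rw [mem_erase]
            refine ⟨fun e => ?_, (hmemA _).2 ⟨hDp'.ne_zero r hr, h1⟩⟩
            rcases abs_cases (D r) with h4 | h4 <;> omega)
          have h4 := ((hmemA _).1 (mem_erase.1 h3).2).2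
          have h5 := (hQ r hrQ).2
          refine ⟨hrQ, h4, ?_, h5⟩
          simp only [hY] at h1 h4
          unfold pass at h5; omega
        have hnQ' : ∀ r < p, C r < 0 → r ∈ Q := fun r hr h1 => by
          by_contra h2; have := (hnQ r hr h2).1; omega
        rcases lt_or_gt_of_ne hx0 with hxneg | hxpos
        · obtain ⟨N, hN⟩ : ∃ N : ℕ, (N : ℤ) = -x - 1 := ⟨(-x - 1).toNat, by omega⟩
          have he := even_ng h.inj hDp' H.condIn N
            (fun y h1 h2 => by
              obtain ⟨r, hr, e⟩ := hfull y h1 (by omega) (by omega) (by omega)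
              exact ⟨r, (hQ r hr).1, e⟩)
            (fun r hr h1 h2 => by
              rw [abs_le] at h1
              have hrQ : r ∈ Q := by
                by_contra h3; have := (hnQ r hr h3).1; omega
              have h3 := (hQ r hrQ).2
              have h4 := hDc r hr
              have h5 : ¬ Y (D r) := fun h5 => by
                have := (hinv r hr h5).2.1
                simp only [hY] at this; omega
              simp only [hY] at h5
              unfold pass at h2 h3; omega)
          have hcnt : cnt C p (-c) (-N) = cnt D p (-c) (-N) := by
            refine cnt_congr fun r => ⟨fun ⟨h1, h2, h3⟩ => ?_, fun ⟨h1, h2, h3⟩ => ?_⟩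
            · have h4 := hlow r h1 h2 (by omega)
              have h5 := (hQ r (hnQ' r h1 (by omega))).2
              by_cases h6 : r = j
              · subst h6; exact ⟨h1, by omega, by omega⟩
              · have h7 : ¬ pass (C r) x (D r) := fun h7 => by
                  have := (adjx r (by omega) h7).1.pos; omega
                unfold pass at h5 h7
                exact ⟨h1, by omega, by omega⟩
            · obtain ⟨h4, h5, h6, h7⟩ := hinv r h1 (by simp only [hY]; omega)
              simp only [hY] at h5
              unfold pass at h7
              exact ⟨h1, by omega, by omega⟩
          rw [ng_split C p (y := N) (N := c) (by omega) (by omega),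
            ng_split D p (y := N) (N := c) (by omega) (by omega), hcnt, Nat.odd_iff] at hodd
          rw [Nat.even_iff] at he
          omega
        · have hYc : ∀ r, -c ≤ D r → D r ≤ c → Y (D r) := fun r h1 h2 => by
            simp only [hY]; omega
          have hfx : ∀ y, 0 < y → y ≤ x → ∃ r < p, |C r| = y := fun y h1 h2 => by
            obtain ⟨r, hr, e⟩ := hfull y h1 (by omega) (by omega) (by omega)
            exact ⟨r, (hQ r hr).1, e⟩
          by_cases hex : ∃ r < p, |C r| ≤ x ∧ pass (C r) x (D r)
          · obtain ⟨r, hr, h1, h2⟩ := hex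
            rw [abs_le] at h1
            have hrj : r < j := by
              refine lt_of_le_of_ne (hlow r hr (by omega) h1.2) ?_
              rintro rfl; unfold pass at h2; omega
            obtain ⟨B, hodd'⟩ := adjx r hrj h2
            obtain ⟨e1, e2⟩ := B.ng_eq h.inj hDp' hr hj hrj.le rfl
            have huniq : ∀ s < j, pass (C s) x (D s) → s = r := fun s hs h3 => by
              have B' := (adjx s hs h3).1
              exact le_antisymm (B.le_of h.inj hr (by omega) B'.le)
                (B'.le_of h.inj (by omega) hr B.le)
            have hjx : ¬ |C j| ≤ x := fun h3 => by
              have := B.le_of h.inj hr hj h3; omega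
            rw [abs_le] at hjx
            have hcnt := cnt_above_blk (N := c) B h.inj hDp' hrj hj hx.symm huniq hs.1 (by omega)
              (fun s hs' h3 h4 h5 => by
                have h6 := (hQ s (hnQ' s hs' (by omega))).2
                have h7 := hlow s hs' h4 (by omega)
                have h8 : ¬ pass (C s) x (D s) := fun h8 => by
                  have := (adjx s (by omega) h8).1.le
                  rw [abs_le] at this; omega
                unfold pass at h6 h8; omega)
              (fun s hs' h3 h4 => by
                obtain ⟨h5, h6, h7, h8⟩ := hinv s hs' (hYc s h3 (by omega))
                simp only [hY] at h6; omega)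
            rw [ng_split C p (y := x) (N := c) (by omega) (by omega),
              ng_split D p (y := x) (N := c) (by omega) (by omega), hcnt, Nat.odd_iff] at hodd
            rw [e1, e2, Nat.odd_iff] at hodd'
            omega
          · push Not at hex
            obtain ⟨N, hN⟩ : ∃ N : ℕ, (N : ℤ) = x := ⟨x.toNat, by omega⟩
            have he := even_ng h.inj hDp' H.condIn N (fun y h1 h2 => hfx y h1 (by omega))
              (fun r hr h1 => by rw [hN]; exact hex r hr (by omega))
            rw [hN] at he
            obtain ⟨hcl, -, -⟩ := closed_of_not_pass h.inj hDp' hfx hex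
            have hcnt : cnt C p (-c) (-x) = cnt D p (-c) (-x) := by
              refine cnt_congr fun r => ⟨fun ⟨h1, h2, h3⟩ => ?_, fun ⟨h1, h2, h3⟩ => ?_⟩
              · have h4 := hlow r h1 h2 (by omega)
                have h5 := (hQ r (hnQ' r h1 (by omega))).2
                have h6 : ¬ |D r| ≤ x := fun h6 => by
                  have := (hcl r h1).2 h6; rw [abs_le] at this; omega
                rw [abs_le] at h6
                have h7 : r ≠ j := by rintro rfl; omega
                have h8 : ¬ pass (C r) x (D r) := fun h8 => by
                  have := (adjx r (by omega) h8).1.le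
                  rw [abs_le] at this; omega
                unfold pass at h5 h8
                exact ⟨h1, by omega, by omega⟩
              · obtain ⟨h4, h5, h6, h7⟩ := hinv r h1 (hYc r h2 (by omega))
                simp only [hY] at h5
                exact ⟨h1, by omega, by omega⟩
            rw [ng_split C p (y := x) (N := c) (by omega) (by omega),
              ng_split D p (y := x) (N := c) (by omega) (by omega), hcnt, Nat.odd_iff] at hodd
            rw [Nat.even_iff] at he
            omega
      · refine count Q (fun r hr => (hQ r hr).1) (fun y hy hYy => ?_) hstay
        simp only [hY] at hYy
        refine hfull y hy (by omega) (fun e => ?_) (by omega)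
        rcases abs_cases w with h4 | h4 <;> omega
    -- A row that passes `c` is blocked there and brings its own parity; if there is none, the
    -- parity comes from `hpar`.
    by_cases hex : ∃ e < p, pass (C e) c (D e)
    · obtain ⟨e, he, hpe⟩ := hex
      obtain ⟨B, hodd⟩ := adjc e he hpe
      have hje : j ≤ e := B.le_of h.inj he hj (by rw [abs_le]; omega)
      have hne : j ≠ e := by
        rintro rfl; unfold pass at hpe; omega
      have hgap := h.gap j e (by omega) he hch
      have hCe := abs_le.1 B.le
      have e1 : ng C (e + 1) c = ng C p c := cnt_congr fun r =>
        ⟨fun h3 => ⟨by omega, h3.2⟩, fun h3 => ⟨by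
          have := B.le_of h.inj he h3.1 (by rw [abs_le]; omega)
          omega, h3.2⟩⟩
      have e2 : ng D e c = ng D p c := cnt_congr fun r =>
        ⟨fun h3 => ⟨by omega, h3.2⟩, fun h3 => ⟨B.lt_of hDp' he h3.1 (by
          have := (hDc r h3.1).2; rw [abs_lt]; omega), h3.2⟩⟩
      refine main (-C e) ((range p).erase e) (fun r hr => ?_) (fun y h1 h2 h3 h4 => ?_) (by omega)
        (fun h1 => B.ne (by omega)) (by have := h.inj.ne_zero e he; omega) (fun _ _ => e1 ▸ e2 ▸ hodd)
        (fun r hr h1 => ?_)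
      · rw [mem_erase, mem_range] at hr
        refine ⟨hr.2, fun h1 => hr.1 ?_⟩
        have B' := (adjc r hr.2 h1).1
        exact le_antisymm (B.le_of h.inj he hr.2 B'.le) (B'.le_of h.inj hr.2 he B.le)
      · obtain ⟨s, hs, e⟩ := B.full y h1 h2
        refine ⟨s, ?_, e⟩
        rw [mem_erase, mem_range]
        refine ⟨?_, by omega⟩
        rintro rfl; rw [abs_neg] at h3; exact h3 e.symm
      · have hre : r = e := by
          by_contra h2; exact h1 (by rw [mem_erase, mem_range]; exact ⟨h2, hr⟩)
        subst hre
        refine ⟨by omega, fun h2 => ?_⟩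
        have h3 := hDc r hr
        have h4 := B.lt_of hDp' hr hr (by
          refine lt_of_le_of_ne h2 fun e => ?_
          rcases abs_cases (D r) with h4 | h4 <;> omega)
        omega
    · push Not at hex
      refine main v (range p) (fun r hr => ⟨mem_range.1 hr, hex r (mem_range.1 hr)⟩)
        (fun y h1 h2 h3 h4 => ?_) (by omega)
        (fun e => hvc (by rw [e, abs_neg])) h.v0 (fun h1 h2 => ?_)
        (fun r hr h1 => absurd (mem_range.2 hr) h1)
      · have key : ∀ z, v < z → z < c → z ≠ 0 → |z| = y → ∃ r ∈ range p, |C r| = y := by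
          intro z h1 h2 h3' h4
          rcases h.full z h1 h2 h3' with h5 | ⟨s, hs, e⟩
          · exact absurd (h4.symm.trans h5) h3
          · exact ⟨s, mem_range.2 hs, by rw [e, h4]⟩
        rcases h4 with h4 | h4 | h4
        · exact key y h4.1 h4.2 (by omega) (abs_of_pos h1)
        · exact key (-y) h4 (by omega) (by omega) (by rw [abs_neg, abs_of_pos h1])
        · exact ⟨j0, mem_range.2 hj0, by rw [e0, abs_neg, h4, abs_of_pos (by omega)]⟩
      · have := hpar (by omega) (by rw [abs_of_neg h1]; exact h2) (fun y h3 h4 => by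
          rcases eq_or_lt_of_le h4 with rfl | h4
          · exact Or.inr ⟨j0, hj0, by rw [e0, abs_neg, abs_of_pos h3]⟩
          · have := h.full y (by omega) h4 (by omega)
            rwa [abs_of_pos h3] at this)
        rwa [if_neg (by omega), add_zero] at this

end Chn

namespace Chn
variable {p k : ℕ} {C C' D : ℕ → ℤ} {v c : ℤ}

/-- A moved row only loses an initial piece of its arc, provided that its target is not in that
piece. -/
theorem pass_back (h : Chn p C C' v c) {i : ℕ} (hi : i < p)
    (ho : C' i ≠ C i → ¬ (C i ≤ D i ∧ D i < C' i)) {x : ℤ} (hp : pass (C' i) x (D i)) :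
    pass (C i) x (D i) ∧ ¬ (C i ≤ x ∧ x < C' i) := by
  by_cases hch : C' i = C i
  · rw [hch] at hp ⊢; exact ⟨hp, by omega⟩
  · have h1 := ho hch
    have h2 := (h.step i hi hch).2.1
    refine ⟨pass_of_pass hp h2.le h1, fun h3 => ?_⟩
    unfold pass at hp; omega

/-- A level which is full in the first rows up to `e` bounds the entries moved into row `e`. -/
theorem abs_gt_of_full (h : Chn p C C' v c) {e : ℕ} {b : ℤ} (he : e < p)
    (full : ∀ x, 0 < x → x ≤ b → ∃ j ≤ e, |C j| = x) (hch : C' e ≠ C e) : b < |C' e| := by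
  by_contra hle
  rcases h.up e he hch with h1 | ⟨j', h1, h2, h3, h4⟩
  · obtain ⟨s, hs, e'⟩ := full |v| (abs_pos.2 h.v0) (by rw [← abs_neg, ← h1]; omega)
    exact h.vC s (by omega) e'
  · obtain ⟨s, hs, e'⟩ := full |C j'| (abs_pos.2 (h.inj.ne_zero j' h2)) (by rw [h4]; omega)
    have := h.inj.inj s (by omega) j' h2 e'
    omega

/-- Sufficiency across the fourth phase. The parity is needed only if `|v|` is the one level up to
`c` that `C` may lack: then both signs of `v` are candidates for the value of row `p`, and the
parity says which of them leads to `D`. -/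
theorem cond (h : Chn p C C' v c) (hD : AbsInj D k) (hpk : p < k) (hDp : D p = c)
    (H : CondLt p k C D)
    (hpar : 0 < c → |v| < c → (∀ x, 0 < x → x ≤ c → x = |v| ∨ ∃ r < p, |C r| = x) →
      Odd (ng C p c + ng D p c + if 0 < v then 1 else 0)) : Cond p k C' D := by
  have hDp' : AbsInj D p := hD.mono hpk.le
  have hDc : ∀ r < k, r ≠ p → D r ≠ c ∧ D r ≠ -c := fun r hr hrp => hDp ▸ abs_ne_of hD hpk hr hrp
  have hlt := h.lt
  obtain ⟨j0, hj0, e0⟩ := h.bot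
  have ho : ∀ i < p, C' i ≠ C i → ¬ (C i ≤ D i ∧ D i < C' i) := fun i hi hch =>
    h.no_overshoot (hD.mono hpk) hDp H hpar hi hch
  have adjc : ∀ r < p, pass (C r) c (D r) → Blk C D r c ∧ Odd (ng C (r + 1) c + ng D r c) :=
    fun r hr hp => by
      have := H.adj r p hr hr le_rfl (by rwa [hDp])
      rwa [hDp] at this
  have hbc : ∀ b i l, 0 < b → i < p → l < k → l ≠ p → D l = b →
      (∀ x, 0 < x → x < b → ∃ j < i, |D j| = x) → b < |c| := by
    intro b i l hb hi hl hlp e hfull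
    by_contra hbc
    rcases lt_or_eq_of_le (not_lt.1 hbc) with h2 | h2
    · obtain ⟨s, hs, e⟩ := hfull |c| (abs_pos.2 h.c0) h2
      have := hDc s (by omega) (by omega)
      rcases abs_eq_abs.1 e with h3 | h3 <;> omega
    · have := hDc l hl hlp
      rcases abs_cases c with h3 | h3 <;> omega
  -- the new column does not pass `c`
  have hc : ∀ i < p, ¬ pass (C' i) c (D i) := by
    intro i hi hp
    obtain ⟨hp', hn⟩ := h.pass_back hi (ho i hi) hp
    obtain ⟨B, -⟩ := adjc i hi hp'
    have hCi := abs_le.1 B.le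
    have hvc : c < |v| := by
      by_contra h1
      obtain ⟨s, hs, e⟩ := B.full |v| (abs_pos.2 h.v0) (by omega)
      exact h.vC s (by omega) e
    have hv : v < -c := by rcases abs_cases v with h1 | h1 <;> omega
    have hchi : C' i ≠ C i := by
      intro hni
      have key : ∀ d j, p - j = d → j < i → C' j ≠ C j → False := by
        intro d
        induction d using Nat.strong_induction_on with
        | _ d ih =>
        intro j hd hj hch
        have h1 := h.step j (by omega) hch
        have h2 := h.gap j i hj hi hch
        rcases h.up j (by omega) hch with h3 | ⟨j', h3, h4, h5, h6⟩
        · omega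
        · have h7 := B.le_of h.inj hi h4 (by rw [abs_le]; omega)
          rcases lt_or_eq_of_le h7 with h8 | rfl
          · exact ih (p - j') (by omega) j' rfl h8 h5
          · exact h5 hni
      have hj0i : j0 ≤ i := B.le_of h.inj hi hj0 (by rw [e0, abs_neg, abs_of_pos B.pos])
      have hch0 : C' j0 ≠ C j0 := fun e => h.cC j0 hj0 (by rw [e, e0, abs_neg])
      rcases lt_or_eq_of_le hj0i with h1 | rfl
      · exact key _ j0 rfl h1 hch0
      · exact hch0 hni
    have h2 := h.abs_gt_of_full hi B.full hchi
    have h3 := h.step i hi hchi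
    rcases abs_cases (C' i) with h4 | h4 <;> omega
  have adj : ∀ i l, i < l → l < p → pass (C' i) (D l) (D i) →
      Blk C' D i (D l) ∧ Odd (ng C' (i + 1) (D l) + ng D i (D l)) := by
    intro i l hil hl hp
    obtain ⟨hp', hn⟩ := h.pass_back (by omega) (ho i (by omega)) hp
    obtain ⟨B, hodd⟩ := H.adj i l hil (by omega) hl.le hp'
    have hCi := abs_le.1 B.le
    have hch : C' i = C i := by
      by_contra hch
      have h2 := h.abs_gt_of_full (by omega) B.full hch
      have h3 := h.step i (by omega) hch
      have := B.ne
      rcases abs_cases (C' i) with h4 | h4 <;> omega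
    have hb := hbc _ i l B.pos (by omega) (by omega) hl.ne rfl B.full'
    obtain ⟨B', e⟩ := B.transfer (g := C') (fun j hj h1 => h.outside (by omega) hch B.full B.le hb j hj h1)
    exact ⟨B', e ▸ hodd⟩
  refine ⟨adj, fun i l hi hl hlk hp => ?_, fun i hi _ B => ?_⟩
  · rcases eq_or_lt_of_le hl with rfl | hl
    · exact hc i hi (hDp ▸ hp)
    · exact H.out i l hi hl hlk (h.pass_back hi (ho i hi) hp).1
  have hb0 := B.pos
  set b := D i with hbdef
  have hb : b < |c| := by
    by_contra hbc
    obtain ⟨s, hs, e⟩ := B.full |c| (abs_pos.2 h.c0) (by omega)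
    exact h.cC s (by omega) e
  -- If all moved entries in question lie beyond `b`, blocking means the same for `C` and `C'`.
  -- Otherwise a moved row `j` lies within level `b`, which forces `b < c` and makes all levels
  -- below `c` full.
  by_cases hall : ∀ j ≤ i, C' j ≠ C j → b < |C' j|
  · obtain ⟨B', e⟩ := B.transfer (g := C) (fun j hj hch => by
      refine ⟨hall j hj hch.symm, ?_⟩
      rcases h.down j (by omega) hch.symm with h3 | ⟨j', h3, h4, h5⟩
      · rw [h3, abs_neg]; exact hb
      · rw [← h5]; exact hall j' (by omega) h4)
    rw [← e]; exact H.blk i hi B'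
  push Not at hall
  obtain ⟨j, hj, hch, hjb⟩ := hall
  rw [abs_le] at hjb
  have hsj := h.step j (by omega) hch
  have hbc' : b < c := by rcases abs_cases c with h3 | h3 <;> omega
  have hfull : ∀ x, 0 < x → x ≤ c - 1 → ∃ j < p, |C' j| = x := by
    intro x h5 h6
    rcases le_or_gt x b with h7 | h7
    · obtain ⟨s, hs, e⟩ := B.full x h5 h7; exact ⟨s, by omega, e⟩
    · have := h.full_mid (y := x) (by omega) (by omega) (by omega)
        (by rw [abs_of_pos h5, abs_of_pos (show 0 < c by omega)]; omega)
      rwa [abs_of_pos h5] at this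
  have hCfull : ∀ x, 0 < x → x ≤ c → x = |v| ∨ ∃ r < p, |C r| = x := by
    intro x h1 h2
    rcases eq_or_lt_of_le h2 with rfl | h2
    · exact Or.inr ⟨j0, hj0, by rw [e0, abs_neg, abs_of_pos h1]⟩
    · obtain ⟨s, hs, e⟩ := hfull x h1 (by omega)
      by_cases hsv : C' s = -v
      · left; rw [← e, hsv, abs_neg]
      · obtain ⟨r, hr, e'⟩ := h.val_mem' hsv ⟨s, hs, rfl⟩
        exact Or.inr ⟨r, hr, by rw [e', e]⟩
  have hng := h.ng_eq (show 0 < c by omega)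
  -- Below `c` the total is even: by `hpar` if `|v| < c`, and otherwise because some row of `C` has
  -- to pass `c` and is blocked there.
  have htot : Even (ng C' p c + ng D p c) := by
    rcases lt_or_gt_of_ne h.abs_vc with h1 | h1
    · rw [abs_of_pos (show 0 < c by omega)] at h1
      have := hpar (by omega) h1 hCfull
      rw [Nat.odd_iff] at this; rw [Nat.even_iff]; omega
    · rw [abs_of_pos (show 0 < c by omega)] at h1
      have hv : v < 0 := by rcases abs_cases v with h2 | h2 <;> omega
      have hCf : ∀ x, 0 < x → x ≤ c → ∃ r < p, |C r| = x := fun x h2 h3 => by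
        rcases hCfull x h2 h3 with h4 | h4
        · omega
        · exact h4
      obtain ⟨e, he, hpe⟩ : ∃ e < p, pass (C e) c (D e) := by
        by_contra hno
        push Not at hno
        obtain ⟨s, hs, es⟩ := (closed_of_not_pass h.inj hDp' hCf (fun r hr _ => hno r hr)).2.2 c
          (by omega) le_rfl
        have := hDc s (by omega) (by omega)
        rcases abs_cases (D s) with h4 | h4 <;> omega
      obtain ⟨Be, hodd⟩ := adjc e he hpe
      have e1 : ng C (e + 1) c = ng C p c := cnt_congr fun r =>
        ⟨fun h3 => ⟨by omega, h3.2⟩, fun h3 => ⟨by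
          have := Be.le_of h.inj he h3.1 (by rw [abs_le]; omega)
          omega, h3.2⟩⟩
      have e2 : ng D e c = ng D p c := cnt_congr fun r =>
        ⟨fun h3 => ⟨by omega, h3.2⟩, fun h3 => ⟨Be.lt_of hDp' he h3.1 (by
          have := (hDc r (by omega) (by omega)).2; rw [abs_lt]; omega), h3.2⟩⟩
      rw [if_neg (by omega)] at hng
      rw [e1, e2, Nat.odd_iff] at hodd
      rw [Nat.even_iff]; omega
  have hcl := closed_of_not_pass h.inj' hDp' hfull (fun r hr h1 h2 => by
    have h3 := hc r hr
    have h4 := hDc r (by omega) (by omega)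
    rw [abs_le] at h1
    unfold pass at h2 h3; omega)
  obtain ⟨e1, e2⟩ := B.ng_eq h.inj' hDp' hi hi le_rfl rfl
  rw [e1, e2]
  by_contra hodd
  -- With the wrong parity within level `b`, the counts between `b` and `c` would differ, so some
  -- row leaves `[-c, -b)`. It lies below row `i`, hence below row `j`, against `gap`.
  have hex : ∃ l < p, -c ≤ C' l ∧ C' l < -b ∧ ¬ D l < -b := by
    by_contra hno
    push Not at hno
    have hcnt : cnt C' p (-c) (-b) = cnt D p (-c) (-b) := by
      refine cnt_congr fun r => ⟨fun ⟨h1, h2, h3⟩ => ?_, fun ⟨h1, h2, h3⟩ => ?_⟩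
      · have h4 := h.cC r h1
        have h5 : |C' r| ≤ c - 1 := by
          rcases abs_cases (C' r) with h6 | h6 <;> rcases abs_cases c with h7 | h7 <;> omega
        have := hcl.2.1 r h1 h5
        exact ⟨h1, by omega, hno r h1 h2 h3⟩
      · have h4 := (hDc r (by omega) (by omega)).2
        have h5 := (hcl.1 r h1).2 (by rw [abs_le]; omega)
        have := hcl.2.1 r h1 h5
        rw [abs_le] at h5
        exact ⟨h1, by omega, by omega⟩
    rw [ng_split C' p (y := b) (N := c) (by omega) (by omega),
      ng_split D p (y := b) (N := c) (by omega) (by omega), hcnt, Nat.even_iff] at htot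
    rw [Nat.even_iff] at hodd
    omega
  obtain ⟨l, hl, h1, h2, h3⟩ := hex
  have hB := B.le
  have hli : l ≠ i := by rintro rfl; rw [abs_le] at hB; omega
  have huniq : ∀ r < i, ¬ pass (C' r) b (D r) := fun r hr h4 => by
    have := (adj r i hr hi h4).1.le_of h.inj' (by omega) hi B.le
    omega
  have h4 := (B.closed h.inj' hDp' hi hi le_rfl rfl (fun r hr _ => huniq r hr) l hl hli).1
  have h5 : ¬ |C' l| ≤ b := by rw [abs_le]; omega
  have h6 : ¬ |D l| < b := fun h6 => h5 (h4.2 h6)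
  have h7 : D l ≠ b ∧ D l ≠ -b := by
    constructor <;> intro e <;> refine hli (hDp'.inj l hl i hi ?_) <;> rw [e] <;> simp [hbdef]
  have h8 : i < l := by
    by_contra h8
    refine huniq l (by omega) ?_
    rw [abs_lt] at h6
    unfold pass; omega
  have h9 := h.gap j l (by omega) hl hch
  by_cases h10 : C' l = C l
  · omega
  · have := h.step l hl h10; omega

end Chn

/-- The conditions when the entry of row `p` is not moved into the rows above. -/
theorem Cond.condLt {p k : ℕ} {C D : ℕ → ℤ} (H : Cond p k C D) (hpk : p < k) : CondLt p k C D :=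
  ⟨fun i l hil hi hl hp => by
    rcases eq_or_lt_of_le hl with rfl | hl
    · exact absurd hp (H.out i l hi le_rfl hpk)
    · exact H.adj i l hil hl hp,
   fun i l hi hl hlk => H.out i l hi hl.le hlk,
   fun i hi => H.blk i hi (by omega)⟩

/-- A row passing `D p` would be blocked by it, and then level `D p` would have to occur among the
rows above. -/
theorem CondLt.cond {p k : ℕ} {C D : ℕ → ℤ} (H : CondLt p k C D) (hC : AbsInj C p)
    (hc : ∀ x < p, |C x| ≠ |D p|) : Cond p k C D :=
  ⟨fun i l hil hl hp => H.adj i l hil (by omega) hl.le hp, fun i l hi hl hlk hp => by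
    rcases eq_or_lt_of_le hl with rfl | hl
    · have B := (H.adj i p hi hi le_rfl hp).1
      obtain ⟨s, hs, e⟩ := B.full (D p) B.pos le_rfl
      exact hc s (by omega) (by rw [e, abs_of_pos B.pos])
    · exact H.out i l hi hl hlk hp,
   fun i hi _ => H.blk i hi⟩

theorem Cond.succ {p k : ℕ} {C D : ℕ → ℤ} (H : CondLt p k C D) (hpk : p < k)
    (hp : ∀ l, p < l → l < k → ¬ pass (C p) (D l) (D p))
    (hb : p + 1 < k → Blk C D p (D p) → Even (ng C (p + 1) (D p) + ng D p (D p))) :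
    Cond (p + 1) k C D :=
  ⟨fun i l hil hl hpa => H.adj i l hil (by omega) (by omega) hpa,
   fun i l hi hl hlk => by
    rcases Nat.lt_succ_iff_lt_or_eq.1 hi with hi | rfl
    · exact H.out i l hi hl hlk
    · exact hp l hl hlk,
   fun i hi h1 => by
    rcases Nat.lt_succ_iff_lt_or_eq.1 hi with hi | rfl
    · exact H.blk i hi
    · exact hb h1⟩

theorem Cond.pred {p k : ℕ} {C D : ℕ → ℤ} (H : Cond (p + 1) k C D) (hpk : p < k) : CondLt p k C D :=
  ⟨fun i l hil hi hl => H.adj i l hil (by omega), fun i l hi hl hlk => H.out i l (by omega) hl hlk,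
   fun i hi => H.blk i (by omega) (by omega)⟩

/-! ### Walks -/

/-- `Walk n L g s g'`: applying to `g` those operations of `L` which are selected by the mask `s`
gives `g'`, and each of them is an edge of the quantum Bruhat graph. -/
inductive Walk (n : ℕ) : List Op → (ℕ → ℤ) → List Bool → (ℕ → ℤ) → Prop
  | nil (g : ℕ → ℤ) : Walk n [] g [] g
  | skip {o : Op} {L : List Op} {g : ℕ → ℤ} {s : List Bool} {g' : ℕ → ℤ} (h : Walk n L g s g') :
      Walk n (o :: L) g (false :: s) g'
  | take {o : Op} {L : List Op} {g : ℕ → ℤ} {s : List Bool} {g' : ℕ → ℤ} (ok : o.ok n g)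
      (h : Walk n L (o.act g) s g') : Walk n (o :: L) g (true :: s) g'

namespace Walk
variable {n : ℕ} {L L' : List Op} {g g' g'' : ℕ → ℤ} {s s' : List Bool}

theorem append (h : Walk n L g s g') (h' : Walk n L' g' s' g'') : Walk n (L ++ L') g (s ++ s') g'' := by
  induction h with
  | nil g => exact h'
  | skip h ih => exact .skip (ih h')
  | take ok h ih => exact .take ok (ih h')

theorem split (h : Walk n (L ++ L') g s g'') :
    ∃ s1 s2 g', s = s1 ++ s2 ∧ Walk n L g s1 g' ∧ Walk n L' g' s2 g'' := by
  induction L generalizing g s with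
  | nil => exact ⟨[], s, g, rfl, .nil g, h⟩
  | cons o L ih =>
    cases h with
    | skip h =>
      obtain ⟨s1, s2, g', rfl, h1, h2⟩ := ih h
      exact ⟨_, s2, g', rfl, .skip h1, h2⟩
    | take ok h =>
      obtain ⟨s1, s2, g', rfl, h1, h2⟩ := ih h
      exact ⟨_, s2, g', rfl, .take ok h1, h2⟩

theorem length (h : Walk n L g s g') : s.length = L.length := by
  induction h <;> simp_all

theorem det (h : Walk n L g s g') (h' : Walk n L g s g'') : g' = g'' := by
  induction h with
  | nil g => cases h'; rfl
  | skip h ih => cases h' with | skip h' => exact ih h'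
  | take ok h ih => cases h' with | take ok' h' => exact ih h'

theorem skip_all (L : List Op) (g : ℕ → ℤ) : Walk n L g (List.replicate L.length false) g := by
  induction L with
  | nil => exact .nil g
  | cons o L ih => exact .skip ih

end Walk

/-- An operation only involves positions smaller than `n`. -/
def Op.Valid (n : ℕ) : Op → Prop
  | .dif i j => i < n ∧ j < n
  | .sum i j => i < n ∧ j < n
  | .sgn i => i < n

theorem Op.Valid.isSgn {n : ℕ} {o : Op} (ho : o.Valid n) {g : ℕ → ℤ} (hg : IsSgn n g) :
    IsSgn n (o.act g) := by
  cases o with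
  | dif i j => exact hg.act_dif ho.1 ho.2
  | sum i j => exact hg.act_sum ho.1 ho.2
  | sgn i => exact hg.act_sgn ho

theorem Walk.isSgn {n : ℕ} {L : List Op} {g g' : ℕ → ℤ} {s : List Bool} (h : Walk n L g s g')
    (hL : ∀ o ∈ L, o.Valid n) (hg : IsSgn n g) : IsSgn n g' := by
  induction h with
  | nil g => exact hg
  | skip h ih => exact ih (fun o ho => hL o (List.mem_cons_of_mem _ ho)) hg
  | take ok h ih =>
    exact ih (fun o ho => hL o (List.mem_cons_of_mem _ ho)) ((hL _ List.mem_cons_self).isSgn hg)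

theorem IsSgn.surj {n : ℕ} {g : ℕ → ℤ} (hg : IsSgn n g) {y : ℤ} (h1 : 0 < y) (h2 : y ≤ n) :
    ∃ x < n, |g x| = y := by
  have hsub : (range n).image (fun x => |g x|) ⊆ Icc (1 : ℤ) n := by
    intro z hz
    obtain ⟨x, hx, rfl⟩ := mem_image.1 hz
    rw [mem_range] at hx
    exact mem_Icc.2 ⟨abs_pos.2 (hg.ne_zero x hx), hg.abs_le x hx⟩
  have hcard : #((range n).image (fun x => |g x|)) = n := by
    rw [card_image_of_injOn, card_range]
    intro x hx y hy e
    exact hg.inj x (mem_range.1 hx) y (mem_range.1 hy) e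
  have := eq_of_subset_of_card_le hsub (by rw [hcard, Int.card_Icc]; omega)
  have hy : y ∈ (range n).image (fun x => |g x|) := by rw [this, mem_Icc]; omega
  obtain ⟨x, hx, e⟩ := mem_image.1 hy
  exact ⟨x, mem_range.1 hx, e⟩

theorem IsSgn.absInj {n m : ℕ} {g : ℕ → ℤ} (hg : IsSgn n g) (hm : m ≤ n) : AbsInj g m :=
  ⟨fun i hi => hg.ne_zero i (by omega), fun i hi j hj => hg.inj i (by omega) j (by omega)⟩

/-- The operations `ε_p - ε_j, …, ε_p - ε_(j + m - 1)`. -/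
def difOps (p : ℕ) : ℕ → ℕ → List Op
  | _, 0 => []
  | j, m + 1 => .dif p j :: difOps p (j + 1) m

/-- The operations `ε_p + ε_(k + m - 1), …, ε_p + ε_k`. -/
def sumOps (p k : ℕ) : ℕ → List Op
  | 0 => []
  | m + 1 => .sum p (k + m) :: sumOps p k m

theorem difOps_valid {n p j m : ℕ} (hp : p < n) (h : j + m ≤ n) : ∀ o ∈ difOps p j m, o.Valid n := by
  induction m generalizing j with
  | zero => simp [difOps]
  | succ m ih =>
    intro o ho
    rcases List.mem_cons.1 ho with rfl | ho
    · exact ⟨hp, by omega⟩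
    · exact ih (by omega) o ho

theorem sumOps_valid {n p k m : ℕ} (hp : p < n) (h : k + m ≤ n) : ∀ o ∈ sumOps p k m, o.Valid n := by
  induction m with
  | zero => simp [sumOps]
  | succ m ih =>
    intro o ho
    rcases List.mem_cons.1 ho with rfl | ho
    · exact ⟨hp, by omega⟩
    · exact ih (by omega) o ho

/-- The value `v` can be brought to position `p`. -/
def Reach (n : ℕ) (L : List Op) (p : ℕ) (g : ℕ → ℤ) (v : ℤ) : Prop :=
  ∃ s g', Walk n L g s g' ∧ g' p = v

theorem reach_nil {n p : ℕ} {g : ℕ → ℤ} {v : ℤ} : Reach n [] p g v ↔ g p = v := by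
  constructor
  · rintro ⟨s, g', h, e⟩; cases h; exact e
  · intro e; exact ⟨_, _, .nil g, e⟩

theorem reach_cons {n p : ℕ} {o : Op} {L : List Op} {g : ℕ → ℤ} {v : ℤ} :
    Reach n (o :: L) p g v ↔ Reach n L p g v ∨ (o.ok n g ∧ Reach n L p (o.act g) v) := by
  constructor
  · rintro ⟨s, g', h, e⟩
    cases h with
    | skip h => exact Or.inl ⟨_, _, h, e⟩
    | take ok h => exact Or.inr ⟨ok, _, _, h, e⟩
  · rintro (⟨s, g', h, e⟩ | ⟨ok, s, g', h, e⟩)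
    · exact ⟨_, _, .skip h, e⟩
    · exact ⟨_, _, .take ok h, e⟩

theorem dif_act_self (p j : ℕ) (g : ℕ → ℤ) : (Op.dif p j).act g p = g j := by simp [Op.act]
theorem dif_act_right {p j : ℕ} (h : j ≠ p) (g : ℕ → ℤ) : (Op.dif p j).act g j = g p := by
  simp [Op.act, h]
theorem dif_act_of_ne {p j x : ℕ} (h : x ≠ p) (h' : x ≠ j) (g : ℕ → ℤ) :
    (Op.dif p j).act g x = g x := by simp [Op.act, h, h']
theorem sum_act_self (p j : ℕ) (g : ℕ → ℤ) : (Op.sum p j).act g p = -g j := by simp [Op.act]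
theorem sum_act_right {p j : ℕ} (h : j ≠ p) (g : ℕ → ℤ) : (Op.sum p j).act g j = -g p := by
  simp [Op.act, h]
theorem sum_act_of_ne {p j x : ℕ} (h : x ≠ p) (h' : x ≠ j) (g : ℕ → ℤ) :
    (Op.sum p j).act g x = g x := by simp [Op.act, h, h']

/-! #### The first phase -/

/-- The criterion for reaching `y` with the operations `ε_p - ε_j, …, ε_p - ε_(j + m - 1)`. -/
def DifCond (p j m : ℕ) (g : ℕ → ℤ) (y : ℤ) : Prop :=
  g p = y ∨ (∃ x, j ≤ x ∧ x < j + m ∧ g x = y) ∧ ∀ x, p < x → x < j → ¬ cyc (g p) (g x) y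

/-- The target decides greedily: `ε_p - ε_j` has to be applied iff `g j` is the target or lies on
the arc from `g p` to it. The exclusion in the second half makes the walk unique. -/
theorem difCond_step {n p j m : ℕ} {g : ℕ → ℤ} (hg : IsSgn n g) (hpj : p < j) (hn : j + (m + 1) ≤ n)
    (y : ℤ) : (DifCond p j (m + 1) g y ↔ DifCond p (j + 1) m g y ∨
      ((Op.dif p j).ok n g ∧ DifCond p (j + 1) m ((Op.dif p j).act g) y)) ∧
      ¬ (DifCond p (j + 1) m g y ∧ DifCond p (j + 1) m ((Op.dif p j).act g) y) := by
  have hne : ∀ x z, x < n → z < n → x ≠ z → g x ≠ g z := fun x z h1 h2 h3 => (hg.abs_ne h1 h2 h3).1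
  have hpj' := hne p j (by omega) (by omega) hpj.ne
  have ha := dif_act_self p j g
  have hb := dif_act_right hpj.ne' g
  have hc : ∀ x, x ≠ p → x ≠ j → (Op.dif p j).act g x = g x := fun x h1 h2 => dif_act_of_ne h1 h2 g
  constructor
  · constructor
    · rintro (h | ⟨⟨x0, h1, h2, h3⟩, h4⟩)
      · exact Or.inl (Or.inl h)
      · rcases eq_or_lt_of_le h1 with rfl | h1
        · right
          refine ⟨fun x h5 h6 => ?_, Or.inl (by rw [ha, h3])⟩
          have := h4 x h5 h6
          rwa [← h3] at this
        · by_cases hj : cyc (g p) (g j) y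
          · right
            refine ⟨fun x h5 h6 h7 => h4 x h5 h6 ?_, Or.inr ⟨⟨x0, by omega, by omega, ?_⟩, ?_⟩⟩
            · unfold cyc at *; omega
            · rw [hc x0 (by omega) (by omega), h3]
            · intro x h5 h6
              rw [ha]
              rcases Nat.lt_succ_iff_lt_or_eq.1 h6 with h6 | rfl
              · rw [hc x (by omega) (by omega)]
                have := h4 x h5 h6
                unfold cyc at *; omega
              · rw [hb]; unfold cyc at *; omega
          · left
            refine Or.inr ⟨⟨x0, by omega, by omega, h3⟩, fun x h5 h6 => ?_⟩
            rcases Nat.lt_succ_iff_lt_or_eq.1 h6 with h6 | rfl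
            · exact h4 x h5 h6
            · exact hj
    · rintro ((h | ⟨⟨x0, h1, h2, h3⟩, h4⟩) | ⟨ok, (h | ⟨⟨x0, h1, h2, h3⟩, h4⟩)⟩)
      · exact Or.inl h
      · exact Or.inr ⟨⟨x0, by omega, by omega, h3⟩, fun x h5 h6 => h4 x h5 (by omega)⟩
      · rw [ha] at h
        refine Or.inr ⟨⟨j, le_rfl, by omega, h⟩, fun x h5 h6 => ?_⟩
        rw [← h]; exact ok x h5 h6
      · rw [hc x0 (by omega) (by omega)] at h3
        refine Or.inr ⟨⟨x0, by omega, by omega, h3⟩, fun x h5 h6 => ?_⟩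
        have h7 := h4 x h5 (by omega)
        have h8 := h4 j hpj (by omega)
        have h9 := ok x h5 h6
        rw [ha, hc x (by omega) (by omega)] at h7
        rw [ha, hb] at h8
        have h10 := hne x j (by omega) (by omega) (by omega)
        have h11 := hne x p (by omega) (by omega) (by omega)
        have h12 := hne x0 p (by omega) (by omega) (by omega)
        have h13 := hne x0 j (by omega) (by omega) (by omega)
        unfold cyc at *; omega
  · rintro ⟨h | ⟨⟨x0, h1, h2, h3⟩, h4⟩, h' | ⟨⟨x0', h1', h2', h3'⟩, h4'⟩⟩
    · rw [ha] at h'; omega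
    · rw [hc x0' (by omega) (by omega)] at h3'
      have := hne x0' p (by omega) (by omega) (by omega); omega
    · rw [ha] at h'
      have := hne x0 j (by omega) (by omega) (by omega); omega
    · have h5 := h4 j hpj (by omega)
      have h6 := h4' j hpj (by omega)
      rw [ha, hb] at h6
      have := hne x0 p (by omega) (by omega) (by omega)
      have := hne x0 j (by omega) (by omega) (by omega)
      unfold cyc at *; omega

theorem reach_dif {n p j m : ℕ} {g : ℕ → ℤ} (hg : IsSgn n g) (hpj : p < j) (hn : j + m ≤ n) (y : ℤ) :
    Reach n (difOps p j m) p g y ↔ DifCond p j m g y := by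
  induction m generalizing j g with
  | zero =>
    rw [difOps, reach_nil, DifCond]
    exact ⟨Or.inl, by rintro (h | ⟨⟨x, h1, h2, -⟩, -⟩) <;> [exact h; omega]⟩
  | succ m ih =>
    rw [difOps, reach_cons, ih hg (by omega) (by omega),
      ih (hg.act_dif (by omega) (by omega)) (by omega) (by omega)]
    exact (difCond_step hg hpj hn y).1.symm

theorem dif_unique {n p j m : ℕ} {g g' g'' : ℕ → ℤ} {s s' : List Bool} (hg : IsSgn n g) (hpj : p < j)
    (hn : j + m ≤ n) (h : Walk n (difOps p j m) g s g') (h' : Walk n (difOps p j m) g s' g'')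
    (e : g' p = g'' p) : s = s' := by
  induction m generalizing j g s s' with
  | zero => cases h; cases h'; rfl
  | succ m ih =>
    have hg1 : IsSgn n ((Op.dif p j).act g) := hg.act_dif (by omega) (by omega)
    have hex := (difCond_step hg hpj hn (g' p)).2
    rw [← reach_dif hg (by omega) (by omega), ← reach_dif hg1 (by omega) (by omega)] at hex
    cases h with
    | skip h =>
      cases h' with
      | skip h' => rw [ih hg (by omega) (by omega) h h']
      | take ok h' => exact absurd ⟨⟨_, _, h, rfl⟩, ⟨_, _, h', e.symm⟩⟩ hex
    | take ok h =>
      cases h' with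
      | skip h' => exact absurd ⟨⟨_, _, h', e.symm⟩, ⟨_, _, h, rfl⟩⟩ hex
      | take ok h' => rw [ih hg1 (by omega) (by omega) h h']

theorem dif_frame {n p j m : ℕ} {g g' : ℕ → ℤ} {s : List Bool} (h : Walk n (difOps p j m) g s g')
    (hpj : p < j) : (∀ x, x ≠ p → (x < j ∨ j + m ≤ x) → g' x = g x) ∧
    ∀ z : ℤ, (∃ x, (x = p ∨ j ≤ x ∧ x < j + m) ∧ g' x = z) ↔
      (∃ x, (x = p ∨ j ≤ x ∧ x < j + m) ∧ g x = z) := by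
  induction m generalizing j g s with
  | zero => cases h; exact ⟨fun _ _ _ => rfl, fun _ => Iff.rfl⟩
  | succ m ih =>
    cases h with
    | skip h =>
      obtain ⟨h1, h2⟩ := ih h (by omega)
      have hj := h1 j (by omega) (by omega)
      refine ⟨fun x hx hx' => h1 x hx (by omega), fun z => ⟨?_, ?_⟩⟩
      · rintro ⟨x, hx, e⟩
        by_cases hxj : x = j
        · subst hxj; exact ⟨x, hx, by rw [← hj, e]⟩
        · obtain ⟨x', hx', e'⟩ := (h2 z).1 ⟨x, by omega, e⟩
          exact ⟨x', by omega, e'⟩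
      · rintro ⟨x, hx, e⟩
        by_cases hxj : x = j
        · subst hxj; exact ⟨x, hx, by rw [hj, e]⟩
        · obtain ⟨x', hx', e'⟩ := (h2 z).2 ⟨x, by omega, e⟩
          exact ⟨x', by omega, e'⟩
    | take ok h =>
      obtain ⟨h1, h2⟩ := ih h (by omega)
      have hj := h1 j (by omega) (by omega)
      have ha := dif_act_self p j g
      have hb := dif_act_right hpj.ne' g
      have hc : ∀ x, x ≠ p → x ≠ j → (Op.dif p j).act g x = g x := fun x h1 h2 => dif_act_of_ne h1 h2 g
      refine ⟨fun x hx hx' => by rw [h1 x hx (by omega), hc x hx (by omega)], fun z => ⟨?_, ?_⟩⟩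
      · rintro ⟨x, hx, e⟩
        by_cases hxj : x = j
        · subst hxj; exact ⟨p, by omega, by rw [← e, hj, hb]⟩
        · obtain ⟨x', hx', e'⟩ := (h2 z).1 ⟨x, by omega, e⟩
          by_cases hxp : x' = p
          · subst hxp; exact ⟨j, by omega, by rw [← e', ha]⟩
          · exact ⟨x', by omega, by rw [← e', hc x' hxp (by omega)]⟩
      · rintro ⟨x, hx, e⟩
        by_cases hxp : x = p
        · subst hxp; exact ⟨j, by omega, by rw [hj, hb, e]⟩
        · obtain ⟨x', hx', e'⟩ := (h2 z).2 (by
            by_cases hxj : x = j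
            · subst hxj; exact ⟨p, by omega, by rw [ha, e]⟩
            · exact ⟨x, by omega, by rw [hc x hxp hxj, e]⟩)
          exact ⟨x', by omega, e'⟩

/-! #### The third phase -/

/-- The criterion for reaching `v` with the operations `ε_p + ε_(k + m - 1), …, ε_p + ε_k`, where
`p < k`. -/
def SumCond (n p k m : ℕ) (g : ℕ → ℤ) (v : ℤ) : Prop :=
  g p = v ∨ g p < v ∧ ∃ x0, k ≤ x0 ∧ x0 < k + m ∧ g x0 = -v ∧
    (∀ x, p < x → x < k + m → x ≠ x0 → ¬ (g p < g x ∧ g x < v)) ∧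
    ∀ x, k + m ≤ x → x < n → ¬ (g p < g x ∧ g x < v) ∧ ¬ (g p < -g x ∧ -g x < v)

/-- Again the target decides: the reflection with position `k + m` is needed iff that position
supplies `v`, or its negated entry lies strictly between `g p` and `v`. -/
theorem sumCond_step {n p k m : ℕ} {g : ℕ → ℤ} (hg : IsSgn n g) (hpk : p < k) (hn : k + (m + 1) ≤ n)
    (v : ℤ) : (SumCond n p k (m + 1) g v ↔ SumCond n p k m g v ∨
      ((Op.sum p (k + m)).ok n g ∧ SumCond n p k m ((Op.sum p (k + m)).act g) v)) ∧
      ¬ (SumCond n p k m g v ∧ (Op.sum p (k + m)).ok n g ∧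
        SumCond n p k m ((Op.sum p (k + m)).act g) v) := by
  have hne : ∀ x z, x < n → z < n → x ≠ z → g x ≠ g z ∧ g x ≠ -g z :=
    fun x z h1 h2 h3 => hg.abs_ne h1 h2 h3
  have hpj := hne p (k + m) (by omega) (by omega) (by omega)
  have ha := sum_act_self p (k + m) g
  have hb := sum_act_right (p := p) (j := k + m) (by omega) g
  have hc : ∀ x, x ≠ p → x ≠ k + m → (Op.sum p (k + m)).act g x = g x :=
    fun x h1 h2 => sum_act_of_ne h1 h2 g
  rw [ok_sum_of_lt (show p < k + m by omega)]
  constructor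
  · constructor
    · rintro (h | ⟨hlt, x0, h1, h2, h3, h4, h5⟩)
      · exact Or.inl (Or.inl h)
      · by_cases hx0 : x0 = k + m
        · subst hx0
          right
          refine ⟨⟨by omega, fun x h6 h7 => ?_, fun x h6 h7 => ?_⟩, Or.inl (by rw [ha]; omega)⟩
          · have := h4 x h6 (by omega) (by omega); omega
          · have := h5 x (by omega) h7; omega
        · have h6 := h4 (k + m) (by omega) (by omega) (Ne.symm hx0)
          by_cases hj : g p < -g (k + m) ∧ -g (k + m) < v
          · right
            refine ⟨⟨hj.1, fun x h7 h8 => ?_, fun x h7 h8 => ?_⟩,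
              Or.inr ⟨by rw [ha]; exact hj.2, x0, h1, by omega, by
                rw [hc x0 (by omega) hx0]; exact h3, fun x h7 h8 h9 => ?_, fun x h7 h8 => ?_⟩⟩
            · by_cases hx : x = x0
              · subst hx; omega
              · have := h4 x h7 (by omega) hx; omega
            · have := h5 x (by omega) h8; omega
            · have := h4 x h7 (by omega) h9
              rw [ha, hc x (by omega) (by omega)]; omega
            · rw [ha]
              by_cases hx : x = k + m
              · subst hx; rw [hb]; omega
              · rw [hc x (by omega) hx]
                have := h5 x (by omega) h8; omega
          · left
            refine Or.inr ⟨hlt, x0, h1, by omega, h3, fun x h7 h8 h9 => h4 x h7 (by omega) h9,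
              fun x h7 h8 => ?_⟩
            by_cases hx : x = k + m
            · subst hx; omega
            · exact h5 x (by omega) h8
    · rintro ((h | ⟨hlt, x0, h1, h2, h3, h4, h5⟩) | ⟨⟨ok1, ok2, ok3⟩, (h | ⟨hlt, x0, h1, h2, h3, h4, h5⟩)⟩)
      · exact Or.inl h
      · refine Or.inr ⟨hlt, x0, h1, by omega, h3, fun x h6 h7 h8 => ?_,
          fun x h6 h7 => h5 x (by omega) h7⟩
        by_cases hx : x = k + m
        · subst hx; exact (h5 _ le_rfl (by omega)).1
        · exact h4 x h6 (by omega) h8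
      · rw [ha] at h
        refine Or.inr ⟨by omega, k + m, by omega, by omega, by omega, fun x h6 h7 h8 => ?_,
          fun x h6 h7 => ?_⟩
        · have := ok2 x h6 (by omega); omega
        · have := ok3 x (by omega) h7; omega
      · rw [ha] at hlt h4 h5
        rw [hc x0 (by omega) (by omega)] at h3
        refine Or.inr ⟨by omega, x0, h1, by omega, h3, fun x h6 h7 h8 => ?_, fun x h6 h7 => ?_⟩
        · by_cases hx : x = k + m
          · subst hx
            have h9 := (h5 (k + m) le_rfl (by omega)).1
            rw [hb] at h9
            have h10 := hne p x0 (by omega) (by omega) (by omega)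
            have h11 := ok2 x0 (by omega) (by omega)
            omega
          · have h9 := h4 x h6 (by omega) h8
            rw [hc x (by omega) hx] at h9
            have h10 := ok2 x h6 (by omega)
            have h11 := hne x (k + m) (by omega) (by omega) hx
            omega
        · have h9 := h5 x (by omega) h7
          rw [hc x (by omega) (by omega)] at h9
          have h10 := ok3 x (by omega) h7
          have h11 := hne x (k + m) (by omega) (by omega) (by omega)
          omega
  · rintro ⟨h | ⟨hlt, x0, h1, h2, h3, h4, h5⟩, ⟨ok1, ok2, ok3⟩, h' | ⟨hlt', x0', h1', h2', h3', h4', h5'⟩⟩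
    · rw [ha] at h'; omega
    · rw [ha] at hlt'; omega
    · rw [ha] at h'
      have := hne x0 (k + m) (by omega) (by omega) (by omega); omega
    · rw [ha] at hlt'
      have := h5 (k + m) le_rfl (by omega); omega

theorem reach_sum {n p k m : ℕ} {g : ℕ → ℤ} (hg : IsSgn n g) (hpk : p < k) (hn : k + m ≤ n) (v : ℤ) :
    Reach n (sumOps p k m) p g v ↔ SumCond n p k m g v := by
  induction m generalizing g with
  | zero =>
    rw [sumOps, reach_nil, SumCond]
    exact ⟨Or.inl, by rintro (h | ⟨-, x, h1, h2, -⟩) <;> [exact h; omega]⟩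
  | succ m ih =>
    rw [sumOps, reach_cons, ih hg (by omega), ih (hg.act_sum (by omega) (by omega)) (by omega)]
    exact (sumCond_step hg hpk hn v).1.symm

theorem sum_unique {n p k m : ℕ} {g g' g'' : ℕ → ℤ} {s s' : List Bool} (hg : IsSgn n g) (hpk : p < k)
    (hn : k + m ≤ n) (h : Walk n (sumOps p k m) g s g') (h' : Walk n (sumOps p k m) g s' g'')
    (e : g' p = g'' p) : s = s' := by
  induction m generalizing g s s' with
  | zero => cases h; cases h'; rfl
  | succ m ih =>
    have hg1 : IsSgn n ((Op.sum p (k + m)).act g) := hg.act_sum (by omega) (by omega)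
    have hex := (sumCond_step hg hpk hn (g' p)).2
    rw [← reach_sum hg hpk (by omega), ← reach_sum hg1 hpk (by omega)] at hex
    cases h with
    | skip h =>
      cases h' with
      | skip h' => rw [ih hg (by omega) h h']
      | take ok h' => exact absurd ⟨⟨_, _, h, rfl⟩, ok, ⟨_, _, h', e.symm⟩⟩ hex
    | take ok h =>
      cases h' with
      | skip h' => exact absurd ⟨⟨_, _, h', e.symm⟩, ok, ⟨_, _, h, rfl⟩⟩ hex
      | take ok h' => rw [ih hg1 (by omega) h h']

theorem sum_frame {n p k m : ℕ} {g g' : ℕ → ℤ} {s : List Bool} (h : Walk n (sumOps p k m) g s g') :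
    ∀ x, x ≠ p → (x < k ∨ k + m ≤ x) → g' x = g x := by
  induction m generalizing g s with
  | zero => cases h; exact fun _ _ _ => rfl
  | succ m ih =>
    intro x hx hx'
    cases h with
    | skip h => exact ih h x hx (by omega)
    | take ok h => rw [ih h x hx (by omega), sum_act_of_ne hx (by omega)]

/-! #### The fourth phase -/

/-- The criterion for reaching `v` with the operations `ε_p + ε_(m - 1), …, ε_p + ε_0`, where
`m ≤ p`. -/
def TopCond (n p m : ℕ) (g : ℕ → ℤ) (v : ℤ) : Prop :=
  g p = v ∨ g p < v ∧ ∃ x0 < m, g x0 = -v ∧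
    (∀ x, m ≤ x → x < p → ¬ (g p < -g x ∧ -g x < v)) ∧
    ∀ x, p < x → x < n → ¬ (g p < g x ∧ g x < v) ∧ ¬ (g p < -g x ∧ -g x < v)

theorem ok_sum_of_gt {n i j : ℕ} (hij : j < i) (g : ℕ → ℤ) : (Op.sum i j).ok n g ↔ g j < -g i ∧
    (∀ x, j < x → x < i → ¬ (g j < g x ∧ g x < -g i)) ∧
    (∀ x, i < x → x < n → ¬ (g j < g x ∧ g x < -g i) ∧ ¬ (g j < -g x ∧ -g x < -g i)) := by
  rw [Op.ok_sum_comm, ok_sum_of_lt hij]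

/-- As for the third phase, but now the partner is above row `p`: the entries between the two
positions are constrained up to negation by earlier choices, while those after `p` are constrained
with both signs. -/
theorem topCond_step {n p m : ℕ} {g : ℕ → ℤ} (hg : IsSgn n g) (hm : m + 1 ≤ p) (hn : p < n)
    (v : ℤ) : (TopCond n p (m + 1) g v ↔ TopCond n p m g v ∨
      ((Op.sum p m).ok n g ∧ TopCond n p m ((Op.sum p m).act g) v)) ∧
      ¬ (TopCond n p m g v ∧ (Op.sum p m).ok n g ∧ TopCond n p m ((Op.sum p m).act g) v) := by
  have hne : ∀ x z, x < n → z < n → x ≠ z → g x ≠ g z ∧ g x ≠ -g z :=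
    fun x z h1 h2 h3 => hg.abs_ne h1 h2 h3
  have hpj := hne p m (by omega) (by omega) (by omega)
  have ha := sum_act_self p m g
  have hb := sum_act_right (p := p) (j := m) (by omega) g
  have hc : ∀ x, x ≠ p → x ≠ m → (Op.sum p m).act g x = g x :=
    fun x h1 h2 => sum_act_of_ne h1 h2 g
  rw [ok_sum_of_gt (show m < p by omega)]
  constructor
  · constructor
    · rintro (h | ⟨hlt, x0, h2, h3, h4, h5⟩)
      · exact Or.inl (Or.inl h)
      · by_cases hx0 : x0 = m
        · subst hx0
          right
          refine ⟨⟨by omega, fun x h6 h7 => ?_, fun x h6 h7 => ?_⟩, Or.inl (by rw [ha]; omega)⟩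
          · have := h4 x (by omega) h7; omega
          · have := h5 x (by omega) h7; omega
        · by_cases hj : g p < -g m ∧ -g m < v
          · right
            refine ⟨⟨by omega, fun x h7 h8 => ?_, fun x h7 h8 => ?_⟩,
              Or.inr ⟨by rw [ha]; exact hj.2, x0, by omega, by
                rw [hc x0 (by omega) hx0]; exact h3, fun x h7 h8 => ?_, fun x h7 h8 => ?_⟩⟩
            · have := h4 x (by omega) h8; omega
            · have := h5 x (by omega) h8; omega
            · rw [ha]
              by_cases hx : x = m
              · subst hx; rw [hb]; omega
              · rw [hc x (by omega) hx]
                have := h4 x (by omega) h8; omega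
            · rw [ha, hc x (by omega) (by omega)]
              have := h5 x (by omega) h8; omega
          · left
            refine Or.inr ⟨hlt, x0, by omega, h3, fun x h7 h8 => ?_, h5⟩
            by_cases hx : x = m
            · subst hx; omega
            · exact h4 x (by omega) h8
    · rintro ((h | ⟨hlt, x0, h2, h3, h4, h5⟩) | ⟨⟨ok1, ok2, ok3⟩, (h | ⟨hlt, x0, h2, h3, h4, h5⟩)⟩)
      · exact Or.inl h
      · exact Or.inr ⟨hlt, x0, by omega, h3, fun x h6 h7 => h4 x (by omega) h7, h5⟩
      · rw [ha] at h
        refine Or.inr ⟨by omega, m, by omega, by omega, fun x h6 h7 => ?_, fun x h6 h7 => ?_⟩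
        · have := ok2 x (by omega) h7; omega
        · have := ok3 x (by omega) h7; omega
      · rw [ha] at hlt h4 h5
        rw [hc x0 (by omega) (by omega)] at h3
        refine Or.inr ⟨by omega, x0, by omega, h3, fun x h6 h7 => ?_, fun x h6 h7 => ?_⟩
        · have h9 := h4 x (by omega) h7
          rw [hc x (by omega) (by omega)] at h9
          have h10 := ok2 x (by omega) h7
          have h11 := hne x m (by omega) (by omega) (by omega)
          omega
        · have h9 := h5 x (by omega) h7
          rw [hc x (by omega) (by omega)] at h9
          have h10 := ok3 x (by omega) h7
          have h11 := hne x m (by omega) (by omega) (by omega)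
          omega
  · rintro ⟨h | ⟨hlt, x0, h2, h3, h4, h5⟩, ⟨ok1, ok2, ok3⟩, h' | ⟨hlt', x0', h2', h3', h4', h5'⟩⟩
    · rw [ha] at h'; omega
    · rw [ha] at hlt'; omega
    · rw [ha] at h'
      have := hne x0 m (by omega) (by omega) (by omega); omega
    · rw [ha] at hlt'
      have := h4 m le_rfl (by omega); omega

theorem reach_top {n p m : ℕ} {g : ℕ → ℤ} (hg : IsSgn n g) (hm : m ≤ p) (hn : p < n) (v : ℤ) :
    Reach n (sumOps p 0 m) p g v ↔ TopCond n p m g v := by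
  induction m generalizing g with
  | zero =>
    rw [sumOps, reach_nil, TopCond]
    exact ⟨Or.inl, by rintro (h | ⟨-, x, h1, -⟩) <;> [exact h; omega]⟩
  | succ m ih =>
    rw [sumOps, reach_cons, ih hg (by omega), zero_add,
      ih (hg.act_sum (by omega) (by omega)) (by omega)]
    exact (topCond_step hg hm hn v).1.symm

theorem top_unique {n p m : ℕ} {g g' g'' : ℕ → ℤ} {s s' : List Bool} (hg : IsSgn n g) (hm : m ≤ p)
    (hn : p < n) (h : Walk n (sumOps p 0 m) g s g') (h' : Walk n (sumOps p 0 m) g s' g'')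
    (e : g' p = g'' p) : s = s' := by
  induction m generalizing g s s' with
  | zero => cases h; cases h'; rfl
  | succ m ih =>
    have hg1 : IsSgn n ((Op.sum p m).act g) := hg.act_sum (by omega) (by omega)
    have hex := (topCond_step hg hm hn (g' p)).2
    rw [← reach_top hg (by omega) hn, ← reach_top hg1 (by omega) hn] at hex
    rw [sumOps, zero_add] at h h'
    cases h with
    | skip h =>
      cases h' with
      | skip h' => rw [ih hg (by omega) h h']
      | take ok h' => exact absurd ⟨⟨_, _, h, rfl⟩, ok, ⟨_, _, h', e.symm⟩⟩ hex
    | take ok h =>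
      cases h' with
      | skip h' => exact absurd ⟨⟨_, _, h', e.symm⟩, ok, ⟨_, _, h, rfl⟩⟩ hex
      | take ok h' => rw [ih hg1 (by omega) h h']

/-- The effect of the fourth phase on the first rows. -/
theorem top_chain {n p m : ℕ} {g g' : ℕ → ℤ} {s : List Bool} {v c : ℤ} (hg : IsSgn n g) (hm : m ≤ p)
    (hn : p < n) (h : Walk n (sumOps p 0 m) g s g') (hv : g p = v) (hc : g' p = c) :
    (∀ j < m, g' j ≠ g j → -c ≤ g j ∧ g j < g' j ∧ g' j ≤ -v) ∧
    (∀ j j', j < j' → j' < m → g' j ≠ g j → ¬ (-c ≤ g j' ∧ g j' < g' j)) ∧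
    (∀ j < m, g' j ≠ g j → g' j = -v ∨ ∃ j', j < j' ∧ j' < m ∧ g' j' ≠ g j' ∧ g j' = g' j) ∧
    (∀ j < m, g' j ≠ g j → g j = -c ∨ ∃ j' < j, g' j' ≠ g j' ∧ g' j' = g j) ∧
    (v = c ∨ ∃ j < m, g' j ≠ g j ∧ g' j = -v) := by
  induction m generalizing g s v with
  | zero =>
    cases h
    exact ⟨fun j hj => by omega, fun j j' _ hj => by omega, fun j hj => by omega,
      fun j hj => by omega, Or.inl (hv.symm.trans hc)⟩
  | succ m ih =>
    have hne : ∀ x z, x < n → z < n → x ≠ z → g x ≠ g z ∧ g x ≠ -g z :=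
      fun x z h1 h2 h3 => hg.abs_ne h1 h2 h3
    rw [sumOps, zero_add] at h
    have hlt : ∀ j < m + 1, j ≠ m → j < m := fun j h1 h2 => by omega
    cases h with
    | skip h =>
      obtain ⟨i1, i2, i3, i4, i5⟩ := ih hg (by omega) h hv
      have hm' : g' m = g m := sum_frame h m (by omega) (by omega)
      have hT := (reach_top hg (by omega) hn c).1 ⟨_, _, h, hc⟩
      refine ⟨fun j hj hch => ?_, fun j j' hj hj' hch => ?_, fun j hj hch => ?_, fun j hj hch => ?_, ?_⟩
      · exact i1 j (hlt j hj (by rintro rfl; exact hch hm')) hch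
      · rcases Nat.lt_succ_iff_lt_or_eq.1 hj' with h1 | rfl
        · exact i2 j j' hj h1 hch
        · have h2 := i1 j hj hch
          rcases hT with h3 | ⟨h3, x0, h4, h5, h6, -⟩
          · omega
          · have h7 := h6 j' le_rfl (by omega)
            have h8 := hne x0 j' (by omega) (by omega) (by omega)
            omega
      · have hj' := hlt j hj (by rintro rfl; exact hch hm')
        rcases i3 j hj' hch with h1 | ⟨j', h1, h2, h3⟩
        · exact Or.inl h1
        · exact Or.inr ⟨j', h1, by omega, h3⟩
      · exact i4 j (hlt j hj (by rintro rfl; exact hch hm')) hch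
      · rcases i5 with h1 | ⟨j, h1, h2⟩
        · exact Or.inl h1
        · exact Or.inr ⟨j, by omega, h2⟩
    | take ok h =>
      have hg1 : IsSgn n ((Op.sum p m).act g) := hg.act_sum (by omega) (by omega)
      have ha := sum_act_self p m g
      have hb := sum_act_right (p := p) (j := m) (by omega) g
      have hcc : ∀ x, x ≠ p → x ≠ m → (Op.sum p m).act g x = g x :=
        fun x h1 h2 => sum_act_of_ne h1 h2 g
      obtain ⟨i1, i2, i3, i4, i5⟩ := ih hg1 (by omega) h ha
      have hm' : g' m = -v := by rw [sum_frame h m (by omega) (by omega), hb, hv]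
      have hT := (reach_top hg1 (by omega) hn c).1 ⟨_, _, h, hc⟩
      rw [ok_sum_of_gt (show m < p by omega)] at ok
      have hpm := hne p m (by omega) (by omega) (by omega)
      have hmch : g' m ≠ g m := by rw [hm']; omega
      have hact : ∀ j < m, (Op.sum p m).act g j = g j := fun j hj => hcc j (by omega) (by omega)
      have hle : -g m ≤ c := by
        rcases hT with h1 | ⟨h1, -⟩ <;> rw [ha] at h1 <;> omega
      refine ⟨fun j hj hch => ?_, fun j j' hj hj' hch => ?_, fun j hj hch => ?_, fun j hj hch => ?_, ?_⟩
      · rcases Nat.lt_succ_iff_lt_or_eq.1 hj with h1 | rfl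
        · have := i1 j h1 (by rwa [hact j h1])
          rw [hact j h1] at this; omega
        · omega
      · have hjm : j < m := by omega
        rcases Nat.lt_succ_iff_lt_or_eq.1 hj' with h1 | rfl
        · have := i2 j j' hj h1 (by rwa [hact j hjm])
          rwa [hact j' h1] at this
        · have := i1 j hjm (by rwa [hact j hjm])
          omega
      · rcases Nat.lt_succ_iff_lt_or_eq.1 hj with h1 | rfl
        · right
          rcases i3 j h1 (by rwa [hact j h1]) with h2 | ⟨j', h2, h3, h4, h5⟩
          · exact ⟨m, h1, by omega, hmch, by omega⟩
          · rw [hact j' h3] at h4 h5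
            exact ⟨j', h2, by omega, h4, h5⟩
        · exact Or.inl hm'
      · rcases Nat.lt_succ_iff_lt_or_eq.1 hj with h1 | rfl
        · rcases i4 j h1 (by rwa [hact j h1]) with h2 | ⟨j', h2, h3, h4⟩
          · rw [hact j h1] at h2; exact Or.inl h2
          · rw [hact j' (by omega)] at h3
            rw [hact j h1] at h4
            exact Or.inr ⟨j', h2, h3, h4⟩
        · rcases i5 with h2 | ⟨j', h2, h3, h4⟩
          · left; omega
          · right
            rw [hact j' h2] at h3
            exact ⟨j', h2, h3, by omega⟩
      · exact Or.inr ⟨m, by omega, hmch, hm'⟩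

/-- The property `full` holds since every absolute value occurs somewhere in a signed permutation,
and `TopCond` keeps the values at the positions after `p` and their negatives out of the interval
from `v` to `c`. -/
theorem chn_of_walk {n p : ℕ} {g g' : ℕ → ℤ} {s : List Bool} (hg : IsSgn n g) (hn : p < n)
    (h : Walk n (sumOps p 0 p) g s g') (hlt : g p ≠ g' p) : Chn p g g' (g p) (g' p) := by
  have hg' : IsSgn n g' := h.isSgn (sumOps_valid hn (by omega)) hg
  obtain ⟨h1, h2, h3, h4, h5⟩ := top_chain hg le_rfl hn h rfl rfl
  have hT := (reach_top hg le_rfl hn (g' p)).1 ⟨_, _, h, rfl⟩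
  rcases hT with hT | ⟨h6, x0, h7, h8, -, h9⟩
  · exact absurd hT hlt
  have hc := hg'.abs_le p hn
  have hv := hg.abs_le p hn
  rw [abs_le] at hc hv
  refine ⟨h6, h1, h2, h3, h4, h5.resolve_left hlt, ⟨x0, h7, h8⟩, fun y hy1 hy2 hy0 => ?_,
    hg.absInj hn.le, hg'.absInj hn.le, hg.ne_zero p hn, hg'.ne_zero p hn,
    fun x hx e => ?_, fun x hx e => ?_⟩
  · obtain ⟨x, hx, e⟩ := hg.surj (abs_pos.2 hy0) (by rw [abs_le]; omega)
    rcases lt_trichotomy x p with hxp | rfl | hxp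
    · exact Or.inr ⟨x, hxp, e⟩
    · exact Or.inl e.symm
    · have := h9 x hxp hx
      rcases abs_eq_abs.1 e with e | e <;> omega
  · have := hg.inj x (by omega) p hn e; omega
  · have := hg'.inj x (by omega) p hn e; omega

/-! #### The first three phases together -/

/-- The operations of row `p` which do not involve the rows above. -/
def outOps (n k p : ℕ) : List Op := difOps p k (n - k) ++ .sgn p :: sumOps p k (n - k)

theorem outOps_valid {n k p : ℕ} (hpk : p < k) (hkn : k < n) : ∀ o ∈ outOps n k p, o.Valid n := by
  intro o ho
  rcases List.mem_append.1 ho with ho | ho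
  · exact difOps_valid (by omega) (by omega) o ho
  · rcases List.mem_cons.1 ho with rfl | ho
    · exact (by omega : p < n)
    · exact sumOps_valid (by omega) (by omega) o ho

/-- The criterion for the third phase, in terms of the original column; `y` is the value after the
first phase, and `z` that after the second. -/
def ThirdCond (n k p : ℕ) (g : ℕ → ℤ) (y z v : ℤ) : Prop :=
  z = v ∨ z < v ∧ (∃ x, (x = p ∨ k ≤ x ∧ x < n) ∧ g x ≠ y ∧ g x = -v) ∧
    (∀ x, (x = p ∨ k ≤ x ∧ x < n) → g x ≠ y → g x ≠ -v → ¬ (z < g x ∧ g x < v)) ∧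
    ∀ x, p < x → x < k → ¬ (z < g x ∧ g x < v)

/-- The criterion for the second phase, in terms of the original column. -/
def SecondCond (n k p : ℕ) (g : ℕ → ℤ) (y : ℤ) : Prop :=
  0 < y ∧ (∀ x, (x = p ∨ k ≤ x ∧ x < n) → g x ≠ y → |g x| < y) ∧ ∀ x, p < x → x < k → |g x| < y

/-- The first phase only permutes the values at `p` and at the outer positions, and the third phase
does not care where the outer values are. Its criterion can thus be read off from the original
sequence, leaving out the value `y` now in row `p`. -/
theorem sumCond_iff {n k p : ℕ} {g g1 g2 : ℕ → ℤ} {s : List Bool} (hg : IsSgn n g) (hpk : p < k)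
    (hkn : k < n) (h : Walk n (difOps p k (n - k)) g s g1) (h2 : ∀ x, x ≠ p → g2 x = g1 x) (v : ℤ) :
    SumCond n p k (n - k) g2 v ↔ ThirdCond n k p g (g1 p) (g2 p) v := by
  have hg1 : IsSgn n g1 := h.isSgn (difOps_valid (by omega) (by omega)) hg
  obtain ⟨f1, f2⟩ := dif_frame h hpk
  rw [show k + (n - k) = n by omega] at f1 f2
  have key1 : ∀ x, (x = p ∨ k ≤ x ∧ x < n) → g x ≠ g1 p → ∃ x', k ≤ x' ∧ x' < n ∧ g1 x' = g x := by
    intro x hx hne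
    obtain ⟨x', h3, h4⟩ := (f2 (g x)).2 ⟨x, hx, rfl⟩
    rcases h3 with rfl | h3
    · exact absurd h4.symm hne
    · exact ⟨x', h3.1, h3.2, h4⟩
  have key2 : ∀ x', k ≤ x' → x' < n → ∃ x, (x = p ∨ k ≤ x ∧ x < n) ∧ g x ≠ g1 p ∧ g x = g1 x' := by
    intro x' h3 h4
    obtain ⟨x, h5, h6⟩ := (f2 (g1 x')).1 ⟨x', Or.inr ⟨h3, h4⟩, rfl⟩
    exact ⟨x, h5, by rw [h6]; exact (hg1.abs_ne h4 (by omega) (by omega)).1, h6⟩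
  unfold SumCond ThirdCond
  rw [show k + (n - k) = n by omega]
  refine or_congr Iff.rfl (and_congr Iff.rfl ?_)
  constructor
  · rintro ⟨x0, h3, h4, h5, h6, -⟩
    rw [h2 x0 (by omega)] at h5
    obtain ⟨x, h7, h8, h9⟩ := key2 x0 h3 h4
    refine ⟨⟨x, h7, h8, by omega⟩, fun x h10 h11 h12 => ?_, fun x h10 h11 => ?_⟩
    · obtain ⟨x', h13, h14, h15⟩ := key1 x h10 h11
      have := h6 x' (by omega) h14 (by rintro rfl; omega)
      rwa [h2 x' (by omega), h15] at this
    · have := h6 x h10 (by omega) (by omega)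
      rwa [h2 x (by omega), f1 x (by omega) (by omega)] at this
  · rintro ⟨⟨x, h7, h8, h9⟩, h10, h11⟩
    obtain ⟨x0, h3, h4, h5⟩ := key1 x h7 h8
    refine ⟨x0, h3, h4, by rw [h2 x0 (by omega)]; omega, fun x h12 h13 h14 => ?_,
      fun x h12 h13 => by omega⟩
    rw [h2 x (by omega)]
    rcases lt_or_ge x k with h15 | h15
    · rw [f1 x (by omega) (by omega)]; exact h11 x h12 h15
    · obtain ⟨x1, h16, h17, h18⟩ := key2 x h15 h13
      rw [← h18]
      refine h10 x1 h16 h17 fun e => h14 ?_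
      exact hg1.inj x h13 x0 h4 (by rw [← h18, h5, e, h9])

theorem secondCond_iff {n k p : ℕ} {g g1 : ℕ → ℤ} {s : List Bool} (hg : IsSgn n g) (hpk : p < k)
    (hkn : k < n) (h : Walk n (difOps p k (n - k)) g s g1) :
    (Op.sgn p).ok n g1 ↔ SecondCond n k p g (g1 p) := by
  have hg1 : IsSgn n g1 := h.isSgn (difOps_valid (by omega) (by omega)) hg
  obtain ⟨f1, f2⟩ := dif_frame h hpk
  rw [show k + (n - k) = n by omega] at f1 f2
  unfold Op.ok SecondCond
  refine and_congr Iff.rfl ⟨fun h3 => ⟨fun x hx hne => ?_, fun x h4 h5 => ?_⟩, ?_⟩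
  · obtain ⟨x', h4, h5⟩ := (f2 (g x)).2 ⟨x, hx, rfl⟩
    rcases h4 with rfl | h4
    · exact absurd h5.symm hne
    · rw [← h5]; exact h3 x' (by omega) h4.2
  · rw [← f1 x (by omega) (by omega)]; exact h3 x h4 (by omega)
  · rintro ⟨h3, h4⟩ x h5 h6
    rcases lt_or_ge x k with h7 | h7
    · rw [f1 x (by omega) (by omega)]; exact h4 x h5 h7
    · obtain ⟨x', h8, h9⟩ := (f2 (g1 x)).1 ⟨x, Or.inr ⟨h7, h6⟩, rfl⟩
      rw [← h9]
      exact h3 x' h8 (by rw [h9]; exact (hg1.abs_ne h6 (by omega) (by omega)).1)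

theorem sgn_act_self (p : ℕ) (g : ℕ → ℤ) : (Op.sgn p).act g p = -g p := by simp [Op.act]
theorem sgn_act_of_ne {p x : ℕ} (h : x ≠ p) (g : ℕ → ℤ) : (Op.sgn p).act g x = g x := by
  simp [Op.act, h]

theorem reach_out_iff {n k p : ℕ} {g : ℕ → ℤ} (hg : IsSgn n g) (hpk : p < k) (hkn : k < n) (v : ℤ) :
    Reach n (outOps n k p) p g v ↔ ∃ y, DifCond p k (n - k) g y ∧ (ThirdCond n k p g y y v ∨
      SecondCond n k p g y ∧ ThirdCond n k p g y (-y) v) := by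
  constructor
  · rintro ⟨s, g', h, e⟩
    obtain ⟨s1, s2, g1, -, h1, h2⟩ := h.split
    have hg1 : IsSgn n g1 := h1.isSgn (difOps_valid (by omega) (by omega)) hg
    refine ⟨g1 p, (reach_dif hg hpk (by omega) _).1 ⟨_, _, h1, rfl⟩, ?_⟩
    cases h2 with
    | skip h2 =>
      exact Or.inl ((sumCond_iff hg hpk hkn h1 (fun _ _ => rfl) v).1
        ((reach_sum hg1 hpk (by omega) v).1 ⟨_, _, h2, e⟩))
    | take ok h2 =>
      refine Or.inr ⟨(secondCond_iff hg hpk hkn h1).1 ok, ?_⟩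
      rw [← sgn_act_self p g1]
      exact (sumCond_iff hg hpk hkn h1 (fun x hx => sgn_act_of_ne hx g1) v).1
        ((reach_sum (hg1.act_sgn (by omega)) hpk (by omega) v).1 ⟨_, _, h2, e⟩)
  · rintro ⟨y, hy, hv⟩
    obtain ⟨s1, g1, h1, rfl⟩ := (reach_dif hg hpk (by omega) y).2 hy
    have hg1 : IsSgn n g1 := h1.isSgn (difOps_valid (by omega) (by omega)) hg
    rcases hv with hv | ⟨hs, hv⟩
    · obtain ⟨s2, g2, h2, e⟩ := (reach_sum hg1 hpk (by omega) v).2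
        ((sumCond_iff hg hpk hkn h1 (fun _ _ => rfl) v).2 hv)
      exact ⟨_, _, h1.append (.skip h2), e⟩
    · rw [← sgn_act_self p g1] at hv
      obtain ⟨s2, g2, h2, e⟩ := (reach_sum (hg1.act_sgn (by omega)) hpk (by omega) v).2
        ((sumCond_iff hg hpk hkn h1 (fun x hx => sgn_act_of_ne hx g1) v).2 hv)
      exact ⟨_, _, h1.append (.take ((secondCond_iff hg hpk hkn h1).2 hs) h2), e⟩

/-- The criterion for moving the value `v` to position `p` in the first three phases. -/
def OutCond (n k p : ℕ) (g : ℕ → ℤ) (v : ℤ) : Prop :=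
  g p = v ∨ (∃ x, (x = p ∨ k ≤ x ∧ x < n) ∧ |g x| = |v|) ∧
    (∀ x, p < x → x < k → ¬ cyc (g p) (g x) v) ∧
    ¬ (g p < 0 ∧ v = -g p ∧ p + 1 < k ∧ ∀ x, k ≤ x → x < n → |g p| < |g x|)

/-- The three phases together move along one cyclic arc that must avoid the rows between `p` and
`k`. The only further obstruction concerns turning a negative entry into its opposite: this needs a
detour through an outer value of smaller absolute value, unless there is no row between. -/
theorem reach_out {n k p : ℕ} {g : ℕ → ℤ} (hg : IsSgn n g) (hpk : p < k) (hkn : k < n) (v : ℤ) :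
    Reach n (outOps n k p) p g v ↔ OutCond n k p g v := by
  rw [reach_out_iff hg hpk hkn]
  have hne : ∀ x z, x < n → z < n → x ≠ z → g x ≠ g z ∧ g x ≠ -g z :=
    fun x z h1 h2 h3 => hg.abs_ne h1 h2 h3
  have hnz : ∀ x, x < n → g x ≠ 0 := hg.ne_zero
  have hFa : ∀ x, p < x → x < k → g x ≠ g p ∧ g x ≠ -g p := fun x h1 h2 =>
    hne x p (by omega) (by omega) (by omega)
  have ha0 := hnz p (by omega)
  constructor
  · rintro ⟨y, hy, hv⟩
    by_cases hav : g p = v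
    · exact Or.inl hav
    right
    -- the value after the first phase belongs to an outer position or to `p`
    obtain ⟨xy, hxy, exy⟩ : ∃ x, (x = p ∨ k ≤ x ∧ x < n) ∧ g x = y := by
      rcases hy with hy | ⟨⟨x, h1, h2, h3⟩, -⟩
      · exact ⟨p, Or.inl rfl, hy⟩
      · exact ⟨x, Or.inr ⟨h1, by omega⟩, h3⟩
    have hFy : ∀ x, p < x → x < k → ¬ cyc (g p) (g x) y := by
      intro x h1 h2
      rcases hy with hy | ⟨-, hy⟩
      · unfold cyc; omega
      · exact hy x h1 h2
    have hFne : ∀ x, p < x → x < k → g x ≠ y ∧ g x ≠ -y := fun x h1 h2 => by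
      have := hne x xy (by omega) (by omega) (by omega); omega
    have hFv : ∀ x, p < x → x < k → ¬ cyc (g p) (g x) v := by
      intro x h1 h2
      have h3 := hFy x h1 h2
      have h4 := hFne x h1 h2
      rcases hv with (rfl | ⟨h5, -, -, h6⟩) | ⟨⟨h5, -, h7⟩, (h8 | ⟨h8, -, -, h9⟩)⟩
      · exact h3
      · have := h6 x h1 h2; unfold cyc at *; omega
      · have := h7 x h1 h2; rw [abs_lt] at this; unfold cyc at *; omega
      · have := h7 x h1 h2; have := h9 x h1 h2; rw [abs_lt] at *; unfold cyc at *; omega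
    have hvS : ∃ x, (x = p ∨ k ≤ x ∧ x < n) ∧ |g x| = |v| := by
      rcases hv with (rfl | ⟨h5, ⟨x, hx, -, e⟩, -⟩) | ⟨-, (h8 | ⟨h8, ⟨x, hx, -, e⟩, -⟩)⟩
      · exact ⟨xy, hxy, by rw [exy]⟩
      · exact ⟨x, hx, by rw [e, abs_neg]⟩
      · exact ⟨xy, hxy, by rw [exy, ← h8, abs_neg]⟩
      · exact ⟨x, hx, by rw [e, abs_neg]⟩
    refine ⟨hvS, hFv, ?_⟩
    -- All outer values are less than `g p` or greater than `-g p`, so a detour through one of them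
    -- cannot avoid the entry of row `p + 1`.
    rintro ⟨h1, h2, h3, h4⟩
    have h5 := hFy (p + 1) (by omega) h3
    have h6 := hFne (p + 1) (by omega) h3
    have h7 := hFa (p + 1) (by omega) h3
    have h10 := hFv (p + 1) (by omega) h3
    have hyp : y = g p ∨ y < g p ∨ -g p < y := by
      rcases hxy with rfl | hxy
      · exact Or.inl exy.symm
      · have := h4 xy hxy.1 hxy.2
        rw [exy, abs_of_neg h1] at this
        rcases abs_cases y with h8 | h8 <;> omega
    rcases hv with (h8 | ⟨h8, ⟨x, hx, hxy', e⟩, -, h9⟩) | ⟨⟨hy0, -, h11⟩, (h8 | ⟨h8, ⟨x, hx, hxy', e⟩, -, h9⟩)⟩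
    · have := hne xy p (by omega) (by omega)
      by_cases hxp : xy = p
      · subst hxp; omega
      · have := this hxp; omega
    · have hxp : x = p := by
        by_contra hxp
        have := hne x p (by omega) (by omega) hxp; omega
      subst hxp
      have := h9 (x + 1) (by omega) h3
      unfold cyc at *; omega
    · omega
    · have hxp : x = p := by
        by_contra hxp
        have := hne x p (by omega) (by omega) hxp; omega
      subst hxp
      have := h9 (x + 1) (by omega) h3
      have := h11 (x + 1) (by omega) h3
      rw [abs_lt] at *
      unfold cyc at *; omega
  · rintro (h | ⟨⟨xv, hxv, hv⟩, hF, hex⟩)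
    · exact ⟨g p, Or.inl rfl, Or.inl (Or.inl h)⟩
    by_cases hav : g p = v
    · exact ⟨g p, Or.inl rfl, Or.inl (Or.inl hav)⟩
    rcases abs_eq_abs.1 hv with hv | hv
    · refine ⟨v, Or.inr ⟨⟨xv, ?_, ?_, hv⟩, hF⟩, Or.inl (Or.inl rfl)⟩ <;>
      · rcases hxv with rfl | hxv <;> omega
    -- now `-v` is the value at an outer position or at `p`
    have hdif : ∀ x, (x = p ∨ k ≤ x ∧ x < n) → (∀ z, p < z → z < k → ¬ cyc (g p) (g z) (g x)) →
        DifCond p k (n - k) g (g x) := by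
      rintro x (rfl | hx) h1
      · exact Or.inl rfl
      · exact Or.inr ⟨⟨x, hx.1, by omega, rfl⟩, h1⟩
    have hSn : ∀ x, (x = p ∨ k ≤ x ∧ x < n) → x < n := fun x hx => by omega
    -- The third phase produces `v` from `-v`. The first phase should stop at the greatest available
    -- value below `v` other than `-v`, so that nothing lies between.
    by_cases hlow : ∃ x, (x = p ∨ k ≤ x ∧ x < n) ∧ g x ≠ -v ∧ g x < v
    · obtain ⟨x1, hx1, hmax⟩ := exists_max_image
        ((range n).filter fun x => (x = p ∨ k ≤ x ∧ x < n) ∧ g x ≠ -v ∧ g x < v) g (by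
          obtain ⟨x, h1, h2, h3⟩ := hlow
          exact ⟨x, mem_filter.2 ⟨mem_range.2 (hSn x h1), h1, h2, h3⟩⟩)
      simp only [mem_filter, mem_range] at hx1 hmax
      obtain ⟨hx1n, hx1S, hx1v, hx1lt⟩ := hx1
      have hmax' : ∀ x, (x = p ∨ k ≤ x ∧ x < n) → g x ≠ -v → g x < v → g x ≤ g x1 :=
        fun x h1 h2 h3 => hmax x ⟨hSn x h1, h1, h2, h3⟩
      have hFF : ∀ z, p < z → z < k → ¬ cyc (g p) (g z) (g x1) ∧ ¬ (g x1 < g z ∧ g z < v) := by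
        intro z h1 h2
        have h3 := hF z h1 h2
        have h4 := hFa z h1 h2
        have h5 := hmax' p (Or.inl rfl)
        have h6 := hne z x1 (by omega) hx1n (by omega)
        by_cases hpv : g p = -v
        · by_cases hneg : g p < 0
          · have : ∃ x, k ≤ x ∧ x < n ∧ ¬ |g p| < |g x| := by
              by_contra h7; push Not at h7
              exact hex ⟨hneg, by omega, by omega, h7⟩
            obtain ⟨x, h7, h8, h9⟩ := this
            rw [abs_of_neg hneg] at h9
            have h10 := hne x p h8 (by omega) (by omega)
            have h11 := hmax' x (Or.inr ⟨h7, h8⟩)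
            have := abs_le.1 (not_lt.1 h9)
            unfold cyc at *; omega
          · unfold cyc at *; omega
        · have := h5 hpv
          unfold cyc at *; omega
      exact ⟨g x1, hdif x1 hx1S fun z h1 h2 => (hFF z h1 h2).1, Or.inl (Or.inr ⟨hx1lt,
        ⟨xv, hxv, by omega, hv⟩, fun x h1 h2 h3 h4 => by
          have := hmax' x h1 h3 h4.2; omega, fun z h1 h2 => (hFF z h1 h2).2⟩)⟩
    -- Nothing suitable lies below `v`. Then the first phase goes to the greatest available value,
    -- which the sign change turns into the least one.
    · push Not at hlow
      obtain ⟨x1, hx1, hmax⟩ := exists_max_image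
        ((range n).filter fun x => (x = p ∨ k ≤ x ∧ x < n)) g
          ⟨p, mem_filter.2 ⟨mem_range.2 (by omega), Or.inl rfl⟩⟩
      simp only [mem_filter, mem_range] at hx1 hmax
      obtain ⟨hx1n, hx1S⟩ := hx1
      have hmax' : ∀ x, (x = p ∨ k ≤ x ∧ x < n) → g x ≤ g x1 := fun x h1 => hmax x ⟨hSn x h1, h1⟩
      have hv0 : v ≠ 0 := by have := hnz xv (hSn xv hxv); omega
      have hvn : ∀ x, (x = p ∨ k ≤ x ∧ x < n) → x ≠ xv → g x ≠ v ∧ g x ≠ -v := fun x h1 h2 => by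
        have := hne x xv (hSn x h1) (hSn xv hxv) h2; omega
      have hxk : ∃ x, (x = p ∨ k ≤ x ∧ x < n) ∧ x ≠ xv := by
        by_cases h : xv = p
        · exact ⟨k, Or.inr ⟨le_rfl, hkn⟩, by omega⟩
        · exact ⟨p, Or.inl rfl, Ne.symm h⟩
      obtain ⟨xw, hxw, hxwv⟩ := hxk
      have hw1 := hvn xw hxw hxwv
      have hw2 := hlow xw hxw hw1.2
      have hw3 := hmax' xw hxw
      have hv3 := hmax' xv hxv
      have hp1 := hlow p (Or.inl rfl)
      have hp2 := hmax' p (Or.inl rfl)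
      have hFF : ∀ z, p < z → z < k → |g z| < g x1 ∧ ¬ cyc (g p) (g z) (g x1) ∧
          ¬ (-g x1 < g z ∧ g z < v) := by
        intro z h1 h2
        have h3 := hF z h1 h2
        have h4 := hFa z h1 h2
        have h6 := hne z x1 (by omega) hx1n (by omega)
        rw [abs_lt]
        by_cases hpv : g p = -v
        · by_cases hneg : g p < 0
          · exfalso
            refine hex ⟨hneg, by omega, by omega, fun x h7 h8 => ?_⟩
            have h9 := hne x p h8 (by omega) (by omega)
            have h10 := hlow x (Or.inr ⟨h7, h8⟩)
            rcases abs_cases (g p) with h11 | h11 <;> rcases abs_cases (g x) with h12 | h12 <;> omega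
          · unfold cyc at *; omega
        · have := hp1 hpv
          unfold cyc at *; omega
      refine ⟨g x1, hdif x1 hx1S fun z h1 h2 => (hFF z h1 h2).2.1, Or.inr ⟨⟨by omega,
        fun x h1 h2 => ?_, fun z h1 h2 => (hFF z h1 h2).1⟩, ?_⟩⟩
      · have h3 := hmax' x h1
        have h4 : x ≠ x1 := by rintro rfl; exact h2 rfl
        have h5 := hne x x1 (hSn x h1) hx1n h4
        rw [abs_lt]
        by_cases hxv' : x = xv
        · subst hxv'; omega
        · have h6 := hvn x h1 hxv'
          have h7 := hlow x h1 h6.2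
          omega
      · by_cases h1 : -g x1 = v
        · exact Or.inl h1
        · refine Or.inr ⟨by omega, ⟨xv, hxv, by omega, hv⟩, fun x h2 h3 h4 h5 => ?_,
            fun z h2 h3 => (hFF z h2 h3).2.2⟩
          have := hlow x h2 h4; omega

/-- Each phase is determined by its result, so it is enough that the final value determines the
value after the first phase and whether the sign changes. -/
theorem out_unique {n k p : ℕ} {g g' g'' : ℕ → ℤ} {s s' : List Bool} (hg : IsSgn n g) (hpk : p < k)
    (hkn : k < n) (h : Walk n (outOps n k p) g s g') (h' : Walk n (outOps n k p) g s' g'')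
    (e : g' p = g'' p) : s = s' := by
  have hne : ∀ x z, x < n → z < n → x ≠ z → g x ≠ g z ∧ g x ≠ -g z :=
    fun x z h1 h2 h3 => hg.abs_ne h1 h2 h3
  obtain ⟨s1, s2, g1, rfl, h1, h2⟩ := h.split
  obtain ⟨s1', s2', g1', rfl, h1', h2'⟩ := h'.split
  have hg1 : IsSgn n g1 := h1.isSgn (difOps_valid (by omega) (by omega)) hg
  have hg1' : IsSgn n g1' := h1'.isSgn (difOps_valid (by omega) (by omega)) hg
  have hy : ∀ {s1 : List Bool} {g1 : ℕ → ℤ}, Walk n (difOps p k (n - k)) g s1 g1 →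
      ∃ x, (x = p ∨ k ≤ x ∧ x < n) ∧ g x = g1 p := fun {s1 g1} h1 => by
    have := ((dif_frame h1 hpk).2 (g1 p)).1 ⟨p, Or.inl rfl, rfl⟩
    rwa [show k + (n - k) = n by omega] at this
  obtain ⟨x1, hx1, e1⟩ := hy h1
  obtain ⟨x1', hx1', e1'⟩ := hy h1'
  have hfin : ∀ {s2 : List Bool} {g1 g2 g' : ℕ → ℤ} {s1 : List Bool}, Walk n (difOps p k (n - k)) g s1 g1 →
      IsSgn n g2 → (∀ x, x ≠ p → g2 x = g1 x) → Walk n (sumOps p k (n - k)) g2 s2 g' →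
      ThirdCond n k p g (g1 p) (g2 p) (g' p) := fun {s2 g1 g2 g' s1} h1 hg2 hf h2 =>
    (sumCond_iff hg hpk hkn h1 hf _).1 ((reach_sum hg2 hpk (by omega) _).1 ⟨_, _, h2, rfl⟩)
  have hdist : ∀ x z, (x = p ∨ k ≤ x ∧ x < n) → (z = p ∨ k ≤ z ∧ z < n) → x ≠ z →
      g x ≠ g z ∧ g x ≠ -g z := fun x z h1 h2 h3 => hne x z (by omega) (by omega) h3
  -- equal values after the first phase suffice
  have hsame : g1 p = g1' p → s1 = s1' ∧ g1 = g1' := fun e => by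
    have := dif_unique hg hpk (by omega) h1 h1' e
    subst this
    exact ⟨rfl, h1.det h1'⟩
  have hnz : ∀ x, (x = p ∨ k ≤ x ∧ x < n) → g x ≠ 0 := fun x hx => hg.ne_zero x (by omega)
  have hz1 := hnz x1 hx1
  have hz1' := hnz x1' hx1'
  -- With a sign change, `y` exceeds the other available absolute values. A route without sign
  -- change through `y'` would need a value that is not there, or would leave `y'` in the way
  -- between `-y` and `v`.
  have mixed : ∀ y y' v x x', (x = p ∨ k ≤ x ∧ x < n) → (x' = p ∨ k ≤ x' ∧ x' < n) → g x = y →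
      g x' = y' → SecondCond n k p g y → ThirdCond n k p g y (-y) v → ThirdCond n k p g y' y' v →
      False := by
    rintro y y' v x x' hx hx' ex ex' ⟨hy0, hs, -⟩ ht ht'
    have hyy : y' ≠ y → |y'| < y := fun h => by
      rw [← ex']; exact hs x' hx' (by rw [ex']; exact h)
    have hle : |y'| ≤ y := by
      by_cases h : y' = y
      · rw [h, abs_of_pos hy0]
      · exact (hyy h).le
    rw [abs_le] at hle
    have hvle : v ≤ y := by
      rcases ht with h3 | ⟨h3, ⟨z, hz, hzy, hzv⟩, -⟩
      · omega
      · have := hs z hz hzy; rw [abs_lt] at this; omega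
    rcases ht' with rfl | ⟨h3, ⟨z, hz, hzy, hzv⟩, h4, h5⟩
    · rcases ht with h3 | ⟨h3, ⟨z, hz, hzy, hzv⟩, -⟩
      · by_cases h : y' = y
        · omega
        · have := hyy h; rw [abs_lt] at this; omega
      · by_cases hzx : z = x'
        · subst hzx; have := hnz z hz; omega
        · have := hdist z x' hz hx' hzx; omega
    · by_cases h : y' = y
      · omega
      · have h6 := hyy h
        rw [abs_lt] at h6
        rcases ht with h7 | ⟨h7, -, h8, -⟩
        · omega
        · have := h8 x' hx' (by rw [ex']; exact h) (by
            rw [ex']; omega)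
          omega
  cases h2 with
  | skip h2 =>
    have t1 := hfin h1 hg1 (fun _ _ => rfl) h2
    cases h2' with
    | skip h2' =>
      have t2 := hfin h1' hg1' (fun _ _ => rfl) h2'
      rw [← e] at t2
      have hey : g1 p = g1' p := by
        by_contra hne'
        have hx : x1 ≠ x1' := by rintro rfl; omega
        have hd := hdist x1 x1' hx1 hx1' hx
        rcases t1 with t1 | ⟨t1, ⟨z, hz, hzy, hzv⟩, t3, -⟩ <;>
        rcases t2 with t2 | ⟨t2, ⟨z', hz', hzy', hzv'⟩, t4, -⟩
        · omega
        · by_cases hzx : z' = x1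
          · subst hzx; omega
          · have := hdist z' x1 hz' hx1 hzx; omega
        · by_cases hzx : z = x1'
          · subst hzx; omega
          · have := hdist z x1' hz hx1' hzx; omega
        · have h5 := t3 x1' hx1' (by omega)
          have h6 := t4 x1 hx1 (by omega)
          rw [e1'] at h5; rw [e1] at h6
          by_cases h7 : z' = x1
          · subst h7
            by_cases h8 : z = x1'
            · subst h8; omega
            · have := hdist z z' hz hz' (by rintro rfl; omega); omega
          · by_cases h8 : z = x1'
            · subst h8
              have := hdist z z' hz hz' (by rintro rfl; omega); omega
            · have h9 := hdist z' x1 hz' hx1 h7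
              have h10 := hdist z x1' hz hx1' h8
              omega
      obtain ⟨rfl, rfl⟩ := hsame hey
      rw [sum_unique hg1 hpk (by omega) h2 h2' e]
    | take ok h2' =>
      have t2 := hfin h1' (hg1'.act_sgn (by omega)) (fun x hx => sgn_act_of_ne hx _) h2'
      rw [← e, sgn_act_self] at t2
      exact (mixed _ _ _ _ _ hx1' hx1 e1' e1 ((secondCond_iff hg hpk hkn h1').1 ok) t2 t1).elim
  | take ok h2 =>
    have t1 := hfin h1 (hg1.act_sgn (by omega)) (fun x hx => sgn_act_of_ne hx _) h2
    rw [sgn_act_self] at t1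
    cases h2' with
    | skip h2' =>
      have t2 := hfin h1' hg1' (fun _ _ => rfl) h2'
      rw [← e] at t2
      exact (mixed _ _ _ _ _ hx1 hx1' e1 e1' ((secondCond_iff hg hpk hkn h1).1 ok) t1 t2).elim
    | take ok' h2' =>
      have c1 := (secondCond_iff hg hpk hkn h1).1 ok
      have c2 := (secondCond_iff hg hpk hkn h1').1 ok'
      have hey : g1 p = g1' p := by
        by_contra hne'
        have h3 := c1.2.1 x1' hx1' (by omega)
        have h4 := c2.2.1 x1 hx1 (by omega)
        rw [e1', abs_of_pos c2.1] at h3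
        rw [e1, abs_of_pos c1.1] at h4
        omega
      obtain ⟨rfl, rfl⟩ := hsame hey
      rw [sum_unique (hg1.act_sgn (by omega)) hpk (by omega) h2 h2' e]

theorem out_frame {n k p : ℕ} {g g' : ℕ → ℤ} {s : List Bool} (hpk : p < k)
    (h : Walk n (outOps n k p) g s g') {x : ℕ} (hx : x < k) (hxp : x ≠ p) : g' x = g x := by
  obtain ⟨s1, s2, g1, rfl, h1, h2⟩ := h.split
  have e1 := (dif_frame h1 hpk).1 x hxp (by omega)
  cases h2 with
  | skip h2 => rw [sum_frame h2 x hxp (by omega), e1]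
  | take ok h2 => rw [sum_frame h2 x hxp (by omega), sgn_act_of_ne hxp, e1]

/-! ### One row of the left half: necessity and uniqueness -/

theorem ng_succ (f : ℕ → ℤ) (m : ℕ) (b : ℤ) :
    ng f (m + 1) b = ng f m b + if -b ≤ f m ∧ f m < 0 then 1 else 0 := by
  unfold ng cnt
  rw [range_add_one, filter_insert]
  split_ifs
  · rw [card_insert_of_notMem (by simp)]
  · rfl

theorem ng_congr {f g : ℕ → ℤ} {m : ℕ} (h : ∀ x < m, f x = g x) (b : ℤ) : ng f m b = ng g m b :=
  cnt_congr fun j => and_congr_right fun hj => by rw [h j hj]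

theorem Blk.congr {f g h : ℕ → ℤ} {i : ℕ} {b : ℤ} (B : Blk f h i b) (H : ∀ x ≤ i, f x = g x) :
    Blk g h i b := by
  have hi := H i le_rfl
  refine ⟨B.pos, hi ▸ B.le, hi ▸ B.ne, fun x h1 h2 => ?_, B.full'⟩
  obtain ⟨j, hj, e⟩ := B.full x h1 h2
  exact ⟨j, hj, by rw [← H j hj, e]⟩

theorem CondLt.congr {p k : ℕ} {f g h : ℕ → ℤ} (C : CondLt p k f h) (H : ∀ x < p, f x = g x) :
    CondLt p k g h := by
  refine ⟨fun i l hil hi hl hp => ?_, fun i l hi hl hlk => ?_, fun i hi B => ?_⟩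
  · obtain ⟨B, o⟩ := C.adj i l hil hi hl (by rwa [H i hi])
    exact ⟨B.congr fun x hx => H x (by omega), by
      rwa [← ng_congr (m := i + 1) fun x hx => H x (by omega)]⟩
  · rw [← H i hi]; exact C.out i l hi hl hlk
  · have := C.blk i hi (B.congr fun x hx => (H x (by omega)).symm)
    rwa [← ng_congr (m := i + 1) fun x hx => H x (by omega)]

theorem not_pass_pred {a c d : ℤ} (h : ¬ pass a c d) (hd : d ≠ c) : ¬ pass a (c - 1) d := by
  unfold pass at *; omega

/-- The parity of the negative entries below a level which no row passes. -/
theorem even_ng_lt {C D : ℕ → ℤ} {p : ℕ} {c : ℤ} (hC : AbsInj C p) (hD : AbsInj D p)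
    (H : CondIn p C D) (hc : 0 < c) (full : ∀ x, 0 < x → x < c → ∃ j < p, |C j| = x)
    (hn : ∀ j < p, ¬ pass (C j) c (D j)) (h1 : ∀ j < p, |C j| ≠ c) (h2 : ∀ j < p, |D j| ≠ c) :
    Even (ng C p c + ng D p c) ∧ ∀ x, 0 < x → x < c → ∃ j < p, |D j| = x := by
  obtain ⟨N, hN⟩ := Int.eq_ofNat_of_zero_le (show 0 ≤ c - 1 by omega)
  have hd : ∀ j < p, D j ≠ c := fun j hj e => h2 j hj (by rw [e, abs_of_pos hc])
  have hn' : ∀ j < p, ¬ pass (C j) N (D j) := fun j hj => by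
    rw [← hN]; exact not_pass_pred (hn j hj) (hd j hj)
  have hfull : ∀ x, 0 < x → x ≤ (N : ℤ) → ∃ j < p, |C j| = x := fun x h3 h4 => full x h3 (by omega)
  have := even_ng hC hD H N hfull fun j hj _ => hn' j hj
  rw [← hN, ng_pred fun r hr e => h1 r hr (by rw [e, abs_neg, abs_of_pos hc]),
    ng_pred fun r hr e => h2 r hr (by rw [e, abs_neg, abs_of_pos hc])] at this
  exact ⟨this, fun x h3 h4 =>
    (closed_of_not_pass hC hD hfull fun j hj _ => hn' j hj).2.2 x h3 (by omega)⟩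

/-- Since `|v|` is stored in the rows above by the fourth phase, all levels below `c` are full in
`C'`, and `Cond` forbids arcs over `c`. So `even_ng_lt` applies. -/
theorem Chn.even {p k : ℕ} {C C' D : ℕ → ℤ} {v c : ℤ} (h : Chn p C C' v c) (hD : AbsInj D k)
    (hpk : p < k) (hDp : D p = c) (H : Cond p k C' D) (hc : 0 < c)
    (full : ∀ x, 0 < x → x < c → x = |v| ∨ ∃ r < p, |C r| = x) : Even (ng C' p c + ng D p c) := by
  refine (even_ng_lt h.inj' (hD.mono hpk.le) (H.condIn le_rfl hpk) hc (fun x h1 h2 => ?_)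
    (fun j hj => hDp ▸ H.out j p hj le_rfl hpk) (fun j hj => ?_) fun j hj e => ?_).1
  · rcases full x h1 h2 with rfl | h3
    · obtain ⟨j, hj, -, e⟩ := h.top
      exact ⟨j, hj, by rw [e, abs_neg]⟩
    · exact h.mem (by rw [abs_of_pos hc]; omega) h3
  · rw [← abs_of_pos hc]; exact h.cC j hj
  · have := hD.inj j (by omega) p hpk (by rw [e, hDp, abs_of_pos hc]); omega

section Row
variable {n k p : ℕ} {g g' g1 D : ℕ → ℤ} {s1 s2 : List Bool}

/-- Skipping everything is one way to keep the value of row `p`, and by uniqueness the only one. -/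
theorem top_of_eq (hg' : IsSgn n g') (hpn : p < n) (h2 : Walk n (sumOps p 0 p) g' s2 g1)
    (e : g' p = g1 p) : g1 = g' := by
  have := Walk.skip_all (n := n) (sumOps p 0 p) g'
  have e2 := top_unique hg' le_rfl hpn h2 this e.symm
  subst e2
  exact h2.det this

/-- The absolute value in row `p` after the first three phases is one of those present before in
row `p` or after row `k`. -/
theorem out_abs (hg : IsSgn n g) (hpk : p < k) (hkn : k < n) (h1 : Walk n (outOps n k p) g s1 g') :
    ∃ x, (x = p ∨ k ≤ x ∧ x < n) ∧ |g x| = |g' p| := by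
  rcases (reach_out hg hpk hkn _).1 ⟨_, _, h1, rfl⟩ with h | h
  · exact ⟨p, Or.inl rfl, by rw [h]⟩
  · exact h.1

theorem out_condLt (hg : IsSgn n g) (hpk : p < k) (hkn : k < n)
    (h1 : Walk n (outOps n k p) g s1 g') (h2 : Walk n (sumOps p 0 p) g' s2 g1) (hD : AbsInj D k)
    (hDp : D p = g1 p) (hDl : ∀ l, p < l → l < k → D l = g l) (H : Cond p k g1 D) :
    CondLt p k g D := by
  have hg' : IsSgn n g' := h1.isSgn (outOps_valid hpk hkn) hg
  have hf : ∀ x < k, x ≠ p → g' x = g x := fun x hx hxp => out_frame hpk h1 hx hxp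
  refine CondLt.congr (f := g') ?_ fun x hx => hf x (by omega) (by omega)
  by_cases e : g' p = g1 p
  · rw [top_of_eq hg' (by omega) h2 e] at H
    exact H.condLt hpk
  · refine (chn_of_walk hg' (by omega) h2 e).condLt hD hpk hDp H fun l h3 h4 => ?_
    rw [hDl l h3 h4, ← hf l h4 (by omega)]
    exact ⟨fun e => absurd (hg'.inj l (by omega) p (by omega) e) (by omega), fun x hx e =>
      absurd (hg'.inj x (by omega) l (by omega) e) (by omega)⟩

/-- Rows above `p` are covered by `out_condLt`. The arc of row `p` is composed of the moves to `g'
p` and on to `g1 p`, each of which avoids the rows below. -/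
theorem Cond.of_row (hg : IsSgn n g) (hpk : p < k) (hkn : k < n)
    (h1 : Walk n (outOps n k p) g s1 g') (h2 : Walk n (sumOps p 0 p) g' s2 g1) (hD : AbsInj D k)
    (hDp : D p = g1 p) (hDl : ∀ l, p < l → l < k → D l = g l) (H : Cond p k g1 D) :
    Cond (p + 1) k g D := by
  have hg' : IsSgn n g' := h1.isSgn (outOps_valid hpk hkn) hg
  have hf : ∀ x < k, x ≠ p → g' x = g x := fun x hx hxp => out_frame hpk h1 hx hxp
  have hO := (reach_out hg hpk hkn _).1 ⟨_, _, h1, rfl⟩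
  have hT := (reach_top hg' le_rfl (by omega) _).1 ⟨_, _, h2, rfl⟩
  refine Cond.succ (out_condLt hg hpk hkn h1 h2 hD hDp hDl H) hpk (fun l hl hlk hp => ?_) ?_
  · rw [hDl l hl hlk, hDp] at hp
    have e1 : g l ≠ g p := (hg.abs_ne (by omega) (by omega) hl.ne').1
    have e2 : g l ≠ g' p := hf l hlk hl.ne' ▸ (hg'.abs_ne (by omega) (by omega) hl.ne').1
    have e3 : ¬ cyc (g p) (g l) (g' p) := by
      rcases hO with h | h
      · rw [h]; unfold cyc; omega
      · exact h.2.1 l hl hlk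
    have e4 : g' p ≤ g1 p ∧ ¬ (g' p < g l ∧ g l < g1 p) := by
      rcases hT with h | ⟨h, x0, -, -, -, h3⟩
      · omega
      · exact ⟨h.le, hf l hlk hl.ne' ▸ (h3 l hl (by omega)).1⟩
    unfold pass at hp; unfold cyc at e3
    omega
  · intro hpk1 B
    rw [hDp] at B ⊢
    have hc0 := B.pos
    have hle := B.le
    have hbig : ∀ x, p < x → x < n → g1 p < |g x| := fun x hx hxn => by
      by_contra hcon
      have := B.le_of (hg.absInj le_rfl) (by omega) hxn (not_lt.1 hcon)
      omega
    have habs := abs_le.1 hle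
    -- All rows below `p` and all outer positions exceed `c` in absolute value. A mere change of
    -- sign meets row `p + 1` or is the exceptional case of `OutCond`; an outer value in row `p`
    -- would leave `±g p` at an outer position, where the fourth phase must not pass it.
    have hva : g' p = g p := by
      rcases hO with h | ⟨⟨x, hx, ex⟩, h3, h4⟩
      · exact h.symm
      rcases hx with rfl | ⟨hx, hxn⟩
      · rcases abs_eq_abs.1 ex with e | e
        · exact e.symm
        · exfalso
          rcases lt_or_ge (g x) 0 with h5 | h5
          · exact h4 ⟨h5, by omega, hpk1, fun y hy hyn => hle.trans_lt (hbig y (by omega) hyn)⟩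
          · refine h3 (x + 1) (by omega) hpk1 ?_
            have h6 := hbig (x + 1) (by omega) (by omega)
            have h7 := hg.ne_zero x (by omega)
            unfold cyc
            rcases abs_cases (g (x + 1)) <;> omega
      · exfalso
        have h5 := hbig x (by omega) hxn
        rw [ex] at h5
        have hne : |g' p| ≠ |g p| := fun e => by
          have := hg.inj x hxn p (by omega) (ex.trans e); omega
        obtain ⟨y, hy, ey⟩ := hg'.surj (abs_pos.2 (hg.ne_zero p (by omega))) (hg.abs_le p (by omega))
        have hyk : k ≤ y := by
          by_contra hlt
          rcases eq_or_ne y p with rfl | hyp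
          · exact hne ey
          · rw [hf y (by omega) hyp] at ey
            exact hyp (hg.inj y hy p (by omega) ey)
        rcases hT with h | ⟨h, x0, -, -, -, h6⟩
        · rw [h] at h5; rcases abs_cases (g1 p) <;> omega
        · have := h6 y (by omega) hy
          rcases abs_cases (g' p) <;> rcases abs_cases (g' y) <;> rcases abs_cases (g p) <;> omega
    -- So the chain of the fourth phase starts from `v = g p`, and `Chn.even` with `Chn.ng_eq` gives
    -- the parity. The entry of row `p` is counted iff `v` is negative.
    have hne : g' p ≠ g1 p := hva ▸ B.ne
    have hch := chn_of_walk hg' (by omega) h2 hne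
    have hev := hch.even hD hpk hDp H hc0 fun x h3 h4 => by
      obtain ⟨j, hj, e⟩ := B.full x h3 h4.le
      rcases eq_or_ne j p with rfl | hjp
      · left; rw [hva, e]
      · exact Or.inr ⟨j, by omega, by rw [hf j (by omega) hjp, e]⟩
    have hng := hch.ng_eq hc0
    rw [ng_congr (fun x hx => hf x (by omega) (by omega) : ∀ x < p, g' x = g x), hva] at hng
    rw [ng_succ]
    have h7 := hg.ne_zero p (by omega)
    rw [Nat.even_iff] at *
    split_ifs at * <;> omega

/-- Of two different values after the third phase, the smaller one is moved past the other. The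
absolute value of the latter does not occur in the rows above, so by `Chn.full` the two values are
opposite. Both final columns then have the same parity by `Chn.even`, while by `Chn.ng_eq` their
numbers of negative entries differ by one. -/
theorem row_unique (hg : IsSgn n g) (hpk : p < k) (hkn : k < n) {s1' s2' : List Bool}
    {g'' g2 : ℕ → ℤ} (h1 : Walk n (outOps n k p) g s1 g') (h2 : Walk n (sumOps p 0 p) g' s2 g1)
    (h1' : Walk n (outOps n k p) g s1' g'') (h2' : Walk n (sumOps p 0 p) g'' s2' g2)
    (hD : AbsInj D k) (hDp : D p = g1 p) (hDp' : D p = g2 p)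
    (H : Cond p k g1 D) (H' : Cond p k g2 D) : s1 = s1' ∧ s2 = s2' := by
  have hg' : IsSgn n g' := h1.isSgn (outOps_valid hpk hkn) hg
  have hg'' : IsSgn n g'' := h1'.isSgn (outOps_valid hpk hkn) hg
  have hf : ∀ x < k, x ≠ p → g' x = g x := fun x hx hxp => out_frame hpk h1 hx hxp
  have hf' : ∀ x < k, x ≠ p → g'' x = g x := fun x hx hxp => out_frame hpk h1' hx hxp
  suffices hv : g' p = g'' p by
    have := out_unique hg hpk hkn h1 h1' hv
    subst this
    have := h1.det h1'
    subst this
    exact ⟨rfl, top_unique hg' le_rfl (by omega) h2 h2' (by rw [← hDp, hDp'])⟩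
  have hmem : ∀ {t : List Bool} {f : ℕ → ℤ}, Walk n (outOps n k p) g t f → ∀ r < p, |g r| ≠ |f p| := by
    intro t f h r hr e
    obtain ⟨x, hx, e'⟩ := out_abs hg hpk hkn h
    have := hg.inj r (by omega) x (by omega) (e.trans e'.symm)
    omega
  -- the two chains
  have main : ∀ {t t' : List Bool} {f f' f1 f2 : ℕ → ℤ} {u u' : List Bool}, IsSgn n f → IsSgn n f' →
      (∀ x < k, x ≠ p → f x = g x) → (∀ x < k, x ≠ p → f' x = g x) →
      Walk n (outOps n k p) g t f → Walk n (sumOps p 0 p) f u f1 →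
      Walk n (outOps n k p) g t' f' → Walk n (sumOps p 0 p) f' u' f2 →
      D p = f1 p → D p = f2 p → Cond p k f1 D → Cond p k f2 D → ¬ f p < f' p := by
    intro t t' f f' f1 f2 u u' hf hf' ef ef' w1 w2 w1' w2' e1 e2 C1 C2 hlt
    have hle : ∀ {h h1 : ℕ → ℤ} {w : List Bool}, IsSgn n h → Walk n (sumOps p 0 p) h w h1 →
        h p ≤ h1 p := fun hh w => by
      rcases (reach_top hh le_rfl (by omega) _).1 ⟨_, _, w, rfl⟩ with h | ⟨h, -⟩
      · exact h.le
      · exact h.le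
    have hle1 := hle hf w2
    have hle2 := hle hf' w2'
    have hne1 : f p ≠ f1 p := by omega
    have ch1 := chn_of_walk hf (by omega) w2 hne1
    have hne2 : f' p ≠ f2 p := fun e => by
      obtain ⟨j, hj, e3⟩ := ch1.bot
      refine hmem w1' j hj ?_
      rw [← ef j (by omega) (by omega), e3, abs_neg, ← e1, e2, e]
    have ch2 := chn_of_walk hf' (by omega) w2' hne2
    have habs : |f' p| = |f p| := by
      rcases ch1.full (f' p) hlt (by omega) (hf'.ne_zero p (by omega)) with h | ⟨x, hx, e⟩
      · exact h
      · rw [ef x (by omega) (by omega)] at e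
        exact absurd e (hmem w1' x hx)
    have hneg : f p = -f' p := by rcases abs_eq_abs.1 habs with h | h <;> omega
    have hc0 : 0 < f1 p := by omega
    have full : ∀ x, 0 < x → x < f1 p → x = |f p| ∨ ∃ r < p, |f r| = x := fun x h3 h4 => by
      have := ch1.full x (by omega) h4 h3.ne'
      rwa [abs_of_pos h3] at this
    have ev1 := ch1.even hD hpk e1 C1 hc0 full
    have ev2 := ch2.even hD hpk e2 C2 (by omega) fun x h3 h4 => by
      rw [habs]
      rcases full x h3 (by omega) with h | ⟨r, hr, e⟩
      · exact Or.inl h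
      · exact Or.inr ⟨r, hr, by rw [ef' r (by omega) (by omega), ← ef r (by omega) (by omega), e]⟩
    have n1 := ch1.ng_eq hc0
    have n2 := ch2.ng_eq (by omega)
    rw [← e1] at n1 ev1
    rw [← e2] at n2 ev2
    rw [ng_congr (fun x hx => ef x (by omega) (by omega) : ∀ x < p, f x = g x)] at n1
    rw [ng_congr (fun x hx => ef' x (by omega) (by omega) : ∀ x < p, f' x = g x)] at n2
    rw [if_neg (by omega)] at n1
    rw [if_pos (by omega)] at n2
    rw [Nat.even_iff] at *
    omega
  have m1 := main hg' hg'' hf hf' h1 h2 h1' h2' hDp hDp' H H'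
  have m2 := main hg'' hg' hf' hf h1' h2' h1 h2 hDp' hDp H' H
  omega

end Row

/-! ### One row of the left half: sufficiency -/

section Value
variable {n k p : ℕ} {g D : ℕ → ℤ} {c : ℤ}

/-- Rows which stay inside a set of absolute values that is full cannot leave room for the entry
of row `p`. -/
theorem absurd_of_full (hD : AbsInj D k) (hpk : p < k) {lo hi : ℤ} (hlo : 0 < lo)
    (full : ∀ y, lo ≤ y → y ≤ hi → ∃ r < k, r ≠ p ∧ |g r| = y)
    (stay : ∀ r < k, r ≠ p → lo ≤ |g r| → |g r| ≤ hi → lo ≤ |D r| ∧ |D r| ≤ hi)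
    (h1 : lo ≤ |D p|) (h2 : |D p| ≤ hi) : False := by
  have := (pigeonhole (Q := (range k).erase p) (f := g) (h := D) (A := Icc lo hi) (A' := Icc lo hi)
    (fun y hy => by
      rw [mem_Icc] at hy
      obtain ⟨r, hr, hrp, e⟩ := full y hy.1 hy.2
      exact ⟨r, by simp [hr, hrp], e⟩)
    (fun r hr s hs e => hD.inj r (by simp at hr; omega) s (by simp at hs; omega) e) le_rfl
    (fun r hr h => by
      simp only [mem_erase, mem_range, mem_Icc] at hr h ⊢
      exact stay r hr.2 hr.1 h.1 h.2)).2 |D p| (mem_Icc.2 ⟨h1, h2⟩)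
  obtain ⟨r, hr, e⟩ := this
  simp only [mem_erase, mem_range] at hr
  exact hr.1 (hD.inj r hr.2 p hpk e)

/-- The absolute values in row `p` and after row `k`. -/
def Free (n k p : ℕ) (g : ℕ → ℤ) (y : ℤ) : Prop := ∃ x, (x = p ∨ k ≤ x ∧ x < n) ∧ |g x| = |y|

theorem Free.neg {y : ℤ} (h : Free n k p g y) : Free n k p g (-y) := by
  unfold Free at *; rwa [abs_neg]

theorem free_cases (hg : IsSgn n g) (hpk : p < k) (hkn : k < n) {y : ℤ} (h0 : y ≠ 0) (hy : |y| ≤ n) :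
    Free n k p g y ∨ ∃ r < k, r ≠ p ∧ |g r| = |y| := by
  obtain ⟨x, hx, e⟩ := hg.surj (abs_pos.2 h0) hy
  by_cases h : x = p ∨ k ≤ x ∧ x < n
  · exact Or.inl ⟨x, h, e⟩
  · exact Or.inr ⟨x, by omega, by omega, e⟩

theorem Free.ne (hg : IsSgn n g) (hpk : p < k) (hkn : k < n) {y : ℤ} (h : Free n k p g y) {r : ℕ}
    (hr : r < k) (hrp : r ≠ p) : g r ≠ y ∧ g r ≠ -y := by
  obtain ⟨x, hx, e⟩ := h
  have := hg.abs_ne (i := r) (j := x) (by omega) (by omega) (by omega)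
  rcases abs_eq_abs.1 e with e | e <;> rw [e] at this <;> simp_all

variable (hg : IsSgn n g) (hpk : p < k) (hkn : k < n) (hD : AbsInj D k) (hDn : ∀ x < k, |D x| ≤ n)
  (hDp : D p = c) (hDl : ∀ l, p < l → l < k → D l = g l) (H : Cond (p + 1) k g D)

include hg hpk hkn hD hDp hDl H

/-- In the exceptional case of `OutCond`, the rows up to `p` fill all levels up to `c`, and no row
above passes `c`. So the count for the rows above is even, the negative entry of row `p` makes it
odd, and this contradicts the third condition at row `p`. -/
theorem outCond_free (hc : Free n k p g c) : OutCond n k p g c := by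
  rcases eq_or_ne (g p) c with e | hne
  · exact Or.inl e
  refine Or.inr ⟨hc, fun l hl hlk hcy => H.out p l (by omega) hl hlk ?_, ?_⟩
  · rw [hDp, hDl l hl hlk]; unfold cyc at hcy; unfold pass; omega
  rintro ⟨ha, hca, hpk1, hbig⟩
  have hc0 : 0 < c := by omega
  have hF : ∀ l, p < l → l < k → c < |g l| := fun l hl hlk => by
    have h1 := H.out p l (by omega) hl hlk
    have h2 := hc.ne hg hpk hkn hlk hl.ne'
    rw [hDp, hDl l hl hlk] at h1
    unfold pass at h1
    rcases abs_cases (g l) <;> omega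
  have hT : ∀ x, 0 < x → x ≤ c → ∃ j ≤ p, |g j| = x := fun x h1 h2 => by
    have hcn := hg.abs_le p (by omega)
    rw [abs_of_neg ha] at hcn
    obtain ⟨j, hj, e⟩ := hg.surj h1 (by omega)
    refine ⟨j, ?_, e⟩
    by_contra hlt
    rcases lt_or_ge j k with h3 | h3
    · have := hF j (by omega) h3; omega
    · have := hbig j h3 hj; rw [abs_of_neg ha] at this; omega
  have hgc : ∀ j < p, |g j| ≠ c := fun j hj e => by
    have := hc.ne hg hpk hkn (r := j) (by omega) (by omega)
    rcases abs_cases (g j) <;> omega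
  have L := H.pred hpk
  have hn : ∀ j < p, ¬ pass (g j) c (D j) := fun j hj hp => by
    have B := (L.adj j p hj hj le_rfl (by rwa [hDp])).1
    rw [hDp] at B
    obtain ⟨s, hs, e⟩ := B.full c hc0 le_rfl
    exact hgc s (by omega) e
  obtain ⟨ev, full'⟩ := even_ng_lt (hg.absInj (by omega)) (hD.mono hpk.le) L.condIn hc0
    (fun x h1 h2 => by
      obtain ⟨j, hj, e⟩ := hT x h1 h2.le
      rcases eq_or_ne j p with rfl | hjp
      · rw [abs_of_neg ha] at e; omega
      · exact ⟨j, by omega, e⟩) hn hgc fun j hj e => by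
        have := hD.inj j (by omega) p hpk (by rw [e, hDp, abs_of_pos hc0]); omega
  have B : Blk g D p c := ⟨hc0, by rw [abs_of_neg ha, hca], hne, hT, full'⟩
  have := H.blk p (by omega) hpk1 (by rwa [hDp])
  rw [hDp, ng_succ, if_pos (by omega)] at this
  rw [Nat.even_iff] at *
  omega

/-- The case in which both signs of the value after the first three phases are possible. -/
theorem outCond_two {u : ℤ} (hu : Free n k p g u) (hu0 : 0 < u) (huc : u < c)
    (hfull : ∀ x, 0 < x → x ≤ c → x = u ∨ ∃ r < p, |g r| = x) {v : ℤ} (hv : |v| = u)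
    (hpar : Odd (ng g p c + ng D p c + if 0 < v then 1 else 0)) : OutCond n k p g v := by
  rcases eq_or_ne (g p) v with e | hne
  · exact Or.inl e
  have hvu : v = u ∨ v = -u := by rcases abs_cases v <;> omega
  have hF : ∀ l, p < l → l < k → c < |g l| := fun l hl hlk => by
    by_contra hcon
    rcases hfull |g l| (abs_pos.2 (hg.ne_zero l (by omega))) (by omega) with h | ⟨r, hr, h⟩
    · have := hu.ne hg hpk hkn hlk hl.ne'; rcases abs_cases (g l) <;> omega
    · have := hg.inj r (by omega) l (by omega) h; omega
  have hgu : ∀ r < p, |g r| ≠ u := fun r hr e => by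
    have := hu.ne hg hpk hkn (r := r) (by omega) (by omega)
    rcases abs_cases (g r) <;> omega
  have hap : |g p| = u ∨ c < |g p| := by
    by_contra! hcon
    rcases hfull |g p| (abs_pos.2 (hg.ne_zero p (by omega))) (by omega) with h | ⟨r, hr, h⟩
    · exact hcon.1 h
    · have := hg.inj r (by omega) p (by omega) h; omega
  -- If `|g p| = u`, then `g p = -v`, and row `p` is blocked by `c`. The third condition then asks
  -- for an even count in which `g p` is included iff `v` is positive, against `hpar`.
  have key : p + 1 < k → |g p| ≠ u := fun hpk1 hau => by
    have L := H.pred hpk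
    have hn : ∀ j < p, ¬ pass (g j) c (D j) := fun j hj hp => by
      have B := (L.adj j p hj hj le_rfl (by rwa [hDp])).1
      rw [hDp] at B
      obtain ⟨s, hs, e⟩ := B.full u hu0 huc.le
      exact hgu s (by omega) e
    have hDc : ∀ j < p, |D j| ≠ c := fun j hj e => by
      have := hD.inj j (by omega) p hpk (by rw [e, hDp, abs_of_pos (hu0.trans huc)]); omega
    have hpig := (pigeonhole (Q := range p) (f := g) (h := D) (A := (Icc 1 c).erase u)
      (A' := (Icc 1 c).erase c) (fun y hy => by
        rw [mem_erase, mem_Icc] at hy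
        rcases hfull y (by omega) hy.2.2 with h | ⟨r, hr, e⟩
        · exact absurd h hy.1
        · exact ⟨r, mem_range.2 hr, e⟩)
      (fun r hr s hs e => by
        rw [mem_range] at hr hs; exact hD.inj r (by omega) s (by omega) e)
      (by rw [card_erase_of_mem (mem_Icc.2 ⟨by omega, le_rfl⟩),
            card_erase_of_mem (mem_Icc.2 ⟨(by omega : 1 ≤ u), huc.le⟩)])
      (fun r hr h => by
        rw [mem_range] at hr
        rw [mem_erase, mem_Icc] at h ⊢
        have h1 := hn r hr
        have h2 := hDc r hr
        have h3 := hD.ne_zero r (by omega)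
        unfold pass at h1
        rcases abs_cases (g r) <;> rcases abs_cases (D r) <;> omega)).2
    have B : Blk g D p c := ⟨by omega, by omega, by rcases abs_cases (g p) <;> omega, fun x h1 h2 => by
        rcases hfull x h1 h2 with rfl | ⟨r, hr, e⟩
        · exact ⟨p, le_rfl, hau⟩
        · exact ⟨r, hr.le, e⟩, fun x h1 h2 => by
        obtain ⟨r, hr, e⟩ := hpig x (mem_erase.2 ⟨h2.ne, mem_Icc.2 ⟨h1, h2.le⟩⟩)
        exact ⟨r, mem_range.1 hr, e⟩⟩
    have := H.blk p (by omega) hpk1 (by rwa [hDp])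
    rw [hDp, ng_succ] at this
    rw [Nat.even_iff] at this
    rw [Nat.odd_iff] at hpar
    have h0 := hg.ne_zero p (by omega)
    rcases abs_cases (g p) <;> split_ifs at * <;> omega
  refine Or.inr ⟨?_, fun l hl hlk hcy => ?_, ?_⟩
  · obtain ⟨x, hx, e⟩ := hu
    exact ⟨x, hx, by rw [e, hv, abs_of_pos hu0]⟩
  · have h1 := H.out p l (by omega) hl hlk
    rw [hDp, hDl l hl hlk] at h1
    have h2 := hF l hl hlk
    have h3 := key (by omega)
    have h4 : c < |g p| := by omega
    unfold pass at h1; unfold cyc at hcy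
    rcases abs_cases (g l) <;> rcases abs_cases (g p) <;> omega
  · rintro ⟨h1, h2, h3, -⟩
    have h4 := key h3
    rw [h2, abs_neg] at hv
    exact h4 hv

include hDn in
/-- The case in which the value after the first three phases is the greatest one possible. -/
theorem exists_greatest_free (hc : ¬ Free n k p g c) (hrow : ∀ r < p, pass (g r) c (D r) → Blk g D r c) :
    ∃ v, v < c ∧ Free n k p g v ∧ (∀ y, v < y → y < c → ¬ Free n k p g y) ∧
      ∀ y, v < y → y < c → y ≠ 0 → ∀ l, p < l → l < k → g l ≠ y ∧ g l ≠ -y := by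
  have hcn : |c| ≤ n := hDp ▸ hDn p hpk
  have hc0 : c ≠ 0 := hDp ▸ hD.ne_zero p hpk
  have hDc : ∀ r < k, r ≠ p → D r ≠ c ∧ D r ≠ -c := fun r hr hrp => hDp ▸ Chn.abs_ne_of hD hpk hr hrp
  have hpa : Free n k p g (g p) := ⟨p, Or.inl rfl, rfl⟩
  have hrow0 : c < 0 → ∀ r < p, ¬ pass (g r) c (D r) := fun h r hr hp => by
    have := (hrow r hr hp).pos; omega
  have hD0 : ∀ r < k, D r ≠ 0 := hD.ne_zero
  -- some value lies below `c`
  have hex : ∃ v, v < c ∧ Free n k p g v := by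
    by_contra! hcon
    have hcc : c < 0 := by
      by_contra hlt
      rcases lt_or_ge (g p) 0 with h | h
      · exact hcon _ (by omega) hpa
      · have := hg.ne_zero p (by omega)
        exact hcon (-g p) (by omega) hpa.neg
    refine absurd_of_full (g := g) hD hpk (lo := -c) (hi := n) (by omega) (fun y h1 h2 => ?_)
      (fun r hr hrp h1 h2 => ?_) (by rw [hDp, abs_of_neg hcc]) (hDn p hpk)
    · rcases free_cases hg hpk hkn (y := -y) (by omega) (by rw [abs_neg, abs_of_nonneg] <;> omega)
        with h | ⟨r, hr, hrp, e⟩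
      · rcases eq_or_ne (-y) c with e | e
        · exact absurd (e ▸ h) hc
        · exact absurd h (hcon _ (by omega))
      · exact ⟨r, hr, hrp, by rw [e, abs_neg, abs_of_nonneg (by omega)]⟩
    · refine ⟨?_, hDn r hr⟩
      rcases lt_or_gt_of_ne hrp with h | h
      · have h3 := hrow0 hcc r h
        have h4 := hDc r hr hrp
        unfold pass at h3
        rcases abs_cases (g r) <;> rcases abs_cases (D r) <;> omega
      · rwa [hDl r h hr]
  obtain ⟨v, ⟨hvc, hv⟩, hmax⟩ := Int.exists_greatest_of_bdd
    (P := fun z => z < c ∧ Free n k p g z) ⟨c, fun z hz => hz.1.le⟩ hex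
  have hnf : ∀ y, v < y → y < c → ¬ Free n k p g y := fun y h1 h2 h3 => by
    have := hmax y ⟨h2, h3⟩; omega
  have hvn : |v| ≤ n := by obtain ⟨x, hx, e⟩ := hv; rw [← e]; exact hg.abs_le x (by omega)
  have hac : g p ≠ c := fun e => hc (e ▸ hpa)
  have hav : ¬ (v < g p ∧ g p < c) := fun h => hnf _ h.1 h.2 hpa
  -- the remaining rows
  have hF : ∀ l, p < l → l < k → g l ≠ v ∧ g l ≠ -v ∧ g l ≠ c ∧ g l ≠ -c ∧ g l ≠ g p ∧
      ¬ (v < g l ∧ g l < c) := fun l hl hlk => by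
    have h1 := H.out p l (by omega) hl hlk
    have h2 := hDc l hlk hl.ne'
    have h3 := hv.ne hg hpk hkn hlk hl.ne'
    have h4 := (hg.abs_ne (by omega) (by omega) hl.ne' : g l ≠ g p ∧ _).1
    rw [hDl l hl hlk] at h2
    rw [hDp, hDl l hl hlk] at h1
    unfold pass at h1
    omega
  refine ⟨v, hvc, hv, hnf, fun y h1 h2 h0 l hl hlk => ⟨fun e => (hF l hl hlk).2.2.2.2.2 (by omega),
    fun e => ?_⟩⟩
  obtain ⟨f1, f2, f3, f4, f5, f6⟩ := hF l hl hlk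
  have hpl : ∀ r < p, ¬ pass (g r) (g l) (D r) := fun r hr => hDl l hl hlk ▸ H.out r l (by omega) hl hlk
  have hgl : ∀ r < k, r ≠ l → g r ≠ g l ∧ g r ≠ -g l := fun r hr hrl =>
    hg.abs_ne (by omega) (by omega) hrl
  have hDg : ∀ r < k, r ≠ l → D r ≠ g l ∧ D r ≠ -g l := fun r hr hrl =>
    hDl l hl hlk ▸ Chn.abs_ne_of hD hlk hr hrl
  have hnfree : ∀ w, (v < w ∧ w ≤ c ∧ w ≠ 0) → |w| ≤ n → ∃ r < k, r ≠ p ∧ |g r| = |w| := fun w hw hwn => by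
    rcases free_cases hg hpk hkn hw.2.2 hwn with h | h
    · rcases eq_or_ne w c with e | e
      · exact absurd (e ▸ h) hc
      · exact absurd h (hnf w hw.1 (by omega))
    · exact h
  have hvn' := abs_le.1 hvn
  have hcn' := abs_le.1 hcn
  -- A lower row with entry `-y` would bound a range of absolute values that is full outside row `p`
  -- and that no row leaves, although `|c|` belongs to it. The range is `[-c, -y]`, `[1, -y]` or
  -- `[y, c]`, according to the signs.
  rcases lt_or_gt_of_ne h0 with hy | hy
  · rcases lt_or_gt_of_ne hc0 with hcc | hcc
    · refine absurd_of_full (g := g) hD hpk (lo := -c) (hi := -y) (by omega) (fun x h3 h4 => ?_)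
        (fun r hr hrp h3 h4 => ?_) (by rw [hDp, abs_of_neg hcc]) (by rw [hDp, abs_of_neg hcc]; omega)
      · obtain ⟨r, hr, hrp, e'⟩ := hnfree (-x) (by omega) (by rw [abs_neg, abs_of_pos] <;> omega)
        exact ⟨r, hr, hrp, by rw [e', abs_neg, abs_of_pos (by omega)]⟩
      · rcases lt_or_gt_of_ne hrp with h | h
        · have h5 := hrow0 hcc r h
          have h6 := hDc r hr hrp
          have h7 := hpl r h
          have h8 := hDg r hr (by omega)
          unfold pass at h5 h7
          rcases abs_cases (g r) <;> rcases abs_cases (D r) <;> omega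
        · rw [hDl r h hr]; exact ⟨h3, h4⟩
    · refine absurd_of_full (g := g) hD hpk (lo := 1) (hi := -y) (by omega) (fun x h3 h4 => ?_)
        (fun r hr hrp h3 h4 => ?_) (abs_pos.2 (hD0 p hpk)) (by rw [hDp, abs_of_pos hcc]; omega)
      · obtain ⟨r, hr, hrp, e'⟩ := hnfree (-x) (by omega) (by rw [abs_neg, abs_of_pos] <;> omega)
        exact ⟨r, hr, hrp, by rw [e', abs_neg, abs_of_pos (by omega)]⟩
      · rcases lt_or_gt_of_ne hrp with h | h
        · have h7 := hpl r h
          have h8 := hDg r hr (by omega)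
          have h9 := hD0 r hr
          unfold pass at h7
          rcases abs_cases (g r) <;> rcases abs_cases (D r) <;> omega
        · rw [hDl r h hr]; exact ⟨h3, h4⟩
  · refine absurd_of_full (g := g) hD hpk (lo := y) (hi := c) (by omega) (fun x h3 h4 => ?_)
      (fun r hr hrp h3 h4 => ?_) (by rw [hDp, abs_of_pos] <;> omega) (by rw [hDp, abs_of_pos]; omega)
    · obtain ⟨r, hr, hrp, e'⟩ := hnfree x (by omega) (by rw [abs_of_pos] <;> omega)
      exact ⟨r, hr, hrp, by rw [e', abs_of_pos (by omega)]⟩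
    · rcases lt_or_gt_of_ne hrp with h | h
      · have h5 : g r = c ∨ ¬ pass (g r) c (D r) := by
          right; intro hp
          obtain ⟨s, hs, es⟩ := (hrow r h hp).full y hy h2.le
          have := hgl s (by omega) (by omega)
          rcases abs_cases (g s) <;> omega
        have h6 := hDc r hr hrp
        have h7 := hpl r h
        have h8 := hDg r hr (by omega)
        have h9 := hgl r hr (by omega)
        have h10 : g r = c → pass (g r) c (D r) := fun e => by unfold pass; omega
        have h11 : g r ≠ c := fun e => by
          rcases h5 with h5 | h5
          · exact (hrow r h (h10 e)).ne e
          · exact h5 (h10 e)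
        unfold pass at h5 h7
        rcases abs_cases (g r) <;> rcases abs_cases (D r) <;> omega
      · rw [hDl r h hr]; exact ⟨h3, h4⟩

-- The choice of the value after the third phase. If `±c` is available, `c` itself is taken.
-- Otherwise `c` has to come from an entry `-c` above, and the value should be the greatest
-- available one below `c`; when a single level is left below `c`, its sign is chosen by parity
-- instead.
include hDn in
theorem exists_value : ∃ v, OutCond n k p g v ∧ (v = c ∨ v < c ∧ Free n k p g v ∧
    (∃ x < p, g x = -c) ∧
    (∀ y, v < y → y < c → y ≠ 0 → |y| = |v| ∨ ∃ x < p, |g x| = |y|) ∧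
    (0 < c → |v| < c → (∀ x, 0 < x → x ≤ c → x = |v| ∨ ∃ r < p, |g r| = x) →
      Odd (ng g p c + ng D p c + if 0 < v then 1 else 0))) := by
  have hcn : |c| ≤ n := hDp ▸ hDn p hpk
  have hc0 : c ≠ 0 := hDp ▸ hD.ne_zero p hpk
  by_cases hc : Free n k p g c
  · exact ⟨c, outCond_free hg hpk hkn hD hDp hDl H hc, Or.inl rfl⟩
  have hrow : ∀ r < p, pass (g r) c (D r) → Blk g D r c := fun r hr hp =>
    hDp ▸ (H.adj r p hr (by omega) (by rwa [hDp])).1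
  have hj0 : ∃ x < p, g x = -c := by
    rcases free_cases hg hpk hkn hc0 hcn with h | ⟨r, hr, hrp, e⟩
    · exact absurd h hc
    rcases lt_or_gt_of_ne hrp with h | h
    · refine ⟨r, h, (abs_eq_abs.1 e).resolve_left fun e' => ?_⟩
      have hdc : D r ≠ c := hDp ▸ (Chn.abs_ne_of hD hpk hr hrp).1
      exact (hrow r h (by unfold pass; omega)).ne e'
    · rw [← hDl r h hr, ← hDp] at e
      exact absurd (hD.inj r hr p hpk e) hrp
  -- Here `u` is the only available level below `c`, so both `u` and `-u` can be raised to `c`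
  -- without skipping a level.
  by_cases htwo : 0 < c ∧ ∃ u, Free n k p g u ∧ 0 < u ∧ u < c ∧
      ∀ x, 0 < x → x ≤ c → x = u ∨ ∃ r < p, |g r| = x
  · obtain ⟨hc1, u, hu, hu0, huc, hfull⟩ := htwo
    have hv : ∃ v, |v| = u ∧ Odd (ng g p c + ng D p c + if 0 < v then 1 else 0) := by
      rcases Nat.even_or_odd (ng g p c + ng D p c) with h | h
      · exact ⟨u, abs_of_pos hu0, by rw [if_pos hu0]; exact h.add_one⟩
      · exact ⟨-u, by rw [abs_neg, abs_of_pos hu0], by rw [if_neg (by omega)]; exact h⟩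
    obtain ⟨v, hv, hpar⟩ := hv
    refine ⟨v, outCond_two hg hpk hkn hD hDp hDl H hu hu0 huc hfull hv hpar, Or.inr
      ⟨by rcases abs_cases v <;> omega, ?_, hj0, fun y h1 h2 h0 => ?_, fun _ _ _ => hpar⟩⟩
    · obtain ⟨x, hx, e⟩ := hu
      exact ⟨x, hx, by rw [e, hv, abs_of_pos hu0]⟩
    · rw [hv]
      exact hfull |y| (abs_pos.2 h0) (by rcases abs_cases v <;> rcases abs_cases y <;> omega)
  · obtain ⟨v, hvc, hv, hmax, hF⟩ := exists_greatest_free hg hpk hkn hD hDn hDp hDl H hc hrow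
    have hvn : |v| ≤ n := by obtain ⟨x, hx, e⟩ := hv; rw [← e]; exact hg.abs_le x (by omega)
    have hvn' := abs_le.1 hvn
    have hcn' := abs_le.1 hcn
    have hpa : Free n k p g (g p) := ⟨p, Or.inl rfl, rfl⟩
    have hac : g p ≠ c := fun e => hc (e ▸ hpa)
    have hav : ¬ (v < g p ∧ g p < c) := fun h => hmax _ h.1 h.2 hpa
    have full : ∀ y, v < y → y < c → y ≠ 0 → ∃ x < p, |g x| = |y| := fun y h1 h2 h0 => by
      rcases free_cases hg hpk hkn h0 (abs_le.2 (by omega)) with h | ⟨r, hr, hrp, e⟩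
      · exact absurd h (hmax y h1 h2)
      · refine ⟨r, ?_, e⟩
        by_contra hlt
        have := hF y h1 h2 h0 r (by omega) hr
        rcases abs_eq_abs.1 e with e | e <;> omega
    have hFa : ∀ l, p < l → l < k → ¬ pass (g p) (g l) c := fun l hl hlk => by
      have := H.out p l (by omega) hl hlk
      rwa [hDp, hDl l hl hlk] at this
    refine ⟨v, ?_, Or.inr ⟨hvc, hv, hj0, fun y h1 h2 h0 => Or.inr (full y h1 h2 h0), fun h1 h2 h3 => ?_⟩⟩
    · rcases eq_or_ne (g p) v with e | hne
      · exact Or.inl e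
      refine Or.inr ⟨hv, fun l hl hlk hcy => ?_, ?_⟩
      · have := hFa l hl hlk
        unfold cyc at hcy; unfold pass at this; omega
      -- The exceptional case of `OutCond` would make `v` the only available level below `c`, which
      -- is `htwo`.
      · rintro ⟨h1, h2, h3, h4⟩
        refine htwo ⟨by omega, v, hv, by omega, hvc, fun x hx0 hxc => ?_⟩
        rcases lt_trichotomy x v with hxv | hxv | hxv
        · right
          rcases free_cases hg hpk hkn (y := x) (by omega) (by rw [abs_of_pos hx0]; omega) with
            ⟨y, hy, e⟩ | ⟨r, hr, hrp, e⟩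
          · exfalso
            rw [abs_of_pos hx0] at e
            rcases hy with rfl | ⟨hy, hyn⟩
            · rw [abs_of_neg h1] at e; omega
            · have := h4 y hy hyn; rw [abs_of_neg h1] at this; omega
          · rw [abs_of_pos hx0] at e
            refine ⟨r, ?_, e⟩
            by_contra hlt
            have := hFa r (by omega) hr
            unfold pass at this
            rcases abs_cases (g r) <;> omega
        · exact Or.inl hxv
        · right
          rcases eq_or_lt_of_le hxc with rfl | hxc
          · obtain ⟨r, hr, e⟩ := hj0
            exact ⟨r, hr, by rw [e, abs_neg, abs_of_pos hx0]⟩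
          · have := full x hxv hxc (by omega)
            rwa [abs_of_pos hx0] at this
    -- The premises of the parity clause would again give `htwo`, with `u = |v|`.
    · exact absurd ⟨h1, |v|, by
        obtain ⟨x, hx, e⟩ := hv
        exact ⟨x, hx, by rw [e, abs_abs]⟩, abs_pos.2 (by
          obtain ⟨x, hx, e⟩ := hv
          intro h; rw [h, abs_zero] at e
          exact hg.ne_zero x (by omega) (abs_eq_zero.1 e)), h2, h3⟩ htwo

-- The first three phases bring the value of `exists_value` to row `p`. The fourth raises it to `c`,
-- because the levels on the way occur in the rows above or in row `p` itself, so that no position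
-- after `p` can interfere.
include hDn in
theorem Cond.exists_row : ∃ s1 g' s2 g1, Walk n (outOps n k p) g s1 g' ∧
    Walk n (sumOps p 0 p) g' s2 g1 ∧ g1 p = c ∧ Cond p k g1 D := by
  have L := H.pred hpk
  obtain ⟨v, hO, hv⟩ := exists_value hg hpk hkn hD hDn hDp hDl H
  obtain ⟨s1, g', w1, e1⟩ := (reach_out hg hpk hkn v).2 hO
  have hg' : IsSgn n g' := w1.isSgn (outOps_valid hpk hkn) hg
  have hf : ∀ x < k, x ≠ p → g' x = g x := fun x hx hxp => out_frame hpk w1 hx hxp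
  have L' : CondLt p k g' D := L.congr fun x hx => (hf x (by omega) (by omega)).symm
  rcases hv with rfl | ⟨hvc, hv, ⟨j, hj, ej⟩, hfull, hpar⟩
  · refine ⟨s1, g', _, g', w1, Walk.skip_all _ _, e1, L'.cond (hg'.absInj (by omega)) fun x hx e => ?_⟩
    rw [hDp, ← e1] at e
    have := hg'.inj x (by omega) p (by omega) e
    omega
  · have hT : TopCond n p p g' c := Or.inr ⟨by omega, j, hj, by rw [hf j (by omega) (by omega), ej],
      fun x h1 h2 => by omega, fun x h1 h2 => by
        have key : ∀ y, |y| = |g' x| → ¬ (v < y ∧ y < c) := fun y ey hy => by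
          have h0 : y ≠ 0 := fun h => hg'.ne_zero x h2 (abs_eq_zero.1 (by rw [← ey, h, abs_zero]))
          rcases hfull y hy.1 hy.2 h0 with h | ⟨r, hr, h⟩
          · have := hg'.inj x h2 p (by omega) (by rw [← ey, h, e1]); omega
          · have := hg'.inj x h2 r (by omega) (by rw [← ey, ← h, hf r (by omega) (by omega)]); omega
        rw [e1]
        exact ⟨key _ rfl, key _ (abs_neg _)⟩⟩
    obtain ⟨s2, g1, w2, e2⟩ := (reach_top hg' le_rfl (by omega) c).2 hT
    have hch := chn_of_walk hg' (by omega) w2 (by omega)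
    rw [e1, e2] at hch
    refine ⟨s1, g', s2, g1, w1, w2, e2, hch.cond hD hpk hDp L' fun h1 h2 h3 => ?_⟩
    have hgg : ∀ x < p, g' x = g x := fun x hx => hf x (by omega) (by omega)
    rw [ng_congr hgg]
    refine hpar h1 h2 fun x h4 h5 => ?_
    rcases h3 x h4 h5 with h | ⟨r, hr, e⟩
    · exact Or.inl h
    · exact Or.inr ⟨r, hr, by rw [← hgg r hr, e]⟩

end Value

/-! ### The whole left half -/

/-- The operations of the left half of the chain, for the rows `m - 1, …, 0`. -/
def leftOps (n k : ℕ) : ℕ → List Op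
  | 0 => []
  | m + 1 => (outOps n k m ++ sumOps m 0 m) ++ leftOps n k m

theorem leftOps_valid {n k m : ℕ} (hmk : m ≤ k) (hkn : k < n) : ∀ o ∈ leftOps n k m, o.Valid n := by
  induction m with
  | zero => simp [leftOps]
  | succ m ih =>
    intro o ho
    rcases List.mem_append.1 ho with ho | ho
    · rcases List.mem_append.1 ho with ho | ho
      · exact outOps_valid (by omega) hkn o ho
      · exact sumOps_valid (by omega) (by omega) o ho
    · exact ih (by omega) o ho

theorem leftOps_frame {n k m : ℕ} {g g1 : ℕ → ℤ} {s : List Bool} (hmk : m ≤ k)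
    (h : Walk n (leftOps n k m) g s g1) {x : ℕ} (hx : m ≤ x) (hxk : x < k) : g1 x = g x := by
  induction m generalizing g s with
  | zero => cases h; rfl
  | succ m ih =>
    obtain ⟨s1, s2, g2, rfl, h1, h2⟩ := h.split
    obtain ⟨s3, s4, g3, rfl, h3, h4⟩ := h1.split
    rw [ih (by omega) h2 (by omega), sum_frame h4 x (by omega) (by omega),
      out_frame (by omega) h3 hxk (by omega)]

section Left
variable {n k m : ℕ} {g g1 D : ℕ → ℤ} {s : List Bool}

/-- `Cond.of_row` is applied backwards along the walk. At the end `Cond 0` is empty, and later rows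
are not changed any more, so they can be compared with `D` throughout. -/
theorem Cond.of_left (hg : IsSgn n g) (hmk : m ≤ k) (hkn : k < n) (h : Walk n (leftOps n k m) g s g1)
    (hD : ∀ x < k, D x = g1 x) : Cond m k g D := by
  have hg1 : IsSgn n g1 := h.isSgn (leftOps_valid hmk hkn) hg
  have hDi : AbsInj D k := ⟨fun i hi => hD i hi ▸ hg1.ne_zero i (by omega), fun i hi j hj e =>
    hg1.inj i (by omega) j (by omega) (by rwa [hD i hi, hD j hj] at e)⟩
  clear hg1
  induction m generalizing g s with
  | zero => exact ⟨fun _ _ _ h => by omega, fun _ _ h => by omega, fun _ h => by omega⟩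
  | succ m ih =>
    obtain ⟨s1, s2, g2, rfl, h1, h2⟩ := h.split
    obtain ⟨s3, s4, g3, rfl, h3, h4⟩ := h1.split
    have hg3 := h3.isSgn (outOps_valid (by omega) hkn) hg
    have hg2 := h4.isSgn (sumOps_valid (by omega) (by omega)) hg3
    have hf : ∀ x, m ≤ x → x < k → D x = g2 x := fun x hx hxk => by
      rw [hD x hxk, leftOps_frame (by omega) h2 hx hxk]
    refine Cond.of_row hg (by omega) hkn h3 h4 hDi (hf m le_rfl (by omega)) (fun l h5 h6 => ?_)
      (ih hg2 (by omega) h2)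
    rw [hf l (by omega) h6, sum_frame h4 l (by omega) (by omega), out_frame (by omega) h3 h6 (by omega)]

theorem left_unique (hg : IsSgn n g) (hmk : m ≤ k) (hkn : k < n) {s' : List Bool} {g2 : ℕ → ℤ}
    (h : Walk n (leftOps n k m) g s g1) (h' : Walk n (leftOps n k m) g s' g2)
    (e : ∀ x < k, g1 x = g2 x) : s = s' := by
  induction m generalizing g s s' with
  | zero => cases h; cases h'; rfl
  | succ m ih =>
    have hg1 : IsSgn n g1 := h.isSgn (leftOps_valid hmk hkn) hg
    obtain ⟨s1, s2, f, rfl, h1, h2⟩ := h.split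
    obtain ⟨s3, s4, f1, rfl, h3, h4⟩ := h1.split
    obtain ⟨s1', s2', f', rfl, h1', h2'⟩ := h'.split
    obtain ⟨s3', s4', f1', rfl, h3', h4'⟩ := h1'.split
    have hf := h1.isSgn (fun o ho => leftOps_valid hmk hkn o (List.mem_append_left _ ho)) hg
    have hf' := h1'.isSgn (fun o ho => leftOps_valid hmk hkn o (List.mem_append_left _ ho)) hg
    obtain ⟨rfl, rfl⟩ := row_unique hg (by omega) hkn h3 h4 h3' h4' (hg1.absInj hkn.le)
      (leftOps_frame (by omega) h2 le_rfl (by omega))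
      (by rw [e m (by omega)]; exact leftOps_frame (by omega) h2' le_rfl (by omega))
      (Cond.of_left hf (by omega) hkn h2 fun x _ => rfl)
      (Cond.of_left hf' (by omega) hkn h2' fun x hx => e x hx)
    have := h1.det h1'
    subst this
    rw [ih hf (by omega) h2 h2']

/-- With `m = k` there is no assumption on the rows, and with `m = 0` the whole column has been
reached; `Cond.exists_row` is the step. -/
theorem Cond.exists_left (hg : IsSgn n g) (hmk : m ≤ k) (hkn : k < n) (hD : AbsInj D k)
    (hDn : ∀ x < k, |D x| ≤ n) (hDg : ∀ x, m ≤ x → x < k → D x = g x) (H : Cond m k g D) :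
    ∃ s g1, Walk n (leftOps n k m) g s g1 ∧ ∀ x < k, g1 x = D x := by
  induction m generalizing g with
  | zero => exact ⟨[], g, .nil g, fun x hx => (hDg x (by omega) hx).symm⟩
  | succ m ih =>
    obtain ⟨s1, g', s2, g2, w1, w2, e, H2⟩ := H.exists_row hg (by omega) hkn hD hDn rfl
      fun l h1 h2 => hDg l h1 h2
    have hg' := w1.isSgn (outOps_valid (by omega) hkn) hg
    have hg2 := w2.isSgn (sumOps_valid (by omega) (by omega)) hg'
    obtain ⟨s3, g1, w3, e3⟩ := ih hg2 (by omega) (fun x hx hxk => by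
      rcases eq_or_lt_of_le hx with rfl | hx
      · exact e.symm
      · rw [hDg x hx hxk, sum_frame w2 x (by omega) (by omega), out_frame (by omega) w1 hxk (by omega)])
      H2
    exact ⟨_, g1, (w1.append w2).append w3, e3⟩

end Left

/-! ### The right half: balance of the negative entries -/

/-- The number of entries smaller than `-x`. -/
def negc (k : ℕ) (f : ℕ → ℤ) (x : ℤ) : ℤ := ∑ j ∈ range k, if f j < -x then 1 else 0

/-- The columns have the same absolute values, and the number of entries smaller than `-x` grows by
at most `r`, with equality for the absolute values which do not occur. -/
structure Bal (n k : ℕ) (g h : ℕ → ℤ) (r : ℤ) : Prop where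
  abs : ∀ y : ℤ, (∃ x < k, |g x| = y) ↔ ∃ x < k, |h x| = y
  le : ∀ x : ℤ, 0 ≤ x → negc k h x ≤ negc k g x + r
  eq : ∀ x : ℤ, 0 < x → x ≤ n → (∀ i < k, |g i| ≠ x) → negc k h x = negc k g x + r
  even : Even (negc k g 0 + negc k h 0 + r)

theorem Bal.refl (n k : ℕ) (g : ℕ → ℤ) : Bal n k g g 0 :=
  ⟨fun _ => Iff.rfl, fun _ _ => by omega, fun _ _ _ _ => by omega, ⟨negc k g 0, by omega⟩⟩

theorem Bal.trans {n k : ℕ} {g h f : ℕ → ℤ} {r s : ℤ} (H : Bal n k g h r) (H' : Bal n k h f s) :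
    Bal n k g f (r + s) := by
  refine ⟨fun y => (H.abs y).trans (H'.abs y), fun x hx => ?_, fun x h1 h2 h3 => ?_, ?_⟩
  · have := H.le x hx; have := H'.le x hx; omega
  · rw [H'.eq x h1 h2 fun i hi e => ?_, H.eq x h1 h2 h3]; ring
    obtain ⟨j, hj, e'⟩ := (H.abs x).2 ⟨i, hi, e⟩
    exact h3 j hj e'
  · have h1 := H.even; have h2 := H'.even
    rw [Int.even_iff] at *; omega

/-- Changing `g p` to `-g p` adds an entry below `-x` exactly for `x < g p`. An absolute value
missing from the column sits at a later position and is therefore less than `g p`, which gives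
equality. Hence `r` counts the changes of sign. -/
theorem Bal.of_sgn {n k p : ℕ} {g : ℕ → ℤ} (hg : IsSgn n g) (hpk : p < k) (hkn : k < n)
    (ok : (Op.sgn p).ok n g) : Bal n k g ((Op.sgn p).act g) 1 := by
  obtain ⟨h0, hb⟩ := ok
  have key : ∀ x, 0 ≤ x → negc k ((Op.sgn p).act g) x = negc k g x + if x < g p then 1 else 0 := by
    intro x hx
    unfold negc
    rw [← add_sum_erase _ _ (mem_range.2 hpk), ← add_sum_erase (range k) _ (mem_range.2 hpk),
      sum_congr rfl fun j hj => by rw [sgn_act_of_ne (mem_erase.1 hj).1], sgn_act_self]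
    split_ifs <;> omega
  refine ⟨fun y => exists_congr fun x => and_congr_right fun hx => ?_, fun x hx => ?_,
    fun x h1 h2 h3 => ?_, ?_⟩
  · by_cases h : x = p
    · rw [h, sgn_act_self, abs_neg]
    · rw [sgn_act_of_ne h]
  · rw [key x hx]; split_ifs <;> omega
  · obtain ⟨y, hy, e⟩ := hg.surj h1 h2
    have := hb y (by by_contra hlt; exact h3 y (by omega) e) hy
    rw [key x h1.le, if_pos (by omega)]
  · rw [key 0 le_rfl, if_pos h0, Int.even_iff]; omega

/-- Both entries become greater, so no count of entries below `-x` grows. It stays the same for the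
levels at outer positions, since no such value or its negative lies between. The number of negative
entries of the pair keeps its parity. -/
theorem Bal.of_sum {n k p j : ℕ} {g : ℕ → ℤ} (hg : IsSgn n g) (hjp : j < p) (hpk : p < k)
    (hkn : k < n) (ok : (Op.sum p j).ok n g) : Bal n k g ((Op.sum p j).act g) 0 := by
  obtain ⟨h0, -, hb⟩ := (ok_sum_of_gt hjp g).1 ok
  have hgp := hg.ne_zero p (by omega)
  have hgj := hg.ne_zero j (by omega)
  have key : ∀ x, negc k ((Op.sum p j).act g) x + ((if g p < -x then 1 else 0) + if g j < -x then 1 else 0)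
      = negc k g x + ((if -g j < -x then 1 else 0) + if -g p < -x then 1 else 0) := by
    intro x
    have hj : j ∈ (range k).erase p := by simp; omega
    unfold negc
    rw [← add_sum_erase _ _ (mem_range.2 hpk), ← add_sum_erase (range k) (fun i => if g i < -x then 1 else 0)
      (mem_range.2 hpk), ← add_sum_erase _ _ hj, ← add_sum_erase ((range k).erase p) (fun i => if g i < -x then 1 else 0) hj,
      sum_congr rfl fun i hi => by
        rw [sum_act_of_ne (mem_erase.1 (mem_erase.1 hi).2).1 (mem_erase.1 hi).1], sum_act_self,
      sum_act_right hjp.ne]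
    ring
  refine ⟨fun y => ⟨?_, ?_⟩, fun x hx => ?_, fun x h1 h2 h3 => ?_, ?_⟩
  · rintro ⟨x, hx, e⟩
    by_cases h : x = p
    · exact ⟨j, by omega, by rw [sum_act_right hjp.ne, abs_neg, ← h, e]⟩
    by_cases h' : x = j
    · exact ⟨p, hpk, by rw [sum_act_self, abs_neg, ← h', e]⟩
    · exact ⟨x, hx, by rw [sum_act_of_ne h h', e]⟩
  · rintro ⟨x, hx, e⟩
    by_cases h : x = p
    · exact ⟨j, by omega, by rw [h, sum_act_self, abs_neg] at e; exact e⟩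
    by_cases h' : x = j
    · exact ⟨p, hpk, by rw [h', sum_act_right hjp.ne, abs_neg] at e; exact e⟩
    · exact ⟨x, hx, by rwa [sum_act_of_ne h h'] at e⟩
  · have := key x
    split_ifs at this <;> omega
  · obtain ⟨y, hy, e⟩ := hg.surj h1 h2
    have hyk : k ≤ y := by by_contra hlt; exact h3 y (by omega) e
    have h4 := hb y (by omega) hy
    have h5 := h3 p hpk
    have h6 := h3 j (by omega)
    have := key x
    rcases abs_cases (g y) <;> rcases abs_cases (g p) <;> rcases abs_cases (g j) <;>
      split_ifs at this <;> omega
  · have := key 0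
    rw [Int.even_iff]
    split_ifs at this <;> omega

theorem Bal.of_top {n k p m : ℕ} {g g' : ℕ → ℤ} {s : List Bool} (hg : IsSgn n g) (hmp : m ≤ p)
    (hpk : p < k) (hkn : k < n) (h : Walk n (sumOps p 0 m) g s g') : Bal n k g g' 0 := by
  induction m generalizing g s with
  | zero => cases h; exact Bal.refl _ _ _
  | succ m ih =>
    rw [sumOps, zero_add] at h
    cases h with
    | skip h => exact ih hg (by omega) h
    | take ok h =>
      exact (Bal.of_sum hg (by omega) hpk hkn ok).trans (ih (hg.act_sum (by omega) (by omega)) (by omega) h)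

/-- The operations of the right half of the chain, for the rows `m - 1, …, 0`. -/
def rightOps : ℕ → List Op
  | 0 => []
  | m + 1 => (.sgn m :: sumOps m 0 m) ++ rightOps m

theorem rightOps_valid {n m : ℕ} (hmn : m ≤ n) : ∀ o ∈ rightOps m, o.Valid n := by
  induction m with
  | zero => simp [rightOps]
  | succ m ih =>
    intro o ho
    rcases List.mem_append.1 ho with ho | ho
    · rcases List.mem_cons.1 ho with rfl | ho
      · exact (by omega : m < n)
      · exact sumOps_valid (by omega) (by omega) o ho
    · exact ih (by omega) o ho

theorem outOps_sgn {n k p : ℕ} {g g' : ℕ → ℤ} {b : Bool} (h : Walk n [.sgn p] g [b] g') :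
    Walk n (outOps n k p) g (List.replicate (difOps p k (n - k)).length false ++
      b :: List.replicate (sumOps p k (n - k)).length false) g' := by
  refine (Walk.skip_all _ _).append ?_
  cases h with
  | skip h => cases h; exact .skip (Walk.skip_all _ _)
  | take ok h => cases h; exact .take ok (Walk.skip_all _ _)

theorem Walk.cons_inv {n : ℕ} {o : Op} {L : List Op} {g g1 : ℕ → ℤ} {s : List Bool}
    (h : Walk n (o :: L) g s g1) :
    ∃ b s2 g', s = b :: s2 ∧ Walk n [o] g [b] g' ∧ Walk n L g' s2 g1 := by
  cases h with
  | skip h => exact ⟨_, _, _, rfl, .skip (.nil _), h⟩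
  | take ok h => exact ⟨_, _, _, rfl, .take ok (.nil _), h⟩

section Right
variable {n k m : ℕ} {g g1 g2 : ℕ → ℤ} {s s' : List Bool}

/-- A right half is a left half in which the first and the third phase are skipped. So the necessary
conditions and the uniqueness are those of the left half. -/
theorem right_left (h : Walk n (rightOps m) g s g1) : ∃ s', Walk n (leftOps n k m) g s' g1 := by
  induction m generalizing g s with
  | zero => exact ⟨_, h⟩
  | succ m ih =>
    obtain ⟨s1, s2, g2, rfl, h1, h2⟩ := h.split
    obtain ⟨b, s3, g', rfl, h3, h4⟩ := h1.cons_inv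
    obtain ⟨s4, h5⟩ := ih h2
    exact ⟨_, ((outOps_sgn h3).append h4).append h5⟩

theorem right_unique (hg : IsSgn n g) (hmk : m ≤ k) (hkn : k < n)
    (h : Walk n (rightOps m) g s g1) (h' : Walk n (rightOps m) g s' g2)
    (e : ∀ x < k, g1 x = g2 x) : s = s' := by
  induction m generalizing g s s' with
  | zero => cases h; cases h'; rfl
  | succ m ih =>
    have hg1 : IsSgn n g1 := h.isSgn (rightOps_valid (by omega)) hg
    obtain ⟨s1, s2, f, rfl, h1, h2⟩ := h.split
    obtain ⟨b, s3, f1, rfl, h3, h4⟩ := h1.cons_inv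
    obtain ⟨s1', s2', f', rfl, h1', h2'⟩ := h'.split
    obtain ⟨b', s3', f1', rfl, h3', h4'⟩ := h1'.cons_inv
    have hf := h1.isSgn (fun o ho => rightOps_valid (m := m + 1) (by omega) o (List.mem_append_left _ ho)) hg
    have hf' := h1'.isSgn (fun o ho => rightOps_valid (m := m + 1) (by omega) o (List.mem_append_left _ ho)) hg
    obtain ⟨t, h5⟩ := right_left (k := k) h2
    obtain ⟨t', h5'⟩ := right_left (k := k) h2'
    obtain ⟨e1, rfl⟩ := row_unique hg (by omega) hkn (outOps_sgn h3) h4 (outOps_sgn h3') h4'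
      (hg1.absInj hkn.le) (leftOps_frame (by omega) h5 le_rfl (by omega))
      (by rw [e m (by omega)]; exact leftOps_frame (by omega) h5' le_rfl (by omega))
      (Cond.of_left hf (by omega) hkn h5 fun x _ => rfl)
      (Cond.of_left hf' (by omega) hkn h5' fun x hx => e x hx)
    obtain rfl := (List.cons.inj (List.append_cancel_left e1)).1
    have := h1.det h1'
    subst this
    rw [ih hf (by omega) h2 h2']

theorem Bal.of_right (hg : IsSgn n g) (hmk : m ≤ k) (hkn : k < n) (h : Walk n (rightOps m) g s g1) :
    ∃ r, Bal n k g g1 r := by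
  induction m generalizing g s with
  | zero => cases h; exact ⟨0, Bal.refl _ _ _⟩
  | succ m ih =>
    obtain ⟨s1, s2, f, rfl, h1, h2⟩ := h.split
    have hf := h1.isSgn (fun o ho => rightOps_valid (m := m + 1) (by omega) o (List.mem_append_left _ ho)) hg
    obtain ⟨r, H⟩ := ih hf (by omega) h2
    cases h1 with
    | skip h1 => exact ⟨_, (Bal.of_top hg le_rfl (by omega) hkn h1).trans H⟩
    | take ok h1 =>
      exact ⟨_, ((Bal.of_sgn hg (by omega) hkn ok).trans
        (Bal.of_top (hg.act_sgn (by omega)) le_rfl (by omega) hkn h1)).trans H⟩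

end Right

/-! ### The right half: rows treated without the outer positions -/

/-- Up to parity, this tells whether the arc from `a` to `d` crosses `0`. -/
def crs (a d : ℤ) : ℕ := (if d < a then 1 else 0) + (if a < 0 then 1 else 0) + if d < 0 then 1 else 0

theorem ng_eq_sum (f : ℕ → ℤ) (p : ℕ) (b : ℤ) :
    ng f p b = ∑ j ∈ range p, if -b ≤ f j ∧ f j < 0 then 1 else 0 := by
  unfold ng cnt; rw [card_filter]

theorem even_crs {p : ℕ} {g D : ℕ → ℤ} {c : ℤ}
    (h : ∀ r < p, Even (crs (g r) (D r) + (if -c ≤ g r ∧ g r < 0 then 1 else 0) +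
      if -c ≤ D r ∧ D r < 0 then 1 else 0)) :
    Even (∑ r ∈ range p, crs (g r) (D r) + ng g p c + ng D p c) := by
  rw [ng_eq_sum, ng_eq_sum, ← sum_add_distrib, ← sum_add_distrib]
  exact even_sum _ fun r hr => h r (mem_range.1 hr)

/-- A row within the level rises as an integer, so it crosses `0` iff a counted negative entry
disappears. A row outside that does not pass `c` cannot cross `0`. -/
theorem crs_even_of {a d c : ℤ} (h0 : a ≠ 0) (h0' : d ≠ 0) (hc : 0 < c)
    (hin : |a| ≤ c → |d| < c ∧ a ≤ d) (hout : |d| < c → |a| ≤ c) (hd : |d| ≠ c) (hp : |a| ≤ c ∨ ¬ pass a c d) :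
    Even (crs a d + (if -c ≤ a ∧ a < 0 then 1 else 0) + if -c ≤ d ∧ d < 0 then 1 else 0) := by
  unfold pass at hp
  unfold crs
  rw [Nat.even_iff]
  rcases abs_cases a with h1 | h1 <;> rcases abs_cases d with h2 | h2 <;>
    split_ifs <;> omega

/-- As for a full level, except that the level `u` is missing in `g` and the level `c` in `D`; the
two remaining sets are still of equal size. -/
theorem closed_of_skip {p : ℕ} {g D : ℕ → ℤ} {c u : ℤ} (hD : AbsInj D p) (hu : 0 < u) (huc : u ≤ c)
    (full : ∀ x, 0 < x → x ≤ c → x ≠ u → ∃ r < p, |g r| = x)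
    (hn : ∀ r < p, ¬ pass (g r) c (D r)) (hDc : ∀ r < p, |D r| ≠ c) (hgu : ∀ r < p, |g r| ≠ u) :
    ∀ r < p, (|g r| ≤ c → |D r| < c ∧ g r ≤ D r) ∧ (|D r| < c → |g r| ≤ c) := by
  have stay : ∀ r < p, |g r| ≤ c → |D r| < c ∧ g r ≤ D r := fun r hr h => by
    have h1 := hn r hr
    have h2 := hDc r hr
    unfold pass at h1
    rcases abs_cases (g r) <;> rcases abs_cases (D r) <;> omega
  have hpig := (pigeonhole (Q := range p) (f := g) (h := D) (A := (Icc 1 c).erase u)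
    (A' := (Icc 1 c).erase c) (fun y hy => by
      rw [mem_erase, mem_Icc] at hy
      obtain ⟨r, hr, e⟩ := full y (by omega) hy.2.2 hy.1
      exact ⟨r, mem_range.2 hr, e⟩)
    (fun r hr s hs e => by
      rw [mem_range] at hr hs; exact hD.inj r hr s hs e)
    (by rw [card_erase_of_mem (mem_Icc.2 ⟨by omega, le_rfl⟩),
          card_erase_of_mem (mem_Icc.2 ⟨(by omega : 1 ≤ u), huc⟩)])
    (fun r hr h => by
      rw [mem_range] at hr
      rw [mem_erase, mem_Icc] at h ⊢
      have h1 := (stay r hr h.2.2).1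
      have h2 := abs_pos.2 (hD.ne_zero r hr)
      omega)).1
  refine fun r hr => ⟨stay r hr, fun h => ?_⟩
  have h2 := abs_pos.2 (hD.ne_zero r hr)
  have := hpig r (mem_range.2 hr) (mem_erase.2 ⟨by omega, mem_Icc.2 ⟨by omega, h.le⟩⟩)
  rw [mem_erase, mem_Icc] at this
  exact this.2.2

/-- The invariant of the right half of the chain. -/
structure RightInv (n k : ℕ) (g D : ℕ → ℤ) : Prop where
  abs : ∀ y : ℤ, (∃ x < k, |g x| = y) ↔ ∃ x < k, |D x| = y
  free : ∀ i < k, ∀ x, k ≤ x → x < n → ¬ pass (g i) (g x) (D i) ∧ ¬ pass (g i) (-g x) (D i)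
  even : Even (∑ i ∈ range k, crs (g i) (D i))

section Row
variable {n k p : ℕ} {g g' D : ℕ → ℤ} {s : List Bool}

/-- Absolute values other than the new one in row `p` are moved to the rows after `k`. -/
theorem out_moved (hg : IsSgn n g) (hpk : p < k) (hkn : k < n) (h1 : Walk n (outOps n k p) g s g')
    {x : ℕ} (hx : x = p ∨ k ≤ x ∧ x < n) (hne : |g x| ≠ |g' p|) : ∃ y, k ≤ y ∧ y < n ∧ |g' y| = |g x| := by
  have hg' : IsSgn n g' := h1.isSgn (outOps_valid hpk hkn) hg
  obtain ⟨y, hy, ey⟩ := hg'.surj (abs_pos.2 (hg.ne_zero x (by omega))) (hg.abs_le x (by omega))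
  refine ⟨y, ?_, hy, ey⟩
  by_contra hlt
  rcases eq_or_ne y p with rfl | hyp
  · exact hne ey.symm
  · rw [out_frame hpk h1 (by omega) hyp] at ey
    have := hg.inj y hy x (by omega) ey
    omega

theorem even_negc_top {m : ℕ} (hg : IsSgn n g) (hmp : m ≤ p) (hpk : p < k) (hkn : k < n)
    (h : Walk n (sumOps p 0 m) g s g') : Even (negc k g 0 + negc k g' 0) := by
  have := (Bal.of_top hg hmp hpk hkn h).even
  rwa [add_zero] at this

variable (hg : IsSgn n g) (hpk : p < k) (hkn : k < n) (hD : AbsInj D k)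
  (hDl : ∀ l, p < l → l < k → D l = g l) (H : Cond (p + 1) k g D) (R : RightInv n k g D)

include hg hpk hkn hD hDl H R

/-- The parity argument: a level which is full except for the absolute value of row `p`. -/
theorem RightInv.parity (hp1 : p + 1 = k) (hc : 0 < D p) (hac : |g p| ≤ D p)
    (full : ∀ x, 0 < x → x ≤ D p → x ≠ |g p| → ∃ r < p, |g r| = x) :
    Even (ng g p (D p) + ng D p (D p) + crs (g p) (D p)) ∧ ∀ r < p, ¬ pass (g r) (D p) (D r) := by
  have hgp : ∀ r < p, |g r| ≠ |g p| := fun r hr e => by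
    have := hg.inj r (by omega) p (by omega) e; omega
  have hn : ∀ r < p, ¬ pass (g r) (D p) (D r) := fun r hr hp => by
    have B := (H.adj r p hr (by omega) hp).1
    obtain ⟨t, ht, e⟩ := B.full |g p| (abs_pos.2 (hg.ne_zero p (by omega))) hac
    exact hgp t (by omega) e
  have hDc : ∀ r < p, |D r| ≠ D p := fun r hr e => by
    have := hD.inj r (by omega) p hpk (by rw [e, abs_of_pos hc]); omega
  have hcl := closed_of_skip (hD.mono hpk.le) (abs_pos.2 (hg.ne_zero p (by omega))) hac full hn hDc hgp
  have := even_crs (p := p) (g := g) (D := D) (c := D p) fun r hr =>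
    crs_even_of (hg.ne_zero r (by omega)) (hD.ne_zero r (by omega)) hc (hcl r hr).1 (hcl r hr).2
      (hDc r hr) (Or.inr (hn r hr))
  have ev := R.even
  rw [← hp1, sum_range_succ] at ev
  refine ⟨?_, hn⟩
  rw [Nat.even_iff] at *
  omega

/-- By `RightInv.free` the arc of row `p` avoids all outer values and their negatives, so an outer
value cannot get into row `p`. What remains is the change of sign. Where it is not wanted, all outer
levels exceed `D p`, row `p` is the last row, and the parity of the crossings excludes it. -/
theorem RightInv.value {s1 s2 : List Bool} {g1 : ℕ → ℤ} (h1 : Walk n (outOps n k p) g s1 g')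
    (h2 : Walk n (sumOps p 0 p) g' s2 g1) (e : g1 p = D p) (C : Cond p k g1 D) :
    g' p = g p ∧ g p ≤ D p ∨ g' p = -g p ∧ (Op.sgn p).ok n g ∧ D p < g p := by
  have hg' : IsSgn n g' := h1.isSgn (outOps_valid hpk hkn) hg
  have hf : ∀ x < k, x ≠ p → g' x = g x := fun x hx hxp => out_frame hpk h1 hx hxp
  have hO := (reach_out hg hpk hkn _).1 ⟨_, _, h1, rfl⟩
  have hT := (reach_top hg' le_rfl (by omega) _).1 ⟨_, _, h2, rfl⟩
  rw [e] at hT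
  have ha0 := hg.ne_zero p (by omega)
  have hDo : ∀ x, k ≤ x → x < n → |g x| ≠ |D p| := fun x hx hxn he => by
    obtain ⟨y, hy, e'⟩ := (R.abs |D p|).2 ⟨p, hpk, rfl⟩
    have := hg.inj x hxn y (by omega) (he.trans e'.symm)
    omega
  have hT' : g' p = D p ∨ g' p < D p ∧ (∃ x0 < p, g x0 = -D p) ∧
      ∀ x, p < x → x < n → ¬ (g' p < g' x ∧ g' x < D p) ∧ ¬ (g' p < -g' x ∧ -g' x < D p) := by
    rcases hT with h | ⟨h, x0, hx0, e0, -, h3⟩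
    · exact Or.inl h
    · exact Or.inr ⟨h, ⟨x0, hx0, by rw [← hf x0 (by omega) (by omega), e0]⟩, h3⟩
  -- the remaining rows lie outside
  have hTm : ∀ x, (x = p ∨ k ≤ x ∧ x < n) → |g x| ≠ |g' p| → g' p < D p →
      ¬ (g' p < g x ∧ g x < D p) ∧ ¬ (g' p < -g x ∧ -g x < D p) := fun x hx hne hlt => by
    obtain ⟨y, hyk, hyn, ey⟩ := out_moved hg hpk hkn h1 hx hne
    rcases hT' with h | ⟨-, -, h3⟩
    · omega
    · have := h3 y (by omega) hyn
      rcases abs_eq_abs.1 ey with h | h <;> rw [h] at this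
      · exact this
      · rw [neg_neg] at this; exact this.symm
  by_cases hva : g' p = g p
  · exact Or.inl ⟨hva, by rcases hT' with h | ⟨h, -⟩ <;> omega⟩
  right
  rcases hO with h | ⟨⟨x, hx, ex⟩, h3, h4⟩
  · exact absurd h.symm hva
  by_cases habs : |g' p| = |g p|
  swap
  -- The value in row `p` would come from an outer position. Then `±g p` is moved outside and must
  -- not lie between `g' p` and `D p`, so the arc from `g p` to `D p` passes the outer value or its
  -- negative.
  · exfalso
    have hxk : k ≤ x ∧ x < n := by
      rcases hx with rfl | hx
      · exact absurd ex.symm habs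
      · exact hx
    have hvc : g' p ≠ D p := fun h => hDo x hxk.1 hxk.2 (by rw [ex, h])
    rcases hT' with h | ⟨h, ⟨j, hj, ej⟩, -⟩
    · exact hvc h
    have h5 := hTm p (Or.inl rfl) (fun h => habs h.symm) h
    have h6 : g p ≠ D p := fun h => by
      have := hg.inj j (by omega) p (by omega) (by rw [ej, h, abs_neg]); omega
    have h7 := R.free p hpk x hxk.1 hxk.2
    unfold pass at h7
    rcases abs_eq_abs.1 ex with h8 | h8 <;> rw [h8] at h7 <;> omega
  have hneg : g' p = -g p := by rcases abs_eq_abs.1 habs with h | h; exact absurd h hva; exact h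
  have hle : g' p ≤ D p := by rcases hT' with h | ⟨h, -⟩ <;> omega
  have hfree : ∀ x, k ≤ x → x < n → ¬ pass (g p) (g x) (D p) ∧ ¬ pass (g p) (-g x) (D p) :=
    fun x h1 h2 => R.free p hpk x h1 h2
  have hone : ∀ x, k ≤ x → x < n → |g x| ≠ |g p| := fun x h1 h2 e => by
    have := hg.inj x h2 p (by omega) e; omega
  -- the contradictory case
  have bad : ¬ (p + 1 = k ∧ 0 < D p ∧ |g p| ≤ D p ∧ ∀ x, k ≤ x → x < n → D p < |g x|) := by
    rintro ⟨hp1, hc, hac, hbig⟩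
    have hcn : D p ≤ n := by
      obtain ⟨y, hy, e'⟩ := (R.abs |D p|).2 ⟨p, hpk, rfl⟩
      have := hg.abs_le y (by omega)
      rw [e', abs_of_pos hc] at this; exact this
    have full : ∀ x, 0 < x → x ≤ D p → x ≠ |g p| → ∃ r < p, |g r| = x := fun x h5 h6 h7 => by
      obtain ⟨y, hy, e'⟩ := hg.surj h5 (h6.trans hcn)
      refine ⟨y, ?_, e'⟩
      by_contra hlt
      rcases eq_or_ne y p with rfl | hyp
      · exact h7 e'.symm
      · have := hbig y (by omega) hy; omega
    obtain ⟨ev, hn⟩ := R.parity hg hpk hkn hD hDl H hp1 hc hac full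
    have hgg : ∀ x < p, g' x = g x := fun x hx => hf x (by omega) (by omega)
    rcases hT' with h | ⟨h, ⟨j, hj, ej⟩, -⟩
    · have ev2 := (even_ng_lt (hg.absInj (by omega)) (hD.mono hpk.le) (H.condIn (by omega : p ≤ p + 1) hpk)
        hc (fun x h5 h6 => full x h5 h6.le (by rcases abs_cases (g p) <;> omega)) hn (fun r hr e' => by
          have := hg.inj r (by omega) p (by omega) (by rw [e']; rcases abs_cases (g p) <;> omega); omega)
        fun r hr e' => by
          have := hD.inj r (by omega) p hpk (by rw [e', abs_of_pos hc]); omega).1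
      rw [Nat.even_iff] at *
      unfold crs at ev
      split_ifs at ev <;> omega
    · have hch := chn_of_walk hg' (by omega) h2 (by omega)
      rw [e] at hch
      have ev2 := hch.even hD hpk rfl C hc fun x h5 h6 => by
        by_cases h7 : x = |g p|
        · left; rw [h7, habs]
        · obtain ⟨r, hr, e'⟩ := full x h5 h6.le h7
          exact Or.inr ⟨r, hr, by rw [hgg r hr, e']⟩
      have hng := hch.ng_eq hc
      rw [ng_congr hgg] at hng
      have h8 : g p ≠ D p := fun h => by
        have := hg.inj j (by omega) p (by omega) (by rw [ej, h, abs_neg]); omega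
      rw [Nat.even_iff] at *
      unfold crs at ev
      rcases abs_cases (g p) <;> split_ifs at ev hng <;> omega
  rcases lt_or_gt_of_ne ha0 with ha | ha
  · exfalso
    have hbig : ∀ x, k ≤ x → x < n → D p < |g x| := fun x h5 h6 => by
      have h7 := hfree x h5 h6
      have h8 := hDo x h5 h6
      unfold pass at h7
      rcases abs_cases (g x) <;> rcases abs_cases (D p) <;> omega
    refine bad ⟨?_, by omega, by rw [abs_of_neg ha]; omega, hbig⟩
    by_contra hp1
    exact h4 ⟨ha, hneg, by omega, fun x h5 h6 => by
      have := hbig x h5 h6; rw [abs_of_neg ha]; omega⟩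
  · have hF : ∀ l, p < l → l < k → |g l| < g p := fun l hl hlk => by
      have h5 := h3 l hl hlk
      have h6 := hg.abs_ne (i := l) (j := p) (by omega) (by omega) (by omega)
      unfold cyc at h5
      rcases abs_cases (g l) <;> omega
    have hac : g p ≠ D p := fun h => by
      rcases hT' with h5 | ⟨-, ⟨j, hj, ej⟩, -⟩
      · omega
      · have := hg.inj j (by omega) p (by omega) (by rw [ej, h, abs_neg]); omega
    rcases lt_or_ge (D p) (g p) with hlt | hge
    · refine ⟨hneg, ⟨ha, fun x h5 h6 => ?_⟩, hlt⟩
      rcases lt_or_ge x k with h7 | h7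
      · exact hF x h5 h7
      · have h8 := hfree x h7 h6
        have h9 := hone x h7 h6
        unfold pass at h8
        rcases abs_cases (g x) <;> rcases abs_cases (g p) <;> omega
    · exfalso
      have hbig : ∀ x, k ≤ x → x < n → D p < |g x| := fun x h5 h6 => by
        have h7 := hfree x h5 h6
        have h8 := hDo x h5 h6
        have h9 := hone x h5 h6
        have h10 := hTm x (Or.inr ⟨h5, h6⟩) (by rwa [habs]) (by omega)
        unfold pass at h7
        rcases abs_cases (g x) <;> rcases abs_cases (D p) <;> rcases abs_cases (g p) <;> omega
      refine bad ⟨?_, by omega, by rw [abs_of_pos ha]; omega, hbig⟩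
      by_contra hp1
      rcases hT' with h5 | ⟨h5, -, h6⟩
      · omega
      · have h7 := h6 (p + 1) (by omega) (by omega)
        have h8 := hF (p + 1) (by omega) (by omega)
        rw [hf (p + 1) (by omega) (by omega)] at h7
        rcases abs_cases (g (p + 1)) <;> omega

end Row

section Row
variable {n k p : ℕ} {g D : ℕ → ℤ}
variable (hg : IsSgn n g) (hpk : p < k) (hkn : k < n) (hD : AbsInj D k) (hDn : ∀ x < k, |D x| ≤ n)
  (hDl : ∀ l, p < l → l < k → D l = g l) (H : Cond (p + 1) k g D) (R : RightInv n k g D)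

include hg hpk hkn hD hDn hDl H R

/-- The left half provides a walk for row `p`; by `RightInv.value` and `out_unique` it uses at most
the reflection `ε_p` in the first three phases. The invariant survives since the arcs of the rows
above only become shorter. -/
theorem RightInv.exists_row : ∃ s g1, Walk n (.sgn p :: sumOps p 0 p) g s g1 ∧ g1 p = D p ∧
    Cond p k g1 D ∧ RightInv n k g1 D := by
  obtain ⟨s1, g', s2, g1, w1, w2, e, C⟩ := H.exists_row hg hpk hkn hD hDn rfl hDl
  have hg' : IsSgn n g' := w1.isSgn (outOps_valid hpk hkn) hg
  have hg1 : IsSgn n g1 := w2.isSgn (sumOps_valid (by omega) (by omega)) hg'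
  have hV := R.value hg hpk hkn hD hDl H w1 w2 e C
  -- the first operation suffices
  have hstep : ∃ b, Walk n [.sgn p] g [b] g' := by
    rcases hV with ⟨h, -⟩ | ⟨h, ok, -⟩
    · have w : Walk n [.sgn p] g [false] g := .skip (.nil _)
      have e1 := out_unique hg hpk hkn w1 (outOps_sgn w) h
      subst e1
      rw [w1.det (outOps_sgn w)]
      exact ⟨_, w⟩
    · have w : Walk n [.sgn p] g [true] ((Op.sgn p).act g) := .take ok (.nil _)
      have e1 := out_unique hg hpk hkn w1 (outOps_sgn w) (by rw [h, sgn_act_self])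
      subst e1
      rw [w1.det (outOps_sgn w)]
      exact ⟨_, w⟩
  obtain ⟨b, w0⟩ := hstep
  have hf : ∀ x < k, x ≠ p → g' x = g x := fun x hx hxp => out_frame hpk w1 hx hxp
  have hB : ∃ r, Bal n k g g1 r := by
    cases w0 with
    | skip h => cases h; exact ⟨_, Bal.of_top hg le_rfl hpk hkn w2⟩
    | take ok h =>
      cases h
      exact ⟨_, (Bal.of_sgn hg hpk hkn ok).trans (Bal.of_top hg' le_rfl hpk hkn w2)⟩
  obtain ⟨r, hB⟩ := hB
  -- the arcs of the first rows become shorter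
  have hshort : ∀ i < p, (∀ x, pass (g1 i) x (D i) → pass (g i) x (D i)) ∧
      (D i < g i ↔ D i < g1 i) := by
    by_cases hvc : g' p = g1 p
    · intro i hi
      rw [top_of_eq hg' (by omega) w2 hvc, hf i (by omega) (by omega)]
      exact ⟨fun _ h => h, Iff.rfl⟩
    · have hch := chn_of_walk hg' (by omega) w2 hvc
      rw [e] at hch
      have L' : CondLt p k g' D := (H.pred hpk).congr fun x hx => (hf x (by omega) (by omega)).symm
      have hpar : 0 < D p → |g' p| < D p → (∀ x, 0 < x → x ≤ D p → x = |g' p| ∨ ∃ r < p, |g' r| = x) →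
          Odd (ng g' p (D p) + ng D p (D p) + if 0 < g' p then 1 else 0) := fun h1 h2 h3 => by
        have ev := hch.even hD hpk rfl C h1 fun x h4 h5 => h3 x h4 h5.le
        have hng := hch.ng_eq h1
        rw [Nat.odd_iff]; rw [Nat.even_iff] at ev
        split_ifs at * <;> omega
      intro i hi
      have ho : g' i ≠ g1 i → ¬ (g' i ≤ D i ∧ D i < g1 i) := fun h =>
        hch.no_overshoot (hD.mono hpk) rfl L' hpar hi (Ne.symm h)
      rw [← hf i (by omega) (by omega)]
      refine ⟨fun x h => (hch.pass_back hi (fun h => ho h.symm) h).1, ?_⟩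
      by_cases h : g' i = g1 i
      · rw [h]
      · have h1 := ho h
        have h2 := (hch.step i hi (Ne.symm h)).2.1
        omega
  have hg1l : ∀ l, p < l → l < k → g1 l = g l := fun l hl hlk => by
    rw [sum_frame w2 l (by omega) (by omega), hf l hlk (by omega)]
  refine ⟨b :: s2, g1, ?_, e, C, ⟨fun y => (hB.abs y).symm.trans (R.abs y), fun i hi x hkx hxn => ?_, ?_⟩⟩
  · cases w0 with
    | skip h => cases h; exact .skip w2
    | take ok h => cases h; exact .take ok w2
  · rcases lt_trichotomy i p with h | h | h
    · have hx : ∃ y, k ≤ y ∧ y < n ∧ |g y| = |g1 x| := by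
        obtain ⟨y, hy, ey⟩ := hg.surj (abs_pos.2 (hg1.ne_zero x hxn)) (hg1.abs_le x hxn)
        refine ⟨y, ?_, hy, ey⟩
        by_contra hlt
        obtain ⟨z, hz, ez⟩ := (hB.abs _).1 ⟨y, by omega, ey⟩
        have := hg1.inj z (by omega) x hxn ez
        omega
      obtain ⟨y, h1, h2, h3⟩ := hx
      have h4 := R.free i hi y h1 h2
      have h5 := (hshort i h).1
      rcases abs_eq_abs.1 h3 with h6 | h6 <;> rw [h6] at h4
      · exact ⟨fun h => h4.1 (h5 _ h), fun h => h4.2 (h5 _ h)⟩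
      · rw [neg_neg] at h4; exact ⟨fun h => h4.2 (h5 _ h), fun h => h4.1 (h5 _ h)⟩
    · rw [h, e]; unfold pass; omega
    · rw [hDl i h hi, hg1l i h hi]; unfold pass; omega
  · have hrow : ∀ i ∈ range k, Even (((crs (g i) (D i) : ℤ) + crs (g1 i) (D i)) +
        ((if g i < -0 then 1 else 0) + (if g1 i < -0 then 1 else 0)) +
        if i = p then (if D p < g p then 1 else 0) else 0) := fun i hi => by
      rw [mem_range] at hi
      rw [Int.even_iff]
      unfold crs
      rcases lt_trichotomy i p with h | h | h
      · have h1 := (hshort i h).2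
        simp only [h1, h.ne, if_false]
        push_cast
        split_ifs <;> omega
      · subst h
        rw [e]
        push_cast
        split_ifs <;> omega
      · rw [hg1l i h hi, if_neg h.ne']; omega
    have ev := even_sum _ hrow
    simp only [sum_add_distrib] at ev
    rw [sum_ite_eq' (range k) p, if_pos (mem_range.2 hpk)] at ev
    have hev := R.even
    rw [← Int.even_coe_nat] at hev ⊢
    push_cast at hev ⊢
    -- The sign change is used exactly if the arc of row `p` wraps. It alters the number of negative
    -- entries by one, and the fourth phase preserves the parity.
    have e1 : Even (negc k g 0 + negc k g1 0 + if D p < g p then 1 else 0) := by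
      have h2 := even_negc_top hg' le_rfl hpk hkn w2
      rcases hV with ⟨h, hle⟩ | ⟨h, ok, hlt⟩
      · have hgg : g' = g := by
          cases w0 with
          | skip h => cases h; rfl
          | take ok h' =>
            cases h'
            rw [sgn_act_self] at h
            have := hg.ne_zero p (by omega); omega
        rw [hgg] at h2
        rw [if_neg (by omega)]
        simpa using h2
      · have hgg : g' = (Op.sgn p).act g := by
          cases w0 with
          | skip h' =>
            cases h'
            have := hg.ne_zero p (by omega); omega
          | take ok h' => cases h'; rfl
        have h3 := (Bal.of_sgn hg hpk hkn ok).even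
        rw [← hgg] at h3
        rw [if_pos hlt]
        rw [Int.even_iff] at *
        omega
    change Even (_ + (negc k g 0 + negc k g1 0) + _) at ev
    rw [Int.even_iff] at *
    omega

end Row

/-! ### Flow of arcs: from balance to the invariant of the right half -/

section Start
variable {n k : ℕ} {g D : ℕ → ℤ}

instance (a x d : ℤ) : Decidable (pass a x d) := by unfold pass; infer_instance

/-- The number of arcs which pass `x`. -/
def flow (k : ℕ) (g D : ℕ → ℤ) (x : ℤ) : ℤ := ∑ i ∈ range k, if pass (g i) x (D i) then 1 else 0

/-- The number of arcs which pass the end of the alphabet. -/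
def wrap (k : ℕ) (g D : ℕ → ℤ) : ℤ := ∑ i ∈ range k, if D i < g i then 1 else 0

/-- Conservation of flow: an arc from `a` to `d` passes `x` as often as it wraps, plus one if it
starts at or before `x`, minus one if it ends there. -/
theorem flow_eq (k : ℕ) (g D : ℕ → ℤ) (x : ℤ) : flow k g D x = wrap k g D +
      ((∑ i ∈ range k, if g i ≤ x then (1 : ℤ) else 0) - ∑ i ∈ range k, if D i ≤ x then (1 : ℤ) else 0) := by
  unfold flow wrap
  rw [← sum_sub_distrib, ← sum_add_distrib]
  refine sum_congr rfl fun i _ => ?_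
  unfold pass
  split_ifs <;> omega

theorem sum_le_neg (k : ℕ) (f : ℕ → ℤ) (x : ℤ) :
    (∑ i ∈ range k, if f i ≤ -x - 1 then (1 : ℤ) else 0) = negc k f x :=
  sum_congr rfl fun i _ => by split_ifs <;> omega

/-- The sum over a column only depends on the set of absolute values. -/
theorem sum_abs_eq (hg : AbsInj g k) (hD : AbsInj D k) (h : ∀ y : ℤ, (∃ x < k, |g x| = y) ↔ ∃ x < k, |D x| = y)
    (f : ℤ → ℤ) : ∑ i ∈ range k, f |g i| = ∑ i ∈ range k, f |D i| := by
  have e : ∀ {h : ℕ → ℤ}, AbsInj h k → ∑ i ∈ range k, f |h i| = ∑ y ∈ (range k).image (fun i => |h i|), f y :=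
    fun hh => (sum_image fun i hi j hj e => hh.inj i (by simpa using hi) j (by simpa using hj) e).symm
  rw [e hg, e hD]
  congr 1
  ext y
  simpa using h y

/-- The entries at most `x` that are not below `-x` are those of absolute value at most `x`, and
their number is the same for both columns. -/
theorem sum_le_pos (hg : AbsInj g k) (hD : AbsInj D k) (h : ∀ y : ℤ, (∃ x < k, |g x| = y) ↔ ∃ x < k, |D x| = y)
    {x : ℤ} (hx : 0 ≤ x) : (∑ i ∈ range k, if g i ≤ x then (1 : ℤ) else 0) -
      (∑ i ∈ range k, if D i ≤ x then (1 : ℤ) else 0) = negc k g x - negc k D x := by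
  have e : ∀ f : ℕ → ℤ, (∑ i ∈ range k, if f i ≤ x then (1 : ℤ) else 0) - negc k f x =
      ∑ i ∈ range k, (fun y => if y ≤ x then (1 : ℤ) else 0) |f i| := fun f => by
    unfold negc
    rw [← sum_sub_distrib]
    refine sum_congr rfl fun i _ => ?_
    rcases abs_cases (f i) <;> simp only <;> split_ifs <;> omega
  have h1 := e g
  rw [sum_abs_eq hg hD h (fun y => if y ≤ x then (1 : ℤ) else 0), ← e D] at h1
  omega

theorem flow_pos (hg : AbsInj g k) (hD : AbsInj D k) (h : ∀ y : ℤ, (∃ x < k, |g x| = y) ↔ ∃ x < k, |D x| = y)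
    {x : ℤ} (hx : 0 ≤ x) : flow k g D x = wrap k g D + (negc k g x - negc k D x) := by
  rw [flow_eq, sum_le_pos hg hD h hx]

theorem flow_neg (k : ℕ) (g D : ℕ → ℤ) (x : ℤ) :
    flow k g D (-x - 1) = wrap k g D + (negc k g x - negc k D x) := by
  rw [flow_eq, sum_le_neg, sum_le_neg]

theorem flow_nonneg (k : ℕ) (g D : ℕ → ℤ) (x : ℤ) : 0 ≤ flow k g D x :=
  sum_nonneg fun i _ => by split_ifs <;> omega

theorem not_pass_of_flow {x : ℤ} (h : flow k g D x = 0) {i : ℕ} (hi : i < k) : ¬ pass (g i) x (D i) := by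
  intro hp
  have := (sum_eq_zero_iff_of_nonneg (s := range k) (f := fun i => if pass (g i) x (D i) then (1 : ℤ) else 0)
    fun i _ => by split_ifs <;> omega).1 h i (mem_range.2 hi)
  simp [hp] at this

theorem even_crs_iff (hg : AbsInj g k) (hD : AbsInj D k) :
    Even (∑ i ∈ range k, crs (g i) (D i)) ↔ Even (flow k g D 0) := by
  rw [← Int.even_coe_nat]
  have : Even (((∑ i ∈ range k, crs (g i) (D i) : ℕ) : ℤ) + flow k g D 0) := by
    unfold flow
    push_cast
    rw [← sum_add_distrib]
    refine even_sum _ fun i hi => ?_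
    rw [mem_range] at hi
    have h1 := hg.ne_zero i hi
    have h2 := hD.ne_zero i hi
    rw [Int.even_iff]
    unfold pass crs
    push_cast
    split_ifs <;> omega
  exact Int.even_add.1 this

/-- At most one arc passes the last entry, and the parity is as required if there is one. -/
theorem flow_last {p : ℕ} (hg : AbsInj g (p + 1)) (hD : AbsInj D (p + 1)) (H : Cond (p + 1) (p + 1) g D) :
    flow (p + 1) g D (D p) = 0 ∨
      flow (p + 1) g D (D p) = 1 ∧ Even (∑ i ∈ range (p + 1), crs (g i) (D i)) := by
  set c := D p with hc
  have hpp : ¬ pass (g p) c (D p) := by unfold pass; omega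
  by_cases hex : ∃ j < p, pass (g j) c (D j)
  swap
  · left
    push Not at hex
    refine sum_eq_zero fun i hi => if_neg ?_
    rcases Nat.lt_succ_iff_lt_or_eq.1 (mem_range.1 hi) with h | rfl
    · exact hex i h
    · exact hpp
  right
  obtain ⟨j, hj, hjc⟩ := hex
  obtain ⟨B, ho⟩ := H.adj j p hj (by omega) hjc
  rw [← hc] at B ho
  have hc0 := B.pos
  have huniq : ∀ r < p, pass (g r) c (D r) → r = j := fun r hr hp => by
    have B' := (H.adj r p hr (by omega) hp).1
    have h1 := B.le_of hg (by omega) (x := r) (by omega) B'.le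
    have h2 := B'.le_of hg (by omega) (x := j) (by omega) B.le
    omega
  have hcl := B.closed hg hD (by omega) (Nat.lt_succ_self p) hj.le hc.symm fun r hr _ hp => by
    have := huniq r (by omega) hp; omega
  have hDc : ∀ r < p, |D r| ≠ c := fun r hr e => by
    have := hD.inj r (by omega) p (by omega) (by rw [e, ← hc, abs_of_pos hc0]); omega
  constructor
  · unfold flow
    rw [sum_eq_single j, if_pos hjc]
    · intro i hi hij
      refine if_neg fun hp => ?_
      rcases Nat.lt_succ_iff_lt_or_eq.1 (mem_range.1 hi) with h | rfl
      · exact hij (huniq i h hp)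
      · exact hpp hp
    · intro h; simp at h; omega
  · have hgp : c < |g p| := by
      by_contra hlt
      have := B.le_of hg (by omega) (Nat.lt_succ_self p) (not_lt.1 hlt)
      omega
    have hDj : c < |D j| := by
      refine lt_of_le_of_ne (not_lt.1 fun h => ?_) (hDc j hj).symm
      have := B.lt_of hD (by omega) (x := j) (by omega) h; omega
    -- The parities agree also in row `j`, the only arc over `c`: it starts within the level and
    -- ends beyond it.
    have ev := even_crs (p := p) (g := g) (D := D) (c := c) fun r hr => by
      have h1 := hg.ne_zero r (by omega)
      have h2 := hD.ne_zero r (by omega)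
      by_cases hrj : r = j
      · subst hrj
        have h3 := B.le
        have h4 := B.ne
        unfold pass at hjc
        unfold crs
        rw [Nat.even_iff]
        rcases abs_cases (g r) <;> rcases abs_cases (D r) <;> split_ifs <;> omega
      · have h3 := hcl r (by omega) hrj
        exact crs_even_of h1 h2 hc0 (fun h => ⟨h3.1.1 h, h3.2 h⟩) h3.1.2 (hDc r hr)
          (Or.inr fun h => hrj (huniq r hr h))
    obtain ⟨e1, e2⟩ := B.ng_eq hg hD (by omega) (Nat.lt_succ_self p) hj.le hc.symm
    rw [e1, e2, ng_succ, ng_succ, if_neg (by rcases abs_cases (g p) <;> omega), if_neg (by omega)] at ho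
    rw [sum_range_succ, ← hc]
    rw [Nat.even_iff] at *
    rw [Nat.odd_iff] at ho
    unfold crs at ev ⊢
    rcases abs_cases (g p) <;> split_ifs <;> omega

/-- By `Bal`, the flow over every point is at least `wrap - r`, with equality at the levels missing
from the column. The last row of the column forces this minimum to be `0`, so no arc passes an outer
value or its negative. -/
theorem RightInv.of_bal (hg : IsSgn n g) (hkn : k < n) (hD : AbsInj D k) {r : ℤ} (B : Bal n k g D r)
    (H : Cond k k g D) : RightInv n k g D := by
  obtain _ | p := k
  · exact ⟨B.abs, fun i hi => by omega, by simp⟩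
  have hgk : AbsInj g (p + 1) := hg.absInj hkn.le
  set w := wrap (p + 1) g D with hw
  have fle : ∀ x, w - r ≤ flow (p + 1) g D x := fun x => by
    rcases le_or_gt 0 x with hx | hx
    · rw [flow_pos hgk hD B.abs hx]; have := B.le x hx; omega
    · have h1 := flow_neg (p + 1) g D (-x - 1)
      rw [show -(-x - 1) - 1 = x by ring] at h1
      have := B.le (-x - 1) (by omega); omega
  have hout : ∀ x, p + 1 ≤ x → x < n → flow (p + 1) g D |g x| = w - r ∧
      flow (p + 1) g D (-|g x| - 1) = w - r := fun x h1 h2 => by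
    rw [flow_pos hgk hD B.abs (abs_nonneg _), flow_neg,
      B.eq |g x| (abs_pos.2 (hg.ne_zero x h2)) (hg.abs_le x h2) fun i hi e => by
        have := hg.inj i (by omega) x h2 e; omega]
    omega
  have hq0 : 0 ≤ w - r := (hout (p + 1) le_rfl hkn).1 ▸ flow_nonneg _ _ _ _
  have hpar : (flow (p + 1) g D 0 - (w - r)) % 2 = 0 := by
    have := B.even
    rw [flow_pos hgk hD B.abs le_rfl]
    rw [Int.even_iff] at this
    omega
  -- By `flow_last` the minimum is `0` or `1`. In the latter case the flow over `0` is even, while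
  -- `hpar` makes it congruent to the minimum.
  have hq : w - r = 0 := by
    have h1 := fle (D p)
    rcases flow_last hgk hD H with h | ⟨h, h2⟩
    · omega
    · rw [even_crs_iff hgk hD, Int.even_iff] at h2
      omega
  refine ⟨B.abs, fun i hi x h1 h2 => ?_, ?_⟩
  · have hgi : ∀ y, |y| = |g x| → g i ≠ y ∧ D i ≠ y := fun y hy => by
      constructor <;> rintro rfl
      · have := hg.inj i (by omega) x h2 hy; omega
      · obtain ⟨z, hz, e⟩ := (B.abs _).2 ⟨i, hi, rfl⟩
        have := hg.inj z (by omega) x h2 (e.trans hy); omega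
    have h3 := not_pass_of_flow ((hout x h1 h2).1.trans hq) hi
    have h4 := not_pass_of_flow ((hout x h1 h2).2.trans hq) hi
    have h5 := hgi (-|g x|) (by rw [abs_neg, abs_abs])
    unfold pass at *
    rcases abs_cases (g x) <;> omega
  · rw [even_crs_iff hgk hD, Int.even_iff]
    omega

end Start

section Right
variable {n k m : ℕ} {g D : ℕ → ℤ}

theorem RightInv.exists_right (hg : IsSgn n g) (hmk : m ≤ k) (hkn : k < n) (hD : AbsInj D k)
    (hDn : ∀ x < k, |D x| ≤ n) (hDg : ∀ x, m ≤ x → x < k → D x = g x) (H : Cond m k g D)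
    (R : RightInv n k g D) : ∃ s g1, Walk n (rightOps m) g s g1 ∧ ∀ x < k, g1 x = D x := by
  induction m generalizing g with
  | zero => exact ⟨[], g, .nil g, fun x hx => (hDg x (by omega) hx).symm⟩
  | succ m ih =>
    obtain ⟨s1, g2, w1, e, H2, R2⟩ := R.exists_row hg (by omega) hkn hD hDn
      (fun l h1 h2 => hDg l h1 h2) H
    have hg2 := w1.isSgn (fun o ho =>
      rightOps_valid (m := m + 1) (by omega) o (List.mem_append_left _ ho)) hg
    obtain ⟨s3, g1, w3, e3⟩ := ih hg2 (by omega) (fun x hx hxk => by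
      rcases eq_or_lt_of_le hx with rfl | hx
      · exact e.symm
      · obtain ⟨b, s2, g', -, h1, h2⟩ := w1.cons_inv
        obtain ⟨t, h3⟩ : ∃ t, Walk n (outOps n k m) g t g' := ⟨_, outOps_sgn h1⟩
        rw [hDg x hx hxk, sum_frame h2 x (by omega) (by omega), out_frame (by omega) h3 hxk (by omega)])
      H2 R2
    exact ⟨_, g1, w1.append w3, e3⟩

end Right

/-! ### Letters and lists of letters -/

section Letters
variable {n : ℕ}

theorem toKN_val (x : Letter n) : (toKN x : ℕ) = if (x : ℕ) < n then (x : ℕ) else x + 1 := by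
  unfold toKN
  split_ifs with h
  · rw [Fin.succAbove_of_castSucc_lt _ _ (by rw [Fin.lt_def]; exact h)]; rfl
  · rw [Fin.succAbove_of_le_castSucc _ _ (by rw [Fin.le_def]; exact not_lt.1 h)]; rfl

theorem toKN_inj {x y : Letter n} : toKN x = toKN y ↔ x = y := Fin.succAbove_right_inj

theorem toKN_rev (x : Letter n) : toKN x.rev = (toKN x).rev := by
  have := x.isLt
  apply Fin.ext
  rw [toKN_val, Fin.val_rev, Fin.val_rev, toKN_val]
  split_ifs <;> omega

theorem toKN_ne_zero (x : Letter n) : toKN x ≠ zeroL n := Fin.succAbove_ne _ _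

theorem lt_zeroL {y : KNLetter n} : y < zeroL n ↔ (y : ℕ) < n := Iff.rfl

theorem le_zeroL {y : KNLetter n} : y ≤ zeroL n ↔ (y : ℕ) ≤ n := Iff.rfl

theorem eq_zeroL {y : KNLetter n} : y = zeroL n ↔ (y : ℕ) = n := Fin.ext_iff

theorem rev_zeroL : (zeroL n).rev = zeroL n := by
  rw [eq_zeroL, Fin.val_rev]; change 2 * n + 1 - (n + 1) = n; omega

theorem rev_eq_zeroL {y : KNLetter n} : y.rev = zeroL n ↔ y = zeroL n := by
  rw [Fin.rev_eq_iff, rev_zeroL]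

theorem toKN_surj {y : KNLetter n} (hy : y ≠ zeroL n) : ∃ x, toKN x = y := Fin.exists_succAbove_eq hy

theorem abs_sg_eq {x y : Letter n} : |sg x| = |sg y| ↔ x = y ∨ x = y.rev := by
  rw [abs_eq_abs, ← sg_rev]
  exact or_congr ⟨fun h => sg_inj h, fun h => h ▸ rfl⟩ ⟨fun h => sg_inj h, fun h => h ▸ rfl⟩

theorem ne_rev (x : Letter n) : x ≠ x.rev := fun h => by
  have h1 := congrArg sg h
  rw [sg_rev] at h1
  have := sg_ne_zero x; omega

/-- The number of unbarred letters or zeros from `X` on in the list. -/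
def up (l : List (KNLetter n)) (X : ℕ) : ℕ := l.countP fun y : KNLetter n => decide (X ≤ (y : ℕ) ∧ (y : ℕ) ≤ n)

/-- The number of barred letters in the list whose absolute values come from `X` on. -/
def dn (l : List (KNLetter n)) (X : ℕ) : ℕ := l.countP fun y : KNLetter n => decide (n < (y : ℕ) ∧ (y : ℕ) + X ≤ 2 * n)

theorem up_succ (l : List (KNLetter n)) {y : KNLetter n} (hy : y ≤ zeroL n) :
    up l y = up l (y + 1) + l.count y := by
  rw [le_zeroL] at hy
  unfold up
  induction l with
  | nil => rfl
  | cons a l ih =>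
    rw [List.countP_cons, List.countP_cons, List.count_cons, ih]
    simp only [decide_eq_true_eq, beq_iff_eq, Fin.ext_iff]
    split_ifs <;> omega

theorem dn_succ (l : List (KNLetter n)) {y : KNLetter n} (hy : y < zeroL n) :
    dn l y = dn l (y + 1) + l.count y.rev := by
  rw [lt_zeroL] at hy
  unfold dn
  induction l with
  | nil => rfl
  | cons a l ih =>
    rw [List.countP_cons, List.countP_cons, List.count_cons, ih]
    simp only [decide_eq_true_eq, beq_iff_eq, Fin.ext_iff, Fin.val_rev]
    split_ifs <;> omega

theorem dn_append (l l' : List (KNLetter n)) (X : ℕ) : dn (l ++ l') X = dn l X + dn l' X :=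
  List.countP_append

theorem dn_perm {l l' : List (KNLetter n)} (h : l.Perm l') (X : ℕ) : dn l X = dn l' X := h.countP_eq _

theorem dn_eq_zero {l : List (KNLetter n)} {X : ℕ} (h : ∀ y ∈ l, n < (y : ℕ) → 2 * n < (y : ℕ) + X) :
    dn l X = 0 := by
  rw [dn, List.countP_eq_zero]
  intro y hy
  have := h y hy
  simp only [decide_eq_true_eq]; omega

theorem up_eq_zero {l : List (KNLetter n)} {X : ℕ} (h : ∀ y ∈ l, (y : ℕ) < X) : up l X = 0 := by
  rw [up, List.countP_eq_zero]
  intro y hy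
  have := h y hy
  simp only [decide_eq_true_eq]; omega

theorem dn_last (l : List (KNLetter n)) : dn l n = 0 := dn_eq_zero fun y _ h => by omega

theorem up_last (l : List (KNLetter n)) : up l n = l.count (zeroL n) := by
  have h1 : up l n = up l (n + 1) + l.count (zeroL n) := up_succ l (le_refl (zeroL n))
  have h2 : up l (n + 1) = 0 := by
    rw [up, List.countP_eq_zero]
    intro y _
    rw [decide_eq_true_eq]; omega
  rw [h1, h2, zero_add]

theorem up_zero {l : List (KNLetter n)} (h : ∀ y ∈ l, y ≤ zeroL n) : up l 0 = l.length := by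
  rw [up, List.countP_eq_length]
  intro y hy
  have := h y hy
  rw [le_zeroL] at this
  rw [decide_eq_true_eq]; omega

theorem dn_map_rev {l : List (KNLetter n)} (h : ∀ y ∈ l, y < zeroL n) (X : ℕ) :
    dn (l.map Fin.rev) X = up l X := by
  rw [dn, List.countP_map]
  refine List.countP_congr fun y hy => ?_
  have := h y hy
  rw [lt_zeroL] at this
  simp only [Function.comp, decide_eq_true_eq, Fin.val_rev]; omega

/-- In a decreasing list, an entry is at least `X` iff there are sufficiently many such entries. -/
theorem le_getElem_iff {l : List (KNLetter n)} (h : l.Pairwise (· ≥ ·)) (h0 : ∀ y ∈ l, y ≤ zeroL n)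
    {i : ℕ} (hi : i < l.length) (X : ℕ) : X ≤ (l[i] : ℕ) ↔ i < up l X := by
  induction l generalizing i with
  | nil => simp at hi
  | cons a l ih =>
    rw [List.pairwise_cons] at h
    have ha : (a : ℕ) ≤ n := h0 a List.mem_cons_self
    have e : up (a :: l) X = up l X + if X ≤ (a : ℕ) then 1 else 0 := by
      unfold up
      rw [List.countP_cons]
      simp [ha]
    rw [e]
    by_cases hX : X ≤ (a : ℕ)
    · rw [if_pos hX]
      cases i with
      | zero => simpa using hX
      | succ i =>
        simp only [List.length_cons] at hi
        rw [List.getElem_cons_succ, ih h.2 (fun y hy => h0 y (List.mem_cons_of_mem _ hy)) (by omega)]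
        omega
    · have : up l X = 0 := up_eq_zero fun y hy => by
        have := Fin.le_def.1 (h.1 y hy); omega
      rw [if_neg hX, this]
      have h1 : (((a :: l)[i] : KNLetter n) : ℕ) ≤ a := by
        cases i with
        | zero => rfl
        | succ i =>
          rw [List.getElem_cons_succ]
          exact Fin.le_def.1 (h.1 _ (List.getElem_mem _))
      omega

/-- The letters of a column. -/
def letters {k : ℕ} (C : Column n k) : List (KNLetter n) := List.ofFn fun i => toKN (C i)

theorem mem_letters {k : ℕ} {C : Column n k} {y : KNLetter n} : y ∈ letters C ↔ ∃ i, toKN (C i) = y :=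
  List.mem_ofFn

theorem zeroL_notMem_letters {k : ℕ} (C : Column n k) : zeroL n ∉ letters C := fun h => by
  obtain ⟨i, e⟩ := mem_letters.1 h
  exact toKN_ne_zero _ e

theorem length_letters {k : ℕ} (C : Column n k) : (letters C).length = k := List.length_ofFn

theorem insertionSort_eq_iff {l l' : List (KNLetter n)} :
    l.insertionSort (· ≤ ·) = l'.insertionSort (· ≤ ·) ↔ l.Perm l' := by
  constructor
  · intro h
    exact ((List.perm_insertionSort (· ≤ ·) l).symm.trans (h ▸ List.Perm.refl _)).trans
      (List.perm_insertionSort (· ≤ ·) l')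
  · intro h
    refine List.Perm.eq_of_pairwise (le := (· ≤ ·)) (fun a b _ _ h1 h2 => le_antisymm h1 h2)
      (List.pairwise_insertionSort _ _) (List.pairwise_insertionSort _ _) ?_
    exact ((List.perm_insertionSort _ l).trans h).trans (List.perm_insertionSort _ l').symm

theorem countP_ofFn {α : Type*} {k : ℕ} (f : Fin k → α) (p : α → Bool) :
    (List.ofFn f).countP p = ∑ i, if p (f i) then 1 else 0 := by
  induction k with
  | zero => simp
  | succ k ih =>
    rw [List.ofFn_succ, List.countP_cons, ih, Fin.sum_univ_succ]
    omega

variable {k : ℕ} {C C' : Column n k} {g h : ℕ → ℤ}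

/-- Absolute values are counted from `1` in `g` and from `0` in the list, so being less than `-X`
means having index at least `X`. -/
theorem negc_eq_dn (hg : ∀ i : Fin k, g i = sg (C i)) (X : ℕ) : negc k g X = dn (letters C) X := by
  unfold negc dn letters
  rw [countP_ofFn, sum_range]
  push_cast
  refine sum_congr rfl fun i _ => ?_
  have := (C i).isLt
  rw [hg]
  simp only [decide_eq_true_eq, toKN_val, sg]
  split_ifs <;> omega

theorem absInj_iff (hg : ∀ i : Fin k, g i = sg (C i)) :
    AbsInj g k ↔ (letters C).Nodup ∧ ∀ y ∈ letters C, y.rev ∉ letters C := by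
  constructor
  · intro H
    have key : ∀ i j, C i = C j ∨ C i = (C j).rev → i = j := fun i j e => by
      rw [← abs_sg_eq, ← hg, ← hg] at e
      exact Fin.ext (H.inj i i.2 j j.2 e)
    refine ⟨List.nodup_ofFn.2 fun i j e => key i j (Or.inl (toKN_inj.1 e)), fun y h1 h2 => ?_⟩
    obtain ⟨i, rfl⟩ := mem_letters.1 h1
    obtain ⟨j, e⟩ := mem_letters.1 h2
    rw [← toKN_rev, toKN_inj] at e
    have := key j i (Or.inr e)
    subst this
    exact ne_rev _ e
  · rintro ⟨h1, h2⟩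
    refine ⟨fun i hi => hg ⟨i, hi⟩ ▸ sg_ne_zero _, fun i hi j hj e => ?_⟩
    rw [show g i = sg (C ⟨i, hi⟩) from hg ⟨i, hi⟩, show g j = sg (C ⟨j, hj⟩) from hg ⟨j, hj⟩, abs_sg_eq] at e
    rcases e with e | e
    · simpa using List.nodup_ofFn.1 h1 (toKN_inj.2 e)
    · refine absurd ?_ (h2 _ (mem_letters.2 ⟨⟨j, hj⟩, rfl⟩))
      rw [← toKN_rev, ← e]
      exact mem_letters.2 ⟨_, rfl⟩

theorem abs_mem_iff (hg : ∀ i : Fin k, g i = sg (C i)) (x : Letter n) :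
    (∃ i < k, |g i| = |sg x|) ↔ toKN x ∈ letters C ∨ (toKN x).rev ∈ letters C := by
  rw [← toKN_rev, mem_letters, mem_letters]
  simp only [toKN_inj]
  constructor
  · rintro ⟨i, hi, e⟩
    rw [show g i = sg (C ⟨i, hi⟩) from hg ⟨i, hi⟩, abs_sg_eq] at e
    exact e.imp (fun h => ⟨_, h⟩) fun h => ⟨_, h⟩
  · rintro (⟨i, e⟩ | ⟨i, e⟩)
    · exact ⟨i, i.2, by rw [hg, e]⟩
    · exact ⟨i, i.2, by rw [hg, e, sg_rev, abs_neg]⟩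

/-- The version of `Bal` for lists of letters. -/
structure ListBal (l l' : List (KNLetter n)) (r : ℤ) : Prop where
  nodup : l.Nodup
  nodup' : l'.Nodup
  rev : ∀ y ∈ l, y.rev ∉ l
  rev' : ∀ y ∈ l', y.rev ∉ l'
  abs : ∀ y, (y ∈ l ∨ y.rev ∈ l) ↔ (y ∈ l' ∨ y.rev ∈ l')
  le : ∀ X ≤ n, (dn l' X : ℤ) ≤ dn l X + r
  eq : ∀ y : KNLetter n, y < zeroL n → y ∉ l → y.rev ∉ l → (dn l' (y + 1) : ℤ) = dn l (y + 1) + r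
  even : Even ((dn l 0 : ℤ) + dn l' 0 + r)

theorem ListBal.perm {l l' m m' : List (KNLetter n)} {r : ℤ} (H : ListBal l l' r) (h : l.Perm m)
    (h' : l'.Perm m') : ListBal m m' r := by
  have e := fun X => dn_perm h X
  have e' := fun X => dn_perm h' X
  refine ⟨h.nodup_iff.1 H.nodup, h'.nodup_iff.1 H.nodup', fun y => ?_, fun y => ?_, fun y => ?_,
    fun X hX => ?_, fun y => ?_, ?_⟩
  · rw [← h.mem_iff, ← h.mem_iff]; exact H.rev y
  · rw [← h'.mem_iff, ← h'.mem_iff]; exact H.rev' y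
  · rw [← h.mem_iff, ← h.mem_iff, ← h'.mem_iff, ← h'.mem_iff]; exact H.abs y
  · rw [← e, ← e']; exact H.le X hX
  · rw [← h.mem_iff, ← h.mem_iff, ← e, ← e']; exact H.eq y
  · rw [← e, ← e']; exact H.even

theorem listBal_iff (hg : ∀ i : Fin k, g i = sg (C i)) (hh : ∀ i : Fin k, h i = sg (C' i)) (r : ℤ) :
    AbsInj g k ∧ AbsInj h k ∧ Bal n k g h r ↔ ListBal (letters C) (letters C') r := by
  have e := negc_eq_dn hg
  have e' := negc_eq_dn hh
  have m := abs_mem_iff hg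
  have m' := abs_mem_iff hh
  have hsg : ∀ x : Letter n, (toKN x : ℕ) < n → |sg x| = ((toKN x : ℕ) + 1 : ℕ) := fun x hx => by
    rw [toKN_val] at hx ⊢
    simp only [sg]
    split_ifs at hx ⊢ with h1
    · rw [abs_of_nonneg (by omega)]; push_cast; rfl
    · omega
  have hlev : ∀ y : ℤ, 0 < y → y ≤ n → ∃ x : Letter n, (toKN x : ℕ) < n ∧ |sg x| = y := fun y h1 h2 => by
    obtain ⟨Y, rfl⟩ := Int.eq_ofNat_of_zero_le h1.le
    refine ⟨⟨Y - 1, by omega⟩, ?_, ?_⟩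
    · rw [toKN_val]; simp only; split_ifs <;> omega
    · simp only [sg]; rw [if_pos (by omega), abs_of_nonneg (by omega)]; omega
  have hcol : ∀ {f : ℕ → ℤ} {B : Column n k}, (∀ i : Fin k, f i = sg (B i)) → ∀ i < k, 0 < |f i| ∧ |f i| ≤ n :=
    fun hf i hi => by
      have : _ = _ := hf ⟨i, hi⟩
      simp only at this
      rw [this]; exact ⟨abs_pos.2 (sg_ne_zero _), abs_sg_le _⟩
  constructor
  · rintro ⟨h1, h2, H⟩
    obtain ⟨a1, a2⟩ := (absInj_iff hg).1 h1
    obtain ⟨b1, b2⟩ := (absInj_iff hh).1 h2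
    refine ⟨a1, b1, a2, b2, fun y => ?_, fun X _ => ?_, fun y hy h3 h4 => ?_, ?_⟩
    · by_cases hy : y = zeroL n
      · subst hy
        simp only [rev_zeroL, or_self, zeroL_notMem_letters]
      · obtain ⟨x, rfl⟩ := toKN_surj hy
        rw [← m, ← m']; exact H.abs _
    · rw [← e, ← e']; exact H.le _ (by omega)
    · obtain ⟨x, rfl⟩ := toKN_surj hy.ne
      rw [lt_zeroL] at hy
      rw [← e, ← e', ← hsg x hy]
      refine H.eq _ (abs_pos.2 (sg_ne_zero _)) (abs_sg_le _) fun i hi e1 => ?_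
      rcases (m x).1 ⟨i, hi, e1⟩ with h | h
      · exact h3 h
      · exact h4 h
    · rw [← e, ← e']; exact H.even
  · intro H
    have hr : 0 ≤ r := by
      have := H.le n le_rfl
      rw [dn_last, dn_last] at this
      omega
    refine ⟨(absInj_iff hg).2 ⟨H.nodup, H.rev⟩, (absInj_iff hh).2 ⟨H.nodup', H.rev'⟩,
      fun y => ?_, fun x hx => ?_, fun x h1 h2 h3 => ?_, ?_⟩
    · by_cases hy : 0 < y ∧ y ≤ n
      · obtain ⟨x, -, rfl⟩ := hlev y hy.1 hy.2
        rw [m, m']; exact H.abs _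
      · exact iff_of_false (fun ⟨i, hi, e1⟩ => hy (e1 ▸ hcol hg i hi)) fun ⟨i, hi, e1⟩ => hy (e1 ▸ hcol hh i hi)
    · obtain ⟨X, rfl⟩ := Int.eq_ofNat_of_zero_le hx
      rw [e, e']
      rcases le_or_gt X n with hX | hX
      · exact H.le X hX
      · rw [dn_eq_zero fun y _ h => by omega, dn_eq_zero fun y _ h => by omega]
        push_cast; omega
    · obtain ⟨x, hx, rfl⟩ := hlev x h1 h2
      have := (not_congr (m x)).1 fun ⟨i, hi, e1⟩ => h3 i hi e1
      rw [not_or] at this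
      rw [hsg x hx, e, e']
      exact H.eq _ hx this.1 this.2
    · have := H.even
      rw [← e, ← e'] at this; exact this

end Letters

/-! ### Extended split columns are balanced -/

section Split
variable {n : ℕ} {D t : List (KNLetter n)}

theorem mem_splitLetters {y : KNLetter n} : y ∈ splitLetters D ↔ y ∈ D ∧ y ≤ zeroL n ∧ y.rev ∈ D := by
  simp [splitLetters]

/-- The order of the letters in a column. -/
def KNOrd (D : List (KNLetter n)) : Prop := D.Pairwise fun x y => x < y ∨ (x = zeroL n ∧ y = zeroL n)

theorem KNOrd.count (hD : KNOrd D) {y : KNLetter n} (hy : y ≠ zeroL n) :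
    D.count y = if y ∈ D then 1 else 0 := by
  induction D with
  | nil => simp
  | cons a D ih =>
    obtain ⟨h1, h2⟩ := List.pairwise_cons.1 hD
    rw [List.count_cons, ih h2]
    by_cases hya : a = y
    · subst hya
      have : a ∉ D := fun h => by
        rcases h1 a h with h | h
        · exact lt_irrefl _ h
        · exact hy h.1
      simp [this]
    · simp [hya, Ne.symm hya]

theorem KNOrd.splitLetters (hD : KNOrd D) : (splitLetters D).Pairwise (· ≥ ·) := by
  unfold TypeB.splitLetters
  rw [List.pairwise_reverse]
  refine (List.Pairwise.filter _ hD).imp fun h => ?_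
  rcases h with h | ⟨h1, h2⟩
  · exact h.le
  · exact (h1.trans h2.symm).le

theorem KNOrd.count_splitLetters (hD : KNOrd D) {y : KNLetter n} (hy : y < zeroL n) :
    (TypeB.splitLetters D).count y = if y ∈ D ∧ y.rev ∈ D then 1 else 0 := by
  unfold TypeB.splitLetters
  rw [List.count_reverse, List.count, List.countP_filter]
  have := hD.count hy.ne
  rw [List.count] at this
  by_cases h : y.rev ∈ D
  · rw [List.countP_congr (q := (· == y)), this]
    · simp [h]
    · intro x _
      simp only [Bool.and_eq_true, beq_iff_eq, decide_eq_true_eq]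
      exact ⟨fun h => h.1, fun e => ⟨e, e ▸ hy.le, e ▸ h⟩⟩
  · rw [if_neg fun h' => h h'.2, List.countP_eq_zero]
    intro x _
    simp only [Bool.and_eq_true, beq_iff_eq, decide_eq_true_eq]
    rintro ⟨rfl, -, h'⟩
    exact h h'

theorem length_leftSplit (h : t.length = (splitLetters D).length) : (leftSplit D t).length = D.length := by
  unfold leftSplit
  rw [List.length_append, h]
  unfold splitLetters
  rw [List.length_reverse, ← List.countP_eq_length_filter, ← List.countP_eq_length_filter,
    List.length_eq_countP_add_countP (l := D) (fun x => decide (x ≤ zeroL n ∧ x.rev ∈ D)), add_comm]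
  congr 1
  refine List.countP_congr fun y hy => ?_
  simp only [decide_eq_true_eq, List.mem_reverse, List.mem_filter, hy, true_and]

theorem IsSplitting.lt (ht : IsSplitting D t) {i j : ℕ} (hij : i < j) (hj : j < t.length) : t[j] < t[i] := by
  obtain ⟨h, H⟩ := ht
  induction j with
  | zero => omega
  | succ j ih =>
    have h1 := (H (j + 1) hj).1.2.2.1 (Nat.succ_pos _)
    rcases Nat.lt_succ_iff_lt_or_eq.1 hij with h2 | rfl
    · exact h1.trans (ih h2 (by omega))
    · exact h1

theorem IsSplitting.pairwise (ht : IsSplitting D t) : t.Pairwise (· > ·) := by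
  rw [List.pairwise_iff_getElem]
  exact fun i j hi hj hij => ht.lt hij hj

theorem IsSplitting.mem (ht : IsSplitting D t) {y : KNLetter n} (hy : y ∈ t) :
    y < zeroL n ∧ y ∉ D ∧ y.rev ∉ D := by
  obtain ⟨i, hi, rfl⟩ := List.mem_iff_getElem.1 hy
  have := (ht.2 i hi).1
  exact ⟨this.1, this.2.2.2⟩

/-- Both lists decrease, and the splitting letters lie below the letters to be split term by term.
-/
theorem IsSplitting.up_le (hD : KNOrd D) (ht : IsSplitting D t) (X : ℕ) : up t X ≤ up (splitLetters D) X := by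
  rcases Nat.eq_zero_or_pos (up t X) with h | h
  · omega
  have hlen : up t X ≤ t.length := List.countP_le_length
  have h1 := (le_getElem_iff (ht.pairwise.imp le_of_lt) (fun y hy => (ht.mem hy).1.le)
    (show up t X - 1 < t.length by omega) X).2 (by omega)
  have h2 := (ht.2 (up t X - 1) (by omega)).1.2.1
  have h3 := (le_getElem_iff hD.splitLetters (fun y hy => (mem_splitLetters.1 hy).2.1)
    (show up t X - 1 < _ by rw [← ht.1]; omega) X).1 (h1.trans (Fin.le_def.1 h2.le))
  omega

/-- The greedy choice of the letters leaves no gaps. -/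
theorem IsSplitting.up_eq (hD : KNOrd D) (ht : IsSplitting D t) {y : KNLetter n} (hy : y < zeroL n)
    (h1 : y ∉ D) (h2 : y.rev ∉ D) (h3 : y ∉ t) : up t (y + 1) = up (splitLetters D) (y + 1) := by
  refine le_antisymm (ht.up_le hD _) ?_
  have hpz := hD.splitLetters
  have hz0 : ∀ y ∈ splitLetters D, y ≤ zeroL n := fun y hy => (mem_splitLetters.1 hy).2.1
  have hpt := ht.pairwise.imp (S := (· ≥ ·)) le_of_lt
  have ht0 : ∀ y ∈ t, y ≤ zeroL n := fun y hy => (ht.mem hy).1.le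
  have key : ∀ i (hi : i < t.length), i < up (splitLetters D) (y + 1) → y < t[i] := by
    intro i
    induction i with
    | zero =>
      intro hi h
      have h4 := (le_getElem_iff hpz hz0 (by rw [← ht.1]; exact hi) (y + 1)).2 h
      refine lt_of_le_of_ne ((ht.2 0 hi).2 ⟨hy, Fin.lt_def.2 h4, fun h => by omega, h1, h2⟩) fun e => ?_
      exact h3 (e ▸ List.getElem_mem _)
    | succ i ih =>
      intro hi h
      have h4 := (le_getElem_iff hpz hz0 (by rw [← ht.1]; exact hi) (y + 1)).2 h
      refine lt_of_le_of_ne ((ht.2 (i + 1) hi).2 ⟨hy, Fin.lt_def.2 h4,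
        fun _ => ih (by omega) (by omega), h1, h2⟩) fun e => ?_
      exact h3 (e ▸ List.getElem_mem _)
  rcases Nat.eq_zero_or_pos (up (splitLetters D) (y + 1)) with h | h
  · omega
  have hlen : up (splitLetters D) (y + 1) ≤ (splitLetters D).length := List.countP_le_length
  have := key (up (splitLetters D) (y + 1) - 1) (by have := ht.1; omega) (by omega)
  have := (le_getElem_iff hpt ht0 (by have := ht.1; omega) (y + 1)).1 (Fin.lt_def.1 this)
  omega

/-- The letters of the two extended split columns, before sorting. -/
def leftList (D t : List (KNLetter n)) (m : ℕ) : List (KNLetter n) :=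
  leftSplit D t ++ (extLetters D t m).map Fin.rev

/-- The letters of the right extended split column, before sorting. -/
def rightList (D t : List (KNLetter n)) (m : ℕ) : List (KNLetter n) :=
  rightSplit D t ++ extLetters D t m

theorem mem_map_rev {l : List (KNLetter n)} {y : KNLetter n} : y ∈ l.map Fin.rev ↔ y.rev ∈ l := by
  rw [List.mem_map]
  exact ⟨fun ⟨x, hx, e⟩ => by rw [← e, Fin.rev_rev]; exact hx, fun h => ⟨_, h, Fin.rev_rev y⟩⟩

theorem mem_leftSplit {y : KNLetter n} :
    y ∈ leftSplit D t ↔ (y ∈ D ∧ ¬ (y ≤ zeroL n ∧ y.rev ∈ D)) ∨ y ∈ t := by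
  unfold leftSplit
  rw [List.mem_append, List.mem_filter, decide_eq_true_eq, mem_splitLetters]
  tauto

theorem mem_rightSplit {y : KNLetter n} :
    y ∈ rightSplit D t ↔ (y ∈ D ∧ ¬ (y.rev ≤ zeroL n ∧ y.rev ∈ D)) ∨ y.rev ∈ t := by
  unfold rightSplit
  rw [List.mem_append, List.mem_filter, decide_eq_true_eq, mem_splitLetters, Fin.rev_rev, mem_map_rev]
  tauto

theorem mem_extLetters {m : ℕ} {y : KNLetter n} (h : y ∈ extLetters D t m) : y < zeroL n ∧
    y ∉ leftSplit D t ∧ y.rev ∉ leftSplit D t ∧ y ∉ rightSplit D t ∧ y.rev ∉ rightSplit D t := by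
  have := List.mem_of_mem_take h
  rw [List.mem_filter, decide_eq_true_eq] at this
  exact this.2

/-- The extension uses the smallest free letters. -/
theorem lt_of_mem_extLetters {m : ℕ} {y e : KNLetter n} (hy : y < zeroL n) (h1 : y ∉ leftSplit D t)
    (h2 : y.rev ∉ leftSplit D t) (h3 : y ∉ rightSplit D t) (h4 : y.rev ∉ rightSplit D t)
    (h5 : y ∉ extLetters D t m) (he : e ∈ extLetters D t m) : e < y := by
  unfold extLetters at h5 he
  set L := (List.finRange (2 * n + 1)).filter fun x => decide (x < zeroL n ∧
    x ∉ leftSplit D t ∧ x.rev ∉ leftSplit D t ∧ x ∉ rightSplit D t ∧ x.rev ∉ rightSplit D t) with hL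
  have hy : y ∈ L := by
    rw [hL, List.mem_filter, decide_eq_true_eq]
    exact ⟨List.mem_finRange _, hy, h1, h2, h3, h4⟩
  have hp : L.Pairwise (· < ·) := List.Pairwise.filter _ (List.pairwise_lt_finRange _)
  rw [← List.take_append_drop m L, List.mem_append] at hy
  rw [← List.take_append_drop m L, List.pairwise_append] at hp
  exact hp.2.2 e he y (hy.resolve_left h5)

theorem not_lt_both {y : KNLetter n} (h : y < zeroL n) (h' : y.rev < zeroL n) : False := by
  rw [lt_zeroL] at *; rw [Fin.val_rev] at h'; omega

theorem le_or_rev_le (y : KNLetter n) : y ≤ zeroL n ∨ y.rev ≤ zeroL n := by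
  rw [le_zeroL, le_zeroL, Fin.val_rev]; omega

theorem KNOrd.nodup_filter (hD : KNOrd D) {p : KNLetter n → Bool} (hp : zeroL n ∈ D → p (zeroL n) = false) :
    (D.filter p).Nodup := by
  rw [List.nodup_iff_count_le_one]
  intro y
  by_cases hy : y = zeroL n
  · subst hy
    rw [List.count_eq_zero.2]
    · omega
    · rw [List.mem_filter]; rintro ⟨h1, h2⟩; rw [hp h1] at h2; exact absurd h2 (by simp)
  · refine ((List.filter_sublist (p := p)).count_le _).trans ?_
    rw [hD.count hy]; split_ifs <;> omega

/-- Counting down from `n`, a barred letter is lost exactly where its partner is a split letter. The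
zeros are among the split letters without being barred, which explains the extra term. -/
theorem dn_right (hD : KNOrd D) {X : ℕ} (hX : X ≤ n) :
    dn (D.filter fun x => x.rev ∉ splitLetters D) X + up (splitLetters D) X =
      dn D X + (splitLetters D).count (zeroL n) := by
  induction hX using Nat.decreasingInduction with
  | self => rw [dn_last, dn_last, up_last]
  | of_succ X hX ih =>
    obtain ⟨y, rfl⟩ : ∃ y : KNLetter n, (y : ℕ) = X := ⟨⟨X, by omega⟩, rfl⟩
    have hy : y < zeroL n := hX
    have e1 := dn_succ (D.filter fun x => x.rev ∉ splitLetters D) hy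
    have e2 := dn_succ D hy
    have e3 := up_succ (splitLetters D) hy.le
    have hyr : y.rev ≠ zeroL n := fun h => hy.ne (rev_eq_zeroL.1 h)
    have e4 := hD.count hyr
    have e5 := hD.count_splitLetters hy
    have e6 : (D.filter fun x => x.rev ∉ splitLetters D).count y.rev =
        if y.rev ∈ D ∧ y ∉ D then 1 else 0 := by
      by_cases h : y ∈ splitLetters D
      · rw [List.count_eq_zero.2, if_neg fun h' => h'.2 (mem_splitLetters.1 h).1]
        rw [List.mem_filter, decide_eq_true_eq, Fin.rev_rev]
        exact fun h' => h'.2 h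
      · rw [List.count_filter (by rw [decide_eq_true_eq, Fin.rev_rev]; exact h), e4]
        rw [mem_splitLetters] at h
        by_cases h1 : y.rev ∈ D
        · have h2 : y ∉ D := fun h2 => h ⟨h2, hy.le, h1⟩
          rw [if_pos h1, if_pos ⟨h1, h2⟩]
        · rw [if_neg h1, if_neg fun h' => h1 h'.1]
    by_cases h1 : y.rev ∈ D <;> by_cases h2 : y ∈ D <;>
      simp only [h1, h2, and_true, and_false, not_true, not_false_eq_true, if_true, if_false] at e4 e5 e6 <;>
      omega

theorem mem_leftList {m : ℕ} {y : KNLetter n} : y ∈ leftList D t m ↔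
    (y ∈ D ∧ ¬ (y ≤ zeroL n ∧ y.rev ∈ D)) ∨ y ∈ t ∨ y.rev ∈ extLetters D t m := by
  rw [leftList, List.mem_append, mem_leftSplit, mem_map_rev, or_assoc]

theorem mem_rightList {m : ℕ} {y : KNLetter n} : y ∈ rightList D t m ↔
    (y ∈ D ∧ ¬ (y.rev ≤ zeroL n ∧ y.rev ∈ D)) ∨ y.rev ∈ t ∨ y ∈ extLetters D t m := by
  rw [rightList, List.mem_append, mem_rightSplit, or_assoc]

theorem nodup_extLetters (D t : List (KNLetter n)) (m : ℕ) : (extLetters D t m).Nodup :=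
  ((List.nodup_finRange _).filter _).sublist (List.take_sublist _ _)

theorem dn_leftList {m : ℕ} (ht : IsSplitting D t) (X : ℕ) :
    dn (leftList D t m) X = dn D X + up (extLetters D t m) X := by
  rw [leftList, leftSplit, dn_append, dn_append, dn_map_rev fun y hy => (mem_extLetters hy).1,
    dn_eq_zero (l := t) fun y hy h => by have := lt_zeroL.1 (ht.mem hy).1; omega, add_zero]
  congr 1
  unfold dn
  rw [List.countP_filter]
  refine List.countP_congr fun y _ => ?_
  simp only [Bool.and_eq_true, decide_eq_true_eq]
  refine ⟨fun h => h.1, fun h => ⟨h, fun h' => ?_⟩⟩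
  have := le_zeroL.1 (mem_splitLetters.1 h').2.1
  omega

theorem dn_rightList {m : ℕ} (hD : KNOrd D) (ht : IsSplitting D t) {X : ℕ} (hX : X ≤ n) :
    dn (rightList D t m) X + up (splitLetters D) X = dn D X + (splitLetters D).count (zeroL n) + up t X := by
  rw [rightList, rightSplit, dn_append, dn_append, dn_map_rev fun y hy => (ht.mem hy).1,
    dn_eq_zero (l := extLetters D t m) fun y hy h => by
      have := lt_zeroL.1 (mem_extLetters hy).1; omega, ← dn_right hD hX]
  omega

/-- The inequality is `IsSplitting.up_le`, so `r` is the number of zeros. At a letter missing from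
the columns there is equality, since neither the greedy splitting nor the extension by the smallest
free letters leaves a gap there. The parity is that of the number of added letters. -/
theorem ListBal.of_splitting {m : ℕ} (hD : KNOrd D) (ht : IsSplitting D t)
    (hm : Even (extLetters D t m).length) :
    ListBal (leftList D t m) (rightList D t m) ((splitLetters D).count (zeroL n)) := by
  have hmt := fun {y} => ht.mem (y := y)
  have hnt : t.Nodup := ht.pairwise.imp fun h => h.ne'
  have habs : ∀ y, (y ∈ leftList D t m ∨ y.rev ∈ leftList D t m) ↔
      (y ∈ rightList D t m ∨ y.rev ∈ rightList D t m) := fun y => by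
    rw [mem_leftList, mem_leftList, mem_rightList, mem_rightList, Fin.rev_rev]
    tauto
  refine ⟨?_, ?_, fun y h1 h2 => ?_, fun y h1 h2 => ?_, habs, fun X hX => ?_, fun y hy h1 h2 => ?_, ?_⟩
  · unfold leftList leftSplit
    refine List.nodup_append.2 ⟨List.nodup_append.2 ⟨hD.nodup_filter fun h => ?_, hnt, ?_⟩,
      (nodup_extLetters D t m).map Fin.rev_injective, ?_⟩
    · simp [mem_splitLetters, h, rev_zeroL]
    · rintro a ha b hb rfl
      exact (ht.mem hb).2.1 (List.mem_filter.1 ha).1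
    · rintro a ha b hb rfl
      rw [mem_map_rev] at hb
      have := (mem_extLetters hb).2.2.1
      rw [Fin.rev_rev] at this
      exact this ha
  · unfold rightList rightSplit
    refine List.nodup_append.2 ⟨List.nodup_append.2 ⟨hD.nodup_filter fun h => ?_,
      hnt.map Fin.rev_injective, ?_⟩, nodup_extLetters D t m, ?_⟩
    · simp [mem_splitLetters, h, rev_zeroL]
    · rintro a ha b hb rfl
      rw [mem_map_rev] at hb
      have := (ht.mem hb).2.2
      rw [Fin.rev_rev] at this
      exact this (List.mem_filter.1 ha).1
    · rintro a ha b hb rfl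
      exact (mem_extLetters hb).2.2.2.1 ha
  · have key : ∀ z, z ∈ leftSplit D t → z.rev ∉ leftSplit D t := fun z h3 h4 => by
      rw [mem_leftSplit] at h3 h4
      rw [Fin.rev_rev] at h4
      rcases h3 with ⟨h3, h3'⟩ | h3 <;> rcases h4 with ⟨h4, h4'⟩ | h4
      · exact (le_or_rev_le z).elim (fun h => h3' ⟨h, h4⟩) fun h => h4' ⟨h, h3⟩
      · have := (hmt h4).2.2; rw [Fin.rev_rev] at this; exact this h3
      · exact (hmt h3).2.2 h4
      · exact not_lt_both (hmt h3).1 (hmt h4).1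
    rw [leftList, List.mem_append, mem_map_rev] at h1 h2
    rw [Fin.rev_rev] at h2
    rcases h1 with h1 | h1 <;> rcases h2 with h2 | h2
    · exact key y h1 h2
    · exact (mem_extLetters h2).2.1 h1
    · exact (mem_extLetters h1).2.1 h2
    · exact not_lt_both (mem_extLetters h2).1 (mem_extLetters h1).1
  · have key : ∀ z, z ∈ rightSplit D t → z.rev ∉ rightSplit D t := fun z h3 h4 => by
      rw [mem_rightSplit] at h3 h4
      rw [Fin.rev_rev] at h4
      rcases h3 with ⟨h3, h3'⟩ | h3 <;> rcases h4 with ⟨h4, h4'⟩ | h4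
      · exact (le_or_rev_le z).elim (fun h => h4' ⟨h, h3⟩) fun h => h3' ⟨h, h4⟩
      · exact (hmt h4).2.1 h3
      · exact (hmt h3).2.1 h4
      · exact not_lt_both (hmt h4).1 (hmt h3).1
    rw [rightList, List.mem_append] at h1 h2
    rcases h1 with h1 | h1 <;> rcases h2 with h2 | h2
    · exact key y h1 h2
    · have := (mem_extLetters h2).2.2.2.2; rw [Fin.rev_rev] at this; exact this h1
    · exact (mem_extLetters h1).2.2.2.2 h2
    · exact not_lt_both (mem_extLetters h1).1 (mem_extLetters h2).1
  · have h1 := dn_leftList (m := m) ht X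
    have h2 := dn_rightList (m := m) hD ht hX
    have h3 := ht.up_le hD X
    omega
  · have h3 := (not_congr (habs y)).1 (not_or.2 ⟨h1, h2⟩)
    rw [not_or] at h3
    have h4 := dn_leftList (m := m) ht (y + 1)
    have h5 := dn_rightList (m := m) hD ht (X := y + 1) (lt_zeroL.1 hy)
    have hl : y ∉ leftSplit D t := fun h => h1 (List.mem_append_left _ h)
    have hl' : y.rev ∉ leftSplit D t := fun h => h2 (List.mem_append_left _ h)
    have hr : y ∉ rightSplit D t := fun h => h3.1 (List.mem_append_left _ h)
    have hr' : y.rev ∉ rightSplit D t := fun h => h3.2 (List.mem_append_left _ h)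
    have hyt : y ∉ t := fun h => hl (mem_leftSplit.2 (Or.inr h))
    have hyD : y ∉ D ∧ y.rev ∉ D := by
      simp only [mem_leftSplit, mem_rightSplit, Fin.rev_rev] at hl hl' hr hr'
      have h6 := le_or_rev_le y
      have h7 : ¬ y.rev ≤ zeroL n := fun h => by
        rw [lt_zeroL] at hy; rw [le_zeroL, Fin.val_rev] at h; omega
      tauto
    have h6 := ht.up_eq hD hy hyD.1 hyD.2 hyt
    have h7 : up (extLetters D t m) (y + 1) = 0 := up_eq_zero fun e he => by
      have := Fin.lt_def.1 (lt_of_mem_extLetters hy hl hl' hr hr'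
        (fun h => h3.1 (List.mem_append_right _ h)) he)
      omega
    omega
  · have h1 := dn_leftList (m := m) ht 0
    have h2 := dn_rightList (m := m) hD ht (Nat.zero_le n)
    rw [up_zero fun y hy => (mem_extLetters hy).1.le] at h1
    rw [up_zero fun y hy => (ht.mem hy).1.le, ht.1, up_zero fun y hy => (mem_splitLetters.1 hy).2.1] at h2
    rw [Nat.even_iff] at hm
    rw [Int.even_iff]
    omega

end Split

section Counts
variable {n : ℕ}

/-- The number of letters before `X`. -/
def lo (l : List (KNLetter n)) (X : ℕ) : ℕ := l.countP fun y : KNLetter n => decide ((y : ℕ) < X)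

/-- The number of letters after the bar of `X`. -/
def hi (l : List (KNLetter n)) (X : ℕ) : ℕ := l.countP fun y : KNLetter n => decide (2 * n < (y : ℕ) + X)

theorem lo_succ (l : List (KNLetter n)) (y : KNLetter n) : lo l (y + 1) = lo l y + l.count y := by
  unfold lo
  induction l with
  | nil => rfl
  | cons a l ih =>
    rw [List.countP_cons, List.countP_cons, List.count_cons, ih]
    simp only [decide_eq_true_eq, beq_iff_eq, Fin.ext_iff]
    split_ifs <;> omega

theorem hi_succ (l : List (KNLetter n)) (y : KNLetter n) : hi l (y + 1) = hi l y + l.count y.rev := by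
  unfold hi
  have hy := y.isLt
  induction l with
  | nil => rfl
  | cons a l ih =>
    rw [List.countP_cons, List.countP_cons, List.count_cons, ih]
    simp only [decide_eq_true_eq, beq_iff_eq, Fin.ext_iff, Fin.val_rev]
    split_ifs <;> omega

theorem lo_add_up {l : List (KNLetter n)} (h : ∀ y ∈ l, y ≤ zeroL n) (X : ℕ) : lo l X + up l X = l.length := by
  rw [List.length_eq_countP_add_countP (l := l) fun y : KNLetter n => decide ((y : ℕ) < X)]
  unfold lo up
  congr 1
  refine List.countP_congr fun y hy => ?_
  have := le_zeroL.1 (h y hy)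
  simp only [decide_eq_true_eq]
  omega

theorem KNOrd.succ_le_lo {D : List (KNLetter n)} (hD : KNOrd D) {p : ℕ} (hp : p < D.length) :
    p + 1 ≤ lo D (D[p] + 1) := by
  have h1 : (D.take (p + 1)).length = p + 1 := by rw [List.length_take]; omega
  rw [← h1]
  refine le_trans (le_of_eq ?_) ((List.take_sublist (p + 1) D).countP_le)
  rw [eq_comm, List.countP_eq_length]
  intro y hy
  obtain ⟨i, hi, rfl⟩ := List.mem_iff_getElem.1 hy
  rw [List.length_take] at hi
  rw [List.getElem_take, decide_eq_true_eq]
  rcases Nat.lt_or_ge i p with h | h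
  · rcases List.pairwise_iff_getElem.1 hD i p (by omega) hp h with h2 | ⟨h2, h3⟩
    · have := Fin.lt_def.1 h2; omega
    · rw [h2, h3]; omega
  · have : i = p := by omega
    subst this; omega

theorem KNOrd.length_sub_le_hi {D : List (KNLetter n)} (hD : KNOrd D) {q : ℕ} (hq : q < D.length)
    {y : KNLetter n} (e : D[q] = y.rev) : D.length - q ≤ hi D (y + 1) := by
  have hyl := y.isLt
  rw [← List.length_drop]
  refine le_trans (le_of_eq ?_) ((List.drop_sublist q D).countP_le)
  rw [eq_comm, List.countP_eq_length]
  intro z hz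
  obtain ⟨i, hi, rfl⟩ := List.mem_iff_getElem.1 hz
  rw [List.length_drop] at hi
  rw [List.getElem_drop, decide_eq_true_eq]
  have hv : (D[q] : ℕ) = 2 * n + 1 - (y + 1) := by rw [e, Fin.val_rev]
  rcases Nat.eq_zero_or_pos i with rfl | h
  · simp only [add_zero]; omega
  · rcases List.pairwise_iff_getElem.1 hD q (q + i) hq (by omega) (by omega) with h2 | ⟨h2, h3⟩
    · have := Fin.lt_def.1 h2; omega
    · rw [h3, ← h2]; omega

end Counts

/-! ### Reconstruction of the column from a balanced pair -/

/-- The minimum of the first values of a sequence. -/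
def runMin (F : ℕ → ℤ) : ℕ → ℤ
  | 0 => F 0
  | X + 1 => min (runMin F X) (F (X + 1))

theorem runMin_le (F : ℕ → ℤ) (X : ℕ) : runMin F X ≤ F X := by
  cases X with
  | zero => exact le_rfl
  | succ X => exact min_le_right _ _

theorem runMin_antitone (F : ℕ → ℤ) {X Y : ℕ} (h : X ≤ Y) : runMin F Y ≤ runMin F X := by
  induction Y, h using Nat.le_induction with
  | base => exact le_rfl
  | succ Y _ ih => exact (min_le_left _ _).trans ih

section Construct
variable {n : ℕ} {l l' : List (KNLetter n)} {r : ℤ}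

/-- The difference of the numbers of barred letters from `X` on, shifted by `r`. -/
def excess (l l' : List (KNLetter n)) (r : ℤ) (X : ℕ) : ℤ := dn l X - dn l' X + r

/-- The letters added by the extension. -/
abbrev IsExt (l l' : List (KNLetter n)) (r : ℤ) (y : ℕ) : Prop :=
  excess l l' r (y + 1) < runMin (excess l l' r) y

/-- The unbarred part of the column. -/
def posPart (l l' : List (KNLetter n)) (r : ℤ) : List (KNLetter n) :=
  (List.finRange (2 * n + 1)).filter fun y => y < zeroL n ∧ y ∈ l' ∧ ¬ IsExt l l' r y

/-- The barred part of the column. -/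
def negPart (l l' : List (KNLetter n)) (r : ℤ) : List (KNLetter n) :=
  (List.finRange (2 * n + 1)).filter fun y => zeroL n < y ∧ y ∈ l ∧ ¬ IsExt l l' r y.rev

/-- The column of which `l` and `l'` are the extended split columns. -/
def baseCol (l l' : List (KNLetter n)) (r : ℤ) : List (KNLetter n) :=
  posPart l l' r ++ (List.replicate r.toNat (zeroL n) ++ negPart l l' r)

/-- The letters used for splitting. -/
def splitList (l l' : List (KNLetter n)) : List (KNLetter n) :=
  ((List.finRange (2 * n + 1)).filter fun y => y < zeroL n ∧ y ∈ l ∧ y.rev ∈ l').reverse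

/-- The letters used for extending. -/
def extList (l l' : List (KNLetter n)) (r : ℤ) : List (KNLetter n) :=
  (List.finRange (2 * n + 1)).filter fun y => y < zeroL n ∧ IsExt l l' r y

theorem mem_posPart {y : KNLetter n} : y ∈ posPart l l' r ↔ y < zeroL n ∧ y ∈ l' ∧ ¬ IsExt l l' r y := by
  rw [posPart, List.mem_filter, decide_eq_true_eq]
  exact and_iff_right (List.mem_finRange _)

theorem mem_negPart {y : KNLetter n} :
    y ∈ negPart l l' r ↔ zeroL n < y ∧ y ∈ l ∧ ¬ IsExt l l' r y.rev := by
  rw [negPart, List.mem_filter, decide_eq_true_eq]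
  exact and_iff_right (List.mem_finRange _)

theorem mem_splitList {y : KNLetter n} : y ∈ splitList l l' ↔ y < zeroL n ∧ y ∈ l ∧ y.rev ∈ l' := by
  rw [splitList, List.mem_reverse, List.mem_filter, decide_eq_true_eq]
  exact and_iff_right (List.mem_finRange _)

theorem mem_extList {y : KNLetter n} : y ∈ extList l l' r ↔ y < zeroL n ∧ IsExt l l' r y := by
  rw [extList, List.mem_filter, decide_eq_true_eq]
  exact and_iff_right (List.mem_finRange _)

theorem lt_rev_zeroL {y : KNLetter n} : zeroL n < y.rev ↔ y < zeroL n := by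
  rw [Fin.lt_def, Fin.lt_def, Fin.val_rev]; change n < _ ↔ _ < n; omega

theorem mem_baseCol {y : KNLetter n} (hy : y < zeroL n) :
    y ∈ baseCol l l' r ↔ y ∈ l' ∧ ¬ IsExt l l' r y := by
  rw [baseCol, List.mem_append, List.mem_append, mem_posPart, mem_negPart, List.mem_replicate]
  have h1 := hy.ne
  have h2 := hy.not_gt
  tauto

theorem rev_mem_baseCol {y : KNLetter n} (hy : y < zeroL n) :
    y.rev ∈ baseCol l l' r ↔ y.rev ∈ l ∧ ¬ IsExt l l' r y := by
  have h0 := lt_rev_zeroL.2 hy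
  rw [baseCol, List.mem_append, List.mem_append, mem_posPart, mem_negPart, List.mem_replicate, Fin.rev_rev]
  have h1 := h0.ne'
  have h2 := h0.not_gt
  tauto

theorem knOrd_baseCol : KNOrd (baseCol l l' r) := by
  have hp : ∀ p : KNLetter n → Bool, ((List.finRange (2 * n + 1)).filter p).Pairwise
      fun x y => x < y ∨ (x = zeroL n ∧ y = zeroL n) := fun p =>
    (List.Pairwise.filter _ (List.pairwise_lt_finRange _)).imp Or.inl
  refine List.pairwise_append.2 ⟨hp _, List.pairwise_append.2 ⟨?_, hp _, fun a ha b hb => ?_⟩, fun a ha b hb => ?_⟩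
  · rw [List.pairwise_replicate]; exact Or.inr (Or.inr ⟨rfl, rfl⟩)
  · rw [(List.mem_replicate.1 ha).2]; exact Or.inl (mem_negPart.1 hb).1
  · have h1 := (mem_posPart.1 ha).1
    rcases List.mem_append.1 hb with hb | hb
    · rw [(List.mem_replicate.1 hb).2]; exact Or.inl h1
    · exact Or.inl (h1.trans (mem_negPart.1 hb).1)

theorem pairwise_splitList : (splitList l l').Pairwise (· > ·) := by
  rw [splitList, List.pairwise_reverse]
  exact List.Pairwise.filter _ (List.pairwise_lt_finRange _)

theorem count_zeroL_splitLetters (hr : 0 ≤ r) :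
    ((splitLetters (baseCol l l' r)).count (zeroL n) : ℤ) = r := by
  have h1 : (baseCol l l' r).count (zeroL n) = r.toNat := by
    rw [baseCol, List.count_append, List.count_append, List.count_replicate_self,
      List.count_eq_zero.2 fun h => lt_irrefl _ (mem_posPart.1 h).1,
      List.count_eq_zero.2 fun h => lt_irrefl _ (mem_negPart.1 h).1]
    omega
  have h2 : (splitLetters (baseCol l l' r)).count (zeroL n) = (baseCol l l' r).count (zeroL n) := by
    by_cases h : zeroL n ∈ baseCol l l' r
    · unfold splitLetters
      rw [List.count_reverse, List.count_filter]
      simpa [rev_zeroL] using h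
    · rw [List.count_eq_zero.2 h, List.count_eq_zero.2 fun h' => h (mem_splitLetters.1 h').1]
  rw [h2, h1]; omega

variable (H : ListBal l l' r) (h0 : zeroL n ∉ l) (h0' : zeroL n ∉ l') (hlen : l.length < n)

include H

theorem excess_nonneg {X : ℕ} (hX : X ≤ n) : 0 ≤ excess l l' r X := by
  have := H.le X hX
  unfold excess; omega

theorem runMin_nonneg {X : ℕ} (hX : X ≤ n) : 0 ≤ runMin (excess l l' r) X := by
  induction X with
  | zero => exact excess_nonneg H hX
  | succ X ih => exact le_min (ih (by omega)) (excess_nonneg H hX)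

theorem excess_step {y : KNLetter n} (hy : y < zeroL n) : excess l l' r y = excess l l' r (y + 1) +
    (if y.rev ∈ l then 1 else 0) - if y.rev ∈ l' then 1 else 0 := by
  have h1 := dn_succ l hy
  have h2 := dn_succ l' hy
  rw [H.nodup.count] at h1
  rw [H.nodup'.count] at h2
  unfold excess
  split_ifs at * <;> omega

/-- The excess can fall only at a letter whose bar is in the left column but not in the right one;
the letter itself is then in the right column. This is just what an extension letter looks like. -/
theorem IsExt.mem {y : KNLetter n} (hy : y < zeroL n) (hE : IsExt l l' r y) :
    y.rev ∈ l ∧ y.rev ∉ l' ∧ y ∈ l' ∧ y ∉ l := by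
  have h1 := excess_step H hy
  have h2 := runMin_le (excess l l' r) y
  have h3 : y.rev ∈ l ∧ y.rev ∉ l' := by
    unfold IsExt at hE
    split_ifs at h1 with h4 h5 h5
    · omega
    · exact ⟨h4, h5⟩
    · omega
    · omega
  refine ⟨h3.1, h3.2, ((H.abs y).1 (Or.inr h3.1)).resolve_right h3.2, fun h => H.rev y h h3.1⟩

/-- The excess changes by at most one, so a new minimum is lower by exactly one. -/
theorem runMin_step {y : KNLetter n} (hy : y < zeroL n) : runMin (excess l l' r) y =
    runMin (excess l l' r) (y + 1) + if IsExt l l' r y then 1 else 0 := by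
  have h1 := excess_step H hy
  have h2 := runMin_le (excess l l' r) y
  rw [show runMin (excess l l' r) (y + 1) = min (runMin (excess l l' r) y) (excess l l' r (y + 1)) from rfl]
  unfold IsExt
  rcases min_cases (runMin (excess l l' r) y) (excess l l' r (y + 1)) with h3 | h3 <;> rw [h3.1] <;>
    split_ifs at * <;> omega

/-- Just after a missing letter the excess is `0`, which is its least possible value. -/
theorem runMin_outer {y : KNLetter n} (hy : y < zeroL n) (h1 : y ∉ l) (h2 : y.rev ∉ l) {X : ℕ}
    (hX : (y : ℕ) + 1 ≤ X) (hXn : X ≤ n) : runMin (excess l l' r) X = 0 := by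
  have h3 := H.eq y hy h1 h2
  have h4 : excess l l' r (y + 1) = 0 := by unfold excess; omega
  have h5 := runMin_le (excess l l' r) (y + 1)
  have h6 := runMin_antitone (excess l l' r) hX
  have h7 := runMin_nonneg H hXn
  omega

/-- After a missing letter there can be no new minimum. So the extension letters precede all missing
letters, as the minimality in the extension requires. -/
theorem IsExt.lt_outer {y e : KNLetter n} (hy : y < zeroL n) (h1 : y ∉ l) (h2 : y.rev ∉ l)
    (he : e < zeroL n) (hE : IsExt l l' r e) : e < y := by
  rw [Fin.lt_def]
  by_contra hlt
  rcases Nat.lt_or_ge y e with h | h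
  · have h3 := runMin_outer H hy h1 h2 (X := e) h (lt_zeroL.1 he).le
    have h4 := excess_nonneg H (X := e + 1) (lt_zeroL.1 he)
    unfold IsExt at hE; omega
  · have : e = y := Fin.ext (by omega)
    subst this
    exact h2 (hE.mem H he).1

-- Here the height less than `n` enters: some absolute value is missing, so the minimum of the
-- excess does reach `0`.
include hlen in
theorem exists_outer : ∃ y : KNLetter n, y < zeroL n ∧ y ∉ l ∧ y.rev ∉ l := by
  by_contra! hcon
  have h1 : ((range n).image fun x => x) ⊆ (l.map fun y : KNLetter n => min (y : ℕ) y.rev).toFinset := by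
    intro x hx
    simp only [image_id', mem_range] at hx
    simp only [List.mem_toFinset, List.mem_map]
    have := hcon ⟨x, by omega⟩ hx
    by_cases h : (⟨x, by omega⟩ : KNLetter n) ∈ l
    · exact ⟨_, h, by rw [Fin.val_rev]; simp only; omega⟩
    · exact ⟨_, this h, by rw [Fin.rev_rev, Fin.val_rev]; simp only; omega⟩
  have h2 := card_le_card h1
  rw [image_id', card_range] at h2
  have h3 := List.toFinset_card_le (l.map fun y : KNLetter n => min (y : ℕ) y.rev)
  rw [List.length_map] at h3
  omega

include hlen in
theorem runMin_last : runMin (excess l l' r) n = 0 := by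
  obtain ⟨y, hy, h1, h2⟩ := exists_outer H hlen
  exact runMin_outer H hy h1 h2 hy le_rfl

theorem ListBal.r_nonneg : 0 ≤ r := by
  have := H.le n le_rfl
  rw [dn_last, dn_last] at this
  omega

include hlen in
theorem up_extList {X : ℕ} (hX : X ≤ n) : (up (extList l l' r) X : ℤ) = runMin (excess l l' r) X := by
  induction hX using Nat.decreasingInduction with
  | self =>
    rw [runMin_last H hlen, up_last, List.count_eq_zero.2 fun h => lt_irrefl _ (mem_extList.1 h).1]; rfl
  | of_succ X hX ih =>
    obtain ⟨y, rfl⟩ : ∃ y : KNLetter n, (y : ℕ) = X := ⟨⟨X, by omega⟩, rfl⟩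
    have hy : y < zeroL n := hX
    have h1 := up_succ (extList l l' r) hy.le
    have hnd : (extList l l' r).Nodup := (List.nodup_finRange _).filter _
    rw [hnd.count] at h1
    have h2 := runMin_step H hy
    simp only [mem_extList, hy, true_and] at h1
    split_ifs at * <;> omega

-- Downward induction. At `n` both sides equal `r`, the number of zeros; below, a step changes the
-- excess and its minimum according to which of the letter and its bar are in the two columns.
include hlen in
theorem up_sub_up {X : ℕ} (hX : X ≤ n) :
    (up (splitLetters (baseCol l l' r)) X : ℤ) - up (splitList l l') X =
      excess l l' r X - runMin (excess l l' r) X := by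
  induction hX using Nat.decreasingInduction with
  | self =>
    rw [runMin_last H hlen, up_last, up_last, count_zeroL_splitLetters H.r_nonneg,
      List.count_eq_zero.2 fun h => lt_irrefl _ (mem_splitList.1 h).1, excess, dn_last, dn_last]
    simp
  | of_succ X hX ih =>
    obtain ⟨y, rfl⟩ : ∃ y : KNLetter n, (y : ℕ) = X := ⟨⟨X, by omega⟩, rfl⟩
    have hy : y < zeroL n := hX
    have h1 := up_succ (splitLetters (baseCol l l' r)) hy.le
    have h2 := up_succ (splitList l l') hy.le
    have h3 := runMin_step H hy
    have h4 := excess_step H hy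
    rw [knOrd_baseCol.count_splitLetters hy] at h1
    simp only [mem_baseCol hy, rev_mem_baseCol hy] at h1
    have hnd : (splitList l l').Nodup := pairwise_splitList.imp fun h => h.ne'
    rw [hnd.count] at h2
    simp only [mem_splitList] at h2
    have h5 := H.abs y
    have h6 := H.rev y
    have h7 := H.rev' y
    have h8 := IsExt.mem H hy
    by_cases a : y ∈ l <;> by_cases b : y.rev ∈ l <;> by_cases c : y ∈ l' <;> by_cases d : y.rev ∈ l' <;>
      by_cases e : IsExt l l' r y <;>
      simp only [a, b, c, d, e, hy, true_and, and_true, and_false, false_and, not_true, not_false_eq_true,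
        if_true, if_false, or_true, or_false, forall_const, false_or, true_or, iff_false, iff_true,
        and_self, imp_false] at h1 h2 h3 h4 h5 h6 h7 h8 <;> omega

end Construct

section Construct
variable {n : ℕ} {l l' : List (KNLetter n)} {r : ℤ}
variable (H : ListBal l l' r) (h0 : zeroL n ∉ l) (h0' : zeroL n ∉ l') (hlen : l.length < n)

include H hlen

theorem up_le_up {X : ℕ} (hX : X ≤ n) :
    up (splitList l l') X ≤ up (splitLetters (baseCol l l' r)) X := by
  have h1 := up_sub_up H hlen hX
  have h2 := runMin_le (excess l l' r) X
  omega

theorem length_splitList : (splitList l l').length = (splitLetters (baseCol l l' r)).length := by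
  have h1 := up_sub_up H hlen (Nat.zero_le n)
  rw [up_zero fun y hy => (mem_splitLetters.1 hy).2.1, up_zero fun y hy => (mem_splitList.1 hy).1.le,
    show runMin (excess l l' r) 0 = excess l l' r 0 from rfl] at h1
  omega

theorem notMem_baseCol_of_mem_splitList {y : KNLetter n} (hy : y ∈ splitList l l') :
    y ∉ baseCol l l' r ∧ y.rev ∉ baseCol l l' r := by
  obtain ⟨h1, h2, h3⟩ := mem_splitList.1 hy
  rw [mem_baseCol h1, rev_mem_baseCol h1]
  refine ⟨fun h => H.rev' _ h.1 h3, fun h => H.rev _ h2 h.1⟩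

theorem free_iff {y : KNLetter n} (hy : y < zeroL n) :
    (y ∉ baseCol l l' r ∧ y.rev ∉ baseCol l l' r ∧ y ∉ splitList l l') ↔
      (IsExt l l' r y ∨ (y ∉ l ∧ y.rev ∉ l)) := by
  rw [mem_baseCol hy, rev_mem_baseCol hy, mem_splitList]
  have h1 := H.abs y
  have h2 := H.rev y
  have h3 := H.rev' y
  have h4 := IsExt.mem H hy
  tauto

/-- Comparing entries of the two decreasing lists amounts to comparing the counts `up`. By
`up_sub_up` these differ by how far the excess is above its running minimum, which is never negative
and vanishes after every free letter. -/
theorem isSplitting_splitList : IsSplitting (baseCol l l' r) (splitList l l') := by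
  have hpz := (knOrd_baseCol (l := l) (l' := l') (r := r)).splitLetters
  have hz0 : ∀ y ∈ splitLetters (baseCol l l' r), y ≤ zeroL n := fun y hy => (mem_splitLetters.1 hy).2.1
  have hpt := (pairwise_splitList (l := l) (l' := l')).imp (S := (· ≥ ·)) le_of_lt
  have ht0 : ∀ y ∈ splitList l l', y ≤ zeroL n := fun y hy => (mem_splitList.1 hy).1.le
  have hl := length_splitList H hlen
  have hlt : ∀ i j (hij : i < j) (hj : j < (splitList l l').length), (splitList l l')[j] < (splitList l l')[i] :=
    fun i j hij hj => List.pairwise_iff_getElem.1 pairwise_splitList i j _ hj hij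
  refine ⟨hl, fun i hi => ⟨?_, ?_⟩⟩
  · have hm := List.getElem_mem hi
    have hD := notMem_baseCol_of_mem_splitList H hlen hm
    have hy := (mem_splitList.1 hm).1
    refine ⟨hy, lt_of_le_of_ne ?_ fun e => ?_, fun h => hlt _ _ (by omega) _, hD⟩
    · refine Fin.le_def.2 ((le_getElem_iff hpz hz0 (hl ▸ hi) _).2 ?_)
      exact ((le_getElem_iff hpt ht0 hi _).1 le_rfl).trans_le (up_le_up H hlen (lt_zeroL.1 hy).le)
    · exact hD.1 (e ▸ (mem_splitLetters.1 (List.getElem_mem _)).1)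
  · rintro x ⟨hx, hxz, hxt, hxD, hxD'⟩
    by_cases hxm : x ∈ splitList l l'
    · obtain ⟨j, hj, rfl⟩ := List.mem_iff_getElem.1 hxm
      rcases Nat.lt_trichotomy j i with h | rfl | h
      · have h1 := hxt (by omega)
        rcases Nat.lt_or_ge j (i - 1) with h2 | h2
        · exact absurd (hlt _ _ h2 (by omega)) h1.asymm
        · have h3 : j = i - 1 := by omega
          subst h3
          exact absurd h1 (lt_irrefl _)
      · exact le_rfl
      · exact (hlt _ _ h _).le
    · have h1 : excess l l' r (x + 1) = runMin (excess l l' r) (x + 1) := by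
        rcases (free_iff H hlen hx).1 ⟨hxD, hxD', hxm⟩ with h | ⟨h, h'⟩
        · exact (min_eq_right (le_of_lt h)).symm
        · rw [runMin_outer H hx h h' le_rfl (lt_zeroL.1 hx), excess, H.eq x hx h h']
          ring
      have h2 := up_sub_up H hlen (X := (x : ℕ) + 1) (lt_zeroL.1 hx)
      have h3 := (le_getElem_iff hpz hz0 (hl ▸ hi) (x + 1)).1 (Fin.lt_def.1 hxz)
      exact (Fin.lt_def.2 ((le_getElem_iff hpt ht0 hi (x + 1)).2 (by omega))).le

/-- The free letters in increasing order are first the extension letters and then the letters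
missing from the columns, so taking the right number of smallest ones returns the former. -/
theorem extLetters_baseCol :
    extLetters (baseCol l l' r) (splitList l l') (extList l l' r).length = extList l l' r := by
  have hp : ∀ p : KNLetter n → Bool, ((List.finRange (2 * n + 1)).filter p).Pairwise (· < ·) := fun p =>
    List.Pairwise.filter _ (List.pairwise_lt_finRange _)
  unfold extLetters
  have key : ((List.finRange (2 * n + 1)).filter fun x => decide (x < zeroL n ∧
      x ∉ leftSplit (baseCol l l' r) (splitList l l') ∧ x.rev ∉ leftSplit (baseCol l l' r) (splitList l l') ∧
      x ∉ rightSplit (baseCol l l' r) (splitList l l') ∧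
      x.rev ∉ rightSplit (baseCol l l' r) (splitList l l'))) =
      extList l l' r ++ (List.finRange (2 * n + 1)).filter fun x => decide (x < zeroL n ∧ x ∉ l ∧ x.rev ∉ l) := by
    refine List.Perm.eq_of_pairwise (le := (· < ·)) (fun a b _ _ h1 h2 => absurd h2 h1.asymm) (hp _) ?_ ?_
    · refine List.pairwise_append.2 ⟨hp _, hp _, fun a ha b hb => ?_⟩
      obtain ⟨h1, h2⟩ := mem_extList.1 ha
      rw [List.mem_filter, decide_eq_true_eq] at hb
      exact h2.lt_outer H hb.2.1 hb.2.2.1 hb.2.2.2 h1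
    · rw [List.perm_ext_iff_of_nodup ((hp _).imp fun h => h.ne)]
      · intro x
        rw [List.mem_append, List.mem_filter, List.mem_filter, decide_eq_true_eq, decide_eq_true_eq, mem_extList]
        simp only [List.mem_finRange, true_and, mem_leftSplit, mem_rightSplit, Fin.rev_rev]
        by_cases hx : x < zeroL n
        · have h1 := free_iff H hlen hx
          have h2 : ¬ x.rev ≤ zeroL n := (lt_rev_zeroL.2 hx).not_ge
          have h3 : x.rev ∉ splitList l l' := fun h => h2 (mem_splitList.1 h).1.le
          have h4 := hx.le
          simp only [hx, h2, h3, h4, true_and, false_and, not_false_eq_true, and_true, or_false]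
          refine Iff.trans ?_ h1
          by_cases a : x ∈ baseCol l l' r <;> by_cases b : x.rev ∈ baseCol l l' r <;>
            by_cases c : x ∈ splitList l l' <;> simp [a, b, c]
        · simp only [hx, false_and, or_self]
      · refine List.nodup_append.2 ⟨(hp _).imp fun h => h.ne, (hp _).imp fun h => h.ne, ?_⟩
        rintro a ha b hb rfl
        obtain ⟨h1, h2⟩ := mem_extList.1 ha
        rw [List.mem_filter, decide_eq_true_eq] at hb
        exact hb.2.2.2 (h2.mem H h1).1
  rw [key, List.take_left']
  rfl

theorem even_extList : Even (extList l l' r).length := by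
  have h1 := up_extList H hlen (Nat.zero_le n)
  rw [up_zero fun y hy => (mem_extList.1 hy).1.le, show runMin (excess l l' r) 0 = excess l l' r 0 from rfl,
    excess] at h1
  have h2 := H.even
  rw [Int.even_iff] at h2
  rw [Nat.even_iff]
  omega

theorem isKNColumn_baseCol : IsKNColumn (baseCol l l' r) := by
  refine ⟨knOrd_baseCol, fun p q hp hq => ?_⟩
  -- A position counted twice on the left holds both a letter and its bar and is counted on the
  -- right as split; a splitting letter is free in the column. As there are at least as many
  -- splitting letters as split letters before `X`, the condition `a + b ≤ j` follows.
  have key : ∀ X ≤ n, lo (baseCol l l' r) X + hi (baseCol l l' r) X + lo (splitList l l') X ≤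
      X + lo (splitLetters (baseCol l l' r)) X := by
    intro X
    induction X with
    | zero =>
      intro _
      have e : hi (baseCol l l' r) 0 = 0 := by
        unfold hi; rw [List.countP_eq_zero]; intro y _; have := y.isLt; simp only [decide_eq_true_eq]; omega
      have e' : ∀ m : List (KNLetter n), lo m 0 = 0 := fun m => by
        unfold lo; rw [List.countP_eq_zero]; intro y _; simp
      rw [e, e', e', e']
    | succ X ih =>
      intro hX
      have := ih (by omega)
      obtain ⟨y, rfl⟩ : ∃ y : KNLetter n, (y : ℕ) = X := ⟨⟨X, by omega⟩, rfl⟩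
      have hy : y < zeroL n := hX
      have hyr : y.rev ≠ zeroL n := (lt_rev_zeroL.2 hy).ne'
      have hnd : (splitList l l').Nodup := pairwise_splitList.imp fun h => h.ne'
      rw [lo_succ, hi_succ, lo_succ, lo_succ, knOrd_baseCol.count_splitLetters hy, knOrd_baseCol.count hy.ne,
        knOrd_baseCol.count hyr, hnd.count]
      have h1 := notMem_baseCol_of_mem_splitList H hlen (y := y)
      split_ifs <;> first | omega | (exfalso; tauto)
  have hX : ((baseCol l l' r).get p : ℕ) + 1 ≤ n := lt_zeroL.1 hp
  have h1 := key _ hX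
  have h2 := lo_add_up (l := splitList l l') (fun y hy => (mem_splitList.1 hy).1.le)
    ((baseCol l l' r).get p + 1)
  have h3 := lo_add_up (l := splitLetters (baseCol l l' r)) (fun y hy => (mem_splitLetters.1 hy).2.1)
    ((baseCol l l' r).get p + 1)
  have h4 := length_splitList H hlen
  have h5 := up_le_up H hlen hX
  have h6 := (knOrd_baseCol (l := l) (l' := l') (r := r)).succ_le_lo p.isLt
  have h7 := (knOrd_baseCol (l := l) (l' := l') (r := r)).length_sub_le_hi q.isLt hq
  simp only [List.get_eq_getElem] at *
  omega

theorem listBal_baseCol : ListBal (leftList (baseCol l l' r) (splitList l l') (extList l l' r).length)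
    (rightList (baseCol l l' r) (splitList l l') (extList l l' r).length)
    ((splitLetters (baseCol l l' r)).count (zeroL n)) :=
  ListBal.of_splitting knOrd_baseCol (isSplitting_splitList H hlen)
    (by rw [extLetters_baseCol H hlen]; exact even_extList H hlen)

include h0 in
theorem perm_leftList :
    l.Perm (leftList (baseCol l l' r) (splitList l l') (extList l l' r).length) := by
  rw [List.perm_ext_iff_of_nodup H.nodup (listBal_baseCol H hlen).nodup]
  intro y
  rw [mem_leftList, extLetters_baseCol H hlen]
  rcases lt_trichotomy y (zeroL n) with hy | rfl | hy
  · have h2 : ¬ y.rev ≤ zeroL n := (lt_rev_zeroL.2 hy).not_ge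
    have h3 : y.rev ∉ extList l l' r := fun h => h2 (mem_extList.1 h).1.le
    rw [mem_baseCol hy, rev_mem_baseCol hy, mem_splitList]
    have h4 := IsExt.mem H hy
    have h5 := H.abs y
    have h6 := H.rev y
    have h7 := H.rev' y
    have h8 := hy.le
    tauto
  · have h1 : zeroL n ∉ splitList l l' := fun h => lt_irrefl _ (mem_splitList.1 h).1
    have h2 : zeroL n ∉ extList l l' r := fun h => lt_irrefl _ (mem_extList.1 h).1
    rw [rev_zeroL]
    simp only [h0, h1, h2, le_refl, true_and, and_not_self_iff, or_self]
  · obtain ⟨x, rfl⟩ : ∃ x : KNLetter n, x.rev = y := ⟨y.rev, Fin.rev_rev y⟩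
    have hx := lt_rev_zeroL.1 hy
    have h2 : ¬ x.rev ≤ zeroL n := hy.not_ge
    have h3 : x.rev ∉ splitList l l' := fun h => h2 (mem_splitList.1 h).1.le
    rw [rev_mem_baseCol hx, Fin.rev_rev, mem_extList]
    have h4 := IsExt.mem H hx
    tauto

include h0' in
theorem perm_rightList :
    l'.Perm (rightList (baseCol l l' r) (splitList l l') (extList l l' r).length) := by
  rw [List.perm_ext_iff_of_nodup H.nodup' (listBal_baseCol H hlen).nodup']
  intro y
  rw [mem_rightList, extLetters_baseCol H hlen]
  rcases lt_trichotomy y (zeroL n) with hy | rfl | hy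
  · have h2 : ¬ y.rev ≤ zeroL n := (lt_rev_zeroL.2 hy).not_ge
    have h3 : y.rev ∉ splitList l l' := fun h => h2 (mem_splitList.1 h).1.le
    rw [mem_baseCol hy, rev_mem_baseCol hy, mem_extList]
    have h4 := IsExt.mem H hy
    tauto
  · have h1 : zeroL n ∉ splitList l l' := fun h => lt_irrefl _ (mem_splitList.1 h).1
    have h2 : zeroL n ∉ extList l l' r := fun h => lt_irrefl _ (mem_extList.1 h).1
    rw [rev_zeroL]
    simp only [h0', h1, h2, le_refl, true_and, and_not_self_iff, or_self]
  · obtain ⟨x, rfl⟩ : ∃ x : KNLetter n, x.rev = y := ⟨y.rev, Fin.rev_rev y⟩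
    have hx := lt_rev_zeroL.1 hy
    have h2 : ¬ x.rev ≤ zeroL n := hy.not_ge
    have h3 : x.rev ∉ extList l l' r := fun h => h2 (mem_extList.1 h).1.le
    rw [rev_mem_baseCol hx, Fin.rev_rev, mem_baseCol hx, mem_splitList]
    have h4 := IsExt.mem H hx
    have h5 := H.abs x
    have h6 := H.rev x
    have h7 := H.rev' x
    have h8 := hx.le
    tauto

include h0 in
theorem length_baseCol : l.length = (baseCol l l' r).length + (extList l l' r).length := by
  rw [(perm_leftList H h0 hlen).length_eq, leftList, List.length_append,
    length_leftSplit (length_splitList H hlen), List.length_map, extLetters_baseCol H hlen]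

end Construct

/-- Only the sets of entries matter, since both columns are sorted in the definition. The height of
the column found is `k` minus the number of extension letters, which is even. -/
theorem isSplitPair_iff_listBal {n k : ℕ} (hkn : k < n) {C C' : Column n k} :
    IsSplitPair C C' ↔ ∃ r, ListBal (letters C) (letters C') r := by
  constructor
  · rintro ⟨D, t, hD, hDk, hev, ht, e, e'⟩
    have p : (letters C).Perm (leftList D t (k - D.length)) := insertionSort_eq_iff.1 e
    have p' : (letters C').Perm (rightList D t (k - D.length)) := insertionSort_eq_iff.1 e'
    refine ⟨_, (ListBal.of_splitting hD.1 ht ?_).perm p.symm p'.symm⟩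
    have := p.length_eq
    rw [length_letters, leftList, List.length_append, length_leftSplit ht.1, List.length_map] at this
    rwa [show (extLetters D t (k - D.length)).length = k - D.length by omega]
  · rintro ⟨r, H⟩
    have hl : (letters C).length < n := by rw [length_letters]; exact hkn
    have h0 := zeroL_notMem_letters C
    have h0' := zeroL_notMem_letters C'
    have h1 := length_baseCol H h0 hl
    rw [length_letters] at h1
    have h2 : k - (baseCol (letters C) (letters C') r).length =
      (extList (letters C) (letters C') r).length := by omega
    refine ⟨baseCol (letters C) (letters C') r, splitList (letters C) (letters C'),
      isKNColumn_baseCol H hl, by omega, h2 ▸ even_extList H hl, isSplitting_splitList H hl,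
      insertionSort_eq_iff.2 ?_, insertionSort_eq_iff.2 ?_⟩
    · rw [h2]; exact perm_leftList H h0 hl
    · rw [h2]; exact perm_rightList H h0' hl

theorem isSplitPair_iff {n k : ℕ} (hkn : k < n) {C C' : Column n k} {g h : ℕ → ℤ}
    (hg : ∀ i : Fin k, g i = sg (C i)) (hh : ∀ i : Fin k, h i = sg (C' i)) :
    IsSplitPair C C' ↔ AbsInj g k ∧ AbsInj h k ∧ ∃ r, Bal n k g h r := by
  rw [isSplitPair_iff_listBal hkn]
  constructor
  · rintro ⟨r, H⟩
    obtain ⟨h1, h2, h3⟩ := (listBal_iff hg hh r).2 H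
    exact ⟨h1, h2, r, h3⟩
  · rintro ⟨h1, h2, r, h3⟩
    exact ⟨r, (listBal_iff hg hh r).1 ⟨h1, h2, h3⟩⟩

/-! ### Translation of the conditions on columns -/

section Translate
variable {n k : ℕ}

theorem circLT_iff {a b c : Letter n} : CircLT a b c ↔ cyc (sg a) (sg b) (sg c) := by
  have ha := a.isLt
  have hb := b.isLt
  have hc := c.isLt
  simp only [CircLT, circRank, cyc, sg, Fin.le_def]
  split_ifs <;> omega

theorem pass_iff {a x d : ℤ} (h : x ≠ d) : pass a x d ↔ a = x ∨ cyc a x d := by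
  unfold pass cyc; omega

theorem sg_pos {x : Letter n} : 0 < sg x ↔ (x : ℕ) < n := by
  have := x.isLt
  simp only [sg]; split_ifs <;> omega

theorem sg_neg {x : Letter n} : sg x < 0 ↔ ¬ (x : ℕ) < n := by
  have := x.isLt
  simp only [sg]; split_ifs <;> omega

theorem abs_sg (x : Letter n) : |sg x| = (absL x : ℤ) + 1 := by
  have := x.isLt
  have h : (absL x : ℕ) = min (x : ℕ) x.rev := by
    unfold absL
    rcases le_total x x.rev with h | h
    · rw [min_eq_left h, min_eq_left (Fin.le_def.1 h)]
    · rw [min_eq_right h, min_eq_right (Fin.le_def.1 h)]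
  rw [h, Fin.val_rev]
  simp only [sg]
  split_ifs
  · rw [abs_of_nonneg (by omega), min_eq_left (by omega)]
  · rw [abs_of_neg (by omega), min_eq_right (by omega)]; omega

variable {C C' E : Column n k} {g h : ℕ → ℤ} {i l : Fin k}

/-- The levels up to `b` occupy distinct rows up to `i`, so `b ≤ k < n`: the bound in the definition
of blocking is automatic. -/
theorem Blk.lt_of_lt {b : ℤ} (B : Blk g h i b) (hkn : k < n) : b < n := by
  have h1 : Icc 1 b ⊆ (range (i + 1)).image fun j => |g j| := fun x hx => by
    rw [mem_Icc] at hx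
    obtain ⟨j, hj, e⟩ := B.full x (by omega) hx.2
    exact mem_image.2 ⟨j, mem_range.2 (by omega), e⟩
  have h2 := (card_le_card h1).trans card_image_le
  rw [card_range, Int.card_Icc] at h2
  have := i.isLt
  omega

/-- The number of rows up to `i` in which the sign changes from minus to plus. -/
def signChanges (C E : Column n k) (i : Fin k) : ℕ :=
  (univ.filter fun j : Fin k => j ≤ i ∧ ¬ IsPos (C j) ∧ IsPos (E j)).card

/-- Row `i` of `E` holds `b` itself, so only the levels below `b` are required of the rows before
`i`. Therefore one notion `Blk` serves both the exchanged column of the second condition and the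
column `C'` of the third. -/
theorem blockedOff_iff (hkn : k < n) (hg : ∀ j : Fin k, g j = sg (C j))
    (hE : ∀ j < i, h j = sg (E j)) {b : ℤ} (hb : b = sg (E i)) :
    BlockedOff C E i ↔ Blk g h i b ∧ Odd (signChanges C E i) := by
  have hC := abs_sg (C i)
  constructor
  · rintro ⟨⟨h1, h2, h3⟩, h4, h5⟩
    have hlt := Fin.le_def.1 h1
    have hb' : b = (E i : ℤ) + 1 := by rw [hb]; simp only [sg]; rw [if_pos (by omega)]
    refine ⟨⟨by omega, by rw [hg, hC]; omega, fun e => ?_, fun x hx hxb => ?_, fun x hx hxb => ?_⟩, h5⟩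
    · have e2 : C i = E i := sg_inj (by rw [← hg, e, hb])
      have e3 : |sg (C i)| = sg (E i) := by rw [e2, ← hb, abs_of_pos (by omega)]
      have e4 := h3.1 (Fin.ext (by omega))
      exact ne_rev _ (e2.symm.trans e4)
    · obtain ⟨j, hj, e⟩ := (h4 ⟨(x - 1).toNat, by omega⟩ (Fin.le_def.2 (by simp only; omega))).1
      refine ⟨j, Fin.le_def.1 hj, ?_⟩
      rw [hg, abs_sg, e]; simp only; omega
    · obtain ⟨j, hj, e⟩ := (h4 ⟨(x - 1).toNat, by omega⟩ (Fin.le_def.2 (by simp only; omega))).2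
      have hji : j < i := lt_of_le_of_ne hj fun hji => by
        subst hji
        have := abs_sg (E j)
        rw [← hb, e, abs_of_pos (by omega)] at this
        simp only at this; omega
      refine ⟨j, Fin.lt_def.1 hji, ?_⟩
      rw [hE j hji, abs_sg, e]; simp only; omega
  · rintro ⟨B, h5⟩
    have h0 := B.pos
    have hn := B.lt_of_lt hkn
    have hle := B.le
    rw [hg, hC] at hle
    have hp : (E i : ℕ) < n := sg_pos.1 (hb ▸ h0)
    have hb' : b = (E i : ℤ) + 1 := by rw [hb]; simp only [sg]; rw [if_pos hp]
    refine ⟨⟨Fin.le_def.2 (by omega), by omega, ?_, ?_⟩, fun x hx => ⟨?_, ?_⟩, h5⟩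
    · intro e
      have h1 : |sg (C i)| = |sg (E i)| := by rw [hC, e, ← hb, abs_of_pos h0, hb']
      exact (abs_sg_eq.1 h1).resolve_left fun h2 => B.ne (by rw [hg, h2, hb])
    · intro e
      have h1 : |sg (C i)| = b := by rw [e, sg_rev, abs_neg, ← hb, abs_of_pos h0]
      exact Fin.ext (by omega)
    · obtain ⟨j, hj, e⟩ := B.full (x + 1) (by omega) (by have := Fin.le_def.1 hx; omega)
      refine ⟨⟨j, by omega⟩, hj, Fin.ext ?_⟩
      rw [show g j = sg (C ⟨j, by omega⟩) from hg ⟨j, by omega⟩, abs_sg] at e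
      omega
    · rcases Nat.lt_or_ge x (E i) with h1 | h1
      · obtain ⟨j, hj, e⟩ := B.full' (x + 1) (by omega) (by omega)
        refine ⟨⟨j, by omega⟩, hj.le, Fin.ext ?_⟩
        rw [show h j = sg (E ⟨j, by omega⟩) from hE ⟨j, by omega⟩ hj, abs_sg] at e
        omega
      · refine ⟨i, le_rfl, Fin.ext ?_⟩
        have := abs_sg (E i)
        rw [← hb, abs_of_pos h0] at this
        have := Fin.le_def.1 hx
        omega

theorem signChanges_eq (hg : ∀ j : Fin k, g j = sg (C j)) (hE : ∀ j < i, h j = sg (E j)) {b : ℤ}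
    (hb : b = sg (E i)) (h0 : 0 < b) : signChanges C E i =
      (∑ j ∈ range i, if g j < 0 ∧ 0 < h j then 1 else 0) + if g i < 0 then 1 else 0 := by
  have e : signChanges C E i = #{j ∈ range (i + 1) | g j < 0 ∧ (j < i → 0 < h j)} := by
    unfold signChanges
    refine card_bij (fun j _ => (j : ℕ)) (fun j hj => ?_) (fun a _ b _ => Fin.ext) fun j hj => ?_
    · rw [mem_filter] at hj ⊢
      obtain ⟨-, h1, h2, h3⟩ := hj
      refine ⟨mem_range.2 (Nat.lt_succ_of_le h1), ?_, fun h4 => ?_⟩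
      · rw [hg, sg_neg]; exact h2
      · rw [hE j h4, sg_pos]; exact h3
    · rw [mem_filter, mem_range] at hj
      obtain ⟨h1, h2, h3⟩ := hj
      refine ⟨⟨j, by omega⟩, mem_filter.2 ⟨mem_univ _, Nat.le_of_lt_succ h1, ?_, ?_⟩, rfl⟩
      · rw [show g j = sg (C ⟨j, by omega⟩) from hg ⟨j, by omega⟩, sg_neg] at h2
        exact h2
      · rcases Nat.lt_or_ge j i with h4 | h4
        · have h5 := h3 h4
          rw [show h j = sg (E ⟨j, by omega⟩) from hE ⟨j, by omega⟩ h4, sg_pos] at h5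
          exact h5
        · obtain rfl : j = i := by omega
          exact sg_pos.1 (hb ▸ h0)
  rw [e, card_filter, sum_range_succ]
  congr 1
  · exact sum_congr rfl fun j hj => by simp [mem_range.1 hj]
  · simp

/-- No row before `i` passes the level, so entries within it rise as integers: a negative one stays
negative or produces a change of sign. Beyond the level, a change from negative to positive would
pass it. So the changes of sign are the difference of the two counts of negative entries. -/
theorem odd_signChanges_iff (hkn : k < n) (hg : ∀ j : Fin k, g j = sg (C j))
    (hE : ∀ j < i, h j = sg (E j)) (hb : h l = sg (E i)) (hG : AbsInj g k) (hH : AbsInj h k) (hil : i ≤ l)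
    (hadj : ∀ i l, i < l → l < k → pass (g i) (h l) (h i) → Blk g h i (h l)) (B : Blk g h i (h l)) :
    Odd (signChanges C E i) ↔ Odd (ng g (i + 1) (h l) + ng h i (h l)) := by
  have hn : ∀ r < (i : ℕ), ¬ pass (g r) (h l) (h r) := fun r hr hp => by
    have := (hadj r l (by have := Fin.le_def.1 hil; omega) l.isLt hp).le_of hG (by omega) i.isLt B.le
    omega
  have hc := B.closed hG hH i.isLt l.isLt hil rfl fun r hr _ => hn r hr
  have h0 := B.pos
  have key : ng g (i + 1) (h l) = signChanges C E i + ng h i (h l) := by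
    rw [ng_succ, signChanges_eq hg hE hb h0, ng_eq_sum, ng_eq_sum, add_right_comm, ← sum_add_distrib]
    congr 1
    · refine sum_congr rfl fun j hj => ?_
      rw [mem_range] at hj
      have h1 := hc j (by omega) (by omega)
      have h2 := hn j hj
      have h3 := hG.ne_zero j (by omega)
      have h4 := hH.ne_zero j (by omega)
      have h5 : |h j| ≠ h l := fun e => by
        have := hH.inj j (by omega) l l.isLt (by rw [e, abs_of_pos h0])
        have := Fin.le_def.1 hil; omega
      unfold pass at h2
      rcases abs_cases (g j) with h6 | h6 <;> rcases abs_cases (h j) with h7 | h7 <;>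
        rw [h6.1, h7.1] at h1 <;> rw [h7.1] at h5 <;> split_ifs <;> omega
    · have := abs_le.1 B.le
      split_ifs <;> omega
  rw [key, Nat.odd_iff, Nat.odd_iff]
  omega

/-- The arcs in `pass` contain their starting points, so the first condition is part of the second:
an equality `C(i) = C'(l)` would require blocking, which excludes it. -/
theorem adjConditions_iff (hkn : k < n) (hg : ∀ j : Fin k, g j = sg (C j))
    (hh : ∀ j : Fin k, h j = sg (C' j)) (hG : AbsInj g k) (hH : AbsInj h k) :
    AdjConditions C C' ↔ Cond k k g h := by
  have hsw : ∀ i l : Fin k, i < l → ∀ j < i, h j = sg ((C' ∘ Equiv.swap i l) j) := fun i l hil j hj => by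
    rw [Function.comp_apply, Equiv.swap_apply_of_ne_of_ne hj.ne (hj.trans hil).ne, hh]
  have hsi : ∀ i l : Fin k, h l = sg ((C' ∘ Equiv.swap i l) i) := fun i l => by
    rw [Function.comp_apply, Equiv.swap_apply_left, hh]
  have hne : ∀ i l : Fin k, i < l → h l ≠ h i := fun i l hil e =>
    hil.ne' (Fin.ext (hH.inj l l.isLt i i.isLt (by rw [e])))
  constructor
  · rintro ⟨h1, h2, h3⟩
    have hp : ∀ i l : Fin k, i < l → pass (g i) (h l) (h i) → BlockedOff C (C' ∘ Equiv.swap i l) i :=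
      fun i l hil hp => by
        rcases (pass_iff (hne i l hil)).1 hp with e | e
        · exact absurd (sg_inj (by rw [← hg, ← hh, e])) (h1 i l hil)
        · exact h2 i l hil (circLT_iff.2 (by rwa [← hg, ← hh, ← hh]))
    have hadj : ∀ i l, i < l → l < k → pass (g i) (h l) (h i) → Blk g h i (h l) := fun i l hil hl hp' =>
      ((blockedOff_iff (i := ⟨i, by omega⟩) hkn hg (hsw ⟨i, by omega⟩ ⟨l, hl⟩ hil) (hsi _ ⟨l, hl⟩)).1
        (hp ⟨i, by omega⟩ ⟨l, hl⟩ hil hp')).1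
    refine ⟨fun i l hil hl hp' => ?_, fun i l h4 h5 h6 => by omega, fun i hi hik B => ?_⟩
    · have B := hadj i l hil hl hp'
      refine ⟨B, ?_⟩
      have := ((blockedOff_iff (i := ⟨i, by omega⟩) hkn hg (hsw ⟨i, by omega⟩ ⟨l, hl⟩ hil) (hsi _ ⟨l, hl⟩)).1
        (hp ⟨i, by omega⟩ ⟨l, hl⟩ hil hp')).2
      exact (odd_signChanges_iff (i := ⟨i, by omega⟩) (l := ⟨l, hl⟩) hkn hg (hsw ⟨i, by omega⟩ ⟨l, hl⟩ hil)
        (hsi _ _) hG hH hil.le hadj B).1 this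
    · rw [← Nat.not_odd_iff_even]
      intro ho
      refine h3 ⟨i, hi⟩ hik ((blockedOff_iff hkn hg (fun j _ => hh j) (hh _)).2 ⟨B, ?_⟩)
      exact (odd_signChanges_iff (i := ⟨i, hi⟩) (l := ⟨i, hi⟩) hkn hg (fun j _ => hh j) (hh _) hG hH le_rfl
        hadj B).2 ho
  · intro H
    have hadj : ∀ i l, i < l → l < k → pass (g i) (h l) (h i) → Blk g h i (h l) := fun i l h1 h2 h3 =>
      (H.adj i l h1 h2 h3).1
    refine ⟨fun i l hil e => ?_, fun i l hil hc => ?_, fun i hi B => ?_⟩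
    · have e2 : g i = h l := by rw [hg, hh, e]
      exact (hadj i l hil l.isLt ((pass_iff (hne i l hil)).2 (Or.inl e2))).ne e2
    · have hp : pass (g i) (h l) (h i) :=
        (pass_iff (hne i l hil)).2 (Or.inr (by rw [hg, hh, hh]; exact circLT_iff.1 hc))
      obtain ⟨B, ho⟩ := H.adj i l hil l.isLt hp
      exact (blockedOff_iff hkn hg (hsw i l hil) (hsi i l)).2
        ⟨B, (odd_signChanges_iff hkn hg (hsw i l hil) (hsi i l) hG hH hil.le hadj B).2 ho⟩
    · obtain ⟨B, ho⟩ := (blockedOff_iff hkn hg (fun j _ => hh j) (hh i)).1 B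
      have h1 := H.blk i i.isLt hi B
      rw [← Nat.not_odd_iff_even] at h1
      exact h1 ((odd_signChanges_iff hkn hg (fun j _ => hh j) (hh i) hG hH le_rfl hadj B).1 ho)

theorem not_pass_succ_iff {x d : Letter n} {i : ℕ} (hi : i < n) (hx : i ≤ x) (hd : i ≤ d) :
    ¬ pass ((i : ℤ) + 1) (sg x) (sg d) ↔ d ≤ x := by
  have h1 := x.isLt
  have h2 := d.isLt
  simp only [pass, sg, Fin.le_def]
  split_ifs <;> omega

/-- Starting from the identity nothing is blocked, and the arc from `i` to the entry of row `i`
avoids all later entries iff the column increases. The entries of rows from `i` on are inductively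
at least `i`, so no arc wraps. -/
theorem cond_one_iff (hkn : k < n) (hg : ∀ j < k, g j = (j : ℤ) + 1) (hh : ∀ j : Fin k, h j = sg (C j))
    (hH : AbsInj h k) : Cond k k g h ↔ StrictMono C := by
  -- The first `i + 1` entries are `1, …, i + 1`, so `le` and `full` force `b = g i`, which `ne`
  -- forbids.
  have hB : ∀ i < k, ∀ b, ¬ Blk g h i b := fun i hi b B => by
    have h0 := B.pos
    have h1 := B.le
    have h2 := B.ne
    obtain ⟨j, hj, e⟩ := B.full b h0 le_rfl
    rw [hg j (by omega), abs_of_pos (by omega)] at e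
    rw [hg i hi, abs_of_pos (by omega)] at h1
    rw [hg i hi] at h2
    omega
  have hp : ∀ i l : Fin k, (i : ℕ) ≤ C i → (i : ℕ) ≤ C l → (¬ pass (g i) (h l) (h i) ↔ C i ≤ C l) :=
    fun i l h1 h2 => by
      rw [hg i i.isLt, hh, hh, not_pass_succ_iff (by omega) h2 h1]
  constructor
  · intro H
    have hlt : ∀ i l : Fin k, i < l → (i : ℕ) ≤ C i → (i : ℕ) ≤ C l → C i < C l := fun i l hil h1 h2 => by
      refine lt_of_le_of_ne ((hp i l h1 h2).1 fun h3 => hB i i.isLt _ (H.adj i l hil l.isLt h3).1) fun e => ?_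
      exact hil.ne (Fin.ext (hH.inj i i.isLt l l.isLt (by rw [hh, hh, e])))
    have key : ∀ i, ∀ l : Fin k, i ≤ (l : ℕ) → i ≤ (C l : ℕ) := by
      intro i
      induction i with
      | zero => intro l _; exact Nat.zero_le _
      | succ i ih =>
        intro l hl
        have hi : i < k := by omega
        have h1 := ih ⟨i, hi⟩ le_rfl
        have h2 := Fin.lt_def.1 (hlt ⟨i, hi⟩ l hl h1 (ih l (by omega)))
        omega
    exact fun i l hil => hlt i l hil (key i i le_rfl) (key i l hil.le)
  · intro H
    have key : ∀ i, ∀ l : Fin k, i ≤ (l : ℕ) → i ≤ (C l : ℕ) := by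
      intro i
      induction i with
      | zero => intro l _; exact Nat.zero_le _
      | succ i ih =>
        intro l hl
        have hi : i < k := by omega
        have := ih ⟨i, hi⟩ le_rfl
        have := Fin.lt_def.1 (H (show (⟨i, hi⟩ : Fin k) < l from hl))
        omega
    refine ⟨fun i l hil hl h1 => ?_, fun i l _ _ _ => by omega, fun i hi _ B => absurd B (hB i hi _)⟩
    exact absurd h1 ((hp ⟨i, by omega⟩ ⟨l, hl⟩ (key i _ le_rfl) (key i _ hil.le)).2
      (H (show (⟨i, by omega⟩ : Fin k) < ⟨l, hl⟩ from hil)).le)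

end Translate

/-! ### The chain of roots as a list of operations -/

section Chain
variable {n : ℕ}

/-- The operation on signed sequences given by a root. -/
def opOf (r : Letter n × Letter n) : Op :=
  if (r.2 : ℕ) < n then .dif r.1 r.2 else if r.2 = r.1.rev then .sgn r.1 else .sum r.1 r.2.rev

theorem opOf_dif (i j : Fin n) : opOf (unb i, unb j) = .dif i j := if_pos j.isLt

theorem opOf_sgn (i : Fin n) : opOf (unb i, barred i) = .sgn i := by
  have h : ¬ ((barred i : Letter n) : ℕ) < n := by
    rw [barred, Fin.val_rev]; simp only [unb]; omega
  unfold opOf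
  rw [if_neg h, if_pos (show barred i = (unb i).rev from rfl)]; rfl

theorem opOf_sum {i j : Fin n} (hij : j ≠ i) : opOf (unb i, barred j) = .sum i j := by
  have h : ¬ ((barred j : Letter n) : ℕ) < n := by
    rw [barred, Fin.val_rev]; simp only [unb]; omega
  unfold opOf
  rw [if_neg h, if_neg]
  · simp only [barred, Fin.rev_rev]; rfl
  · intro e
    exact hij (Fin.ext (congrArg Fin.val (Fin.rev_inj.1 e) :))

/-- The roots which occur in the chain. -/
inductive IsChainRoot : Letter n × Letter n → Prop
  | dif {i j : Fin n} (h : i < j) : IsChainRoot (unb i, unb j)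
  | sum {i j : Fin n} (h : i ≠ j) : IsChainRoot (unb i, barred j)
  | sgn {i : Fin n} (h : (i : ℕ) + 1 < n) : IsChainRoot (unb i, barred i)

theorem IsChainRoot.edge {r : Letter n × Letter n} (hr : IsChainRoot r) (w : weyl n) :
    (QBGEdge w r ↔ (opOf r).ok n (st w)) ∧ st (w * refl r) = (opOf r).act (st w) := by
  cases hr with
  | dif h => rw [opOf_dif]; exact ⟨qbgEdge_dif w h, st_mul_dif w h.ne⟩
  | sum h => rw [opOf_sum h.symm]; exact ⟨qbgEdge_sum w h, st_mul_sum w h⟩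
  | sgn h => rw [opOf_sgn]; exact ⟨qbgEdge_sgn w h, st_mul_sgn w _⟩

/-- The positions `a, …, b - 1`. -/
def posList (n a b : ℕ) : List (Fin n) := (List.finRange n).filter fun j : Fin n => a ≤ (j : ℕ) ∧ (j : ℕ) < b

theorem mem_posList {a b : ℕ} {j : Fin n} : j ∈ posList n a b ↔ a ≤ (j : ℕ) ∧ (j : ℕ) < b := by
  rw [posList, List.mem_filter, decide_eq_true_eq]
  exact and_iff_right (List.mem_finRange _)

theorem pairwise_posList (a b : ℕ) : (posList n a b).Pairwise (· < ·) :=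
  List.Pairwise.filter _ (List.pairwise_lt_finRange _)

theorem eq_posList {a b : ℕ} {l : List (Fin n)} (hl : l.Pairwise (· < ·))
    (h : ∀ j, j ∈ l ↔ a ≤ (j : ℕ) ∧ (j : ℕ) < b) : l = posList n a b := by
  refine List.Perm.eq_of_pairwise (le := (· < ·)) (fun a b _ _ h1 h2 => absurd h2 h1.asymm) hl
    (pairwise_posList a b) ?_
  rw [List.perm_ext_iff_of_nodup (hl.imp fun h => h.ne) ((pairwise_posList a b).imp fun h => h.ne)]
  exact fun j => (h j).trans mem_posList.symm

theorem posList_nil (a : ℕ) : posList n a a = [] :=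
  List.eq_nil_iff_forall_not_mem.2 fun j h => by have := mem_posList.1 h; omega

theorem posList_cons {a b : ℕ} (hab : a < b) (ha : a < n) : posList n a b = ⟨a, ha⟩ :: posList n (a + 1) b := by
  refine (eq_posList (List.pairwise_cons.2 ⟨fun j hj => ?_, pairwise_posList _ _⟩) fun j => ?_).symm
  · exact Fin.lt_def.2 (mem_posList.1 hj).1
  · rw [List.mem_cons, mem_posList, Fin.ext_iff]; simp only; omega

theorem posList_append {a b : ℕ} (hab : a ≤ b) (hb : b < n) :
    posList n a (b + 1) = posList n a b ++ [⟨b, hb⟩] := by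
  refine (eq_posList (List.pairwise_append.2 ⟨pairwise_posList _ _, List.pairwise_singleton _ _,
    fun j hj i hi => ?_⟩) fun j => ?_).symm
  · rw [List.mem_singleton.1 hi]; exact Fin.lt_def.2 (mem_posList.1 hj).2
  · rw [List.mem_append, List.mem_singleton, mem_posList, Fin.ext_iff]; simp only; omega

theorem map_dif (i : Fin n) {k m : ℕ} (h : k + m ≤ n) :
    ((posList n k (k + m)).map fun j => (unb i, unb j)).map opOf = difOps i k m := by
  induction m generalizing k with
  | zero => rw [add_zero, posList_nil]; rfl
  | succ m ih =>
    rw [posList_cons (by omega) (by omega), List.map_cons, List.map_cons, opOf_dif, difOps,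
      show k + (m + 1) = k + 1 + m by omega, ih (by omega)]

theorem map_sum (i : Fin n) {k m : ℕ} (h : k + m ≤ n) (hi : (i : ℕ) < k ∨ k + m ≤ i) :
    ((posList n k (k + m)).reverse.map fun j => (unb i, barred j)).map opOf = sumOps i k m := by
  induction m with
  | zero => rw [add_zero, posList_nil]; rfl
  | succ m ih =>
    rw [← add_assoc, posList_append (by omega) (by omega), List.reverse_append, List.reverse_singleton,
      List.singleton_append, List.map_cons, List.map_cons, opOf_sum, sumOps, ih (by omega) (by omega)]
    rw [Ne, Fin.ext_iff]; simp only; omega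

theorem map_stageIV (i : Fin n) : (stageIV i).map opOf = sumOps i 0 i := by
  have := map_sum i (k := 0) (m := i) (by omega) (by omega)
  rw [zero_add] at this
  rw [← this, stageIV]
  congr 3
  exact eq_posList (List.Pairwise.filter _ (List.pairwise_lt_finRange _)) fun j => by
    rw [List.mem_filter, decide_eq_true_eq, Fin.lt_def]
    exact ⟨fun h => ⟨Nat.zero_le _, h.2⟩, fun h => ⟨List.mem_finRange _, h.2⟩⟩

theorem filter_le (k : ℕ) : ((List.finRange n).filter fun j : Fin n => k ≤ (j : ℕ)) = posList n k n :=
  eq_posList (List.Pairwise.filter _ (List.pairwise_lt_finRange _)) fun j => by simp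

theorem filter_lt (k : ℕ) : ((List.finRange n).filter fun j : Fin n => (j : ℕ) < k) = posList n 0 k :=
  eq_posList (List.Pairwise.filter _ (List.pairwise_lt_finRange _)) fun j => by simp

theorem map_gammaLeftRow {k : ℕ} (hk : k ≤ n) {i : Fin n} (hi : (i : ℕ) < k) :
    (gammaLeftRow k i).map opOf = outOps n k i ++ sumOps i 0 i := by
  have h1 := map_dif i (k := k) (m := n - k) (by omega)
  have h2 := map_sum i (k := k) (m := n - k) (by omega) (by omega)
  rw [show k + (n - k) = n by omega] at h1 h2
  rw [gammaLeftRow, filter_le, List.map_append, List.map_append, List.map_append, h1, h2, map_stageIV,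
    List.map_singleton, opOf_sgn, outOps]
  simp only [List.append_assoc, List.cons_append, List.nil_append]

theorem map_gammaLeft {k : ℕ} (hk : k ≤ n) : (gammaLeft n k).map opOf = leftOps n k k := by
  rw [gammaLeft, filter_lt]
  suffices ∀ m ≤ k, ((posList n 0 m).reverse.flatMap (gammaLeftRow k)).map opOf = leftOps n k m from this k le_rfl
  intro m hm
  induction m with
  | zero => rw [posList_nil]; rfl
  | succ m ih =>
    rw [posList_append (Nat.zero_le m) (by omega), List.reverse_append, List.reverse_singleton,
      List.singleton_append, List.flatMap_cons, List.map_append, ih (by omega), map_gammaLeftRow hk (i := ⟨m, by omega⟩) hm, leftOps]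

theorem map_gammaRight {k : ℕ} (hk : k ≤ n) : (gammaRight n k).map opOf = rightOps k := by
  rw [gammaRight, filter_lt]
  induction k with
  | zero => rw [posList_nil]; rfl
  | succ m ih =>
    rw [posList_append (Nat.zero_le m) (by omega), List.reverse_append, List.reverse_singleton,
      List.singleton_append, List.flatMap_cons, List.map_append, ih (by omega), gammaRightRow,
      List.map_cons, map_stageIV, opOf_sgn, rightOps]

theorem isChainRoot_stageIV {i : Fin n} {r : Letter n × Letter n} (hr : r ∈ stageIV i) : IsChainRoot r := by
  simp only [stageIV, List.mem_map, List.mem_reverse, List.mem_filter, decide_eq_true_eq] at hr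
  obtain ⟨j, hj, rfl⟩ := hr
  exact .sum hj.2.ne'

theorem isChainRoot_left {k : ℕ} (hk : k < n) {r : Letter n × Letter n} (hr : r ∈ gammaLeft n k) :
    IsChainRoot r := by
  simp only [gammaLeft, gammaLeftRow, List.mem_flatMap, List.mem_reverse, List.mem_filter, decide_eq_true_eq,
    List.mem_append, List.mem_map, List.mem_singleton] at hr
  obtain ⟨i, ⟨-, hi⟩, ((⟨j, hj, rfl⟩ | rfl) | ⟨j, hj, rfl⟩) | h⟩ := hr
  · exact .dif (Fin.lt_def.2 (by omega))
  · exact .sgn (by omega)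
  · exact .sum (Fin.lt_def.2 (by omega)).ne
  · exact isChainRoot_stageIV h

theorem isChainRoot_right {k : ℕ} (hk : k < n) {r : Letter n × Letter n} (hr : r ∈ gammaRight n k) :
    IsChainRoot r := by
  simp only [gammaRight, gammaRightRow, List.mem_flatMap, List.mem_reverse, List.mem_filter, decide_eq_true_eq,
    List.mem_cons] at hr
  obtain ⟨i, ⟨-, hi⟩, rfl | h⟩ := hr
  · exact .sgn (by omega)
  · exact isChainRoot_stageIV h

variable {μ : YoungDiagram}

theorem chainUpTo_succ (j : ℕ) : chainUpTo n μ (j + 1) =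
    chainUpTo n μ j ++ (gammaLeft n (μ.colLen j) ++ gammaRight n (μ.colLen j)) := by
  rw [chainUpTo, List.range_succ, List.flatMap_append, List.flatMap_singleton]; rfl

theorem colLen_lt (hμ : μ.colLen 0 < n) (j : ℕ) : μ.colLen j < n :=
  (μ.colLen_anti 0 j (Nat.zero_le j)).trans_lt hμ

theorem isChainRoot_chain (hμ : μ.colLen 0 < n) {r : Letter n × Letter n} (hr : r ∈ chain n μ) :
    IsChainRoot r := by
  rw [chain, chainUpTo, List.mem_flatMap] at hr
  obtain ⟨j, -, hr⟩ := hr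
  rcases List.mem_append.1 hr with h | h
  · exact isChainRoot_left (colLen_lt hμ j) h
  · exact isChainRoot_right (colLen_lt hμ j) h

theorem prefix_chain {j j' : ℕ} (h : j ≤ j') : chainUpTo n μ j <+: chainUpTo n μ j' := by
  induction j', h using Nat.le_induction with
  | base => exact List.prefix_rfl
  | succ j' _ ih => exact ih.trans (by rw [chainUpTo_succ]; exact List.prefix_append _ _)

/-- The indicator sequence of a set of folding positions. -/
def mask (J : Folding n μ) : List Bool := List.ofFn fun j => decide (j ∈ J)

theorem length_mask (J : Folding n μ) : (mask J).length = (chain n μ).length := List.length_ofFn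

theorem mask_injective : Function.Injective (mask (n := n) (μ := μ)) := fun J J' h => by
  ext j
  have := congrFun (List.ofFn_injective h) j
  exact decide_eq_decide.1 this

theorem partialProd_eq (J : Folding n μ) (p : ℕ) : partialProd J p =
    ((((List.finRange (chain n μ).length).take p).filter fun j => j ∈ J).map
      fun j => refl ((chain n μ).get j)).prod := by
  unfold partialProd
  congr 2
  conv_lhs => rw [← List.take_append_drop p (List.finRange (chain n μ).length)]
  rw [List.filter_append, List.filter_eq_nil_iff (l := List.drop _ _) |>.2, List.append_nil]
  · refine List.filter_congr fun j hj => ?_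
    obtain ⟨i, hi, rfl⟩ := List.mem_iff_getElem.1 hj
    rw [List.length_take] at hi
    rw [List.getElem_take, List.getElem_finRange]
    simp only [decide_eq_decide, and_iff_left_iff_imp]
    intro _
    simp only [Fin.val_cast]
    omega
  · intro j hj
    obtain ⟨i, hi, rfl⟩ := List.mem_iff_getElem.1 hj
    rw [List.getElem_drop, List.getElem_finRange]
    simp

theorem partialProd_zero (J : Folding n μ) : partialProd J 0 = 1 := by
  rw [partialProd_eq]; rfl

theorem partialProd_succ (J : Folding n μ) {p : ℕ} (hp : p < (chain n μ).length) : partialProd J (p + 1) =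
    if (⟨p, hp⟩ : Fin _) ∈ J then partialProd J p * refl ((chain n μ).get ⟨p, hp⟩) else partialProd J p := by
  rw [partialProd_eq, partialProd_eq, List.take_succ_eq_append_getElem (by rwa [List.length_finRange]),
    List.filter_append, List.map_append, List.prod_append, List.getElem_finRange]
  split_ifs with h
  · rw [List.filter_singleton]
    simp [h]
  · rw [List.filter_singleton]
    simp [h]

/-- The hypothesis `hok` may use the walk built so far. Thus the lemma serves both for admissible
sets and for masks of given walks, where determinism identifies the partial products. -/
theorem prefix_walk (hμ : μ.colLen 0 < n) (J : Folding n μ)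
    (hok : ∀ (p : ℕ) (hp : p < (chain n μ).length),
      Walk n (((chain n μ).take p).map opOf) (st (1 : weyl n)) ((mask J).take p) (st (partialProd J p)) →
      (⟨p, hp⟩ : Fin _) ∈ J → (opOf (chain n μ)[p]).ok n (st (partialProd J p))) {p : ℕ}
    (hp : p ≤ (chain n μ).length) :
    Walk n (((chain n μ).take p).map opOf) (st (1 : weyl n)) ((mask J).take p) (st (partialProd J p)) := by
  induction p with
  | zero => rw [partialProd_zero]; exact .nil _
  | succ p ih =>
    have hp' : p < (chain n μ).length := hp
    have w := ih hp'.le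
    rw [List.take_succ_eq_append_getElem hp',
      List.take_succ_eq_append_getElem (l := mask J) (by rwa [length_mask]), List.map_append,
      partialProd_succ J hp', show (mask J)[p]'(by rwa [length_mask]) = decide ((⟨p, hp'⟩ : Fin _) ∈ J) from
        List.getElem_ofFn _]
    refine w.append ?_
    split_ifs with h
    · rw [decide_eq_true h, ((isChainRoot_chain hμ (List.get_mem _ _)).edge _).2]
      exact .take (hok p hp' w h) (.nil _)
    · rw [decide_eq_false h]
      exact .skip (.nil _)

theorem walk_of_admissible (hμ : μ.colLen 0 < n) {J : Folding n μ} (hJ : J ∈ admissible n μ) {p : ℕ}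
    (hp : p ≤ (chain n μ).length) :
    Walk n (((chain n μ).take p).map opOf) (st (1 : weyl n)) ((mask J).take p) (st (partialProd J p)) :=
  prefix_walk hμ J (fun p hp' _ h => ((isChainRoot_chain hμ (List.get_mem _ ⟨p, hp'⟩)).edge _).1.1 (hJ _ h)) hp

theorem exists_admissible (hμ : μ.colLen 0 < n) {s : List Bool} {g : ℕ → ℤ}
    (h : Walk n ((chain n μ).map opOf) (st (1 : weyl n)) s g) : ∃ J ∈ admissible n μ, mask J = s := by
  have hl := h.length
  rw [List.length_map] at hl
  set J : Folding n μ := univ.filter fun j => s[(j : ℕ)]'(by omega) = true with hJ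
  have hm : mask J = s := by
    refine List.ext_getElem (by rw [length_mask, hl]) fun p h1 h2 => ?_
    rw [show (mask J)[p] = decide ((⟨p, by omega⟩ : Fin _) ∈ J) from List.getElem_ofFn _, hJ]
    simp
  have hok : ∀ (p : ℕ) (hp : p < (chain n μ).length),
      Walk n (((chain n μ).take p).map opOf) (st (1 : weyl n)) ((mask J).take p) (st (partialProd J p)) →
      (⟨p, hp⟩ : Fin _) ∈ J → (opOf (chain n μ)[p]).ok n (st (partialProd J p)) := fun p hp w hpJ => by
    rw [← List.take_append_drop p (chain n μ), List.drop_eq_getElem_cons hp, List.map_append, List.map_cons] at h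
    obtain ⟨s1, s2, g1, e, h1, h2⟩ := h.split
    have e1 : s1 = (mask J).take p := by
      rw [hm, e, List.take_left']
      rw [h1.length, List.length_map, List.length_take]; omega
    subst e1
    rw [h1.det w] at h2
    cases h2 with
    | take ok _ => exact ok
    | skip h2 =>
      exfalso
      have h3 : s[p]'(by omega) = true := (mem_filter.1 hpJ).2
      have h4 : ((mask J).take p).length = p := by rw [List.length_take, length_mask]; omega
      rw [List.getElem_of_eq e, List.getElem_append_right (by omega)] at h3
      simp [h4] at h3
  refine ⟨J, fun j hj => ?_, hm⟩
  refine ((isChainRoot_chain hμ (List.get_mem _ j)).edge _).1.2 ?_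
  exact hok j j.isLt (prefix_walk hμ J hok j.isLt.le) hj

end Chain

/-! ### Assembly over all columns -/

section Fills
variable {n : ℕ} {μ : YoungDiagram} {F F' : Filling n μ} {j : ℕ} {s s' : List Bool} {g g' : ℕ → ℤ}

/-- The selection `s` of operations for the first `j` columns leads to the sequence `g` and produces
the first `j` left and right columns of `F`. -/
inductive Fills (F : Filling n μ) : ℕ → List Bool → (ℕ → ℤ) → Prop
  | zero : Fills F 0 [] (st (1 : weyl n))
  | succ {j : ℕ} {s s1 s2 : List Bool} {g g1 g2 : ℕ → ℤ} (hj : j < μ.rowLen 0) (H : Fills F j s g)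
      (w1 : Walk n (leftOps n (μ.colLen j) (μ.colLen j)) g s1 g1)
      (w2 : Walk n (rightOps (μ.colLen j)) g1 s2 g2)
      (e1 : ∀ i : Fin (μ.colLen j), g1 i = sg (F.left ⟨j, hj⟩ i))
      (e2 : ∀ i : Fin (μ.colLen j), g2 i = sg (F.right ⟨j, hj⟩ i)) : Fills F (j + 1) (s ++ (s1 ++ s2)) g2

theorem Fills.walk (hμ : μ.colLen 0 < n) (H : Fills F j s g) :
    Walk n ((chainUpTo n μ j).map opOf) (st (1 : weyl n)) s g := by
  induction H with
  | zero => exact .nil _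
  | succ hj H w1 w2 e1 e2 ih =>
    rw [chainUpTo_succ, List.map_append, List.map_append, map_gammaLeft (colLen_lt hμ _).le,
      map_gammaRight (colLen_lt hμ _).le]
    exact ih.append (w1.append w2)

theorem Fills.isSgn (hμ : μ.colLen 0 < n) (H : Fills F j s g) : IsSgn n g := by
  induction H with
  | zero => exact isSgn_st 1
  | succ hj H w1 w2 e1 e2 ih =>
    exact w2.isSgn (rightOps_valid (colLen_lt hμ _).le)
      (w1.isSgn (leftOps_valid le_rfl (colLen_lt hμ _)) ih)

theorem eq_of_window {k : ℕ} {C C' : Column n k} {g g' : ℕ → ℤ} (h : ∀ i : Fin k, g i = sg (C i))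
    (h' : ∀ i : Fin k, g' i = sg (C' i)) (e : C = C') : ∀ x < k, g x = g' x := fun x hx =>
  (h ⟨x, hx⟩).trans (by rw [e]; exact (h' ⟨x, hx⟩).symm)

/-- The filling prescribes the column after each half, so `left_unique` and `right_unique` determine
the selection half by half. -/
theorem Fills.unique (hμ : μ.colLen 0 < n) (H : Fills F j s g) (H' : Fills F j s' g') : s = s' ∧ g = g' := by
  induction H generalizing s' g' with
  | zero => cases H'; exact ⟨rfl, rfl⟩
  | succ hj H w1 w2 e1 e2 ih =>
    cases H' with
    | succ hj' H' w1' w2' e1' e2' =>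
      obtain ⟨rfl, rfl⟩ := ih H'
      have hk := colLen_lt hμ
      obtain rfl := left_unique (H.isSgn hμ) le_rfl (hk _) w1 w1' (eq_of_window e1 e1' rfl)
      obtain rfl := w1.det w1'
      have h1 := w1.isSgn (leftOps_valid le_rfl (hk _)) (H.isSgn hμ)
      obtain rfl := right_unique h1 le_rfl (hk _) w2 w2' (eq_of_window e2 e2' rfl)
      exact ⟨rfl, w2.det w2'⟩

/-- The selection determines the columns. -/
theorem Fills.columns_eq (hμ : μ.colLen 0 < n) (H : Fills F j s g) (H' : Fills F' j s' g') (e : s = s') :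
    g = g' ∧ ∀ i : Fin (μ.rowLen 0), (i : ℕ) < j → F.left i = F'.left i ∧ F.right i = F'.right i := by
  induction H generalizing s' g' with
  | zero => cases H'; exact ⟨rfl, fun i hi => by omega⟩
  | succ hj H w1 w2 e1 e2 ih =>
    cases H' with
    | succ hj' H' w1' w2' e1' e2' =>
      obtain ⟨rfl, e3⟩ := List.append_inj e ((H.walk hμ).length.trans (H'.walk hμ).length.symm)
      obtain ⟨rfl, rfl⟩ := List.append_inj e3 (w1.length.trans w1'.length.symm)
      obtain ⟨rfl, h⟩ := ih H' rfl
      obtain rfl := w1.det w1'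
      obtain rfl := w2.det w2'
      refine ⟨rfl, fun i hi => ?_⟩
      rcases Nat.lt_succ_iff_lt_or_eq.1 hi with h1 | h1
      · exact h i h1
      · obtain rfl : i = ⟨_, hj⟩ := Fin.ext h1
        exact ⟨funext fun x => sg_inj ((e1 x).symm.trans (e1' x)),
          funext fun x => sg_inj ((e2 x).symm.trans (e2' x))⟩

/-- The condition on the left column `j` and the column before it. -/
def StartOK (F : Filling n μ) (j : ℕ) : Prop :=
  (∀ h : 0 < μ.rowLen 0, j = 0 → StrictMono (F.left ⟨0, h⟩)) ∧
  ∀ (i : ℕ) (hi : i + 1 < μ.rowLen 0), j = i + 1 →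
    AdjConditions
      (fun x => F.right ⟨i, by omega⟩ (Fin.castLE (μ.colLen_anti i (i + 1) (Nat.le_succ i)) x))
      (F.left ⟨i + 1, hi⟩)

/-- The current sequence begins with the identity, or with the previous right column, which may be
longer; in the latter case `Cond` only sees the part cut off at the new height. -/
theorem Fills.cond_iff (hμ : μ.colLen 0 < n) (H : Fills F j s g) (hj : j < μ.rowLen 0) {h : ℕ → ℤ}
    (e : ∀ i : Fin (μ.colLen j), h i = sg (F.left ⟨j, hj⟩ i)) (hh : AbsInj h (μ.colLen j)) :
    Cond (μ.colLen j) (μ.colLen j) g h ↔ StartOK F j := by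
  have hg := H.isSgn hμ
  cases H with
  | zero =>
    rw [cond_one_iff hμ (fun x hx => st_one (hx.trans hμ)) e hh]
    exact ⟨fun h1 => ⟨fun _ _ => h1, fun i _ h2 => absurd h2 (by omega)⟩, fun h1 => h1.1 hj rfl⟩
  | succ hj' H w1 w2 e1 e2 =>
    rename_i i _ _ _ _ _
    rw [← adjConditions_iff (colLen_lt hμ _)
      (C := fun x => F.right ⟨i, hj'⟩ (Fin.castLE (μ.colLen_anti i (i + 1) (Nat.le_succ i)) x))
      (fun x => e2 (Fin.castLE (μ.colLen_anti i (i + 1) (Nat.le_succ i)) x)) e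
      (hg.absInj (colLen_lt hμ _).le) hh]
    refine ⟨fun h1 => ⟨fun _ h2 => absurd h2 (by omega), fun i' hi' h2 => ?_⟩, fun h1 => h1.2 i hj rfl⟩
    obtain rfl : i = i' := by omega
    exact h1

theorem Fills.conditions (hμ : μ.colLen 0 < n) (H : Fills F j s g) (i : Fin (μ.rowLen 0)) (hi : (i : ℕ) < j) :
    StartOK F i ∧ IsSplitPair (F.left i) (F.right i) ∧ AdjConditions (F.left i) (F.right i) := by
  induction H with
  | zero => omega
  | succ hj H w1 w2 e1 e2 ih =>
    rcases Nat.lt_succ_iff_lt_or_eq.1 hi with h | h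
    · exact ih h
    · obtain rfl : i = ⟨_, hj⟩ := Fin.ext h
      rename_i j' _ _ _ _ _ _
      have hk := colLen_lt hμ j'
      have hg := H.isSgn hμ
      have hg1 := w1.isSgn (leftOps_valid le_rfl hk) hg
      have hg2 := w2.isSgn (rightOps_valid hk.le) hg1
      refine ⟨(H.cond_iff hμ hj e1 (hg1.absInj hk.le)).1 (Cond.of_left hg le_rfl hk w1 fun _ _ => rfl),
        (isSplitPair_iff hk e1 e2).2 ⟨hg1.absInj hk.le, hg2.absInj hk.le, Bal.of_right hg1 le_rfl hk w2⟩, ?_⟩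
      obtain ⟨s', w'⟩ := right_left (n := n) (k := μ.colLen j') w2
      exact (adjConditions_iff hk e1 e2 (hg1.absInj hk.le) (hg2.absInj hk.le)).2
        (Cond.of_left hg1 le_rfl hk w' fun _ _ => rfl)

/-- `StartOK` gives the left half. After it, the split pair condition provides the balance from
which the right half can be performed. -/
theorem exists_fills (hμ : μ.colLen 0 < n) (h : ∀ i : Fin (μ.rowLen 0), StartOK F i ∧
    IsSplitPair (F.left i) (F.right i) ∧ AdjConditions (F.left i) (F.right i)) (hj : j ≤ μ.rowLen 0) :
    ∃ s g, Fills F j s g := by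
  induction j with
  | zero => exact ⟨_, _, .zero⟩
  | succ j ih =>
    obtain ⟨s, g, H⟩ := ih (by omega)
    obtain ⟨h1, h2, h3⟩ := h ⟨j, hj⟩
    have hk := colLen_lt hμ j
    have hg := H.isSgn hμ
    set f : ℕ → ℤ := fun x => if hx : x < μ.colLen j then sg (F.left ⟨j, hj⟩ ⟨x, hx⟩) else 0 with hf
    set f' : ℕ → ℤ := fun x => if hx : x < μ.colLen j then sg (F.right ⟨j, hj⟩ ⟨x, hx⟩) else 0 with hf'
    have ef : ∀ i : Fin (μ.colLen j), f i = sg (F.left ⟨j, hj⟩ i) := fun i => by simp [hf]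
    have ef' : ∀ i : Fin (μ.colLen j), f' i = sg (F.right ⟨j, hj⟩ i) := fun i => by simp [hf']
    have fn : ∀ x < μ.colLen j, |f x| ≤ n := fun x hx => (ef ⟨x, hx⟩) ▸ abs_sg_le _
    have fn' : ∀ x < μ.colLen j, |f' x| ≤ n := fun x hx => (ef' ⟨x, hx⟩) ▸ abs_sg_le _
    obtain ⟨a, a', -⟩ := (isSplitPair_iff hk ef ef').1 h2
    obtain ⟨s1, g1, w1, e1⟩ := Cond.exists_left hg le_rfl hk a fn (fun x _ _ => by omega)
      ((H.cond_iff hμ hj ef a).2 h1)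
    have hg1 := w1.isSgn (leftOps_valid le_rfl hk) hg
    have e1' : ∀ i : Fin (μ.colLen j), g1 i = sg (F.left ⟨j, hj⟩ i) := fun i => (e1 i i.isLt).trans (ef i)
    obtain ⟨-, -, r, B⟩ := (isSplitPair_iff hk e1' ef').1 h2
    have C := (adjConditions_iff hk e1' ef' (hg1.absInj hk.le) a').1 h3
    obtain ⟨s2, g2, w2, e2⟩ := RightInv.exists_right hg1 le_rfl hk a' fn' (fun x _ _ => by omega) C
      (RightInv.of_bal hg1 hk a' B C)
    exact ⟨_, _, .succ hj H w1 w2 e1' fun i => (e2 i i.isLt).trans (ef' i)⟩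

theorem take_chain (hj : j ≤ μ.rowLen 0) : (chain n μ).take (chainUpTo n μ j).length = chainUpTo n μ j :=
  (List.prefix_iff_eq_take.1 (prefix_chain hj)).symm

theorem fills_fillB (hμ : μ.colLen 0 < n) {J : Folding n μ} (hJ : J ∈ admissible n μ) (hj : j ≤ μ.rowLen 0) :
    Fills (fillB hμ J) j ((mask J).take (chainUpTo n μ j).length)
      (st (partialProd J (chainUpTo n μ j).length)) := by
  induction j with
  | zero => exact partialProd_zero J ▸ .zero
  | succ j ih =>
    have H := ih (by omega)
    have hk := (colLen_lt hμ j).le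
    have hle : (chainUpTo n μ (j + 1)).length ≤ (chain n μ).length := (prefix_chain hj).length_le
    have hl : (chainUpTo n μ (j + 1)).length = (chainUpTo n μ j).length + (gammaLeft n (μ.colLen j)).length +
        (gammaRight n (μ.colLen j)).length := by
      rw [chainUpTo_succ, List.length_append, List.length_append, add_assoc]
    have t2 := take_chain (n := n) hj
    have t1 : (chain n μ).take ((chainUpTo n μ j).length + (gammaLeft n (μ.colLen j)).length) =
        chainUpTo n μ j ++ gammaLeft n (μ.colLen j) := by
      rw [← Nat.min_eq_left (show (chainUpTo n μ j).length + (gammaLeft n (μ.colLen j)).length ≤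
        (chainUpTo n μ (j + 1)).length by omega), ← List.take_take, t2, chainUpTo_succ, ← List.append_assoc,
        ← List.length_append, List.take_left']
      rfl
    have w2 := walk_of_admissible hμ hJ hle
    have w1 := walk_of_admissible hμ hJ (p := (chainUpTo n μ j).length + (gammaLeft n (μ.colLen j)).length)
      (by omega)
    have w0 := walk_of_admissible hμ hJ (p := (chainUpTo n μ j).length) (by omega)
    rw [take_chain (by omega)] at w0
    rw [t1, List.map_append, map_gammaLeft hk] at w1
    have t3 : (chainUpTo n μ (j + 1)).map opOf = (chainUpTo n μ j).map opOf ++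
        leftOps n (μ.colLen j) (μ.colLen j) ++ rightOps (μ.colLen j) := by
      rw [chainUpTo_succ, List.map_append, List.map_append, map_gammaLeft hk, map_gammaRight hk, List.append_assoc]
    rw [t2, t3] at w2
    obtain ⟨sl, s2, g1, e2, v1, v2⟩ := w2.split
    obtain ⟨s0, s1, g0, e1, u0, u1⟩ := w1.split
    have hm := length_mask J
    have m0 : s0 = (mask J).take (chainUpTo n μ j).length := by
      have h1 := u0.length
      rw [List.length_map] at h1
      have h2 := congrArg (List.take s0.length) e1
      rw [List.take_left', List.take_take, h1, Nat.min_eq_left (by omega)] at h2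
      · exact h2.symm
      · rfl
    have m1 : sl = (mask J).take ((chainUpTo n μ j).length + (gammaLeft n (μ.colLen j)).length) := by
      have h1 := v1.length
      rw [← map_gammaLeft hk, ← List.map_append, List.length_map, List.length_append] at h1
      have h2 := congrArg (List.take sl.length) e2
      rw [List.take_left', List.take_take, h1, Nat.min_eq_left (by omega)] at h2
      · exact h2.symm
      · rfl
    subst m0
    rw [← m1] at w1 e1
    rw [v1.det w1] at v2
    rw [u0.det w0] at u1
    rw [e2, e1, List.append_assoc]
    exact .succ hj H u1 v2 (fun i => st_fin _ (Fin.castLE (colLen_le hμ j) i))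
      fun i => st_fin _ (Fin.castLE (colLen_le hμ j) i)

end Fills
end TypeB

theorem mainTheorem2 (n : ℕ) (μ : YoungDiagram) (hμ : μ.colLen 0 < n) :
    Set.InjOn (TypeB.fillB hμ) (TypeB.admissible n μ) ∧
    TypeB.fillB hμ '' TypeB.admissible n μ =
      {F : TypeB.Filling n μ |
        (∀ h : 0 < μ.rowLen 0, StrictMono (F.left ⟨0, h⟩)) ∧
        (∀ j, TypeB.IsSplitPair (F.left j) (F.right j)) ∧
        TypeB.AdjacentColumnsOK F} := by
  have full : ∀ J ∈ TypeB.admissible n μ, ∃ g, TypeB.Fills (TypeB.fillB hμ J) (μ.rowLen 0) (TypeB.mask J) g :=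
    fun J hJ => by
      have H := TypeB.fills_fillB hμ hJ le_rfl
      rw [List.take_of_length_le (by rw [TypeB.length_mask]; exact le_rfl)] at H
      exact ⟨_, H⟩
  refine ⟨fun J hJ J' hJ' e => ?_, Set.ext fun F => ⟨?_, fun ⟨h1, h2, h3, h4⟩ => ?_⟩⟩
  · obtain ⟨g, H⟩ := full J hJ
    obtain ⟨g', H'⟩ := full J' hJ'
    rw [← e] at H'
    exact TypeB.mask_injective (H.unique hμ H').1
  · rintro ⟨J, hJ, rfl⟩
    obtain ⟨g, H⟩ := full J hJ
    have key := fun i => H.conditions hμ i i.isLt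
    exact ⟨fun h => (key ⟨0, h⟩).1.1 h rfl, fun j => (key j).2.1, fun j => (key j).2.2,
      fun j hj => (key ⟨j + 1, hj⟩).1.2 j hj rfl⟩
  · have hs : ∀ i : Fin (μ.rowLen 0), TypeB.StartOK F i := fun i =>
      ⟨fun h _ => h1 h, fun j hj _ => h4 j hj⟩
    obtain ⟨s, g, H⟩ := TypeB.exists_fills hμ (fun i => ⟨hs i, h2 i, h3 i⟩) le_rfl
    -- The walk for `F` comes from an admissible `J`. The filling of `J` has the same mask, and the
    -- mask determines all columns.
    obtain ⟨J, hJ, rfl⟩ := TypeB.exists_admissible hμ (H.walk hμ)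
    obtain ⟨g', H'⟩ := full J hJ
    have := (H'.columns_eq hμ H rfl).2
    exact ⟨J, hJ, TypeB.Filling.ext (funext fun i => (this i i.isLt).1) (funext fun i => (this i i.isLt).2)⟩
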